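/- Let $(A,[\cdot,\cdot],\rho)$ be a Lie algebroid over a smooth manifold $M$, with bundle projection $q:A\to M$, and let $V$ be a Lie algebroid spray on $A$, i.e. a smooth vector field $V$ on the manifold $A$ with $m_t^*V=tV$ for all $t\neq 0$ (where $m_t:A\to A$ is scalar multiplication by $t$) and $dq(V_a)=\rho(a)$ for all $a\in A$. Let $\phi_V^t$ be the local flow of $V$, and regard $M\subset A$ as the zero section. Let $q^!A=\{(u,a)\in TA\times A : dq(u)=\rho(a)\}$ be the pullback Lie algebroid over the manifold $A$, let $\widehat V\in\Gamma(q^!A)$ be the section $\widehat V_a=(V_a,a)$, and let $\phi_{\widehat V}^t$ be the flow of $\widehat V$ by Lie algebroid automorphisms of $q^!A$, which covers $\phi_V^t$. The realization form of $V$ is the map $\theta(v)=\mathrm{pr}_2(\phi_{\widehat V}^1(v,0))\in A$, defined for $v\in T^qA=\ker(dq)$ based at points at which the flow of $V$ is defined up to time $1$. Put $\sigma=q$ and $\tau=q\circ\phi_V^1$. There is a neighborhood of $M$ in $A\times_{\sigma,\tau}A$ such that for all $(a,b)$ in it the equation $$\theta\Big(\frac{d}{dt}k_t\Big)=\phi_V^t(a),\qquad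 k_0=b,$$ has a unique solution $t\mapsto k_t=k(t,a,b)\in A_{\sigma(b)}$ defined for all $t\in[0,1]$. The maps $\sigma=q$, $\tau=q\circ\phi_V^1$, $\iota=-\phi_V^1$ and $\mu(a,b)=k(1,a,b)$ (the last three restricted to suitable open neighborhoods of $M$ in $A$, respectively in $A\times_{\sigma,\tau}A$) are smooth and are the source, target, inversion and multiplication of a local Lie groupoid with space of arrows $A$ and space of units $M$; that is, every groupoid axiom holds on a neighborhood of the units in the space of composable tuples. On a neighborhood of $M$, the Maurer–Cartan form of this local groupoid, $\frac{d}{dt}g_t\big|_{t=0}\mapsto\frac{d}{dt}\mu(g_t,\iota(g_0))\big|_{t=0}$ for smooth paths $g_t$ in the fibres of $\sigma$, coincides with $\theta$, under the canonical identification of $A$ with the vectors tangent to the fibres of $q$ along the zero section. In particular, this local Lie groupoid integrates $A$: under the same identification $A\cong\ker(d\sigma)|_M$, the anchor $\rho$ is $d\tau|_{\ker(d\sigma)|_M}$ and the bracket of $A$ is the Lie bracket of right invariant vector fields. -/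

import Mathlib

open Bundle Set Filter
open scoped Manifold ContDiff Topology

noncomputable section

/-! ### Local flows and velocities on a manifold -/

section Flow

variable {EN : Type*} [NormedAddCommGroup EN] [NormedSpace ℝ EN]
  {HN : Type*} [TopologicalSpace HN] {J : ModelWithCorners ℝ EN HN}
  {N : Type*} [TopologicalSpace N] [ChartedSpace HN N]

/-- The maximal domain of the local flow of a vector field `V`: all `(t, a)` such that some
integral curve of `V` that starts at `a` is defined on an open interval containing `0` and `t`. -/
def flowDomain (V : (a : N) → TangentSpace J a) : Set (ℝ × N) :=
  {p | ∃ γ : ℝ → N, γ 0 = p.2 ∧ ∀ s ∈ uIcc 0 p.1, IsMIntegralCurveAt γ V s}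

open Classical in
/-- The local flow `φ_V^t(a)` of `V`; its value is only meaningful for `(t, a) ∈ flowDomain V`. -/
def localFlow (V : (a : N) → TangentSpace J a) (t : ℝ) (a : N) : N :=
  if h : (t, a) ∈ flowDomain V then h.choose t else a

/-- The set of points at which the flow of `V` is defined up to time `1`. -/
def timeOneDomain (V : (a : N) → TangentSpace J a) : Set N :=
  {a | ((1 : ℝ), a) ∈ flowDomain V}

variable (J) in
/-- The velocity of a curve, as an element of the tangent bundle. -/
def curveVelocity (c : ℝ → N) (t : ℝ) : TangentBundle J N :=
  ⟨c t, mfderiv 𝓘(ℝ, ℝ) J c t (1 : ℝ)⟩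

variable (J) in
/-- The velocity of a curve that is only considered on the set `s` of parameters. -/
def curveVelocityWithin (c : ℝ → N) (s : Set ℝ) (t : ℝ) : TangentBundle J N :=
  ⟨c t, mfderivWithin 𝓘(ℝ, ℝ) J c s t (1 : ℝ)⟩

/-- The derivative of a real function `f` in the direction of the tangent vector `v` at `x`. -/
def dirDeriv (f : N → ℝ) (x : N) (v : TangentSpace J x) : ℝ :=
  mfderiv J 𝓘(ℝ, ℝ) f x v

end Flow

/-! ### Local Lie groupoids -/

section LocalGroupoid

variable {EG : Type*} [NormedAddCommGroup EG] [NormedSpace ℝ EG]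
  {HG : Type*} [TopologicalSpace HG] (J : ModelWithCorners ℝ EG HG)
  {G : Type*} [TopologicalSpace G] [ChartedSpace HG G]
  {EM : Type*} [NormedAddCommGroup EM] [NormedSpace ℝ EM]
  {HM : Type*} [TopologicalSpace HM] (I : ModelWithCorners ℝ EM HM)
  {M : Type*} [TopologicalSpace M] [ChartedSpace HM M]

/-- The structure of a local Lie groupoid on `(G, M, source)`, where the manifold `M` of units is
a closed embedded submanifold of `G` through `unit : M → G`.

The target, the inversion and the multiplication are only defined on the neighbourhoods
`targetDom`, `invDom` of the units in `G` and `mulDom` of the units in the fibre product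
`{(g, h) | source g = target h}` (their values elsewhere are irrelevant), and are smooth there.
Every groupoid axiom holds on some neighbourhood of the units in the space of composable `k`-tuples:
`∀ᶠ p in 𝓝ˢ K, P p` says that `P` holds on an open set containing `K`. In each axiom both
sides are moreover required to be defined. -/
structure LocalLieGroupoid (unit : M → G) (source : G → M) where
  unit_isClosedEmbedding : Topology.IsClosedEmbedding unit
  unit_smooth : ContMDiff I J ∞ unit
  unit_immersion : ∀ x, Function.Injective (mfderiv I J unit x)
  source_smooth : ContMDiff J I ∞ source
  source_submersion : ∀ g, Function.Surjective (mfderiv J I source g)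
  source_unit : ∀ x, source (unit x) = x
  /-- the target map -/
  target : G → M
  /-- the domain of the target map -/
  targetDom : Set G
  isOpen_targetDom : IsOpen targetDom
  unit_mem_targetDom : ∀ x, unit x ∈ targetDom
  target_smooth : ContMDiffOn J I ∞ target targetDom
  target_unit : ∀ x, target (unit x) = x
  /-- the inversion -/
  inv : G → G
  /-- the domain of the inversion -/
  invDom : Set G
  isOpen_invDom : IsOpen invDom
  unit_mem_invDom : ∀ x, unit x ∈ invDom
  inv_smooth : ContMDiffOn J J ∞ inv invDom
  /-- the multiplication -/
  mul : G → G → G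
  /-- the domain of the multiplication -/
  mulDom : Set (G × G)
  mulDom_relatively_open : ∃ O : Set (G × G), IsOpen O ∧
    mulDom = O ∩ {p | p.2 ∈ targetDom ∧ source p.1 = target p.2}
  unit_mem_mulDom : ∀ x, (unit x, unit x) ∈ mulDom
  mul_smooth : ContMDiffOn (J.prod J) J ∞ (fun p : G × G => mul p.1 p.2) mulDom
  source_inv : ∀ᶠ g in 𝓝ˢ (range unit), source (inv g) = target g
  target_inv : ∀ᶠ g in 𝓝ˢ (range unit), inv g ∈ targetDom ∧ target (inv g) = source g
  inv_unit : ∀ x, inv (unit x) = unit x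
  inv_inv : ∀ᶠ g in 𝓝ˢ (range unit), inv g ∈ invDom ∧ inv (inv g) = g
  source_mul : ∀ᶠ p in 𝓝ˢ (range fun x => (unit x, unit x)),
    p ∈ mulDom → source (mul p.1 p.2) = source p.2
  target_mul : ∀ᶠ p in 𝓝ˢ (range fun x => (unit x, unit x)),
    p ∈ mulDom → p.1 ∈ targetDom ∧ mul p.1 p.2 ∈ targetDom ∧
      target (mul p.1 p.2) = target p.1
  mul_assoc : ∀ᶠ p in 𝓝ˢ (range fun x => (unit x, unit x, unit x)),
    (p.1, p.2.1) ∈ mulDom → (p.2.1, p.2.2) ∈ mulDom →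
      (mul p.1 p.2.1, p.2.2) ∈ mulDom ∧ (p.1, mul p.2.1 p.2.2) ∈ mulDom ∧
        mul (mul p.1 p.2.1) p.2.2 = mul p.1 (mul p.2.1 p.2.2)
  unit_mul : ∀ᶠ g in 𝓝ˢ (range unit),
    (unit (target g), g) ∈ mulDom ∧ mul (unit (target g)) g = g
  mul_unit : ∀ᶠ g in 𝓝ˢ (range unit),
    (g, unit (source g)) ∈ mulDom ∧ mul g (unit (source g)) = g
  mul_inv : ∀ᶠ g in 𝓝ˢ (range unit),
    (g, inv g) ∈ mulDom ∧ mul g (inv g) = unit (target g)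
  inv_mul : ∀ᶠ g in 𝓝ˢ (range unit),
    (inv g, g) ∈ mulDom ∧ mul (inv g) g = unit (source g)

variable {I}

/-- `c` is (near `0`) a smooth path inside a source fibre, with `c 0 = g`. -/
def IsSourcePath (source : G → M) (g : G) (c : ℝ → G) : Prop :=
  c 0 = g ∧ ∀ᶠ t in 𝓝 (0 : ℝ), ContMDiffAt 𝓘(ℝ, ℝ) J ∞ c t ∧ source (c t) = source g

variable {J} {unit : M → G} {source : G → M}

/-- `Θ` is (on a neighbourhood of the units) the Maurer-Cartan form of the local groupoid:
`Θ (d/dt g_t) = d/dt (g_t g_0⁻¹)` at `t = 0`, for all smooth paths `g_t` in source fibres. Its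
values are vectors that are tangent to source fibres at units. -/
def LocalLieGroupoid.IsMaurerCartanForm (𝒢 : LocalLieGroupoid J I unit source)
    (Θ : TangentBundle J G → TangentBundle J G) : Prop :=
  ∀ᶠ g in 𝓝ˢ (range unit), ∀ c : ℝ → G, IsSourcePath J source g c →
    MDifferentiableAt 𝓘(ℝ, ℝ) J (fun t => 𝒢.mul (c t) (𝒢.inv g)) 0 ∧
    Θ (curveVelocity J c 0) = curveVelocity J (fun t => 𝒢.mul (c t) (𝒢.inv g)) 0

/-- Let `a` be a field of vectors along the units, tangent to the source fibres. The vector field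
`X` is, on a neighbourhood of the units, the right invariant vector field extending `a`:
`X g` is the image of `a (target g)` under the differential of `h ↦ h g`. -/
def LocalLieGroupoid.IsRightInvariantExtension (𝒢 : LocalLieGroupoid J I unit source)
    (a : (x : M) → TangentSpace J (unit x)) (X : (g : G) → TangentSpace J g) : Prop :=
  ∀ᶠ g in 𝓝ˢ (range unit), ∀ c : ℝ → G, IsSourcePath J source (unit (𝒢.target g)) c →
    curveVelocity J c 0 = ⟨unit (𝒢.target g), a (𝒢.target g)⟩ →
    MDifferentiableAt 𝓘(ℝ, ℝ) J (fun t => 𝒢.mul (c t) g) 0 ∧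
    curveVelocity J (fun t => 𝒢.mul (c t) g) 0 = ⟨g, X g⟩

end LocalGroupoid

/-! ### Lie algebroids -/

section Algebroid

variable {B : Type*} [NormedAddCommGroup B] [NormedSpace ℝ B]
  {M : Type*} [TopologicalSpace M] [ChartedSpace B M] [IsManifold 𝓘(ℝ, B) ∞ M]
  {F : Type*} [NormedAddCommGroup F] [NormedSpace ℝ F]
  {A : M → Type*} [TopologicalSpace (TotalSpace F A)]
  [∀ x, TopologicalSpace (A x)] [FiberBundle F A]
  [∀ x, AddCommGroup (A x)] [∀ x, Module ℝ (A x)] [VectorBundle ℝ F A]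
  [ContMDiffVectorBundle ∞ F A 𝓘(ℝ, B)]

variable (B F A) in
/-- A Lie algebroid structure on the smooth vector bundle `A → M`: a smooth vector bundle map
`anchor : A → TM` and a Lie bracket on the space of smooth sections of `A` that satisfies
`[α, f β] = f [α, β] + (anchor(α) f) β`. -/
structure LieAlgebroid where
  anchor : (x : M) → A x →ₗ[ℝ] TangentSpace 𝓘(ℝ, B) x
  anchor_smooth : ContMDiff (𝓘(ℝ, B).prod 𝓘(ℝ, F)) 𝓘(ℝ, B).tangent ∞
    (fun e : TotalSpace F A => (⟨e.proj, anchor e.proj e.2⟩ : TangentBundle 𝓘(ℝ, B) M))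
  bracket : Cₛ^∞⟮𝓘(ℝ, B); F, A⟯ →ₗ[ℝ] Cₛ^∞⟮𝓘(ℝ, B); F, A⟯ →ₗ[ℝ] Cₛ^∞⟮𝓘(ℝ, B); F, A⟯
  bracket_self : ∀ α, bracket α α = 0
  jacobi : ∀ α β γ,
    bracket α (bracket β γ) + bracket β (bracket γ α) + bracket γ (bracket α β) = 0
  leibniz : ∀ (α β γ : Cₛ^∞⟮𝓘(ℝ, B); F, A⟯) (f : M → ℝ),
    ContMDiff 𝓘(ℝ, B) 𝓘(ℝ, ℝ) ∞ f → (∀ x, γ x = f x • β x) →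
    ∀ x, bracket α γ x =
      f x • bracket α β x + dirDeriv f x (anchor x (α x)) • β x

/-- Scalar multiplication by `t` on the fibres of a vector bundle. -/
def fiberScale (t : ℝ) (a : TotalSpace F A) : TotalSpace F A := ⟨a.proj, t • a.2⟩

variable (B F) in
/-- The canonical identification of the fibre `A x` with the vectors at `0_x` that are tangent
to the fibre: `e` is sent to the velocity at `t = 0` of `t ↦ t e`. -/
def verticalLift (x : M) (e : A x) :
    TangentSpace (𝓘(ℝ, B).prod 𝓘(ℝ, F)) (zeroSection F A x) :=
  mfderiv 𝓘(ℝ, ℝ) (𝓘(ℝ, B).prod 𝓘(ℝ, F)) (fun t : ℝ => (⟨x, t • e⟩ : TotalSpace F A)) 0 (1 : ℝ)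

/-- A smooth section of the dual bundle of `A`, seen as a smooth function on the total space
that is linear on the fibres. -/
structure IsFiberLinear (B : Type*) [NormedAddCommGroup B] [NormedSpace ℝ B] [ChartedSpace B M]
    (η : TotalSpace F A → ℝ) : Prop where
  smooth : ContMDiff (𝓘(ℝ, B).prod 𝓘(ℝ, F)) 𝓘(ℝ, ℝ) ∞ η
  linear : ∀ x, IsLinearMap ℝ (fun e : A x => η ⟨x, e⟩)

namespace LieAlgebroid

variable (L : LieAlgebroid B F A)

/-- A Lie algebroid spray: a smooth vector field `V` on the manifold `A` that is homogeneous of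
degree one (`m_t^* V = t V` for `t ≠ 0`, i.e. `V (t a) = t dm_t (V a)`, where `m_t` is scalar
multiplication by `t`) and lifts the anchor (`dq (V a) = anchor a`). -/
structure IsSpray (V : (a : TotalSpace F A) → TangentSpace (𝓘(ℝ, B).prod 𝓘(ℝ, F)) a) : Prop where
  smooth : ContMDiff (𝓘(ℝ, B).prod 𝓘(ℝ, F)) (𝓘(ℝ, B).prod 𝓘(ℝ, F)).tangent ∞
    (fun a => (⟨a, V a⟩ : TangentBundle (𝓘(ℝ, B).prod 𝓘(ℝ, F)) (TotalSpace F A)))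
  homogeneous : ∀ t : ℝ, t ≠ 0 → ∀ a : TotalSpace F A, V (fiberScale t a) =
    t • mfderiv (𝓘(ℝ, B).prod 𝓘(ℝ, F)) (𝓘(ℝ, B).prod 𝓘(ℝ, F)) (fiberScale t) a (V a)
  lifts_anchor : ∀ a : TotalSpace F A,
    mfderiv (𝓘(ℝ, B).prod 𝓘(ℝ, F)) 𝓘(ℝ, B) (TotalSpace.proj : TotalSpace F A → M) a (V a)
      = L.anchor a.proj a.2

/-- The Lie algebroid differential `(d_A η)(α, β)` of a section `η` of the dual of `A`, at `x`. -/
def dForm (η : TotalSpace F A → ℝ) (α β : Cₛ^∞⟮𝓘(ℝ, B); F, A⟯) (x : M) : ℝ :=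
  dirDeriv (fun y => η ⟨y, β y⟩) x (L.anchor x (α x))
    - dirDeriv (fun y => η ⟨y, α y⟩) x (L.anchor x (β x))
    - η ⟨x, L.bracket α β x⟩

/-- The pullback Lie algebroid `q^! A = {(u, a) ∈ TA × A | dq u = anchor a}` over the manifold `A`,
as a set. -/
def pullbackAlgebroid :
    Set (TangentBundle (𝓘(ℝ, B).prod 𝓘(ℝ, F)) (TotalSpace F A) × TotalSpace F A) :=
  {p | tangentMap (𝓘(ℝ, B).prod 𝓘(ℝ, F)) 𝓘(ℝ, B) (TotalSpace.proj : TotalSpace F A → M) p.1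
    = ⟨p.2.proj, L.anchor p.2.proj p.2.2⟩}

/-- `W : [0,1] → q^! A` is a flow line `t ↦ φ_{V̂}^t (W 0)` of the flow of the section
`V̂ a = (V a, a)` of the Lie algebroid `q^! A`.

The flow `φ^t` of a section `s` of a Lie algebroid is the flow by bundle automorphisms that
covers the flow of the vector field `anchor s` and satisfies `d/dt (φ^t)^* = (φ^t)^* ∘ L_s` on
`1`-forms (equivalently `d/dt (φ^t)^* = (φ^t)^* ∘ [s, ·]` on sections), where `L_s = i_s d + d i_s`.
The `1`-forms `pr₁^* ξ` and `pr₂^* η` span the dual of `q^! A`, and `d` commutes with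
`pr₁^*` and `pr₂^*` because the anchor `pr₁ : q^! A → TA` and `pr₂ : q^! A → A` are Lie algebroid
morphisms. Hence the flow of `V̂` acts on first components by the differential of `φ_V^t`, and for
`η` in the dual of `A`, `L_{V̂} (pr₂^* η) = d η ∘ pr₁ + (d_A η)(a, pr₂)` at `a`, where
`η = i_{V̂} (pr₂^* η)` is seen as a function on `A`. The sections `α`, `β` only serve
to evaluate the tensor `d_A η` at two given vectors. -/
structure IsPullbackFlowLine
    (V : (a : TotalSpace F A) → TangentSpace (𝓘(ℝ, B).prod 𝓘(ℝ, F)) a)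
    (W : ℝ → TangentBundle (𝓘(ℝ, B).prod 𝓘(ℝ, F)) (TotalSpace F A) × TotalSpace F A) : Prop where
  mem : ∀ t ∈ Icc (0 : ℝ) 1, W t ∈ L.pullbackAlgebroid
  mem_flowDomain : ∀ t ∈ Icc (0 : ℝ) 1, (t, (W 0).1.proj) ∈ flowDomain V
  fst_eq : ∀ t ∈ Icc (0 : ℝ) 1, (W t).1 =
    tangentMap (𝓘(ℝ, B).prod 𝓘(ℝ, F)) (𝓘(ℝ, B).prod 𝓘(ℝ, F)) (localFlow V t) (W 0).1
  snd_deriv : ∀ t ∈ Icc (0 : ℝ) 1, ∀ η : TotalSpace F A → ℝ, IsFiberLinear B η →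
    ∀ α β : Cₛ^∞⟮𝓘(ℝ, B); F, A⟯,
      (⟨(W t).2.proj, α (W t).2.proj⟩ : TotalSpace F A) = (W t).1.proj →
      (⟨(W t).2.proj, β (W t).2.proj⟩ : TotalSpace F A) = (W t).2 →
      HasDerivWithinAt (fun s => η (W s).2)
        (dirDeriv η (W t).1.proj (W t).1.2
          + L.dForm η α β (W t).2.proj) (Icc 0 1) t

/-- `e = pr₂ (φ_{V̂}^1 (v, 0))`. -/
def IsRealizationValue (V : (a : TotalSpace F A) → TangentSpace (𝓘(ℝ, B).prod 𝓘(ℝ, F)) a)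
    (v : TangentBundle (𝓘(ℝ, B).prod 𝓘(ℝ, F)) (TotalSpace F A)) (e : TotalSpace F A) : Prop :=
  ∃ W : ℝ → TangentBundle (𝓘(ℝ, B).prod 𝓘(ℝ, F)) (TotalSpace F A) × TotalSpace F A,
    L.IsPullbackFlowLine V W ∧ W 0 = (v, zeroSection F A v.proj.proj) ∧ (W 1).2 = e

open Classical in
/-- The realization form `θ : T^q A → A` associated to the spray `V`: for a vector `v` that is
tangent to the fibre of `q : A → M` at a point where the flow of `V` is defined up to time `1`,
`θ v = pr₂ (φ_{V̂}^1 (v, 0))`. Its value at other vectors is irrelevant. -/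
def realizationForm (V : (a : TotalSpace F A) → TangentSpace (𝓘(ℝ, B).prod 𝓘(ℝ, F)) a)
    (v : TangentBundle (𝓘(ℝ, B).prod 𝓘(ℝ, F)) (TotalSpace F A)) : TotalSpace F A :=
  if h : ∃ e, L.IsRealizationValue V v e then h.choose else zeroSection F A v.proj.proj

/-- The realization form with values in the vectors tangent to the fibres of `A` along the zero
section, through the canonical identification of these with `A`. -/
def verticalRealizationForm
    (V : (a : TotalSpace F A) → TangentSpace (𝓘(ℝ, B).prod 𝓘(ℝ, F)) a)
    (v : TangentBundle (𝓘(ℝ, B).prod 𝓘(ℝ, F)) (TotalSpace F A)) :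
    TangentBundle (𝓘(ℝ, B).prod 𝓘(ℝ, F)) (TotalSpace F A) :=
  ⟨zeroSection F A (L.realizationForm V v).proj,
    verticalLift B F (L.realizationForm V v).proj (L.realizationForm V v).2⟩

/-- `k : [0,1] → A_{q(b)}` is a solution of the equation `θ (dk_t/dt) = φ_V^t(a)`, `k_0 = b`. -/
structure IsProductPath (V : (a : TotalSpace F A) → TangentSpace (𝓘(ℝ, B).prod 𝓘(ℝ, F)) a)
    (a b : TotalSpace F A) (k : ℝ → TotalSpace F A) : Prop where
  init : k 0 = b
  mem_fiber : ∀ t ∈ Icc (0 : ℝ) 1, (k t).proj = b.proj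
  mem_flowDomain : ∀ t ∈ Icc (0 : ℝ) 1, (t, a) ∈ flowDomain V
  mem_timeOneDomain : ∀ t ∈ Icc (0 : ℝ) 1, k t ∈ timeOneDomain V
  differentiable : ∀ t ∈ Icc (0 : ℝ) 1,
    MDifferentiableWithinAt 𝓘(ℝ, ℝ) (𝓘(ℝ, B).prod 𝓘(ℝ, F)) k (Icc 0 1) t
  equation : ∀ t ∈ Icc (0 : ℝ) 1,
    L.realizationForm V (curveVelocityWithin (𝓘(ℝ, B).prod 𝓘(ℝ, F)) k (Icc 0 1) t)
      = localFlow V t a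

/-- The equation for `k` has a solution on `[0,1]`, and only one. -/
def HasUniqueProductPath (V : (a : TotalSpace F A) → TangentSpace (𝓘(ℝ, B).prod 𝓘(ℝ, F)) a)
    (a b : TotalSpace F A) : Prop :=
  ∃ k, L.IsProductPath V a b k ∧ ∀ k', L.IsProductPath V a b k' → EqOn k' k (Icc 0 1)

end LieAlgebroid

/-- The local Lie groupoid `𝒢` over `M` integrates the Lie algebroid `L` on `A → M`, through the
maps `j x : A x → ker (d source) ⊆ T_{unit x} G`: these form an isomorphism from `A` onto the
Lie algebroid of `𝒢`, i.e. onto the vector bundle `ker (d source)` along the units, whose anchor is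
`d target` and whose bracket is the bracket of right invariant vector fields. -/
structure LocalLieGroupoid.Integrates
    {EG : Type*} [NormedAddCommGroup EG] [NormedSpace ℝ EG]
    {HG : Type*} [TopologicalSpace HG] {J : ModelWithCorners ℝ EG HG}
    {G : Type*} [TopologicalSpace G] [ChartedSpace HG G] [IsManifold J ∞ G]
    {unit : M → G} {source : G → M} (𝒢 : LocalLieGroupoid J 𝓘(ℝ, B) unit source)
    (L : LieAlgebroid B F A) (j : (x : M) → A x → TangentSpace J (unit x)) : Prop where
  isLinear : ∀ x, IsLinearMap ℝ (j x)
  bijective : ∀ x, BijOn (j x) univ {v | mfderiv J 𝓘(ℝ, B) source (unit x) v = 0}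
  smooth : ContMDiff (𝓘(ℝ, B).prod 𝓘(ℝ, F)) J.tangent ∞
    (fun e : TotalSpace F A => (⟨unit e.proj, j e.proj e.2⟩ : TangentBundle J G))
  anchor : ∀ x (e : A x), tangentMap J 𝓘(ℝ, B) 𝒢.target ⟨unit x, j x e⟩ = ⟨x, L.anchor x e⟩
  exists_rightInvariant : ∀ α : Cₛ^∞⟮𝓘(ℝ, B); F, A⟯, ∃ X : (g : G) → TangentSpace J g,
    𝒢.IsRightInvariantExtension (fun x => j x (α x)) X ∧
    ∀ᶠ g in 𝓝ˢ (range unit),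
      ContMDiffAt J J.tangent ∞ (fun g => (⟨g, X g⟩ : TangentBundle J G)) g
  bracket : ∀ (α β : Cₛ^∞⟮𝓘(ℝ, B); F, A⟯) (X Y : (g : G) → TangentSpace J g),
    𝒢.IsRightInvariantExtension (fun x => j x (α x)) X →
    𝒢.IsRightInvariantExtension (fun x => j x (β x)) Y →
    ∀ x, VectorField.mlieBracket J X Y (unit x) = j x (L.bracket α β x)

end Algebroid

end

/-! A chart of `M` and a trivialization of `A` turn the algebroid and its spray, near a point of the
zero section, into an anchor `ρ`, structure functions `c` and a quadratic field `S` on vector spaces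
(`SprayModel`). The spray vanishes on the zero section, so its flow `Φ` exists for long times near
it. For fixed `v`, the fibre component `E v` of the flow of `V̂` applied to `(v, 0)` solves the
linear equation `E' v = pr₂ (dΦ v) - c(Φ)(E v)` with `E v = 0` at time zero, and `Θ`, the value of
`E` at time one, is the realization form.

Three facts about `E` carry the theorem. The anchor of `E` is the base part of `dΦ` (`ρ_E`), hence
the differential of the target along the fibres is `ρ ∘ Θ`. Homogeneity of the spray gives `Θ(l a) a
= φ^l(a)` (`Θ_smul`), hence `Θ` is the identity on the zero section and invertible near it. Finally
the Jacobi identity gives the Maurer-Cartan equation (`maurerCartan`): its defect solves a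
homogeneous linear equation with zero initial value.

Since `Θ` is invertible, the product equation is the ordinary differential equation `k' = Θ(k)⁻¹
φ^t(a)`, with solution `κ`. The unit and inverse laws hold because constant paths, `t a` and `(1 -
t) a` are solutions. Differentiating the equation in `a` and inserting Maurer-Cartan shows that
right multiplication preserves `Θ` (`Θ_fderiv_κ`). Hence `t ↦ k(t, a, b) c` solves the equation that
defines `a (b c)`, and uniqueness gives associativity (`κ_assoc`). Right translation by the inverse
of `g` brings a vector at `g` to a unit, where `Θ` is the identity, so `Θ` is the Maurer-Cartan
form. A right invariant field is `Θ⁻¹(α ∘ τ)`, and its brackets at the units are read off from the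
Maurer-Cartan equation.

No patching is needed: the flow, the realization form and the product are defined globally, the
charts only compute them, and each axiom is a statement near every single unit. Smooth dependence of
solutions on time and initial values is obtained from the inverse function theorem on spaces of
continuous paths. -/

/-! ### Shortcut instances for spaces of continuous linear maps -/

namespace OperatorNorm

variable {E G : Type*} [NormedAddCommGroup E] [NormedSpace ℝ E]
  [NormedAddCommGroup G] [NormedSpace ℝ G]

noncomputable scoped instance (priority := 5000) instNormedAddCommGroupCLM :
    NormedAddCommGroup (E →L[ℝ] G) := ContinuousLinearMap.toNormedAddCommGroup

noncomputable scoped instance (priority := 5000) instSeminormedAddCommGroupCLM :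
    SeminormedAddCommGroup (E →L[ℝ] G) := ContinuousLinearMap.toSeminormedAddCommGroup

noncomputable scoped instance (priority := 5000) instNormedSpaceCLM :
    NormedSpace ℝ (E →L[ℝ] G) := ContinuousLinearMap.toNormedSpace

scoped instance (priority := 5000) instAddCommMonoidCLM :
    AddCommMonoid (E →L[ℝ] G) := ContinuousLinearMap.addCommMonoid

scoped instance (priority := 5000) instModuleCLM :
    Module ℝ (E →L[ℝ] G) := ContinuousLinearMap.module

end OperatorNorm

/-! ### Uniqueness for ordinary differential equations -/

section Uniqueness

open scoped OperatorNorm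

variable {E : Type*} [NormedAddCommGroup E] [NormedSpace ℝ E]

/-- Two curves that solve `x' = v (t, x)` on `[a, b]` and agree at `a` are equal; the second one is
only required to solve the equation as long as it stays in the open set `O` on which `v` is `C¹`
and which contains the graph of the first one. -/
theorem eqOn_Icc_of_solves {v : ℝ → E → E} {O : Set (ℝ × E)} (hO : IsOpen O)
    (hv : ContDiffOn ℝ 1 (fun p : ℝ × E => v p.1 p.2) O) {f g : ℝ → E} {a b : ℝ}
    (hf : ContinuousOn f (Icc a b))
    (hf' : ∀ t ∈ Ico a b, HasDerivWithinAt f (v t (f t)) (Ici t) t)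
    (hfO : ∀ t ∈ Ico a b, (t, f t) ∈ O)
    (hg : ContinuousOn g (Icc a b))
    (hg' : ∀ t ∈ Ico a b, (t, g t) ∈ O → HasDerivWithinAt g (v t (g t)) (Ici t) t)
    (ha : f a = g a) : EqOn f g (Icc a b) := by
  rcases lt_or_ge b a with hab | hab
  · simp [Icc_eq_empty_of_lt hab]
  have hclosed : IsClosed ({t | f t = g t} ∩ Icc a b) := by
    have : {t | f t = g t} ∩ Icc a b = Icc a b ∩ (fun t => f t - g t) ⁻¹' {0} := by
      ext t; simp [sub_eq_zero, and_comm]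
    rw [this]
    exact (hf.sub hg).preimage_isClosed_of_isClosed isClosed_Icc isClosed_singleton
  refine hclosed.Icc_subset_of_forall_mem_nhdsWithin ha ?_
  rintro t ⟨htfg, ht⟩
  have htfg : f t = g t := htfg
  -- Where the curves meet, some ball lies both in `O` and in a set on which `v` is Lipschitz. Both
  -- curves stay in it for a short time, so `g` solves the equation there too and the standard
  -- uniqueness theorem applies.
  obtain ⟨K, s, hs, hK⟩ :=
    (hv.contDiffAt (hO.mem_nhds (hfO t ht))).exists_lipschitzOnWith
  obtain ⟨ε, hε, hball⟩ := Metric.mem_nhds_iff.1 (inter_mem hs (hO.mem_nhds (hfO t ht)))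
  have key : ∀ h : ℝ → E, ContinuousOn h (Icc a b) → h t = f t →
      ∀ᶠ r in 𝓝[≥] t, h r ∈ Metric.ball (f t) ε := by
    intro h hh hht
    have h1 : ContinuousWithinAt h (Icc t b) t :=
      (hh t (Ico_subset_Icc_self ht)).mono (Icc_subset_Icc_left ht.1)
    have h2 : ContinuousWithinAt h (Ici t) t := by
      have : Icc t b ∈ 𝓝[≥] t := Icc_mem_nhdsGE ht.2
      exact h1.mono_of_mem_nhdsWithin this
    have : Metric.ball (f t) ε ∈ 𝓝 (h t) := by rw [hht]; exact Metric.ball_mem_nhds _ hε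
    exact h2 this
  have h3 : ∀ᶠ r in 𝓝[≥] t, r ∈ Metric.ball t ε :=
    mem_nhdsWithin_of_mem_nhds (Metric.ball_mem_nhds _ hε)
  have h4 : ∀ᶠ r in 𝓝[≥] t, r < b := mem_nhdsWithin_of_mem_nhds (Iio_mem_nhds ht.2)
  obtain ⟨u, hu, hu'⟩ := mem_nhdsGE_iff_exists_Icc_subset.1
    ((key f hf rfl).and ((key g hg htfg.symm).and (h3.and h4)))
  have hsub : Icc t u ⊆ Icc a b := fun r hr => ⟨ht.1.trans hr.1, (hu' hr).2.2.2.le⟩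
  have hsubo : Ico t u ⊆ Ico a b := fun r hr =>
    ⟨ht.1.trans hr.1, (hu' (Ico_subset_Icc_self hr)).2.2.2⟩
  have hmem : ∀ r ∈ Ico t u, ∀ x ∈ Metric.ball (f t) ε, (r, x) ∈ s ∩ O := by
    intro r hr x hx
    apply hball
    rw [← ball_prod_same]
    exact ⟨(hu' (Ico_subset_Icc_self hr)).2.2.1, hx⟩
  have := ODE_solution_unique_of_mem_Icc_right (v := v) (s := fun _ => Metric.ball (f t) ε)
    (K := K) (f := f) (g := g) (a := t) (b := u) ?_ (hf.mono hsub)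
    (fun r hr => hf' r (hsubo hr)) (fun r hr => (hu' (Ico_subset_Icc_self hr)).1)
    (hg.mono hsub) (fun r hr => hg' r (hsubo hr)
      (hmem r hr _ (hu' (Ico_subset_Icc_self hr)).2.1).2)
    (fun r hr => (hu' (Ico_subset_Icc_self hr)).2.1) htfg
  · have hIcc : Icc t u ∈ 𝓝[>] t := mem_of_superset (Ioc_mem_nhdsGT hu) Ioc_subset_Icc_self
    exact mem_of_superset hIcc this
  · intro r hr
    rw [lipschitzOnWith_iff_dist_le_mul]
    intro x hx y hy
    have := (lipschitzOnWith_iff_dist_le_mul.1 hK) _ (hmem r hr x hx).1 _ (hmem r hr y hy).1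
    simpa [Prod.dist_eq] using this

/-- Uniqueness for an autonomous equation whose right hand side is `C¹` on an open set. -/
theorem eqOn_Icc_of_solves_autonomous {v : E → E} {O : Set E} (hO : IsOpen O)
    (hv : ContDiffOn ℝ 1 v O) {f g : ℝ → E} {a b : ℝ}
    (hf : ContinuousOn f (Icc a b))
    (hf' : ∀ t ∈ Ico a b, HasDerivWithinAt f (v (f t)) (Ici t) t)
    (hfO : ∀ t ∈ Ico a b, f t ∈ O)
    (hg : ContinuousOn g (Icc a b))
    (hg' : ∀ t ∈ Ico a b, g t ∈ O → HasDerivWithinAt g (v (g t)) (Ici t) t)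
    (ha : f a = g a) : EqOn f g (Icc a b) :=
  eqOn_Icc_of_solves (v := fun _ => v) (O := univ ×ˢ O) (isOpen_univ.prod hO)
    (hv.comp contDiff_snd.contDiffOn fun _ hp => hp.2) hf hf' (fun t ht => ⟨trivial, hfO t ht⟩)
    hg (fun t ht h => hg' t ht h.2) ha

end Uniqueness

/-! ### Superposition operators and Volterra operators on spaces of continuous paths -/

section PathSpace

open scoped OperatorNorm

set_option linter.unusedSectionVars false

set_option synthInstance.maxHeartbeats 400000

universe u

variable {E G : Type u} [NormedAddCommGroup E] [NormedSpace ℝ E]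
  [NormedAddCommGroup G] [NormedSpace ℝ G]
  {K : Type*} [TopologicalSpace K] [CompactSpace K]

open Classical in
/-- Composition of continuous maps with `f`, where `f` may be discontinuous somewhere. -/
noncomputable def superposition (f : E → G) (γ : C(K, E)) : C(K, G) :=
  if h : Continuous (f ∘ γ) then ⟨f ∘ γ, h⟩ else 0

theorem superposition_apply {f : E → G} {U : Set E} (hf : ContinuousOn f U) {γ : C(K, E)}
    (hγ : ∀ t, γ t ∈ U) (t : K) : superposition f γ t = f (γ t) := by
  have : Continuous (f ∘ γ) := hf.comp_continuous γ.continuous hγ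
  simp [superposition, this]

variable (E G K) in
/-- Pointwise application of a continuous family of operators. -/
noncomputable def pathApply : C(K, E →L[ℝ] G) →L[ℝ] C(K, E) →L[ℝ] C(K, G) :=
  LinearMap.mkContinuous₂
    (LinearMap.mk₂ ℝ (fun (A : C(K, E →L[ℝ] G)) (h : C(K, E)) =>
        (⟨fun t => A t (h t), by fun_prop⟩ : C(K, G)))
      (fun A A' h => by ext t; simp) (fun c A h => by ext t; simp)
      (fun A h h' => by ext t; simp) (fun c A h => by ext t; simp)) 1
    (fun A h => by
      rw [one_mul, ContinuousMap.norm_le _ (by positivity)]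
      intro t
      exact (A t).le_of_opNorm_le_of_le (A.norm_coe_le_norm t) (h.norm_coe_le_norm t))

@[simp] theorem pathApply_apply (A : C(K, E →L[ℝ] G)) (h : C(K, E)) (t : K) :
    pathApply E G K A h t = A t (h t) := rfl

theorem isOpen_setOf_forall_mem {U : Set E} (hU : IsOpen U) :
    IsOpen {γ : C(K, E) | ∀ t, γ t ∈ U} := by
  have := ContinuousMap.isOpen_setOfPred_mapsTo (X := K) (Y := E) isCompact_univ hU
  simpa [MapsTo] using this

/-- The range of `γ` is compact, so `fderiv ℝ f` varies by less than `ε` within one distance `δ` of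
all its points. The mean value inequality on a ball then bounds the remainder uniformly in `t`, that
is, in the norm of the path space. -/
theorem hasFDerivAt_superposition {f : E → G} {U : Set E} (hU : IsOpen U)
    (hf : ContDiffOn ℝ 1 f U) {γ : C(K, E)} (hγ : ∀ t, γ t ∈ U) :
    HasFDerivAt (superposition f) (pathApply E G K (superposition (fderiv ℝ f) γ)) γ := by
  have hdf : ContinuousOn (fderiv ℝ f) U := hf.continuousOn_fderiv_of_isOpen hU le_rfl
  have hdiff : ∀ x ∈ U, HasFDerivAt f (fderiv ℝ f x) x := fun x hx =>
    ((hf.differentiableOn one_ne_zero).differentiableAt (hU.mem_nhds hx)).hasFDerivAt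
  rw [hasFDerivAt_iff_isLittleO_nhds_zero, Asymptotics.isLittleO_iff]
  intro ε hε
  have hcomp : IsCompact (range γ) := isCompact_range γ.continuous
  have hsub : range γ ⊆ U := by rintro _ ⟨t, rfl⟩; exact hγ t
  have h1 := hcomp.uniformContinuousAt_of_continuousAt (fderiv ℝ f)
    (fun a ha => hdf.continuousAt (hU.mem_nhds (hsub ha))) (Metric.dist_mem_uniformity hε)
  obtain ⟨δ, hδ, hδ'⟩ := Metric.mem_uniformity_dist.1 h1
  obtain ⟨δ₂, hδ₂, hthick⟩ := hcomp.exists_thickening_subset_open hU hsub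
  have hev : ∀ᶠ h : C(K, E) in 𝓝 0, ‖h‖ < min δ δ₂ := by
    have : ∀ᶠ h : C(K, E) in 𝓝 0, h ∈ Metric.ball (0 : C(K, E)) (min δ δ₂) :=
      Metric.ball_mem_nhds _ (by positivity)
    simpa using this
  filter_upwards [hev] with h hh
  rw [ContinuousMap.norm_le _ (by positivity)]
  intro t
  have hball : Metric.ball (γ t) (min δ δ₂) ⊆ U := fun x hx => hthick
    (Metric.mem_thickening_iff.2 ⟨γ t, mem_range_self t,
      (Metric.mem_ball.1 hx).trans_le (min_le_right _ _)⟩)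
  have hmem : ∀ s, γ s + h s ∈ Metric.ball (γ s) (min δ δ₂) := fun s => by
    simpa using (h.norm_coe_le_norm s).trans_lt hh
  have hγh : ∀ s, (γ + h) s ∈ U := fun s => hthick
    (Metric.mem_thickening_iff.2 ⟨γ s, mem_range_self s,
      (Metric.mem_ball.1 (hmem s)).trans_le (min_le_right _ _)⟩)
  have hmv := (convex_ball (γ t) (min δ δ₂)).norm_image_sub_le_of_norm_hasFDerivWithin_le'
    (f := f) (f' := fderiv ℝ f) (φ := fderiv ℝ f (γ t)) (C := ε)
    (fun x hx => (hdiff x (hball hx)).hasFDerivWithinAt)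
    (fun x hx => by
      have : dist (fderiv ℝ f (γ t)) (fderiv ℝ f x) < ε := @hδ' (γ t) x (by
        rw [dist_comm]; exact (Metric.mem_ball.1 hx).trans_le (min_le_left _ _)) (mem_range_self t)
      rw [dist_comm, dist_eq_norm] at this
      exact this.le) (Metric.mem_ball_self (by positivity)) (hmem t)
  have e1 : superposition f (γ + h) t = f (γ t + h t) :=
    superposition_apply hf.continuousOn hγh t
  have e2 := superposition_apply hf.continuousOn hγ t
  have e3 := superposition_apply hdf hγ t
  simp only [ContinuousMap.sub_apply, pathApply_apply, e1, e2, e3]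
  refine (by simpa using hmv : _ ≤ ε * ‖h t‖).trans ?_
  gcongr
  exact h.norm_coe_le_norm t

/-- The derivative of superposition with `f` is superposition with `fderiv ℝ f`, followed by the
bounded operator `pathApply`. The induction therefore replaces `G` by `E →L[ℝ] G`; this is why `G`
is quantified inside and lives in the universe of `E`. -/
theorem contDiffOn_superposition_nat (n : ℕ) : ∀ {G : Type u} [NormedAddCommGroup G]
    [NormedSpace ℝ G] {f : E → G} {U : Set E}, IsOpen U → ContDiffOn ℝ ∞ f U →
    ContDiffOn ℝ n (superposition (K := K) f) {γ : C(K, E) | ∀ t, γ t ∈ U} := by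
  induction n with
  | zero =>
    intro G _ _ f U hU hf
    refine contDiffOn_zero.2 fun γ hγ => ?_
    exact (hasFDerivAt_superposition hU (hf.of_le (by simp)) hγ).continuousAt.continuousWithinAt
  | succ n ih =>
    intro G _ _ f U hU hf
    have hd : ∀ γ ∈ {γ : C(K, E) | ∀ t, γ t ∈ U}, HasFDerivAt (superposition f)
        (pathApply E G K (superposition (fderiv ℝ f) γ)) γ := fun γ hγ =>
      hasFDerivAt_superposition hU (hf.of_le (by simp)) hγ
    push_cast
    rw [contDiffOn_succ_iff_fderiv_of_isOpen (isOpen_setOf_forall_mem hU)]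
    refine ⟨fun γ hγ => (hd γ hγ).differentiableAt.differentiableWithinAt, by simp, ?_⟩
    refine ContDiffOn.congr ?_ fun γ hγ => (hd γ hγ).fderiv
    exact (pathApply E G K).contDiff.comp_contDiffOn
      (ih hU ((contDiffOn_infty_iff_fderiv_of_isOpen hU).1 hf).2)

theorem contDiffOn_superposition {f : E → G} {U : Set E} (hU : IsOpen U)
    (hf : ContDiffOn ℝ ∞ f U) :
    ContDiffOn ℝ ∞ (superposition (K := K) f) {γ : C(K, E) | ∀ t, γ t ∈ U} :=
  contDiffOn_infty.2 fun n => contDiffOn_superposition_nat n hU hf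

variable (E) in
/-- The integration operator `h ↦ ∫₀ᵗ h` on paths. -/
noncomputable def pathIntegral : C(Icc (0 : ℝ) 1, E) →L[ℝ] C(Icc (0 : ℝ) 1, E) :=
  LinearMap.mkContinuous
    { toFun := fun h => ⟨fun t => ∫ s in (0 : ℝ)..t, h (projIcc 0 1 zero_le_one s), by
        have hc : Continuous fun s => h (projIcc 0 1 zero_le_one s) := by fun_prop
        exact (intervalIntegral.continuous_primitive
          (fun a b => hc.intervalIntegrable a b) 0).comp continuous_subtype_val⟩
      map_add' := fun h h' => by
        ext t
        have hc : ∀ h : C(Icc (0 : ℝ) 1, E),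
          Continuous fun s => h (projIcc 0 1 zero_le_one s) := fun h => by fun_prop
        simpa using intervalIntegral.integral_add ((hc h).intervalIntegrable 0 t)
          ((hc h').intervalIntegrable 0 t)
      map_smul' := fun c h => by ext t; simp } 1
    (fun h => by
      rw [one_mul, ContinuousMap.norm_le _ (by positivity)]
      intro t
      have := intervalIntegral.norm_integral_le_of_norm_le_const (a := 0) (b := t)
        (f := fun s => h (projIcc 0 1 zero_le_one s)) (C := ‖h‖)
        (fun s _ => h.norm_coe_le_norm _)
      refine this.trans ?_
      have h1 : |(t : ℝ) - 0| ≤ 1 := by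
        rw [sub_zero, abs_of_nonneg t.2.1]; exact t.2.2
      exact mul_le_of_le_one_right (norm_nonneg _) h1)

theorem pathIntegral_apply (h : C(Icc (0 : ℝ) 1, E)) (t : Icc (0 : ℝ) 1) :
    pathIntegral E h t = ∫ s in (0 : ℝ)..t, h (projIcc 0 1 zero_le_one s) := rfl

/-- The bound is kept pointwise in `t`: integrating `s ^ n / n!` once more is what produces the next
factorial. -/
theorem norm_volterra_pow_apply_le (A : C(Icc (0 : ℝ) 1, E →L[ℝ] E)) (n : ℕ)
    (h : C(Icc (0 : ℝ) 1, E)) (t : Icc (0 : ℝ) 1) :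
    ‖((pathIntegral E ∘L pathApply E E _ A) ^ n) h t‖
      ≤ ‖A‖ ^ n * ‖h‖ * ((t : ℝ) ^ n / n.factorial) := by
  induction n generalizing t with
  | zero => simpa using h.norm_coe_le_norm t
  | succ n ih =>
    rw [pow_succ']
    change ‖pathIntegral E (pathApply E E _ A (((pathIntegral E ∘L pathApply E E _ A) ^ n) h)) t‖
      ≤ _
    rw [pathIntegral_apply]
    have hb : ∀ s ∈ Ioc (0 : ℝ) t,
        ‖pathApply E E _ A (((pathIntegral E ∘L pathApply E E _ A) ^ n) h)
          (projIcc 0 1 zero_le_one s)‖ ≤ ‖A‖ ^ (n + 1) * ‖h‖ / n.factorial * s ^ n := by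
      intro s hs
      have hs' : s ∈ Icc (0 : ℝ) 1 := ⟨hs.1.le, hs.2.trans t.2.2⟩
      rw [projIcc_of_mem _ hs', pathApply_apply]
      refine ((A ⟨s, hs'⟩).le_of_opNorm_le_of_le (A.norm_coe_le_norm _) (ih ⟨s, hs'⟩)).trans ?_
      apply le_of_eq
      simp only
      field_simp
      ring
    refine (intervalIntegral.norm_integral_le_of_norm_le t.2.1
      (Eventually.of_forall hb) ?_).trans ?_
    · exact (by fun_prop : Continuous fun s : ℝ =>
        ‖A‖ ^ (n + 1) * ‖h‖ / n.factorial * s ^ n).intervalIntegrable _ _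
    · apply le_of_eq
      rw [intervalIntegral.integral_const_mul, integral_pow, Nat.factorial_succ]
      push_cast
      field_simp
      simp

/-- Some power of the Volterra operator `T` has norm below one, because `‖A‖ ^ n / n!` tends to
zero. Then `1 - T ^ n` is a unit, and it is the product of `1 - T` with a geometric sum that
commutes with it. No smallness of `A` is required, so solutions need not be built on short
intervals. -/
theorem isUnit_one_sub_volterra [CompleteSpace E] (A : C(Icc (0 : ℝ) 1, E →L[ℝ] E)) :
    IsUnit (1 - pathIntegral E ∘L pathApply E E _ A) := by
  set T : C(Icc (0 : ℝ) 1, E) →L[ℝ] C(Icc (0 : ℝ) 1, E) := pathIntegral E ∘L pathApply E E _ A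
  obtain ⟨n, hn⟩ := ((FloorSemiring.tendsto_pow_div_factorial_atTop ‖A‖).eventually
    (gt_mem_nhds (show (0 : ℝ) < 1 / 2 by norm_num))).exists
  have hT : ‖T ^ n‖ < 1 := by
    refine (ContinuousLinearMap.opNorm_le_bound _ (by positivity) fun h => ?_ :
      ‖T ^ n‖ ≤ ‖A‖ ^ n / n.factorial).trans_lt (hn.trans (by norm_num))
    rw [ContinuousMap.norm_le _ (by positivity)]
    intro t
    refine (norm_volterra_pow_apply_le A n h t).trans ?_
    have : (t : ℝ) ^ n ≤ 1 := pow_le_one₀ t.2.1 t.2.2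
    calc ‖A‖ ^ n * ‖h‖ * ((t : ℝ) ^ n / n.factorial)
        ≤ ‖A‖ ^ n * ‖h‖ * (1 / n.factorial) := by gcongr
      _ = _ := by ring
  have h1 := isUnit_one_sub_of_norm_lt_one
    (R := C(Icc (0 : ℝ) 1, E) →L[ℝ] C(Icc (0 : ℝ) 1, E)) hT
  rw [← mul_neg_geom_sum T n] at h1
  refine ((Commute.isUnit_mul_iff ?_).1 h1).1
  exact ((Commute.one_left _).sub_left (Commute.sum_right _ _ _ fun i _ => Commute.self_pow T i))

/-- The solutions on `[0, 1]` of the integral equation of `x' = f x` near a given one depend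
smoothly on the initial value. -/
theorem exists_contDiffOn_solutionMap [CompleteSpace E] {f : E → E} {U : Set E} (hU : IsOpen U)
    (hf : ContDiffOn ℝ ∞ f U) {γ₀ : C(Icc (0 : ℝ) 1, E)} (hγ₀ : ∀ t, γ₀ t ∈ U) {p : E}
    (hp : γ₀ - pathIntegral E (superposition f γ₀) = ContinuousMap.const _ p) :
    ∃ Γ : E → C(Icc (0 : ℝ) 1, E), ∃ W : Set E, IsOpen W ∧ p ∈ W ∧ ContDiffOn ℝ ∞ Γ W ∧
      ∀ x ∈ W, (∀ t, Γ x t ∈ U) ∧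
        Γ x - pathIntegral E (superposition f (Γ x)) = ContinuousMap.const _ x := by
  set Ψ : C(Icc (0 : ℝ) 1, E) → C(Icc (0 : ℝ) 1, E) :=
    fun γ => γ - pathIntegral E (superposition f γ) with hΨ
  set O : Set C(Icc (0 : ℝ) 1, E) := {γ | ∀ t, γ t ∈ U} with hO
  have hOo : IsOpen O := isOpen_setOf_forall_mem hU
  have hsm : ∀ γ ∈ O, ContDiffAt ℝ ∞ Ψ γ := fun γ hγ =>
    (contDiffOn_id.sub ((pathIntegral E).contDiff.comp_contDiffOn
      (contDiffOn_superposition hU hf))).contDiffAt (hOo.mem_nhds hγ)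
  -- Invertibility is needed at every path of `O` and not only at `γ₀`, since smoothness of the
  -- local inverse is checked point by point.
  have hd : ∀ γ ∈ O, ∃ L : C(Icc (0 : ℝ) 1, E) ≃L[ℝ] C(Icc (0 : ℝ) 1, E),
      HasFDerivAt Ψ (L : C(Icc (0 : ℝ) 1, E) →L[ℝ] C(Icc (0 : ℝ) 1, E)) γ := by
    intro γ hγ
    obtain ⟨u, hu⟩ := isUnit_one_sub_volterra (superposition (fderiv ℝ f) γ)
    refine ⟨ContinuousLinearEquiv.ofUnit u, ?_⟩
    have h1 := (hasFDerivAt_id (𝕜 := ℝ) γ).sub ((pathIntegral E).hasFDerivAt.comp γ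
      (hasFDerivAt_superposition hU (hf.of_le (by simp)) hγ))
    refine h1.congr_fderiv ?_
    exact hu.symm
  obtain ⟨L₀, hL₀⟩ := hd γ₀ hγ₀
  have hne : (∞ : WithTop ℕ∞) ≠ 0 := by simp
  set e := (hsm γ₀ hγ₀).toOpenPartialHomeomorph Ψ hL₀ hne with he
  have hec : (e : C(Icc (0 : ℝ) 1, E) → C(Icc (0 : ℝ) 1, E)) = Ψ := rfl
  have hsrc : γ₀ ∈ e.source := (hsm γ₀ hγ₀).mem_toOpenPartialHomeomorph_source hL₀ hne
  have hconst : ContDiff ℝ ∞ (fun x : E => (ContinuousMap.const (Icc (0 : ℝ) 1) x)) :=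
    (ContinuousLinearMap.contDiff (𝕜 := ℝ) (LinearMap.mkContinuous
      { toFun := fun x : E => ContinuousMap.const (Icc (0 : ℝ) 1) x
        map_add' := fun x y => rfl
        map_smul' := fun c x => rfl } 1 (fun x => by
          rw [one_mul, ContinuousMap.norm_le _ (by positivity)]
          intro t; exact le_rfl)))
  -- Solving for the initial value `x` amounts to inverting `Ψ` at the constant path `x`; `W`
  -- consists of those `x` for which this inverse exists and stays in `U`.
  refine ⟨fun x => e.symm (ContinuousMap.const _ x),
    (fun x => ContinuousMap.const (Icc (0 : ℝ) 1) x) ⁻¹' (e.target ∩ e.symm ⁻¹' O),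
    (e.isOpen_inter_preimage_symm hOo).preimage hconst.continuous, ?_, ?_, ?_⟩
  · change ContinuousMap.const _ p ∈ e.target ∩ e.symm ⁻¹' O
    rw [← hp]
    have : e γ₀ ∈ e.target := e.map_source hsrc
    refine ⟨this, ?_⟩
    change e.symm (e γ₀) ∈ O
    rw [e.left_inv hsrc]
    exact hγ₀
  · intro x hx
    obtain ⟨L, hL⟩ := hd _ hx.2
    exact ((e.contDiffAt_symm hx.1 hL (hsm _ hx.2)).comp x
      hconst.contDiffAt).contDiffWithinAt
  · intro x hx
    exact ⟨hx.2, e.right_inv hx.1⟩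

theorem HasDerivWithinAt.of_integral_eq [CompleteSpace E] {f : E → E} {U : Set E}
    (hf : ContinuousOn f U) {γ : C(Icc (0 : ℝ) 1, E)} (hγ : ∀ t, γ t ∈ U) {x : E}
    (hx : γ - pathIntegral E (superposition f γ) = ContinuousMap.const _ x) :
    γ ⟨0, by simp⟩ = x ∧ ∀ t ∈ Icc (0 : ℝ) 1,
      HasDerivWithinAt (fun t => γ (projIcc 0 1 zero_le_one t))
        (f (γ (projIcc 0 1 zero_le_one t))) (Icc 0 1) t := by
  have key : ∀ t : Icc (0 : ℝ) 1,
      γ t = x + ∫ s in (0 : ℝ)..t, f (γ (projIcc 0 1 zero_le_one s)) := by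
    intro t
    have h1 : γ t - pathIntegral E (superposition f γ) t = x := by
      rw [← ContinuousMap.sub_apply, hx]; rfl
    rw [pathIntegral_apply] at h1
    simp only [superposition_apply hf hγ] at h1
    rw [← h1, sub_add_cancel]
  refine ⟨by rw [key]; simp, fun t ht => ?_⟩
  have hc : Continuous fun s => f (γ (projIcc 0 1 zero_le_one s)) :=
    (hf.comp_continuous γ.continuous hγ).comp continuous_projIcc
  have h2 := ((intervalIntegral.integral_hasDerivAt_right (hc.intervalIntegrable 0 t)
    hc.aestronglyMeasurable.stronglyMeasurableAtFilter hc.continuousAt).const_add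
      x).hasDerivWithinAt (s := Icc 0 1)
  refine h2.congr (fun s hs => ?_) ?_
  · rw [key, projIcc_of_mem _ hs]
  · rw [key, projIcc_of_mem _ ht]

theorem integral_eq_of_hasDerivAt [CompleteSpace E] {f : E → E} {U : Set E}
    (hf : ContinuousOn f U) {γ : C(Icc (0 : ℝ) 1, E)} (hγ : ∀ t, γ t ∈ U) {c : ℝ → E}
    (hc : ∀ t : Icc (0 : ℝ) 1, γ t = c t)
    (hd : ∀ t ∈ Icc (0 : ℝ) 1, HasDerivAt c (f (c t)) t) :
    γ - pathIntegral E (superposition f γ) = ContinuousMap.const _ (c 0) := by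
  ext t
  rw [ContinuousMap.sub_apply, pathIntegral_apply]
  simp only [superposition_apply hf hγ, ContinuousMap.const_apply]
  have hcont : Continuous fun s => f (γ (projIcc 0 1 zero_le_one s)) :=
    (hf.comp_continuous γ.continuous hγ).comp continuous_projIcc
  rw [intervalIntegral.integral_eq_sub_of_hasDerivAt (f := c) ?_ (hcont.intervalIntegrable _ _),
    hc]
  · abel
  · intro s hs
    rw [uIcc_of_le t.2.1] at hs
    have hs' : s ∈ Icc (0 : ℝ) 1 := ⟨hs.1, hs.2.trans t.2.2⟩
    rw [projIcc_of_mem _ hs', hc]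
    exact hd s hs'

end PathSpace

/-! ### Smooth dependence on time and initial values -/

section SmoothFlow

open scoped OperatorNorm

universe u

variable {E : Type u} [NormedAddCommGroup E] [NormedSpace ℝ E]

/-- `γ` solves `γ' = s f(γ)` on `[0, 1]`, starts at `x`, and stays in `U`. -/
structure IsRescaledSolution (f : E → E) (U : Set E) (s : ℝ) (x : E) (γ : ℝ → E) : Prop where
  init : γ 0 = x
  mem : ∀ t ∈ Icc (0 : ℝ) 1, γ t ∈ U
  deriv : ∀ t ∈ Icc (0 : ℝ) 1, HasDerivWithinAt γ (s • f (γ t)) (Icc 0 1) t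

theorem HasDerivWithinAt.Ici_of_Icc {γ : ℝ → E} {v : E} {a b t : ℝ}
    (h : HasDerivWithinAt γ v (Icc a b) t) (ht : t ∈ Ico a b) :
    HasDerivWithinAt γ v (Ici t) t :=
  h.mono_of_mem_nhdsWithin (Icc_mem_nhdsGE_of_mem ht)

theorem IsRescaledSolution.unique {f : E → E} {U : Set E} (hU : IsOpen U)
    (hf : ContDiffOn ℝ ∞ f U) {s : ℝ} {x : E} {γ γ' : ℝ → E}
    (h : IsRescaledSolution f U s x γ) (h' : IsRescaledSolution f U s x γ') :
    EqOn γ γ' (Icc 0 1) :=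
  eqOn_Icc_of_solves_autonomous (v := fun y => s • f y) hU
    ((contDiff_const_smul s).comp_contDiffOn (hf.of_le (by simp)))
    (fun t ht => (h.deriv t ht).continuousWithinAt)
    (fun t ht => (h.deriv t (Ico_subset_Icc_self ht)).Ici_of_Icc ht)
    (fun t ht => h.mem t (Ico_subset_Icc_self ht))
    (fun t ht => (h'.deriv t ht).continuousWithinAt)
    (fun t ht _ => (h'.deriv t (Ico_subset_Icc_self ht)).Ici_of_Icc ht)
    (h.init.trans h'.init.symm)

/-- A single solution for the speed `s` contains the solutions for all speeds `r * s` with `r ∈ [0,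
1]`. This recovers the dependence on time from solutions on the fixed interval `[0, 1]`. -/
theorem IsRescaledSolution.comp_mul {f : E → E} {U : Set E} {s : ℝ} {x : E} {γ : ℝ → E}
    (h : IsRescaledSolution f U s x γ) {r : ℝ} (hr : r ∈ Icc (0 : ℝ) 1) :
    IsRescaledSolution f U (r * s) x (fun t => γ (r * t)) := by
  have hmaps : MapsTo (fun t => r * t) (Icc (0 : ℝ) 1) (Icc 0 1) := fun t ht =>
    ⟨mul_nonneg hr.1 ht.1, mul_le_one₀ hr.2 ht.1 ht.2⟩
  refine ⟨by simpa using h.init, fun t ht => h.mem _ (hmaps ht), fun t ht => ?_⟩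
  have h1 : HasDerivWithinAt (fun t => r * t) r (Icc 0 1) t := by
    simpa using ((hasDerivAt_id t).const_mul r).hasDerivWithinAt
  have := (h.deriv _ (hmaps ht)).scomp t h1 hmaps
  simpa [mul_smul, Function.comp_def] using this

open Classical in
/-- The value at time `1` of the solution of `γ' = s f(γ)` that starts at `x`. -/
noncomputable def rescaledFlow (f : E → E) (U : Set E) (q : ℝ × E) : E :=
  if h : ∃ γ, IsRescaledSolution f U q.1 q.2 γ then h.choose 1 else q.2

theorem IsRescaledSolution.flow_eq {f : E → E} {U : Set E} (hU : IsOpen U)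
    (hf : ContDiffOn ℝ ∞ f U) {s : ℝ} {x : E} {γ : ℝ → E}
    (h : IsRescaledSolution f U s x γ) : rescaledFlow f U (s, x) = γ 1 := by
  have hex : ∃ γ, IsRescaledSolution f U (s, x).1 (s, x).2 γ := ⟨γ, h⟩
  rw [rescaledFlow, dif_pos hex]
  exact hex.choose_spec.unique hU hf h (by simp)

/-- The speed `s` is adjoined to the state as a component with zero derivative. Smooth dependence on
initial values then covers dependence on `s`, hence on time. -/
theorem eventually_contDiffAt_rescaledFlow [CompleteSpace E] {f : E → E} {U : Set E}
    (hU : IsOpen U) (hf : ContDiffOn ℝ ∞ f U) {γ₀ : ℝ → E} {s₀ : ℝ}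
    (hγ₀ : ∀ t ∈ Icc (0 : ℝ) 1, γ₀ t ∈ U ∧ HasDerivAt γ₀ (s₀ • f (γ₀ t)) t) :
    ∀ᶠ q in 𝓝 (s₀, γ₀ 0), ContDiffAt ℝ ∞ (rescaledFlow f U) q ∧
      ∃ γ, IsRescaledSolution f U q.1 q.2 γ := by
  set g : ℝ × E → ℝ × E := fun q => (0, q.1 • f q.2) with hg
  set O : Set (ℝ × E) := univ ×ˢ U with hO
  have hOo : IsOpen O := isOpen_univ.prod hU
  have hgs : ContDiffOn ℝ ∞ g O :=
    contDiffOn_const.prodMk (contDiff_fst.contDiffOn.smul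
      (hf.comp contDiff_snd.contDiffOn fun _ hq => hq.2))
  set c : ℝ → ℝ × E := fun t => (s₀, γ₀ t) with hc
  have hcd : ∀ t ∈ Icc (0 : ℝ) 1, HasDerivAt c (g (c t)) t := fun t ht =>
    (hasDerivAt_const t s₀).prodMk (hγ₀ t ht).2
  set Γ₀ : C(Icc (0 : ℝ) 1, ℝ × E) := ⟨fun t => c t, by
    have : ContinuousOn c (Icc 0 1) := fun t ht => (hcd t ht).continuousAt.continuousWithinAt
    exact continuousOn_iff_continuous_domRestrict.1 this⟩ with hΓ₀
  have hmem : ∀ t, Γ₀ t ∈ O := fun t => ⟨trivial, (hγ₀ t t.2).1⟩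
  obtain ⟨Γ, W, hW, hpW, hΓ, hsol⟩ := exists_contDiffOn_solutionMap hOo hgs hmem
    (integral_eq_of_hasDerivAt hgs.continuousOn hmem (fun t => rfl) hcd)
  have hres : ∀ q ∈ W, IsRescaledSolution f U q.1 q.2
      (fun t => (Γ q (projIcc 0 1 zero_le_one t)).2) := by
    intro q hq
    obtain ⟨h0, hd⟩ := HasDerivWithinAt.of_integral_eq hgs.continuousOn (hsol q hq).1 (hsol q hq).2
    -- The adjoined component is constant along a solution, so it keeps its initial value as the
    -- speed.
    have hfst : ∀ t ∈ Icc (0 : ℝ) 1, (Γ q (projIcc 0 1 zero_le_one t)).1 = q.1 := by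
      have hd1 : ∀ t ∈ Icc (0 : ℝ) 1, HasDerivWithinAt
          (fun t => (Γ q (projIcc 0 1 zero_le_one t)).1) 0 (Icc 0 1) t := fun t ht =>
        (hd t ht).fst
      intro t ht
      have := constant_of_has_deriv_right_zero (fun t ht => (hd1 t ht).continuousWithinAt)
        (fun t ht => (hd1 t (Ico_subset_Icc_self ht)).Ici_of_Icc ht) t ht
      rw [this, projIcc_left]
      exact congrArg Prod.fst h0
    refine ⟨?_, fun t ht => ((hsol q hq).1 _).2, fun t ht => ?_⟩
    · simp only [projIcc_left]; exact congrArg Prod.snd h0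
    · have h2 : HasDerivWithinAt (fun t => (Γ q (projIcc 0 1 zero_le_one t)).2)
          ((Γ q (projIcc 0 1 zero_le_one t)).1 • f (Γ q (projIcc 0 1 zero_le_one t)).2)
          (Icc 0 1) t := (hd t ht).snd
      rwa [hfst t ht] at h2
  have heq : ∀ q ∈ W, rescaledFlow f U q = (Γ q ⟨1, by simp⟩).2 := by
    intro q hq
    have := (hres q hq).flow_eq hU hf
    simpa only [projIcc_right] using this
  filter_upwards [hW.mem_nhds hpW] with q hq
  refine ⟨?_, _, hres q hq⟩
  have hev : ContDiffOn ℝ ∞ (fun q => (Γ q ⟨1, by simp⟩).2) W :=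
    (contDiff_snd (𝕜 := ℝ) (E := ℝ) (F := E)).comp_contDiffOn
      ((ContinuousLinearMap.contDiff (𝕜 := ℝ) (ContinuousMap.evalCLM (R := ℝ) (M := ℝ × E)
        (⟨1, by simp⟩ : Icc (0 : ℝ) 1))).comp_contDiffOn hΓ)
  exact ((hev q hq).contDiffAt (hW.mem_nhds hq)).congr_of_eventuallyEq
    (eventually_of_mem (hW.mem_nhds hq) heq)

/-- Smooth dependence of solutions of `x' = f x` on time and initial value, near a given solution
on the interval `[-T, T]`. -/
theorem exists_smooth_flow [CompleteSpace E] {f : E → E} {U : Set E} (hU : IsOpen U)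
    (hf : ContDiffOn ℝ ∞ f U) {γ₀ : ℝ → E} {T : ℝ} (hT : 0 < T)
    (hγ₀ : ∀ t ∈ Icc (-T) T, γ₀ t ∈ U ∧ HasDerivAt γ₀ (f (γ₀ t)) t) :
    ∃ φ : ℝ × E → E, ∃ W : Set E, IsOpen W ∧ γ₀ 0 ∈ W ∧
      (∀ t ∈ Icc (-T) T, φ (t, γ₀ 0) = γ₀ t) ∧
      (∀ t ∈ Icc (-T) T, ∀ x ∈ W, ContDiffAt ℝ ∞ φ (t, x)) ∧
      ∀ x ∈ W, φ (0, x) = x ∧ ∀ t ∈ Ioo (-T) T, φ (t, x) ∈ U ∧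
        HasDerivAt (fun s => φ (s, x)) (f (φ (t, x))) t := by
  have hseg : ∀ s ∈ Icc (-T) T, ∀ t ∈ Icc (0 : ℝ) 1,
      γ₀ (s * t) ∈ U ∧ HasDerivAt (fun t => γ₀ (s * t)) (s • f (γ₀ (s * t))) t := by
    intro s hs t ht
    have hst : s * t ∈ Icc (-T) T := by
      constructor <;> nlinarith [hs.1, hs.2, ht.1, ht.2]
    refine ⟨(hγ₀ _ hst).1, ?_⟩
    have h1 : HasDerivAt (fun t => s * t) s t := by
      simpa using (hasDerivAt_id t).const_mul s
    exact (hγ₀ _ hst).2.scomp t h1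
  have hnear : ∀ s ∈ Icc (-T) T, ∀ᶠ q in 𝓝 (s, γ₀ 0), ContDiffAt ℝ ∞ (rescaledFlow f U) q ∧
      ∃ γ, IsRescaledSolution f U q.1 q.2 γ := by
    intro s hs
    have := eventually_contDiffAt_rescaledFlow hU hf (hseg s hs)
    simpa using this
  have hset : {q : ℝ × E | ContDiffAt ℝ ∞ (rescaledFlow f U) q ∧
      ∃ γ, IsRescaledSolution f U q.1 q.2 γ} ∈ 𝓝ˢ (Icc (-T) T ×ˢ {γ₀ 0}) := by
    rw [mem_nhdsSet_iff_forall]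
    rintro ⟨s, x⟩ ⟨hs, hx⟩
    obtain rfl : x = γ₀ 0 := hx
    exact hnear s hs
  obtain ⟨N, hN, hsub, hNs⟩ := mem_nhdsSet_iff_exists.1 hset
  obtain ⟨I, W, -, hW, hI, hpW, hIW⟩ :=
    -- Compactness of `[-T, T]` yields one neighbourhood `W` of the initial value that serves all
    -- times.
    generalized_tube_lemma isCompact_Icc isCompact_singleton hN hsub
  refine ⟨rescaledFlow f U, W, hW, hpW rfl, fun t ht => ?_,
    fun t ht x hx => (hNs (hIW (mk_mem_prod (hI ht) hx))).1, fun x hx => ?_⟩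
  · have : IsRescaledSolution f U t (γ₀ 0) (fun r => γ₀ (t * r)) :=
      ⟨by simp, fun r hr => (hseg t ht r hr).1, fun r hr => (hseg t ht r hr).2.hasDerivWithinAt⟩
    simpa using this.flow_eq hU hf
  have hray : ∀ s ∈ Icc (-T) T, ∃ γ, IsRescaledSolution f U s x γ ∧
      ∀ r ∈ Icc (0 : ℝ) 1, rescaledFlow f U (r * s, x) = γ r := by
    intro s hs
    obtain ⟨γ, hγ⟩ := (hNs (@hIW (s, x) ⟨hI hs, hx⟩)).2
    refine ⟨γ, hγ, fun r hr => ?_⟩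
    simpa using (hγ.comp_mul hr).flow_eq hU hf
  refine ⟨?_, fun t ht => ?_⟩
  · obtain ⟨γ, hγ, hr⟩ := hray T ⟨by linarith, le_rfl⟩
    simpa [hγ.init] using hr 0 (by simp)
  -- The time is written as a fraction of `T` or `-T`. The factor `s` must be nonzero because it is
  -- cancelled at the end.
  obtain ⟨s, hs0, hs, r, hr, rfl⟩ : ∃ s : ℝ, s ≠ 0 ∧ s ∈ Icc (-T) T ∧
      ∃ r ∈ Icc (0 : ℝ) 1, t = r * s := by
    rcases le_or_gt 0 t with h | h
    · exact ⟨T, hT.ne', ⟨by linarith, le_rfl⟩, t / T,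
        ⟨by positivity, (div_le_one hT).2 ht.2.le⟩, by field_simp⟩
    · refine ⟨-T, by linarith, ⟨le_rfl, by linarith⟩, (-t) / T,
        ⟨div_nonneg (by linarith) hT.le, (div_le_one hT).2 (by linarith [ht.1])⟩, by field_simp⟩
  obtain ⟨γ, hγ, hray⟩ := hray s hs
  have hval := hray r hr
  refine ⟨hval ▸ hγ.mem r hr, ?_⟩
  have hdiff : DifferentiableAt ℝ (fun s => rescaledFlow f U (s, x)) (r * s) := by
    have h1 := ((hNs (@hIW (r * s, x) ⟨hI (Ioo_subset_Icc_self ht), hx⟩)).1.differentiableAt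
      (by simp)).comp (r * s) (f := fun s : ℝ => (s, x)) (by fun_prop)
    exact h1
  have h2 := hdiff.hasDerivAt
  have h3 : HasDerivAt (fun r => r * s) s r := by simpa using (hasDerivAt_id r).mul_const s
  have h4 : HasDerivWithinAt (fun r => rescaledFlow f U (r * s, x))
      (s • deriv (fun s => rescaledFlow f U (s, x)) (r * s)) (Icc 0 1) r :=
    (HasDerivAt.scomp (g₁ := fun s => rescaledFlow f U (s, x)) r h2 h3).hasDerivWithinAt
  -- The differential equation only gives a derivative within `[0, 1]`. Two-sided differentiability
  -- is already known from smoothness, so this one-sided value determines the derivative.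
  have h5 : HasDerivWithinAt (fun r => rescaledFlow f U (r * s, x)) (s • f (γ r)) (Icc 0 1) r :=
    (hγ.deriv r hr).congr (fun r hr => hray r hr) hval
  have h6 := (uniqueDiffOn_Icc zero_lt_one r hr).eq_deriv _ h4 h5
  rw [hval, ← smul_right_injective E hs0 h6]
  exact h2

end SmoothFlow

/-! ### The coordinate model of a Lie algebroid with a spray, and its flow near the zero section -/

section SprayModel

open scoped OperatorNorm

theorem two_le_infty : (2 : WithTop ℕ∞) ≤ ∞ := WithTop.coe_le_coe.2 le_top

section Calculus

variable {E G : Type*} [NormedAddCommGroup E] [NormedSpace ℝ E]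
  [NormedAddCommGroup G] [NormedSpace ℝ G]

theorem HasDerivAt.prod_fst {f : ℝ → E × G} {f' : E × G} {t : ℝ} (h : HasDerivAt f f' t) :
    HasDerivAt (fun s => (f s).1) f'.1 t :=
  (hasFDerivAt_fst (p := f t)).comp_hasDerivAt t h

theorem HasDerivAt.prod_snd {f : ℝ → E × G} {f' : E × G} {t : ℝ} (h : HasDerivAt f f' t) :
    HasDerivAt (fun s => (f s).2) f'.2 t :=
  (hasFDerivAt_snd (p := f t)).comp_hasDerivAt t h

/-- Uniqueness on a symmetric time interval for an autonomous equation. -/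
theorem eqOn_Ioo_of_solves_autonomous {v : E → E} {O : Set E} (hO : IsOpen O)
    (hv : ContDiffOn ℝ 1 v O) {f g : ℝ → E} {T : ℝ}
    (hf : ∀ t ∈ Ioo (-T) T, f t ∈ O ∧ HasDerivAt f (v (f t)) t)
    (hg : ∀ t ∈ Ioo (-T) T, g t ∈ O ∧ HasDerivAt g (v (g t)) t)
    (h0 : f 0 = g 0) : EqOn f g (Ioo (-T) T) := by
  -- The forward case is stated for arbitrary fields, so that backward times follow by applying it
  -- to `-v` and the reversed curves.
  have main : ∀ (v : E → E) (f g : ℝ → E), ContDiffOn ℝ 1 v O →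
      (∀ t ∈ Ioo (-T) T, f t ∈ O ∧ HasDerivAt f (v (f t)) t) →
      (∀ t ∈ Ioo (-T) T, g t ∈ O ∧ HasDerivAt g (v (g t)) t) → f 0 = g 0 →
      ∀ t ∈ Ico 0 T, f t = g t := by
    intro v f g hv hf hg h0 t ht
    have hsub : Icc 0 t ⊆ Ioo (-T) T := fun s hs =>
      ⟨by linarith [hs.1, hs.2, ht.1, ht.2], hs.2.trans_lt ht.2⟩
    exact eqOn_Icc_of_solves_autonomous hO hv
      (fun s hs => (hf s (hsub hs)).2.continuousAt.continuousWithinAt)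
      (fun s hs => (hf s (hsub (Ico_subset_Icc_self hs))).2.hasDerivWithinAt)
      (fun s hs => (hf s (hsub (Ico_subset_Icc_self hs))).1)
      (fun s hs => (hg s (hsub hs)).2.continuousAt.continuousWithinAt)
      (fun s hs _ => (hg s (hsub (Ico_subset_Icc_self hs))).2.hasDerivWithinAt) h0
      (right_mem_Icc.2 ht.1)
  intro t ht
  rcases le_or_gt 0 t with h | h
  · exact main v f g hv hf hg h0 t ⟨h, ht.2⟩
  · have hneg : ∀ f : ℝ → E, (∀ t ∈ Ioo (-T) T, f t ∈ O ∧ HasDerivAt f (v (f t)) t) →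
        ∀ t ∈ Ioo (-T) T, f (-t) ∈ O ∧ HasDerivAt (fun t => f (-t)) (-v (f (-t))) t := by
      intro f hf t ht
      have ht' : -t ∈ Ioo (-T) T := ⟨by linarith [ht.2], by linarith [ht.1]⟩
      refine ⟨(hf _ ht').1, ?_⟩
      have := HasDerivAt.scomp (g₁ := f) t (hf _ ht').2 (hasDerivAt_neg t)
      rwa [neg_one_smul] at this
    have := main (fun x => -v x) (fun t => f (-t)) (fun t => g (-t)) hv.neg (hneg f hf)
      (hneg g hg) (by simpa using h0) (-t) ⟨by linarith, by linarith [ht.1]⟩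
    simpa using this

/-- A curve with constant velocity is affine. -/
theorem eq_add_smul_of_hasDerivAt_const {f : ℝ → E} {w : E} {T : ℝ}
    (hf : ∀ t ∈ Ioo (-T) T, HasDerivAt f w t) :
    ∀ t ∈ Ioo (-T) T, f t = f 0 + t • w := by
  refine eqOn_Ioo_of_solves_autonomous (v := fun _ => w) isOpen_univ contDiffOn_const
    (fun t ht => ⟨trivial, hf t ht⟩) (fun t _ => ⟨trivial, ?_⟩) (by simp)
  simpa using ((hasDerivAt_id t).smul_const w).const_add (f 0)

/-- The time derivative of the spatial derivative is the spatial derivative of the time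
derivative. -/
theorem hasDerivAt_fderiv_of_hasDerivAt {φ : ℝ × E → G} {t : ℝ} {z : E}
    (hφ : ContDiffAt ℝ 2 φ (t, z)) {g : E → G}
    (hg : ∀ᶠ z' in 𝓝 z, HasDerivAt (fun s => φ (s, z')) (g z') t) (w : E) :
    HasDerivAt (fun s => fderiv ℝ φ (s, z) (0, w)) (fderiv ℝ g z w) t := by
  have hd : DifferentiableAt ℝ (fderiv ℝ φ) (t, z) :=
    (hφ.fderiv_right (m := 1) (by norm_num)).differentiableAt (by norm_num)
  have hsymm : IsSymmSndFDerivAt ℝ φ (t, z) := hφ.isSymmSndFDerivAt (by simp)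
  have hgeq : g =ᶠ[𝓝 z] fun z' => fderiv ℝ φ (t, z') (1, 0) := by
    have hev : ∀ᶠ q in 𝓝 (t, z), DifferentiableAt ℝ φ q :=
      (hφ.eventually (by simp)).mono fun q hq => hq.differentiableAt (by norm_num)
    have hev' : ∀ᶠ z' in 𝓝 z, DifferentiableAt ℝ φ (t, z') :=
      (Continuous.prodMk_right t).continuousAt.eventually hev
    filter_upwards [hg, hev'] with z' h1 h2
    have h3 : HasDerivAt (fun s : ℝ => (s, z')) ((1 : ℝ), (0 : E)) t :=
      (hasDerivAt_id t).prodMk (hasDerivAt_const t z')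
    exact h1.unique (h2.hasFDerivAt.comp_hasDerivAt t h3)
  have h4 : HasFDerivAt (fun z' => fderiv ℝ φ (t, z') (1, 0))
      (((fderiv ℝ (fderiv ℝ φ) (t, z)).flip (1, 0)).comp (ContinuousLinearMap.inr ℝ ℝ E)) z := by
    have h5 : HasFDerivAt (fun z' : E => (t, z')) (ContinuousLinearMap.inr ℝ ℝ E) z :=
      (hasFDerivAt_const t z).prodMk (hasFDerivAt_id z)
    have := (hd.hasFDerivAt.comp z h5).clm_apply (hasFDerivAt_const ((1 : ℝ), (0 : E)) z)
    refine this.congr_fderiv ?_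
    ext w; simp
  have h6 : fderiv ℝ g z w = fderiv ℝ (fderiv ℝ φ) (t, z) (0, w) (1, 0) := by
    rw [hgeq.fderiv_eq, h4.fderiv]; simp
  rw [h6, hsymm.eq]
  have h3 : HasDerivAt (fun s : ℝ => (s, z)) ((1 : ℝ), (0 : E)) t :=
    (hasDerivAt_id t).prodMk (hasDerivAt_const t z)
  have := (hd.hasFDerivAt.comp_hasDerivAt t h3).clm_apply (hasDerivAt_const t ((0 : ℝ), w))
  simpa using this

end Calculus

universe u v

/-- The coordinate expression of a Lie algebroid with a spray: over the open set `U` of the base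
the anchor is `ρ`, the spray is `(x, a) ↦ (ρ x a, S (x, a))`, and `c` is the bracket of constant
sections. -/
structure SprayModel (B : Type u) (F : Type v) [NormedAddCommGroup B] [NormedSpace ℝ B]
    [NormedAddCommGroup F] [NormedSpace ℝ F] where
  U : Set B
  ρ : B → F →L[ℝ] B
  S : B × F → F
  c : B → F →L[ℝ] F →L[ℝ] F
  isOpen_U : IsOpen U
  ρ_smooth : ContDiffOn ℝ ∞ ρ U
  S_smooth : ContDiffOn ℝ ∞ S (U ×ˢ univ)
  c_smooth : ContDiffOn ℝ ∞ c U
  homogeneous : ∀ x ∈ U, ∀ (t : ℝ) (a : F), S (x, t • a) = t ^ 2 • S (x, a)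
  c_self : ∀ x ∈ U, ∀ a, c x a a = 0
  morphism : ∀ x ∈ U, ∀ a b,
    fderiv ℝ ρ x (ρ x a) b - fderiv ℝ ρ x (ρ x b) a = ρ x (c x a b)
  jacobi : ∀ x ∈ U, ∀ a b d, c x a (c x b d) + c x b (c x d a) + c x d (c x a b)
    + fderiv ℝ c x (ρ x a) b d + fderiv ℝ c x (ρ x b) d a + fderiv ℝ c x (ρ x d) a b = 0

namespace SprayModel

variable {B : Type u} {F : Type v} [NormedAddCommGroup B] [NormedSpace ℝ B]
  [NormedAddCommGroup F] [NormedSpace ℝ F] (D : SprayModel B F)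

/-- The spray as a vector field. -/
def field (z : B × F) : B × F := (D.ρ z.1 z.2, D.S z)

theorem isOpen_domain : IsOpen (D.U ×ˢ (univ : Set F)) := D.isOpen_U.prod isOpen_univ

theorem field_smooth : ContDiffOn ℝ ∞ D.field (D.U ×ˢ univ) :=
  ((D.ρ_smooth.comp contDiff_fst.contDiffOn fun _ h => h.1).clm_apply
    contDiff_snd.contDiffOn).prodMk D.S_smooth

theorem field_smul {x : B} (hx : x ∈ D.U) (t : ℝ) (a : F) :
    D.field (x, t • a) = (t • D.ρ x a, t ^ 2 • D.S (x, a)) := by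
  simp [field, D.homogeneous x hx]

theorem field_zero {x : B} (hx : x ∈ D.U) : D.field (x, 0) = 0 := by
  have := D.field_smul hx 0 0
  simp only [smul_zero, zero_smul, ne_eq, OfNat.ofNat_ne_zero, not_false_eq_true, zero_pow] at this
  exact this

theorem c_skew {x : B} (hx : x ∈ D.U) (a b : F) : D.c x a b = -D.c x b a := by
  have h := D.c_self x hx (a + b)
  simp only [map_add, add_apply, D.c_self x hx, zero_add, add_zero] at h
  exact eq_neg_of_add_eq_zero_right h

theorem fderiv_c_skew {x : B} (hx : x ∈ D.U) (w : B) (a b : F) :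
    fderiv ℝ D.c x w a b = -fderiv ℝ D.c x w b a := by
  have hd : HasFDerivAt D.c (fderiv ℝ D.c x) x :=
    ((D.c_smooth.differentiableOn (by simp)).differentiableAt
      (D.isOpen_U.mem_nhds hx)).hasFDerivAt
  have h1 : ∀ a b : F, HasFDerivAt (fun y => D.c y a b)
      (((ContinuousLinearMap.apply ℝ F b).comp
        (ContinuousLinearMap.apply ℝ (F →L[ℝ] F) a)).comp (fderiv ℝ D.c x)) x := fun a b =>
    ((ContinuousLinearMap.apply ℝ F b).comp
        (ContinuousLinearMap.apply ℝ (F →L[ℝ] F) a)).hasFDerivAt.comp x hd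
  have h2 : (fun y => D.c y a b) =ᶠ[𝓝 x] fun y => -D.c y b a := by
    filter_upwards [D.isOpen_U.mem_nhds hx] with y hy using D.c_skew hy a b
  have := (h1 a b).unique ((h1 b a).neg.congr_of_eventuallyEq h2)
  simpa using congrArg (fun L => L w) this

/-- The flow of the spray near the point `(x₀, 0)`. -/
structure FlowBox (x₀ : B) where
  r : ℝ
  r_pos : 0 < r
  Φ : ℝ × (B × F) → B × F
  Φ_contDiffAt : ∀ t ∈ Ioo (-4 : ℝ) 4, ∀ z ∈ Metric.ball ((x₀, 0) : B × F) r,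
    ContDiffAt ℝ ∞ Φ (t, z)
  Φ_zero : ∀ z ∈ Metric.ball ((x₀, 0) : B × F) r, Φ (0, z) = z
  Φ_mem : ∀ t ∈ Ioo (-4 : ℝ) 4, ∀ z ∈ Metric.ball ((x₀, 0) : B × F) r, (Φ (t, z)).1 ∈ D.U
  Φ_deriv : ∀ t ∈ Ioo (-4 : ℝ) 4, ∀ z ∈ Metric.ball ((x₀, 0) : B × F) r,
    HasDerivAt (fun s => Φ (s, z)) (D.field (Φ (t, z))) t

/-- The constant curve at `(x₀, 0)` is a solution for all times, so nearby flow lines exist as long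
as desired. The length `4` leaves room for `E` on `(-3, 3)`, for `κ` on `(-2, 2)` and for the
reparametrizations below, while only `[0, 1]` matters in the end. -/
theorem nonempty_flowBox [CompleteSpace B] [CompleteSpace F] {x₀ : B} (hx₀ : x₀ ∈ D.U) :
    Nonempty (D.FlowBox x₀) := by
  obtain ⟨φ, W, hW, hxW, -, hφ, hsol⟩ := exists_smooth_flow (T := 4)
    (γ₀ := fun _ => ((x₀, 0) : B × F)) D.isOpen_domain D.field_smooth (by norm_num)
    (fun t _ => ⟨⟨hx₀, trivial⟩, by rw [D.field_zero hx₀]; exact hasDerivAt_const _ _⟩)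
  obtain ⟨r, hr, hrW⟩ := Metric.isOpen_iff.1 hW _ hxW
  exact ⟨⟨r, hr, φ, fun t ht z hz => hφ t (Ioo_subset_Icc_self ht) z (hrW hz),
    fun z hz => (hsol z (hrW hz)).1, fun t ht z hz => ((hsol z (hrW hz)).2 t ht).1.1,
    fun t ht z hz => ((hsol z (hrW hz)).2 t ht).2⟩⟩

namespace FlowBox

variable {D} {x₀ : B} (X : D.FlowBox x₀)

/-- The set of initial values. -/
def dom : Set (B × F) := Metric.ball (x₀, 0) X.r

theorem isOpen_dom : IsOpen X.dom := Metric.isOpen_ball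

theorem base_mem_dom : ((x₀, 0) : B × F) ∈ X.dom := Metric.mem_ball_self X.r_pos

theorem dom_mem_nhds {z : B × F} (hz : z ∈ X.dom) : X.dom ∈ 𝓝 z := X.isOpen_dom.mem_nhds hz

theorem smul_mem_dom {x : B} {a : F} (h : (x, a) ∈ X.dom) {t : ℝ} (ht : |t| ≤ 1) :
    (x, t • a) ∈ X.dom := by
  simp only [dom, Metric.mem_ball, Prod.dist_eq, max_lt_iff, dist_zero_right, norm_smul,
    Real.norm_eq_abs] at h ⊢
  exact ⟨h.1, (mul_le_of_le_one_left (norm_nonneg _) ht).trans_lt h.2⟩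

/-- Restriction to a smaller ball. -/
def restrict {r' : ℝ} (h : 0 < r') (h' : r' ≤ X.r) : D.FlowBox x₀ where
  r := r'
  r_pos := h
  Φ := X.Φ
  Φ_contDiffAt t ht z hz := X.Φ_contDiffAt t ht z (Metric.ball_subset_ball h' hz)
  Φ_zero z hz := X.Φ_zero z (Metric.ball_subset_ball h' hz)
  Φ_mem t ht z hz := X.Φ_mem t ht z (Metric.ball_subset_ball h' hz)
  Φ_deriv t ht z hz := X.Φ_deriv t ht z (Metric.ball_subset_ball h' hz)

/-- Both sides solve the equation of the spray with the same initial value, because `ρ` is linear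
and `S` quadratic in the fibre. The bound `|l| * T ≤ 4` keeps the rescaled time inside the flow box.
-/
theorem Φ_smul {x : B} {a : F} (h : (x, a) ∈ X.dom) {l T : ℝ} (hT : T ≤ 4)
    (hl : |l| * T ≤ 4) (hla : (x, l • a) ∈ X.dom) {t : ℝ} (ht : t ∈ Ioo (-T) T) :
    X.Φ (t, (x, l • a)) = ((X.Φ (l * t, (x, a))).1, l • (X.Φ (l * t, (x, a))).2) := by
  have hmul : ∀ t ∈ Ioo (-T) T, l * t ∈ Ioo (-4 : ℝ) 4 := by
    intro t ht
    have h1 : |t| < T := abs_lt.2 ht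
    have h2 : |l * t| < 4 := by
      rw [abs_mul]
      rcases (abs_nonneg l).eq_or_lt with h0 | h0
      · rw [← h0]; norm_num
      · nlinarith [abs_nonneg t]
    exact abs_lt.1 h2
  have hsub : Ioo (-T) T ⊆ Ioo (-4) 4 := Ioo_subset_Ioo (by linarith) hT
  refine eqOn_Ioo_of_solves_autonomous D.isOpen_domain (D.field_smooth.of_le (by simp))
    (f := fun t => X.Φ (t, (x, l • a)))
    (g := fun t => ((X.Φ (l * t, (x, a))).1, l • (X.Φ (l * t, (x, a))).2))
    (fun s hs => ⟨⟨X.Φ_mem s (hsub hs) _ hla, trivial⟩, X.Φ_deriv s (hsub hs) _ hla⟩)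
    (fun s hs => ⟨⟨X.Φ_mem _ (hmul s hs) _ h, trivial⟩, ?_⟩) ?_ ht
  · have h1 := HasDerivAt.scomp (g₁ := fun s => X.Φ (s, (x, a))) s
      (X.Φ_deriv _ (hmul s hs) _ h) (by simpa using (hasDerivAt_id s).const_mul l :
        HasDerivAt (fun s => l * s) l s)
    rw [D.field_smul (X.Φ_mem _ (hmul s hs) _ h)]
    have h2 : HasDerivAt (fun t => ((X.Φ (l * t, (x, a))).1, l • (X.Φ (l * t, (x, a))).2))
        ((l • D.field (X.Φ (l * s, (x, a)))).1, l • (l • D.field (X.Φ (l * s, (x, a)))).2) s :=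
      h1.prod_fst.prodMk (h1.prod_snd.const_smul l)
    simpa [field, smul_smul, pow_two] using h2
  · simp [X.Φ_zero _ h, X.Φ_zero _ hla]

theorem Φ_base {x : B} (hx : (x, (0 : F)) ∈ X.dom) {t : ℝ} (ht : t ∈ Ioo (-4 : ℝ) 4) :
    X.Φ (t, (x, 0)) = (x, 0) := by
  have hxU : x ∈ D.U := by
    have := X.Φ_mem 0 (by norm_num) _ hx
    rwa [X.Φ_zero _ hx] at this
  refine eqOn_Ioo_of_solves_autonomous D.isOpen_domain (D.field_smooth.of_le (by simp))
    (f := fun t => X.Φ (t, (x, 0))) (g := fun _ => (x, 0))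
    (fun s hs => ⟨⟨X.Φ_mem s hs _ hx, trivial⟩, X.Φ_deriv s hs _ hx⟩)
    (fun s hs => ⟨⟨hxU, trivial⟩, ?_⟩) (X.Φ_zero _ hx) ht
  rw [D.field_zero hxU]
  exact hasDerivAt_const _ _

theorem mem_U {z : B × F} (hz : z ∈ X.dom) : z.1 ∈ D.U := by
  have := X.Φ_mem 0 (by norm_num) _ hz
  rwa [X.Φ_zero _ hz] at this

/-- The flow stays close to `(x₀, 0)`. -/
theorem eventually_Φ_mem {N : Set (B × F)} (hN : N ∈ 𝓝 ((x₀, 0) : B × F)) :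
    ∀ᶠ z in 𝓝 ((x₀, 0) : B × F), ∀ t ∈ Icc (-3 : ℝ) 3, X.Φ (t, z) ∈ N := by
  refine isCompact_Icc.eventually_forall_of_forall_eventually fun t ht => ?_
  have ht' : t ∈ Ioo (-4 : ℝ) 4 := ⟨by linarith [ht.1], by linarith [ht.2]⟩
  have hc : ContinuousAt (fun q : (B × F) × ℝ => X.Φ (q.2, q.1)) ((x₀, 0), t) :=
    ContinuousAt.comp (f := fun q : (B × F) × ℝ => (q.2, q.1)) (g := X.Φ)
      (X.Φ_contDiffAt t ht' _ X.base_mem_dom).continuousAt (by fun_prop)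
  refine hc ?_
  simp only [X.Φ_base X.base_mem_dom ht']
  exact hN

/-- The derivative of the flow in the direction of the fibre. -/
noncomputable def dΦ (q : ℝ × (B × F)) : F →L[ℝ] B × F :=
  (fderiv ℝ X.Φ q).comp
    ((ContinuousLinearMap.inr ℝ ℝ (B × F)).comp (ContinuousLinearMap.inr ℝ B F))

theorem dΦ_contDiffAt {t : ℝ} (ht : t ∈ Ioo (-4 : ℝ) 4) {z : B × F} (hz : z ∈ X.dom) :
    ContDiffAt ℝ ∞ X.dΦ (t, z) :=
  ((X.Φ_contDiffAt t ht z hz).fderiv_right (m := ∞) le_rfl).clm_comp contDiffAt_const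

theorem hasFDerivAt_Φ_fiber {t : ℝ} (ht : t ∈ Ioo (-4 : ℝ) 4) {x : B} {a : F}
    (hz : (x, a) ∈ X.dom) : HasFDerivAt (fun a => X.Φ (t, (x, a))) (X.dΦ (t, (x, a))) a := by
  have h1 : HasFDerivAt (fun a : F => (t, (x, a)))
      ((ContinuousLinearMap.inr ℝ ℝ (B × F)).comp (ContinuousLinearMap.inr ℝ B F)) a :=
    ((hasFDerivAt_const t a).prodMk ((hasFDerivAt_const x a).prodMk
      (hasFDerivAt_id a))).congr_fderiv (by ext <;> simp)
  exact HasFDerivAt.comp (g := X.Φ) a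
    ((X.Φ_contDiffAt t ht _ hz).differentiableAt (by simp)).hasFDerivAt h1

theorem field_differentiableAt {z : B × F} (hz : z.1 ∈ D.U) : DifferentiableAt ℝ D.field z :=
  (D.field_smooth.differentiableOn (by simp)).differentiableAt
    (D.isOpen_domain.mem_nhds ⟨hz, trivial⟩)

/-- The variational equation for the derivative of the flow. -/
theorem hasDerivAt_dΦ {t : ℝ} (ht : t ∈ Ioo (-4 : ℝ) 4) {z : B × F} (hz : z ∈ X.dom) (v : F) :
    HasDerivAt (fun s => X.dΦ (s, z) v) (fderiv ℝ D.field (X.Φ (t, z)) (X.dΦ (t, z) v)) t := by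
  have h1 := hasDerivAt_fderiv_of_hasDerivAt (φ := X.Φ) (g := fun z => D.field (X.Φ (t, z)))
    ((X.Φ_contDiffAt t ht z hz).of_le two_le_infty)
    (eventually_of_mem (X.dom_mem_nhds hz) fun z' hz' => X.Φ_deriv t ht z' hz') (0, v)
  have h2 : HasFDerivAt (fun z => X.Φ (t, z))
      ((fderiv ℝ X.Φ (t, z)).comp (ContinuousLinearMap.inr ℝ ℝ (B × F))) z :=
    HasFDerivAt.comp (g := X.Φ) z
      ((X.Φ_contDiffAt t ht _ hz).differentiableAt (by simp)).hasFDerivAt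
      ((hasFDerivAt_const t z).prodMk (hasFDerivAt_id z))
  have h3 := (field_differentiableAt (X.Φ_mem t ht z hz)).hasFDerivAt.comp z h2
  have h4 : fderiv ℝ (fun z => D.field (X.Φ (t, z))) z (0, v)
      = fderiv ℝ D.field (X.Φ (t, z)) (X.dΦ (t, z) v) := by
    have : (fun z => D.field (X.Φ (t, z))) = D.field ∘ fun z => X.Φ (t, z) := rfl
    rw [this, h3.fderiv]; rfl
  rw [← h4]
  exact h1

theorem dΦ_zero {z : B × F} (hz : z ∈ X.dom) (v : F) : X.dΦ (0, z) v = (0, v) := by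
  obtain ⟨x, a⟩ := z
  have h1 := X.hasFDerivAt_Φ_fiber (t := 0) (by norm_num) hz
  have h2 : HasFDerivAt (fun a => X.Φ (0, (x, a))) (ContinuousLinearMap.inr ℝ B F) a := by
    refine ((hasFDerivAt_const x a).prodMk (hasFDerivAt_id a)).congr_of_eventuallyEq ?_
    have : ∀ᶠ a' in 𝓝 a, (x, a') ∈ X.dom :=
      (Continuous.prodMk_right x).continuousAt.eventually (X.dom_mem_nhds hz)
    filter_upwards [this] with a' ha' using X.Φ_zero _ ha'
  rw [h1.unique h2]; rfl

/-- By homogeneity the fibre component of `Φ (t, (x, l • a))` is `l` times that of `Φ (l * t, (x,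
a))`. Its derivative at `l = 0` is the fibre component of `Φ (0, (x, a))`, which is `a`. -/
theorem dΦ_base {x : B} (hx : (x, (0 : F)) ∈ X.dom) {t : ℝ} (ht : t ∈ Ioo (-4 : ℝ) 4) (a : F) :
    (X.dΦ (t, (x, 0)) a).2 = a := by
  have key : ∀ a : F, (x, a) ∈ X.dom → (X.dΦ (t, (x, 0)) a).2 = a := by
    intro a ha
    have h1 : HasDerivAt (fun l : ℝ => (X.Φ (t, (x, l • a))).2) ((X.dΦ (t, (x, 0)) a).2) 0 := by
      have hl : HasDerivAt (fun l : ℝ => l • a) a 0 := by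
        simpa using (hasDerivAt_id (0 : ℝ)).smul_const a
      have h2 : HasFDerivAt (fun a => X.Φ (t, (x, a))) (X.dΦ (t, (x, 0))) ((0 : ℝ) • a) := by
        rw [zero_smul]; exact X.hasFDerivAt_Φ_fiber ht hx
      exact (h2.comp_hasDerivAt 0 hl).prod_snd
    have h2 : HasDerivAt (fun l : ℝ => l • (X.Φ (l * t, (x, a))).2) a 0 := by
      have h3 : HasDerivAt (fun l => X.Φ (l * t, (x, a))) (t • D.field (X.Φ (0 * t, (x, a)))) 0 :=
        HasDerivAt.scomp (g₁ := fun s => X.Φ (s, (x, a))) 0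
          (X.Φ_deriv _ (by rw [zero_mul]; norm_num) _ ha) (by
            simpa using (hasDerivAt_id (0 : ℝ)).mul_const t)
      refine ((hasDerivAt_id (0 : ℝ)).smul h3.prod_snd).congr_deriv ?_
      simp [X.Φ_zero _ ha]
    refine h1.unique (h2.congr_of_eventuallyEq ?_)
    have : ∀ᶠ l : ℝ in 𝓝 0, l ∈ Ioo (-1 : ℝ) 1 := Ioo_mem_nhds (by norm_num) (by norm_num)
    filter_upwards [this] with l hl
    have hl' : |l| ≤ 1 := (abs_lt.2 hl).le
    rw [X.Φ_smul ha le_rfl (by linarith) (X.smul_mem_dom ha hl') ht]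
  -- The computation requires `(x, a)` in the box. A general `a` is first shrunk, and linearity in
  -- `a` removes the factor.
  have hev : ∀ᶠ l : ℝ in 𝓝[>] 0, (x, l • a) ∈ X.dom := by
    have hc : ContinuousAt (fun l : ℝ => (x, l • a)) 0 := by fun_prop
    refine nhdsWithin_le_nhds (hc ?_)
    simpa using X.dom_mem_nhds hx
  obtain ⟨l, hl, hl0⟩ := (hev.and self_mem_nhdsWithin).exists
  have := key _ hl
  rw [map_smul] at this
  exact smul_right_injective F (ne_of_gt hl0) this

end FlowBox

end SprayModel

end SprayModel

/-! ### The linear equation along the flow that defines the realization form -/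

section Realization

open scoped OperatorNorm

universe u v

namespace SprayModel

variable {B : Type u} {F : Type v} [NormedAddCommGroup B] [NormedSpace ℝ B]
  [NormedAddCommGroup F] [NormedSpace ℝ F] (D : SprayModel B F)

/-- A flow box together with the solution of the linear equation that defines the realization
form: for `v` in the fibre, `E (t, z) v` is the second component of the flow of the pullback
algebroid, applied to `(v, 0)`. -/
structure RealizationBox (x₀ : B) extends D.FlowBox x₀ where
  E : ℝ × (B × F) → F →L[ℝ] F
  E_contDiffAt : ∀ t ∈ Ioo (-3 : ℝ) 3, ∀ z ∈ toFlowBox.dom, ContDiffAt ℝ ∞ E (t, z)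
  E_zero : ∀ z ∈ toFlowBox.dom, E (0, z) = 0
  E_deriv : ∀ t ∈ Ioo (-3 : ℝ) 3, ∀ z ∈ toFlowBox.dom, HasDerivAt (fun s => E (s, z))
    ((ContinuousLinearMap.snd ℝ B F).comp (toFlowBox.dΦ (t, z))
      - (D.c (Φ (t, z)).1 (Φ (t, z)).2).comp (E (t, z))) t

variable {D}

theorem FlowBox.c_contDiffAt {x₀ : B} (X : D.FlowBox x₀) {t : ℝ} (ht : t ∈ Ioo (-4 : ℝ) 4)
    {z : B × F} (hz : z ∈ X.dom) :
    ContDiffAt ℝ ∞ (fun q => D.c (X.Φ q).1 (X.Φ q).2) (t, z) := by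
  have h1 : ContDiffAt ℝ ∞ D.c (X.Φ (t, z)).1 :=
    D.c_smooth.contDiffAt (D.isOpen_U.mem_nhds (X.Φ_mem t ht z hz))
  have h2 := X.Φ_contDiffAt t ht z hz
  exact (h1.comp (t, z) h2.fst).clm_apply h2.snd

/-- The linear equation depends on time and on the point `z`; both become components of an
autonomous system. Over `(x₀, 0)` its coefficients are constant with solution `t • id`, and the
general solutions are perturbations of this one. -/
theorem nonempty_realizationBox [CompleteSpace B] [CompleteSpace F] {x₀ : B} (hx₀ : x₀ ∈ D.U) :
    Nonempty (D.RealizationBox x₀) := by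
  obtain ⟨X⟩ := D.nonempty_flowBox hx₀
  set g : ℝ × ((B × F) × (F →L[ℝ] F)) → ℝ × ((B × F) × (F →L[ℝ] F)) := fun w =>
    (1, (0, (ContinuousLinearMap.snd ℝ B F).comp (X.dΦ (w.1, w.2.1))
      - (D.c (X.Φ (w.1, w.2.1)).1 (X.Φ (w.1, w.2.1)).2).comp w.2.2)) with hg
  set O : Set (ℝ × ((B × F) × (F →L[ℝ] F))) := Ioo (-4) 4 ×ˢ (X.dom ×ˢ univ) with hO
  have hOo : IsOpen O := isOpen_Ioo.prod (X.isOpen_dom.prod isOpen_univ)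
  have hgs : ContDiffOn ℝ ∞ g O := by
    rintro ⟨t, z, e⟩ ⟨ht, hz, -⟩
    refine ContDiffAt.contDiffWithinAt ?_
    have hp : ContDiffAt ℝ ∞ (fun w : ℝ × ((B × F) × (F →L[ℝ] F)) => (w.1, w.2.1)) (t, z, e) :=
      contDiffAt_fst.prodMk contDiffAt_snd.fst
    have h1 : ContDiffAt ℝ ∞ (fun w : ℝ × ((B × F) × (F →L[ℝ] F)) => X.dΦ (w.1, w.2.1))
        (t, z, e) := ContDiffAt.comp (g := X.dΦ) (t, z, e) (X.dΦ_contDiffAt ht hz) hp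
    have h2 : ContDiffAt ℝ ∞ (fun w : ℝ × ((B × F) × (F →L[ℝ] F)) =>
        D.c (X.Φ (w.1, w.2.1)).1 (X.Φ (w.1, w.2.1)).2) (t, z, e) :=
      ContDiffAt.comp (g := fun q => D.c (X.Φ q).1 (X.Φ q).2) (t, z, e) (X.c_contDiffAt ht hz) hp
    exact contDiffAt_const.prodMk (contDiffAt_const.prodMk
      ((contDiffAt_const.clm_comp h1).sub (h2.clm_comp contDiffAt_snd.snd)))
  -- On the zero section the fibre part of `dΦ` is the identity and the term with `c` vanishes,
  -- hence `E = t • id`.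
  set γ : ℝ → ℝ × ((B × F) × (F →L[ℝ] F)) := fun t =>
    (t, ((x₀, 0), t • ContinuousLinearMap.id ℝ F)) with hγ
  obtain ⟨φ, W, hW, hxW, -, hφ, hsol⟩ := exists_smooth_flow (T := 3) (γ₀ := γ) hOo hgs
    (by norm_num) (by
      intro t ht
      have ht' : t ∈ Ioo (-4 : ℝ) 4 := ⟨by linarith [ht.1], by linarith [ht.2]⟩
      refine ⟨⟨ht', X.base_mem_dom, trivial⟩, ?_⟩
      have h1 : g (γ t) = (1, (0, ContinuousLinearMap.id ℝ F)) := by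
        simp only [hg, hγ, Prod.mk.injEq, true_and]
        ext a
        simp [X.Φ_base X.base_mem_dom ht', X.dΦ_base X.base_mem_dom ht']
      rw [h1]
      refine (hasDerivAt_id t).prodMk ((hasDerivAt_const t _).prodMk ?_)
      simpa using (hasDerivAt_id t).smul_const (ContinuousLinearMap.id ℝ F))
  have hincl : Continuous fun z : B × F => ((0 : ℝ), (z, (0 : F →L[ℝ] F))) := by fun_prop
  have hW' : (fun z : B × F => ((0 : ℝ), (z, (0 : F →L[ℝ] F)))) ⁻¹' W ∈ 𝓝 ((x₀, 0) : B × F) := by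
    refine hincl.continuousAt (hW.mem_nhds ?_)
    simpa [hγ] using hxW
  obtain ⟨r, hr, hrW⟩ := Metric.mem_nhds_iff.1 hW'
  have hmin : 0 < min r X.r := lt_min hr X.r_pos
  set X' := X.restrict hmin (min_le_right _ _) with hX'
  have hdW : ∀ z ∈ X'.dom, ((0 : ℝ), (z, (0 : F →L[ℝ] F))) ∈ W := fun z hz =>
    hrW (Metric.ball_subset_ball (min_le_left _ _) hz)
  -- The adjoined components are what they should be: the first runs as time and the second stays at
  -- `z`.
  have hcomp : ∀ t ∈ Ioo (-3 : ℝ) 3, ∀ z ∈ X'.dom,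
      (φ (t, (0, (z, 0)))).1 = t ∧ (φ (t, (0, (z, 0)))).2.1 = z := by
    intro t ht z hz
    obtain ⟨h0, hs⟩ := hsol _ (hdW z hz)
    have h1 := eq_add_smul_of_hasDerivAt_const (T := 3)
      (fun s hs' => (hs s hs').2.prod_fst) t ht
    have h2 := eq_add_smul_of_hasDerivAt_const (T := 3) (w := (0 : B × F))
      (fun s hs' => (hs s hs').2.prod_snd.prod_fst) t ht
    rw [h0] at h1 h2
    refine ⟨h1.trans ?_, by simpa using h2⟩
    change (0 : ℝ) + t • (1 : ℝ) = t
    simp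
  refine ⟨⟨X', fun q => (φ (q.1, (0, (q.2, 0)))).2.2, fun t ht z hz => ?_, fun z hz => ?_,
    fun t ht z hz => ?_⟩⟩
  · have h1 : ContDiffAt ℝ ∞ (fun q : ℝ × (B × F) => (q.1, ((0 : ℝ), (q.2, (0 : F →L[ℝ] F)))))
        (t, z) := contDiffAt_fst.prodMk (contDiffAt_const.prodMk
          (contDiffAt_snd.prodMk contDiffAt_const))
    exact ((hφ t (Ioo_subset_Icc_self ht) _ (hdW z hz)).comp (t, z) h1).snd.snd
  · simp [(hsol _ (hdW z hz)).1]
  · have h1 := ((hsol _ (hdW z hz)).2 t ht).2.prod_snd.prod_snd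
    simp only [hg, (hcomp t ht z hz).1, (hcomp t ht z hz).2] at h1
    exact h1

namespace RealizationBox

variable {x₀ : B} (X : D.RealizationBox x₀)

/-- Restriction to a smaller ball. -/
def shrink {r' : ℝ} (h : 0 < r') (h' : r' ≤ X.r) : D.RealizationBox x₀ where
  toFlowBox := X.toFlowBox.restrict h h'
  E := X.E
  E_contDiffAt t ht z hz := X.E_contDiffAt t ht z (Metric.ball_subset_ball h' hz)
  E_zero z hz := X.E_zero z (Metric.ball_subset_ball h' hz)
  E_deriv t ht z hz := X.E_deriv t ht z (Metric.ball_subset_ball h' hz)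

theorem hasDerivAt_E_apply {t : ℝ} (ht : t ∈ Ioo (-3 : ℝ) 3) {z : B × F} (hz : z ∈ X.dom)
    (v : F) : HasDerivAt (fun s => X.E (s, z) v)
      ((X.dΦ (t, z) v).2 - D.c (X.Φ (t, z)).1 (X.Φ (t, z)).2 (X.E (t, z) v)) t := by
  simpa using (X.E_deriv t ht z hz).clm_apply (hasDerivAt_const t v)

theorem Ioo_three_subset : Ioo (-3 : ℝ) 3 ⊆ Ioo (-4) 4 :=
  Ioo_subset_Ioo (by norm_num) (by norm_num)

/-- Uniqueness for the linear equation that defines `E`. -/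
theorem eqOn_E {T : ℝ} (hT : T < 3) {z : B × F} (hz : z ∈ X.dom) (v : F) {e : ℝ → F}
    (h0 : e 0 = 0) (he : ContinuousOn e (Icc 0 T))
    (hd : ∀ t ∈ Ico 0 T, HasDerivWithinAt e
      ((X.dΦ (t, z) v).2 - D.c (X.Φ (t, z)).1 (X.Φ (t, z)).2 (e t)) (Ici t) t) :
    EqOn (fun s => X.E (s, z) v) e (Icc 0 T) := by
  have hsub : Icc 0 T ⊆ Ioo (-3 : ℝ) 3 := fun s hs => ⟨by linarith [hs.1], by linarith [hs.2]⟩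
  refine eqOn_Icc_of_solves (O := Ioo (-3) 3 ×ˢ univ)
    (v := fun t e => (X.dΦ (t, z) v).2 - D.c (X.Φ (t, z)).1 (X.Φ (t, z)).2 e)
    (isOpen_Ioo.prod isOpen_univ) ?_
    (fun s hs => (X.hasDerivAt_E_apply (hsub hs) hz v).continuousAt.continuousWithinAt)
    (fun s hs => (X.hasDerivAt_E_apply (hsub (Ico_subset_Icc_self hs)) hz v).hasDerivWithinAt)
    (fun s hs => ⟨hsub (Ico_subset_Icc_self hs), trivial⟩) he (fun s hs _ => hd s hs)
    (by simp [X.E_zero z hz, h0])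
  rintro ⟨t, e⟩ ⟨ht, -⟩
  refine ContDiffAt.contDiffWithinAt ?_
  have hp : ContDiffAt ℝ ∞ (fun w : ℝ × F => (w.1, z)) (t, e) :=
    contDiffAt_fst.prodMk contDiffAt_const
  have h1 : ContDiffAt ℝ ∞ (fun w : ℝ × F => X.dΦ (w.1, z)) (t, e) :=
    ContDiffAt.comp (g := X.dΦ) (t, e) (X.dΦ_contDiffAt (Ioo_three_subset ht) hz) hp
  have h2 : ContDiffAt ℝ ∞ (fun w : ℝ × F => D.c (X.Φ (w.1, z)).1 (X.Φ (w.1, z)).2) (t, e) :=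
    ContDiffAt.comp (g := fun q => D.c (X.Φ q).1 (X.Φ q).2) (t, e)
      (X.c_contDiffAt (Ioo_three_subset ht) hz) hp
  exact (((h1.clm_apply contDiffAt_const).snd).sub (h2.clm_apply contDiffAt_snd)).of_le (by simp)

theorem fderiv_field_fst {z : B × F} (hz : z.1 ∈ D.U) (w : B × F) :
    (fderiv ℝ D.field z w).1 = fderiv ℝ D.ρ z.1 w.1 z.2 + D.ρ z.1 w.2 := by
  have h1 : HasFDerivAt D.ρ (fderiv ℝ D.ρ z.1) z.1 :=
    ((D.ρ_smooth.differentiableOn (by simp)).differentiableAt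
      (D.isOpen_U.mem_nhds hz)).hasFDerivAt
  have h2 := (FlowBox.field_differentiableAt hz).hasFDerivAt.fst
  have h3 : HasFDerivAt (fun z : B × F => D.ρ z.1 z.2) _ z :=
    (h1.comp z hasFDerivAt_fst).clm_apply hasFDerivAt_snd
  have := congrArg (fun L => L w) (h2.unique h3)
  simp only [ContinuousLinearMap.comp_apply, ContinuousLinearMap.coe_fst'] at this
  rw [this]
  simp [add_comm]

/-- The anchor of `E` is the base component of the derivative of the flow. -/
theorem ρ_E {t : ℝ} (ht : t ∈ Ico (0 : ℝ) 3) {z : B × F} (hz : z ∈ X.dom) (v : F) :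
    D.ρ (X.Φ (t, z)).1 (X.E (t, z) v) = (X.dΦ (t, z) v).1 := by
  have hsub : Icc 0 t ⊆ Ioo (-3 : ℝ) 3 := fun s hs => ⟨by linarith [hs.1], hs.2.trans_lt ht.2⟩
  have hρ : ∀ s ∈ Ioo (-3 : ℝ) 3, HasFDerivAt D.ρ (fderiv ℝ D.ρ (X.Φ (s, z)).1) (X.Φ (s, z)).1 :=
    fun s hs => ((D.ρ_smooth.differentiableOn (by simp)).differentiableAt
      (D.isOpen_U.mem_nhds (X.Φ_mem s (Ioo_three_subset hs) z hz))).hasFDerivAt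
  -- The variational equation and the morphism property of the anchor show that this difference
  -- solves a homogeneous linear equation. Its vanishing expresses that the flow preserves the
  -- relation that defines the pullback algebroid.
  set u : ℝ → B := fun s => D.ρ (X.Φ (s, z)).1 (X.E (s, z) v) - (X.dΦ (s, z) v).1 with hu
  have hud : ∀ s ∈ Ioo (-3 : ℝ) 3, HasDerivAt u
      (fderiv ℝ D.ρ (X.Φ (s, z)).1 (u s) (X.Φ (s, z)).2) s := by
    intro s hs
    have hs' := Ioo_three_subset hs
    have hU := X.Φ_mem s hs' z hz
    have h1 := (((hρ s hs).comp_hasDerivAt s (X.Φ_deriv s hs' z hz).prod_fst).clm_apply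
      (X.hasDerivAt_E_apply hs hz v)).sub (X.hasDerivAt_dΦ hs' hz v).prod_fst
    refine HasDerivAt.congr_deriv (f := u) h1 ?_
    rw [fderiv_field_fst hU]
    have hm := D.morphism _ hU (X.Φ (s, z)).2 (X.E (s, z) v)
    simp only [field, map_sub, hu, sub_apply, Function.comp_apply]
    rw [← hm]
    abel
  have h0 : u 0 = 0 := by simp [hu, X.E_zero z hz, X.dΦ_zero hz]
  have := eqOn_Icc_of_solves (O := Ioo (-3) 3 ×ˢ univ) (a := 0) (b := t)
    (v := fun s u => fderiv ℝ D.ρ (X.Φ (s, z)).1 u (X.Φ (s, z)).2) (f := u) (g := fun _ => 0)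
    (isOpen_Ioo.prod isOpen_univ) ?_
    (fun s hs => (hud s (hsub hs)).continuousAt.continuousWithinAt)
    (fun s hs => (hud s (hsub (Ico_subset_Icc_self hs))).hasDerivWithinAt)
    (fun s hs => ⟨hsub (Ico_subset_Icc_self hs), trivial⟩) continuousOn_const
    (fun s hs _ => by
      simp only [map_zero, zero_apply]
      exact hasDerivWithinAt_const _ _ _) h0 (right_mem_Icc.2 ht.1)
  · exact sub_eq_zero.1 this
  rintro ⟨s, w⟩ ⟨hs, -⟩
  refine ContDiffAt.contDiffWithinAt ?_
  have hΦ : ContDiffAt ℝ ∞ (fun q : ℝ × B => X.Φ (q.1, z)) (s, w) :=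
    (X.Φ_contDiffAt s (Ioo_three_subset hs) z hz).comp (s, w)
      (contDiffAt_fst.prodMk contDiffAt_const)
  have hdρ : ContDiffAt ℝ ∞ (fderiv ℝ D.ρ) (X.Φ (s, z)).1 :=
    (D.ρ_smooth.contDiffAt (D.isOpen_U.mem_nhds
      (X.Φ_mem s (Ioo_three_subset hs) z hz))).fderiv_right le_rfl
  exact (((hdρ.comp (s, w) hΦ.fst).clm_apply contDiffAt_snd).clm_apply hΦ.snd).of_le (by simp)

/-- The right-hand side solves the equation of `E`. Differentiating the homogeneity of the flow in
`l` computes the fibre part of `dΦ` in the direction `a`, and the bracket term drops out because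
both of its arguments are multiples of the same vector. -/
theorem E_smul {x : B} {a : F} (h : (x, a) ∈ X.dom) {l : ℝ} (hl : |l| ≤ 1) {s : ℝ}
    (hs : s ∈ Ico (0 : ℝ) 2) :
    X.E (s, (x, l • a)) a = s • (X.Φ (l * s, (x, a))).2 := by
  have hla := X.smul_mem_dom h hl
  have hmul : ∀ t ∈ Icc 0 s, l * t ∈ Ioo (-4 : ℝ) 4 := by
    intro t ht
    have h2 : |l * t| < 4 := by
      rw [abs_mul, abs_of_nonneg ht.1]
      nlinarith [abs_nonneg l, ht.1, ht.2, hs.2]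
    exact abs_lt.1 h2
  have hd : ∀ t ∈ Icc 0 s, HasDerivAt (fun t => t • (X.Φ (l * t, (x, a))).2)
      ((X.dΦ (t, (x, l • a)) a).2 - D.c (X.Φ (t, (x, l • a))).1 (X.Φ (t, (x, l • a))).2
        (t • (X.Φ (l * t, (x, a))).2)) t := by
    intro t ht
    have ht2 : t ∈ Ioo (-2 : ℝ) 2 := ⟨by linarith [ht.1], by linarith [ht.2, hs.2]⟩
    have ht4 : t ∈ Ioo (-4 : ℝ) 4 := ⟨by linarith [ht2.1], by linarith [ht2.2]⟩
    have hΦ : HasDerivAt (fun t => (X.Φ (l * t, (x, a))).2)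
        (l • (D.field (X.Φ (l * t, (x, a)))).2) t :=
      (HasDerivAt.scomp (g₁ := fun s => X.Φ (s, (x, a))) t (X.Φ_deriv _ (hmul t ht) _ h)
        (by simpa using (hasDerivAt_id t).const_mul l)).prod_snd
    have hΦ' : HasDerivAt (fun l => (X.Φ (l * t, (x, a))).2)
        (t • (D.field (X.Φ (l * t, (x, a)))).2) l :=
      (HasDerivAt.scomp (g₁ := fun s => X.Φ (s, (x, a))) l (X.Φ_deriv _ (hmul t ht) _ h)
        (by simpa using (hasDerivAt_id l).mul_const t)).prod_snd
    have hd1 : HasDerivAt (fun l : ℝ => (X.Φ (t, (x, l • a))).2)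
        (X.dΦ (t, (x, l • a)) a).2 l := by
      have hl' : HasDerivAt (fun l : ℝ => l • a) a l := by
        simpa using (hasDerivAt_id l).smul_const a
      exact (HasFDerivAt.comp_hasDerivAt (l := fun a => X.Φ (t, (x, a))) l
        (X.hasFDerivAt_Φ_fiber ht4 hla) hl').prod_snd
    -- The relation is needed for `l'` near `l`, which may exceed `1` in absolute value. With times
    -- below `2` the weaker bound `|l'| < 2` suffices.
    have hev : ∀ᶠ l' : ℝ in 𝓝 l, (X.Φ (t, (x, l' • a))).2 = l' • (X.Φ (l' * t, (x, a))).2 := by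
      have hc : ContinuousAt (fun l : ℝ => (x, l • a)) l := by fun_prop
      have h1 : ∀ᶠ l' : ℝ in 𝓝 l, (x, l' • a) ∈ X.dom := hc (X.dom_mem_nhds hla)
      have h2 : ∀ᶠ l' : ℝ in 𝓝 l, |l'| < 2 :=
        continuous_abs.continuousAt.eventually_lt_const (by linarith)
      filter_upwards [h1, h2] with l' h1 h2
      rw [X.Φ_smul h (T := 2) (by norm_num) (by linarith) h1 ht2]
    have hd2 := hd1.unique (((hasDerivAt_id l).smul hΦ').congr_of_eventuallyEq hev)
    have hU := X.Φ_mem _ (hmul t ht) _ h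
    rw [hd2, X.Φ_smul h (T := 2) (by norm_num) (by linarith) hla ht2]
    refine ((hasDerivAt_id t).smul hΦ).congr_deriv ?_
    simp [D.c_self _ hU, smul_smul, mul_comm]
  refine X.eqOn_E (by linarith [hs.2]) hla a (e := fun t => t • (X.Φ (l * t, (x, a))).2) (by simp)
    (fun t ht => (hd t ht).continuousAt.continuousWithinAt)
    (fun t ht => (hd t (Ico_subset_Icc_self ht)).hasDerivWithinAt) (right_mem_Icc.2 hs.1)

/-- The realization form in coordinates. -/
def Θ (z : B × F) : F →L[ℝ] F := X.E (1, z)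

theorem Θ_contDiffAt {z : B × F} (hz : z ∈ X.dom) : ContDiffAt ℝ ∞ X.Θ z :=
  (X.E_contDiffAt 1 (by norm_num) z hz).comp z (contDiffAt_const.prodMk contDiffAt_id)

/-- This is the geometric content of the spray: the velocity of the ray `l ↦ l • a` is sent by the
realization form to the flow line of `a`, so rays solve the product equation that starts at a unit.
-/
theorem Θ_smul {x : B} {a : F} (h : (x, a) ∈ X.dom) {l : ℝ} (hl : |l| ≤ 1) :
    X.Θ (x, l • a) a = (X.Φ (l, (x, a))).2 := by
  have := X.E_smul h hl (s := 1) (by norm_num)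
  rwa [one_smul, mul_one] at this

/-- For small `a` this is the case `l = 0` of `Θ_smul`, and linearity extends it to all `a`. -/
theorem Θ_zero {x : B} (h : (x, (0 : F)) ∈ X.dom) : X.Θ (x, 0) = ContinuousLinearMap.id ℝ F := by
  ext a
  have hev : ∀ᶠ l : ℝ in 𝓝[>] 0, (x, l • a) ∈ X.dom := by
    have hc : ContinuousAt (fun l : ℝ => (x, l • a)) 0 := by fun_prop
    refine nhdsWithin_le_nhds (hc ?_)
    simpa using X.dom_mem_nhds h
  obtain ⟨l, hl, hl0⟩ := (hev.and self_mem_nhdsWithin).exists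
  have := X.Θ_smul hl (l := 0) (by simp)
  rw [zero_smul, map_smul, X.Φ_zero _ hl] at this
  exact smul_right_injective F (ne_of_gt hl0) this

end RealizationBox

end SprayModel

end Realization

/-! ### The Maurer-Cartan equation and the product in the coordinate model -/

section Product

open scoped OperatorNorm

universe u v

namespace SprayModel

variable {B : Type u} {F : Type v} [NormedAddCommGroup B] [NormedSpace ℝ B]
  [NormedAddCommGroup F] [NormedSpace ℝ F] {D : SprayModel B F}

namespace RealizationBox

variable {x₀ : B} (X : D.RealizationBox x₀)

theorem hasDerivAt_line (z : B × F) (w : F) :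
    HasDerivAt (fun l : ℝ => z + l • ((0 : B), w)) ((0 : B), w) 0 := by
  simpa using ((hasDerivAt_id (0 : ℝ)).smul_const ((0 : B), w)).const_add z

theorem hasDerivAt_line_time (t : ℝ) (z : B × F) (w : F) :
    HasDerivAt (fun l : ℝ => (t, z + l • ((0 : B), w))) ((0 : ℝ), ((0 : B), w)) 0 :=
  (hasDerivAt_const (0 : ℝ) t).prodMk (hasDerivAt_line z w)

theorem hasDerivAt_comp_line {G : Type*} [NormedAddCommGroup G] [NormedSpace ℝ G]
    {f : ℝ × (B × F) → G} {t : ℝ} {z : B × F} (hf : DifferentiableAt ℝ f (t, z)) (w : F) :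
    HasDerivAt (fun l : ℝ => f (t, z + l • ((0 : B), w))) (fderiv ℝ f (t, z) (0, (0, w))) 0 := by
  have h : HasFDerivAt f (fderiv ℝ f (t, z)) (t, z + (0 : ℝ) • ((0 : B), w)) := by
    rw [zero_smul, add_zero]; exact hf.hasFDerivAt
  exact h.comp_hasDerivAt (0 : ℝ) (hasDerivAt_line_time t z w)

theorem fderiv_apply_const {t : ℝ} (ht : t ∈ Ioo (-3 : ℝ) 3) {z : B × F} (hz : z ∈ X.dom)
    (v : F) (u : ℝ × (B × F)) :
    fderiv ℝ (fun q => X.E q v) (t, z) u = fderiv ℝ X.E (t, z) u v := by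
  have := (((X.E_contDiffAt t ht z hz).differentiableAt (by simp)).hasFDerivAt.clm_apply
    (hasFDerivAt_const v (t, z)))
  rw [this.fderiv]; simp

theorem c_hasFDerivAt {x : B} (hx : x ∈ D.U) : HasFDerivAt D.c (fderiv ℝ D.c x) x :=
  ((D.c_smooth.differentiableOn (by simp)).differentiableAt
    (D.isOpen_U.mem_nhds hx)).hasFDerivAt

/-- The derivative in time of the fibre derivative of `E`. -/
theorem hasDerivAt_fderiv_E {t : ℝ} (ht : t ∈ Ioo (-3 : ℝ) 3) {z : B × F} (hz : z ∈ X.dom)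
    (w v : F) : HasDerivAt (fun s => fderiv ℝ X.E (s, z) (0, (0, w)) v)
      ((fderiv ℝ (fderiv ℝ X.Φ) (t, z) (0, (0, w)) (0, (0, v))).2
        - (fderiv ℝ D.c (X.Φ (t, z)).1 (X.dΦ (t, z) w).1 (X.Φ (t, z)).2 (X.E (t, z) v)
          + D.c (X.Φ (t, z)).1 (X.dΦ (t, z) w).2 (X.E (t, z) v)
          + D.c (X.Φ (t, z)).1 (X.Φ (t, z)).2 (fderiv ℝ X.E (t, z) (0, (0, w)) v))) t := by
  have ht4 := Ioo_three_subset ht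
  have hE := X.E_contDiffAt t ht z hz
  have hΦ := X.Φ_contDiffAt t ht4 z hz
  set g : B × F → F := fun z =>
    (X.dΦ (t, z) v).2 - D.c (X.Φ (t, z)).1 (X.Φ (t, z)).2 (X.E (t, z) v) with hg
  have h1 := hasDerivAt_fderiv_of_hasDerivAt (φ := fun q => X.E q v) (g := g)
    ((hE.clm_apply contDiffAt_const).of_le two_le_infty)
    (eventually_of_mem (X.dom_mem_nhds hz) fun z' hz' => X.hasDerivAt_E_apply ht hz' v) (0, w)
  have h2 : HasDerivAt (fun s => fderiv ℝ X.E (s, z) (0, (0, w)) v) (fderiv ℝ g z (0, w)) t := by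
    refine h1.congr_of_eventuallyEq ?_
    filter_upwards [isOpen_Ioo.mem_nhds ht] with s hs
    exact (X.fderiv_apply_const hs hz v _).symm
  refine h2.congr_deriv ?_
  have hgd : DifferentiableAt ℝ g z := by
    have hin : ContDiffAt ℝ ∞ (fun z : B × F => (t, z)) z := contDiffAt_const.prodMk contDiffAt_id
    have h3 : ContDiffAt ℝ ∞ (fun z => X.dΦ (t, z)) z :=
      ContDiffAt.comp (g := X.dΦ) z (X.dΦ_contDiffAt ht4 hz) hin
    have h4 : ContDiffAt ℝ ∞ (fun z => D.c (X.Φ (t, z)).1 (X.Φ (t, z)).2) z :=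
      ContDiffAt.comp (g := fun q => D.c (X.Φ q).1 (X.Φ q).2) z (X.c_contDiffAt ht4 hz) hin
    have h5 : ContDiffAt ℝ ∞ (fun z => X.E (t, z)) z := hE.comp z hin
    exact (((h3.clm_apply contDiffAt_const).snd).sub
      (h4.clm_apply (h5.clm_apply contDiffAt_const))).differentiableAt (by simp)
  have hgl : HasDerivAt (fun l : ℝ => g (z + l • ((0 : B), w))) (fderiv ℝ g z (0, w)) 0 := by
    have h : HasFDerivAt g (fderiv ℝ g z) (z + (0 : ℝ) • ((0 : B), w)) := by
      rw [zero_smul, add_zero]; exact hgd.hasFDerivAt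
    exact h.comp_hasDerivAt (0 : ℝ) (hasDerivAt_line z w)
  refine hgl.unique ?_
  have hz0 : z + (0 : ℝ) • ((0 : B), w) = z := by rw [zero_smul, add_zero]
  have k1 : HasDerivAt (fun l : ℝ => X.Φ (t, z + l • ((0 : B), w))) (X.dΦ (t, z) w) 0 :=
    hasDerivAt_comp_line (hΦ.differentiableAt (by simp)) w
  have k2 : HasDerivAt (fun l : ℝ => fderiv ℝ X.Φ (t, z + l • ((0 : B), w)) (0, (0, v)))
      (fderiv ℝ (fderiv ℝ X.Φ) (t, z) (0, (0, w)) (0, (0, v))) 0 := by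
    have := (hasDerivAt_comp_line (((hΦ.fderiv_right (m := ∞) le_rfl)).differentiableAt
      (by simp)) w).clm_apply (hasDerivAt_const (0 : ℝ) ((0 : ℝ), ((0 : B), v)))
    simpa using this
  have k3 : HasDerivAt (fun l : ℝ => X.E (t, z + l • ((0 : B), w)) v)
      (fderiv ℝ X.E (t, z) (0, (0, w)) v) 0 := by
    simpa using (hasDerivAt_comp_line (hE.differentiableAt (by simp)) w).clm_apply
      (hasDerivAt_const (0 : ℝ) v)
  have hc : HasFDerivAt D.c (fderiv ℝ D.c (X.Φ (t, z)).1)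
      (X.Φ (t, z + (0 : ℝ) • ((0 : B), w))).1 := by
    rw [hz0]; exact c_hasFDerivAt (X.Φ_mem t ht4 z hz)
  have k4 := ((hc.comp_hasDerivAt (0 : ℝ) k1.prod_fst).clm_apply k1.prod_snd).clm_apply k3
  refine (k2.prod_snd.sub k4).congr_deriv ?_
  simp only [Function.comp_apply, hz0, add_apply]

/-- The Maurer-Cartan equation along the flow. -/
theorem maurerCartan_E {t : ℝ} (ht : t ∈ Ico (0 : ℝ) 3) {z : B × F} (hz : z ∈ X.dom) (w v : F) :
    fderiv ℝ X.E (t, z) (0, (0, w)) v - fderiv ℝ X.E (t, z) (0, (0, v)) w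
      + D.c (X.Φ (t, z)).1 (X.E (t, z) w) (X.E (t, z) v) = 0 := by
  have hsub : Icc 0 t ⊆ Ioo (-3 : ℝ) 3 := fun s hs => ⟨by linarith [hs.1], hs.2.trans_lt ht.2⟩
  -- `R` is the Maurer-Cartan defect. It satisfies `R' = -c(Φ) R`, so it stays zero if it starts at
  -- zero.
  set R : ℝ → F := fun t => fderiv ℝ X.E (t, z) (0, (0, w)) v - fderiv ℝ X.E (t, z) (0, (0, v)) w
      + D.c (X.Φ (t, z)).1 (X.E (t, z) w) (X.E (t, z) v) with hR
  have hRd : ∀ s ∈ Icc 0 t, HasDerivAt R (-D.c (X.Φ (s, z)).1 (X.Φ (s, z)).2 (R s)) s := by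
    intro s hs
    have hs3 := hsub hs
    have hs4 := Ioo_three_subset hs3
    have hU := X.Φ_mem s hs4 z hz
    have k1 := X.Φ_deriv s hs4 z hz
    have k2 := (((c_hasFDerivAt hU).comp_hasDerivAt s k1.prod_fst).clm_apply
      (X.hasDerivAt_E_apply hs3 hz w)).clm_apply (X.hasDerivAt_E_apply hs3 hz v)
    have k3 := ((X.hasDerivAt_fderiv_E hs3 hz w v).sub (X.hasDerivAt_fderiv_E hs3 hz v w)).add k2
    refine HasDerivAt.congr_deriv (f := R) k3 ?_
    -- The second derivatives of the flow cancel in the antisymmetrization. The base velocities in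
    -- the derivative of `c` are anchors by `ρ_E`, and the rest is the Jacobi identity for the flow
    -- line and the two values of `E`.
    have hsymm : fderiv ℝ (fderiv ℝ X.Φ) (s, z) (0, (0, w)) (0, (0, v))
        = fderiv ℝ (fderiv ℝ X.Φ) (s, z) (0, (0, v)) (0, (0, w)) :=
      ((X.Φ_contDiffAt s hs4 z hz).of_le two_le_infty).isSymmSndFDerivAt (by simp) _ _
    have hρ := X.ρ_E (t := s) ⟨hs.1, hs.2.trans_lt ht.2⟩ hz
    have hj := D.jacobi _ hU (X.Φ (s, z)).2 (X.E (s, z) w) (X.E (s, z) v)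
    simp only [hR, Function.comp_apply, hsymm, ← hρ, field, map_sub, map_add, sub_apply,
      add_apply]
    rw [D.c_skew hU (D.c _ _ (X.E (s, z) w)) (X.E (s, z) v),
      D.c_skew hU (X.E (s, z) w) (X.dΦ (s, z) v).2,
      D.fderiv_c_skew hU _ (X.Φ (s, z)).2 (X.E (s, z) v),
      ← sub_eq_zero, ← hj, D.c_skew hU (X.E (s, z) v) (X.Φ (s, z)).2, map_neg]
    abel
  have hc : ContDiffOn ℝ 1 (fun q : ℝ × F => -D.c (X.Φ (q.1, z)).1 (X.Φ (q.1, z)).2 q.2)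
      (Ioo (-3 : ℝ) 3 ×ˢ univ) := by
    rintro ⟨s, e⟩ ⟨hs, -⟩
    refine ContDiffAt.contDiffWithinAt ?_
    have hp : ContDiffAt ℝ ∞ (fun w : ℝ × F => (w.1, z)) (s, e) :=
      contDiffAt_fst.prodMk contDiffAt_const
    have h2 : ContDiffAt ℝ ∞ (fun w : ℝ × F => D.c (X.Φ (w.1, z)).1 (X.Φ (w.1, z)).2) (s, e) :=
      ContDiffAt.comp (g := fun q => D.c (X.Φ q).1 (X.Φ q).2) (s, e)
        (X.c_contDiffAt (Ioo_three_subset hs) hz) hp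
    exact ((h2.clm_apply contDiffAt_snd).neg).of_le (by simp)
  -- At time zero `E` vanishes for all initial points of the box, so its derivatives in the initial
  -- point vanish as well.
  have hE0 : ∀ w v : F, fderiv ℝ X.E (0, z) (0, (0, w)) v = 0 := by
    intro w v
    have h1 := hasDerivAt_comp_line (t := 0)
      ((X.E_contDiffAt 0 (by norm_num) z hz).differentiableAt (by simp)) w
    have h2 : ∀ᶠ l : ℝ in 𝓝 0, X.E (0, z + l • ((0 : B), w)) = 0 := by
      have hcont : ContinuousAt (fun l : ℝ => z + l • ((0 : B), w)) 0 := by fun_prop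
      have h3 : ∀ᶠ l : ℝ in 𝓝 0, z + l • ((0 : B), w) ∈ X.dom :=
        hcont (by simpa using X.dom_mem_nhds hz)
      filter_upwards [h3] with l hl using X.E_zero _ hl
    have h4 := h1.unique ((hasDerivAt_const (0 : ℝ) (0 : F →L[ℝ] F)).congr_of_eventuallyEq h2)
    rw [h4]; simp
  exact eqOn_Icc_of_solves (v := fun s e => -D.c (X.Φ (s, z)).1 (X.Φ (s, z)).2 e)
    (isOpen_Ioo.prod isOpen_univ) hc (f := R) (g := fun _ => 0)
    (fun s hs => (hRd s hs).continuousAt.continuousWithinAt)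
    (fun s hs => (hRd s (Ico_subset_Icc_self hs)).hasDerivWithinAt)
    (fun s hs => ⟨hsub (Ico_subset_Icc_self hs), trivial⟩) continuousOn_const
    (fun s hs _ => by
      simp only [map_zero, neg_zero]
      exact hasDerivWithinAt_const _ _ _)
    (by simp [hR, hE0, X.E_zero z hz]) (right_mem_Icc.2 ht.1)

theorem fderiv_Θ {z : B × F} (hz : z ∈ X.dom) (u : B × F) :
    fderiv ℝ X.Θ z u = fderiv ℝ X.E (1, z) (0, u) := by
  have h := HasFDerivAt.comp (g := X.E) z
    ((X.E_contDiffAt 1 (by norm_num) z hz).differentiableAt (by simp)).hasFDerivAt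
    ((hasFDerivAt_const (1 : ℝ) z).prodMk (hasFDerivAt_id z))
  have : HasFDerivAt X.Θ _ z := h
  rw [this.fderiv]; simp

/-- The Maurer-Cartan equation for the realization form. -/
theorem maurerCartan {z : B × F} (hz : z ∈ X.dom) (w v : F) :
    fderiv ℝ X.Θ z (0, w) v - fderiv ℝ X.Θ z (0, v) w
      + D.c (X.Φ (1, z)).1 (X.Θ z w) (X.Θ z v) = 0 := by
  rw [X.fderiv_Θ hz, X.fderiv_Θ hz]
  exact X.maurerCartan_E (by norm_num) hz w v

end RealizationBox

variable (D) in
/-- A realization box together with the solutions `κ (t, (b, a))` of the equation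
`Θ (dκ/dt) = Φ (t, a)`, `κ = b` at `t = 0`, in the fibre of `b`. -/
structure ProductBox (x₀ : B) extends D.RealizationBox x₀ where
  Θ_isInvertible : ∀ z ∈ toFlowBox.dom, (toRealizationBox.Θ z).IsInvertible
  s : ℝ
  s_pos : 0 < s
  s_le : s ≤ r
  κ : ℝ × ((B × F) × (B × F)) → F
  κ_contDiffAt : ∀ t ∈ Ioo (-2 : ℝ) 2, ∀ b ∈ Metric.ball ((x₀, 0) : B × F) s,
    ∀ a ∈ Metric.ball ((x₀, 0) : B × F) s, ContDiffAt ℝ ∞ κ (t, (b, a))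
  κ_zero : ∀ b ∈ Metric.ball ((x₀, 0) : B × F) s, ∀ a ∈ Metric.ball ((x₀, 0) : B × F) s,
    κ (0, (b, a)) = b.2
  κ_mem : ∀ t ∈ Ioo (-2 : ℝ) 2, ∀ b ∈ Metric.ball ((x₀, 0) : B × F) s,
    ∀ a ∈ Metric.ball ((x₀, 0) : B × F) s, (b.1, κ (t, (b, a))) ∈ toFlowBox.dom
  κ_deriv : ∀ t ∈ Ioo (-2 : ℝ) 2, ∀ b ∈ Metric.ball ((x₀, 0) : B × F) s,
    ∀ a ∈ Metric.ball ((x₀, 0) : B × F) s, HasDerivAt (fun t => κ (t, (b, a)))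
      ((toRealizationBox.Θ (b.1, κ (t, (b, a)))).inverse (Φ (t, a)).2) t

theorem RealizationBox.inverse_Θ_contDiffAt [CompleteSpace F] {x₀ : B} (X : D.RealizationBox x₀)
    {z : B × F} (hz : z ∈ X.dom) (h : (X.Θ z).IsInvertible) :
    ContDiffAt ℝ ∞ (fun z => (X.Θ z).inverse) z := by
  obtain ⟨e, he⟩ := h
  have h1 : ContDiffAt ℝ ∞ ContinuousLinearMap.inverse (X.Θ z) := by
    rw [← he]; exact contDiffAt_map_inverse e
  exact h1.comp z (X.Θ_contDiffAt hz)

/-- `Θ` is the identity at `(x₀, 0)` and invertibility is an open condition, so the product equation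
can be solved for the velocity on a smaller ball. The pair of origins is a stationary point of the
resulting system. -/
theorem nonempty_productBox [CompleteSpace B] [CompleteSpace F] {x₀ : B} (hx₀ : x₀ ∈ D.U) :
    Nonempty (D.ProductBox x₀) := by
  obtain ⟨Y⟩ := nonempty_realizationBox hx₀
  have hinv : ∀ᶠ z in 𝓝 ((x₀, 0) : B × F), (Y.Θ z).IsInvertible := by
    have h1 : ContinuousAt Y.Θ (x₀, 0) := (Y.Θ_contDiffAt Y.base_mem_dom).continuousAt
    have h2 := ContinuousLinearEquiv.nhds (ContinuousLinearEquiv.refl ℝ F)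
    have h3 := h1 (show range _ ∈ 𝓝 (Y.Θ (x₀, 0)) by
      rw [Y.Θ_zero Y.base_mem_dom]; exact h2)
    exact h3
  obtain ⟨r₁, hr₁, hball⟩ := Metric.mem_nhds_iff.1 hinv
  have hmin : 0 < min r₁ Y.r := lt_min hr₁ Y.r_pos
  set X := Y.shrink hmin (min_le_right _ _) with hX
  have hinvX : ∀ z ∈ X.dom, (X.Θ z).IsInvertible := fun z hz =>
    hball (Metric.ball_subset_ball (min_le_left _ _) hz)
  -- The flow line of `a` is carried along as a second state, which makes the system autonomous; the
  -- base point of `b` is frozen. Composability is not imposed: only the fibre component of the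
  -- product equation is solved here, and its base component is the subject of `target_κ`.
  set g : (B × F) × (B × F) → (B × F) × (B × F) := fun w =>
    ((0, (X.Θ w.1).inverse w.2.2), D.field w.2) with hg
  set O : Set ((B × F) × (B × F)) := X.dom ×ˢ (D.U ×ˢ univ) with hO
  have hOo : IsOpen O := X.isOpen_dom.prod D.isOpen_domain
  have hgs : ContDiffOn ℝ ∞ g O := by
    rintro ⟨b, a⟩ ⟨hb, ha⟩
    refine ContDiffAt.contDiffWithinAt ?_
    have h1 : ContDiffAt ℝ ∞ (fun w : (B × F) × (B × F) => (X.Θ w.1).inverse) (b, a) :=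
      ContDiffAt.comp (g := fun z => (X.Θ z).inverse) (b, a)
        (X.inverse_Θ_contDiffAt hb (hinvX b hb)) contDiffAt_fst
    have h2 : ContDiffAt ℝ ∞ (fun w : (B × F) × (B × F) => D.field w.2) (b, a) :=
      ContDiffAt.comp (g := D.field) (b, a)
        (D.field_smooth.contDiffAt (D.isOpen_domain.mem_nhds ha)) contDiffAt_snd
    exact (contDiffAt_const.prodMk (h1.clm_apply contDiffAt_snd.snd)).prodMk h2
  obtain ⟨φ, W, hW, hxW, -, hφ, hsol⟩ := exists_smooth_flow (T := 2)
    (γ₀ := fun _ => (((x₀, 0) : B × F), ((x₀, 0) : B × F))) hOo hgs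
    (by norm_num) (fun t _ => ⟨⟨X.base_mem_dom, hx₀, trivial⟩, by
      have : g (((x₀, 0) : B × F), ((x₀, 0) : B × F)) = 0 := by
        simp only [hg, map_zero, D.field_zero hx₀]; rfl
      rw [this]; exact hasDerivAt_const _ _⟩)
  obtain ⟨r₂, hr₂, hrW⟩ := Metric.isOpen_iff.1 hW _ hxW
  set s := min r₂ X.r with hs
  have hs0 : 0 < s := lt_min hr₂ X.r_pos
  have hbW : ∀ b ∈ Metric.ball ((x₀, 0) : B × F) s, ∀ a ∈ Metric.ball ((x₀, 0) : B × F) s,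
      (b, a) ∈ W := fun b hb a ha => hrW (by
    rw [← ball_prod_same]
    exact ⟨Metric.ball_subset_ball (min_le_left _ _) hb,
      Metric.ball_subset_ball (min_le_left _ _) ha⟩)
  have hcomp : ∀ t ∈ Ioo (-2 : ℝ) 2, ∀ b ∈ Metric.ball ((x₀, 0) : B × F) s,
      ∀ a ∈ Metric.ball ((x₀, 0) : B × F) s,
      (φ (t, (b, a))).1.1 = b.1 ∧ (φ (t, (b, a))).2 = X.Φ (t, a) := by
    intro t ht b hb a ha
    obtain ⟨h0, hsl⟩ := hsol _ (hbW b hb a ha)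
    have haX : a ∈ X.dom := Metric.ball_subset_ball (min_le_right _ _) ha
    have hsub : Ioo (-2 : ℝ) 2 ⊆ Ioo (-4) 4 := Ioo_subset_Ioo (by norm_num) (by norm_num)
    have h1 := eq_add_smul_of_hasDerivAt_const (T := 2) (w := (0 : B))
      (fun s hs' => (hsl s hs').2.prod_fst.prod_fst) t ht
    rw [h0] at h1
    refine ⟨by simpa using h1, ?_⟩
    exact eqOn_Ioo_of_solves_autonomous (f := fun t => (φ (t, (b, a))).2)
      (g := fun t => X.Φ (t, a)) D.isOpen_domain (D.field_smooth.of_le (by simp))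
      (fun s hs' => ⟨(hsl s hs').1.2, (hsl s hs').2.prod_snd⟩)
      (fun s hs' => ⟨⟨X.Φ_mem s (hsub hs') a haX, trivial⟩, X.Φ_deriv s (hsub hs') a haX⟩)
      (by simp only [h0, X.Φ_zero a haX]) ht
  refine ⟨⟨X, hinvX, s, hs0, min_le_right _ _, fun q => (φ q).1.2,
    fun t ht b hb a ha => (hφ t (Ioo_subset_Icc_self ht) _ (hbW b hb a ha)).fst.snd,
    fun b hb a ha => by simp [(hsol _ (hbW b hb a ha)).1], fun t ht b hb a ha => ?_,
    fun t ht b hb a ha => ?_⟩⟩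
  · have := ((hsol _ (hbW b hb a ha)).2 t ht).1.1
    rw [← (hcomp t ht b hb a ha).1]
    exact this
  · have h1 := ((hsol _ (hbW b hb a ha)).2 t ht).2.prod_fst.prod_snd
    have h2 : (φ (t, (b, a))).1 = (b.1, (φ (t, (b, a))).1.2) :=
      Prod.ext (hcomp t ht b hb a ha).1 rfl
    simp only [hg, (hcomp t ht b hb a ha).2] at h1
    rw [h2] at h1
    exact h1

namespace ProductBox

variable {x₀ : B} (X : D.ProductBox x₀)

/-- The set of admissible factors. -/
def small : Set (B × F) := Metric.ball (x₀, 0) X.s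

theorem isOpen_small : IsOpen X.small := Metric.isOpen_ball

theorem base_mem_small : ((x₀, 0) : B × F) ∈ X.small := Metric.mem_ball_self X.s_pos

theorem small_subset_dom : X.small ⊆ X.dom := Metric.ball_subset_ball X.s_le

theorem zero_mem_small {x : B} {a : F} (h : (x, a) ∈ X.small) : (x, (0 : F)) ∈ X.small := by
  simp only [small, Metric.mem_ball, Prod.dist_eq, max_lt_iff] at h ⊢
  exact ⟨h.1, by rw [dist_self]; exact X.s_pos⟩

theorem Θ_inverse {z : B × F} (hz : z ∈ X.dom) (e : F) : X.Θ z ((X.Θ z).inverse e) = e := by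
  obtain ⟨L, hL⟩ := X.Θ_isInvertible z hz
  rw [← hL, ContinuousLinearMap.inverse_equiv]
  simp

theorem eq_inverse_of_Θ_eq {z : B × F} (hz : z ∈ X.dom) {v e : F} (h : X.Θ z v = e) :
    v = (X.Θ z).inverse e := by
  obtain ⟨L, hL⟩ := X.Θ_isInvertible z hz
  rw [← h, ← hL, ContinuousLinearMap.inverse_equiv]
  simp

theorem Icc_subset_Ioo_two {T : ℝ} (hT : T < 2) : Icc 0 T ⊆ Ioo (-2 : ℝ) 2 :=
  fun s hs => ⟨by linarith [hs.1], by linarith [hs.2]⟩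

/-- Uniqueness of the solution of the product equation. -/
theorem eqOn_κ [CompleteSpace F] {T : ℝ} (hT : T < 2) {b a : B × F} (hb : b ∈ X.small)
    (ha : a ∈ X.small) {m : ℝ → F} (h0 : m 0 = b.2) (hm : ContinuousOn m (Icc 0 T))
    (hd : ∀ t ∈ Ico 0 T, (b.1, m t) ∈ X.dom → HasDerivWithinAt m
      ((X.Θ (b.1, m t)).inverse (X.Φ (t, a)).2) (Ici t) t) :
    EqOn (fun t => X.κ (t, (b, a))) m (Icc 0 T) := by
  have hsub := Icc_subset_Ioo_two hT
  have hcont : Continuous fun q : ℝ × F => (b.1, q.2) := by fun_prop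
  have haX := X.small_subset_dom ha
  refine eqOn_Icc_of_solves (v := fun t e => (X.Θ (b.1, e)).inverse (X.Φ (t, a)).2)
    (O := (Ioo (-2) 2 ×ˢ univ) ∩ (fun q : ℝ × F => (b.1, q.2)) ⁻¹' X.dom)
    ((isOpen_Ioo.prod isOpen_univ).inter (X.isOpen_dom.preimage hcont)) ?_
    (fun t ht => (X.κ_deriv t (hsub ht) b hb a ha).continuousAt.continuousWithinAt)
    (fun t ht => (X.κ_deriv t (hsub (Ico_subset_Icc_self ht)) b hb a ha).hasDerivWithinAt)
    (fun t ht => ⟨⟨hsub (Ico_subset_Icc_self ht), trivial⟩,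
      X.κ_mem t (hsub (Ico_subset_Icc_self ht)) b hb a ha⟩) hm
    (fun t ht h => hd t ht h.2) ((X.κ_zero b hb a ha).trans h0.symm)
  rintro ⟨t, e⟩ ⟨⟨ht, -⟩, he⟩
  refine ContDiffAt.contDiffWithinAt ?_
  have h1 : ContDiffAt ℝ ∞ (fun q : ℝ × F => (X.Θ (b.1, q.2)).inverse) (t, e) :=
    ContDiffAt.comp (g := fun z => (X.Θ z).inverse) (t, e)
      (X.inverse_Θ_contDiffAt he (X.Θ_isInvertible _ he)) (contDiffAt_const.prodMk contDiffAt_snd)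
  have h2 : ContDiffAt ℝ ∞ (fun q : ℝ × F => X.Φ (q.1, a)) (t, e) :=
    ContDiffAt.comp (g := X.Φ) (t, e)
      (X.Φ_contDiffAt t (Ioo_subset_Ioo (by norm_num) (by norm_num) ht) a haX)
      (contDiffAt_fst.prodMk contDiffAt_const)
  exact (h1.clm_apply h2.snd).of_le (by simp)

/-- The anchor relation `ρ_E` at time one: along a fibre, the differential of the target is the
anchor of `Θ`. -/
theorem hasDerivAt_Φ_one_fst {x : B} {m : ℝ → F} {m' : F} {t : ℝ} (hm : HasDerivAt m m' t)
    (hmem : (x, m t) ∈ X.dom) : HasDerivAt (fun s => (X.Φ (1, (x, m s))).1)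
      (D.ρ (X.Φ (1, (x, m t))).1 (X.Θ (x, m t) m')) t := by
  have h1 := (X.hasFDerivAt_Φ_fiber (t := 1) (by norm_num) hmem).comp_hasDerivAt t hm
  rw [RealizationBox.Θ, X.ρ_E (by norm_num) hmem]
  exact h1.prod_fst

/-- The target of the product path. -/
theorem target_κ {b a : B × F} (hb : b ∈ X.small) (ha : a ∈ X.small)
    (hab : a.1 = (X.Φ (1, b)).1) {t : ℝ} (ht : t ∈ Icc (0 : ℝ) 1) :
    (X.Φ (1, (b.1, X.κ (t, (b, a))))).1 = (X.Φ (t, a)).1 := by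
  have hsub : Icc (0 : ℝ) 1 ⊆ Ioo (-2) 2 := Icc_subset_Ioo_two (by norm_num)
  have hsub4 : Icc (0 : ℝ) 1 ⊆ Ioo (-4) 4 := hsub.trans (Ioo_subset_Ioo (by norm_num) (by norm_num))
  have haX := X.small_subset_dom ha
  have hd : ∀ t ∈ Icc (0 : ℝ) 1, HasDerivAt (fun t => (X.Φ (1, (b.1, X.κ (t, (b, a))))).1)
      (D.ρ (X.Φ (1, (b.1, X.κ (t, (b, a))))).1 (X.Φ (t, a)).2) t := by
    intro t ht
    have := X.hasDerivAt_Φ_one_fst (X.κ_deriv t (hsub ht) b hb a ha)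
      (X.κ_mem t (hsub ht) b hb a ha)
    rwa [X.Θ_inverse (X.κ_mem t (hsub ht) b hb a ha)] at this
  -- Both sides solve `u' = ρ(u) φ^t(a)`, where only the fibre part of the flow line enters: one as
  -- the base part of the spray, the other by the anchor relation for `Θ`. Composability is the
  -- equality of the initial values.
  refine (eqOn_Icc_of_solves (v := fun t u => D.ρ u (X.Φ (t, a)).2) (O := Ioo (-4) 4 ×ˢ D.U)
    (f := fun t => (X.Φ (t, a)).1) (isOpen_Ioo.prod D.isOpen_U) ?_
    (fun t ht => (X.Φ_deriv t (hsub4 ht) a haX).prod_fst.continuousAt.continuousWithinAt)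
    (fun t ht => (X.Φ_deriv t (hsub4 (Ico_subset_Icc_self ht)) a haX).prod_fst.hasDerivWithinAt)
    (fun t ht => ⟨hsub4 (Ico_subset_Icc_self ht), X.Φ_mem t (hsub4 (Ico_subset_Icc_self ht)) a haX⟩)
    (fun t ht => (hd t ht).continuousAt.continuousWithinAt)
    (fun t ht _ => (hd t (Ico_subset_Icc_self ht)).hasDerivWithinAt) ?_ ht).symm
  · rintro ⟨t, u⟩ ⟨ht, hu⟩
    refine ContDiffAt.contDiffWithinAt ?_
    have h1 : ContDiffAt ℝ ∞ (fun q : ℝ × B => D.ρ q.2) (t, u) :=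
      ContDiffAt.comp (g := D.ρ) (t, u) (D.ρ_smooth.contDiffAt (D.isOpen_U.mem_nhds hu))
        contDiffAt_snd
    have h2 : ContDiffAt ℝ ∞ (fun q : ℝ × B => X.Φ (q.1, a)) (t, u) :=
      ContDiffAt.comp (g := X.Φ) (t, u) (X.Φ_contDiffAt t ht a haX)
        (contDiffAt_fst.prodMk contDiffAt_const)
    exact (h1.clm_apply h2.snd).of_le (by simp)
  · simp only [X.κ_zero b hb a ha, X.Φ_zero a haX, hab]

/-- Right invariance of the realization form. -/
theorem Θ_fderiv_κ [CompleteSpace F] {b a : B × F} (hb : b ∈ X.small) (ha : a ∈ X.small)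
    (hab : a.1 = (X.Φ (1, b)).1) {t : ℝ} (ht : t ∈ Icc (0 : ℝ) 1) (w : F) :
    X.Θ (b.1, X.κ (t, (b, a))) (fderiv ℝ X.κ (t, (b, a)) (0, (0, (0, w)))) = X.E (t, a) w := by
  have hsub : Icc (0 : ℝ) 1 ⊆ Ioo (-2) 2 := Icc_subset_Ioo_two (by norm_num)
  have haX := X.small_subset_dom ha
  have hsmall : X.small ×ˢ X.small ∈ 𝓝 (b, a) :=
    prod_mem_nhds (X.isOpen_small.mem_nhds hb) (X.isOpen_small.mem_nhds ha)
  have hline : HasDerivAt (fun l : ℝ => (b, a + l • ((0 : B), w))) ((0 : B × F), ((0 : B), w)) 0 :=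
    (hasDerivAt_const (0 : ℝ) b).prodMk (RealizationBox.hasDerivAt_line a w)
  have hcomp : ∀ {G : Type v} [NormedAddCommGroup G] [NormedSpace ℝ G]
      {f : (B × F) × (B × F) → G}, DifferentiableAt ℝ f (b, a) →
      HasDerivAt (fun l : ℝ => f (b, a + l • ((0 : B), w)))
        (fderiv ℝ f (b, a) (0, (0, w))) 0 := by
    intro G _ _ f hf
    have h : HasFDerivAt f (fderiv ℝ f (b, a)) (b, a + (0 : ℝ) • ((0 : B), w)) := by
      rw [zero_smul, add_zero]; exact hf.hasFDerivAt
    exact h.comp_hasDerivAt (0 : ℝ) hline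
  have hlmem : ∀ᶠ l : ℝ in 𝓝 0, a + l • ((0 : B), w) ∈ X.small := by
    have hcont : ContinuousAt (fun l : ℝ => a + l • ((0 : B), w)) 0 := by fun_prop
    exact hcont (by simpa using X.isOpen_small.mem_nhds ha)
  set k : ℝ → F := fun t => X.κ (t, (b, a)) with hk
  set dk : ℝ → F := fun t => fderiv ℝ X.κ (t, (b, a)) (0, (0, (0, w))) with hdk
  have hkl : ∀ t ∈ Ioo (-2 : ℝ) 2,
      HasDerivAt (fun l : ℝ => X.κ (t, (b, a + l • ((0 : B), w)))) (dk t) 0 := by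
    intro t ht
    have hκ := X.κ_contDiffAt t ht b hb a ha
    have h1 : DifferentiableAt ℝ (fun q => X.κ (t, q)) (b, a) :=
      (hκ.differentiableAt (by simp)).comp (b, a) (f := fun q => (t, q)) (by fun_prop)
    have h2 := hcomp h1
    have h3 : fderiv ℝ (fun q => X.κ (t, q)) (b, a) (0, (0, w)) = dk t := by
      have : HasFDerivAt (fun q => X.κ (t, q)) _ (b, a) := HasFDerivAt.comp (g := X.κ) (b, a)
        (hκ.differentiableAt (by simp)).hasFDerivAt
        ((hasFDerivAt_const t (b, a)).prodMk (hasFDerivAt_id (b, a)))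
      rw [this.fderiv]; simp [hdk]
    rwa [h3] at h2
  -- `Θ` applied to the variation `dk` of the product path is shown to satisfy the linear equation
  -- that defines `E (t, a) w`, and both vanish at time zero.
  have hβ : ∀ t ∈ Icc (0 : ℝ) 1, HasDerivAt (fun t => X.Θ (b.1, k t) (dk t))
      ((X.dΦ (t, a) w).2 - D.c (X.Φ (t, a)).1 (X.Φ (t, a)).2 (X.Θ (b.1, k t) (dk t))) t := by
    intro t ht
    have ht2 := hsub ht
    have ht4 : t ∈ Ioo (-4 : ℝ) 4 := Ioo_subset_Ioo (by norm_num) (by norm_num) ht2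
    have hκ := X.κ_contDiffAt t ht2 b hb a ha
    have hmem := X.κ_mem t ht2 b hb a ha
    have hΘd : HasFDerivAt X.Θ (fderiv ℝ X.Θ (b.1, k t)) (b.1, k t) :=
      ((X.Θ_contDiffAt hmem).differentiableAt (by simp)).hasFDerivAt
    set g : (B × F) × (B × F) → F := fun q =>
      (X.Θ (q.1.1, X.κ (t, q))).inverse (X.Φ (t, q.2)).2 with hg
    have hdkd : HasDerivAt dk (fderiv ℝ g (b, a) (0, (0, w))) t :=
      hasDerivAt_fderiv_of_hasDerivAt (hκ.of_le two_le_infty)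
        (eventually_of_mem hsmall fun q hq => X.κ_deriv t ht2 q.1 hq.1 q.2 hq.2) (0, (0, w))
    have hgd : DifferentiableAt ℝ g (b, a) := by
      have h0 : ContDiffAt ℝ ∞ (fun q : (B × F) × (B × F) => X.κ (t, q)) (b, a) :=
        ContDiffAt.comp (g := X.κ) (b, a) hκ (contDiffAt_const.prodMk contDiffAt_id)
      have h1 : ContDiffAt ℝ ∞ (fun q : (B × F) × (B × F) =>
          (X.Θ (q.1.1, X.κ (t, q))).inverse) (b, a) :=
        ContDiffAt.comp (g := fun z => (X.Θ z).inverse) (b, a)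
          (X.inverse_Θ_contDiffAt hmem (X.Θ_isInvertible _ hmem)) (contDiffAt_fst.fst.prodMk h0)
      have h2 : ContDiffAt ℝ ∞ (fun q : (B × F) × (B × F) => X.Φ (t, q.2)) (b, a) :=
        ContDiffAt.comp (g := X.Φ) (b, a) (X.Φ_contDiffAt t ht4 a haX)
          (contDiffAt_const.prodMk contDiffAt_snd)
      exact (h1.clm_apply h2.snd).differentiableAt (by simp)
    have e1 : HasDerivAt (fun l : ℝ => X.Θ (b.1, X.κ (t, (b, a + l • ((0 : B), w))))
        (g (b, a + l • ((0 : B), w))))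
        (fderiv ℝ X.Θ (b.1, k t) (0, dk t) (g (b, a))
          + X.Θ (b.1, k t) (fderiv ℝ g (b, a) (0, (0, w)))) 0 := by
      have h1 : HasDerivAt (fun l : ℝ => (b.1, X.κ (t, (b, a + l • ((0 : B), w)))))
          ((0 : B), dk t) 0 := (hasDerivAt_const (0 : ℝ) b.1).prodMk (hkl t ht2)
      have h2 : HasFDerivAt X.Θ (fderiv ℝ X.Θ (b.1, k t))
          (b.1, X.κ (t, (b, a + (0 : ℝ) • ((0 : B), w)))) := by
        rw [zero_smul, add_zero]; exact hΘd
      have h3 := (h2.comp_hasDerivAt (0 : ℝ) h1).clm_apply (hcomp hgd)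
      have h00 : ((0 : B), (0 : F)) = 0 := rfl
      simpa [hk, h00] using h3
    have e2 : HasDerivAt (fun l : ℝ => (X.Φ (t, a + l • ((0 : B), w))).2) (X.dΦ (t, a) w).2 0 :=
      (RealizationBox.hasDerivAt_comp_line
        ((X.Φ_contDiffAt t ht4 a haX).differentiableAt (by simp)) w).prod_snd
    -- This is the product equation `Θ(k) k' = φ^t(a)` differentiated in the direction `w` of `a`.
    have e3 := e1.unique (e2.congr_of_eventuallyEq (by
      filter_upwards [hlmem] with l hl using X.Θ_inverse (X.κ_mem t ht2 b hb _ hl) _))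
    have hkd : HasDerivAt k (g (b, a)) t := X.κ_deriv t ht2 b hb a ha
    have e4 := (hΘd.comp_hasDerivAt t ((hasDerivAt_const t b.1).prodMk hkd)).clm_apply hdkd
    refine HasDerivAt.congr_deriv (f := fun t => X.Θ (b.1, k t) (dk t)) e4 ?_
    -- The two derivatives of `Θ(k)`, taken along the variation and along time, differ by exactly
    -- the term with `c`. Its base point is that of the flow line of `a` by `target_κ`.
    have hmc := X.maurerCartan hmem (g (b, a)) (dk t)
    have hτ := X.target_κ hb ha hab ht
    have hΘg : X.Θ (b.1, k t) (g (b, a)) = (X.Φ (t, a)).2 := X.Θ_inverse hmem _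
    rw [hΘg, hτ] at hmc
    rw [← e3, ← sub_eq_zero, ← hmc]
    simp only [Function.comp_apply, hk]
    abel
  have h0 : (fun t => X.Θ (b.1, k t) (dk t)) 0 = 0 := by
    have h1 : dk 0 = 0 := (hkl 0 (by norm_num)).unique
      ((hasDerivAt_const (0 : ℝ) b.2).congr_of_eventuallyEq (by
        filter_upwards [hlmem] with l hl using X.κ_zero b hb _ hl))
    simp only [h1, map_zero]
  exact (X.eqOn_E (T := 1) (by norm_num) haX w h0
    (fun t ht => (hβ t ht).continuousAt.continuousWithinAt)
    (fun t ht => (hβ t (Ico_subset_Icc_self ht)).hasDerivWithinAt) ht).symm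

/-- The flow line of a zero vector has zero fibre part, so the constant path solves the equation. -/
theorem κ_unit_left [CompleteSpace F] {b : B × F} {y : B} (hb : b ∈ X.small)
    (hy : (y, (0 : F)) ∈ X.small) {t : ℝ} (ht : t ∈ Icc (0 : ℝ) 1) :
    X.κ (t, (b, (y, 0))) = b.2 := by
  refine X.eqOn_κ (T := 1) (by norm_num) hb hy (m := fun _ => b.2) rfl continuousOn_const
    (fun s hs _ => ?_) ht
  rw [X.Φ_base (X.small_subset_dom hy) ⟨by linarith [hs.1], by linarith [hs.2]⟩, map_zero]
  exact hasDerivWithinAt_const _ _ _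

/-- The ray `t • a` is a solution by `Θ_smul`. -/
theorem κ_unit_right [CompleteSpace F] {x : B} {a : F} (ha : (x, a) ∈ X.small) {t : ℝ}
    (ht : t ∈ Icc (0 : ℝ) 1) : X.κ (t, ((x, 0), (x, a))) = t • a := by
  refine X.eqOn_κ (T := 1) (by norm_num) (X.zero_mem_small ha) ha (m := fun t => t • a) (by simp)
    (by fun_prop) (fun s hs h => ?_) ht
  have hs1 : |s| ≤ 1 := abs_le.2 ⟨by linarith [hs.1], hs.2.le⟩
  have := X.eq_inverse_of_Θ_eq h (X.Θ_smul (X.small_subset_dom ha) hs1)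
  rw [← this]
  simpa using ((hasDerivAt_id s).smul_const a).hasDerivWithinAt

/-- Homogeneity with factor `-1`: negation composed with time reversal maps flow lines to flow
lines. It makes `-φ^1` an involution that exchanges source and target. -/
theorem Φ_neg {z : B × F} (hz : z ∈ X.dom)
    (hz' : ((X.Φ (1, z)).1, -(X.Φ (1, z)).2) ∈ X.dom) {t : ℝ} (ht : t ∈ Ioo (-3 : ℝ) 3) :
    X.Φ (t, ((X.Φ (1, z)).1, -(X.Φ (1, z)).2)) = ((X.Φ (1 - t, z)).1, -(X.Φ (1 - t, z)).2) := by
  have hsub : Ioo (-3 : ℝ) 3 ⊆ Ioo (-4) 4 := Ioo_subset_Ioo (by norm_num) (by norm_num)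
  have hsub' : ∀ s ∈ Ioo (-3 : ℝ) 3, 1 - s ∈ Ioo (-4 : ℝ) 4 := fun s hs =>
    ⟨by linarith [hs.2], by linarith [hs.1]⟩
  refine eqOn_Ioo_of_solves_autonomous D.isOpen_domain (D.field_smooth.of_le (by simp))
    (f := fun t => X.Φ (t, ((X.Φ (1, z)).1, -(X.Φ (1, z)).2)))
    (g := fun t => ((X.Φ (1 - t, z)).1, -(X.Φ (1 - t, z)).2))
    (fun s hs => ⟨⟨X.Φ_mem s (hsub hs) _ hz', trivial⟩, X.Φ_deriv s (hsub hs) _ hz'⟩)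
    (fun s hs => ⟨⟨X.Φ_mem _ (hsub' s hs) _ hz, trivial⟩, ?_⟩)
    (by simp [X.Φ_zero _ hz']) ht
  have h1 : HasDerivAt (fun s => X.Φ (1 - s, z)) ((-1 : ℝ) • D.field (X.Φ (1 - s, z))) s :=
    HasDerivAt.scomp (g₁ := fun s => X.Φ (s, z)) s (X.Φ_deriv _ (hsub' s hs) _ hz)
      (by simpa using (hasDerivAt_id s).const_sub 1)
  have h2 := D.field_smul (X.Φ_mem _ (hsub' s hs) _ hz) (-1) (X.Φ (1 - s, z)).2
  rw [neg_one_smul] at h2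
  rw [h2]
  refine (h1.prod_fst.prodMk h1.prod_snd.neg).congr_deriv ?_
  simp [field]

/-- The ray runs back to the origin: the velocity of `(1 - t) • a` is sent by `Θ` to minus the fibre
part of `φ^(1 - t)(a)`, and by `Φ_neg` this is the flow line of the inverse. At `t = 1` the path
reaches the unit. -/
theorem κ_inverse [CompleteSpace F] {x : B} {a : F} (ha : (x, a) ∈ X.small)
    (ha' : ((X.Φ (1, (x, a))).1, -(X.Φ (1, (x, a))).2) ∈ X.small) {t : ℝ}
    (ht : t ∈ Icc (0 : ℝ) 1) :
    X.κ (t, ((x, a), ((X.Φ (1, (x, a))).1, -(X.Φ (1, (x, a))).2))) = (1 - t) • a := by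
  refine X.eqOn_κ (T := 1) (by norm_num) ha ha' (m := fun t => (1 - t) • a) (by simp)
    (by fun_prop) (fun s hs h => ?_) ht
  have hs1 : |1 - s| ≤ 1 := abs_le.2 ⟨by linarith [hs.2], by linarith [hs.1]⟩
  have h1 := X.Θ_smul (X.small_subset_dom ha) hs1
  rw [X.Φ_neg (X.small_subset_dom ha) (X.small_subset_dom ha')
    ⟨by linarith [hs.1], by linarith [hs.2]⟩]
  have := X.eq_inverse_of_Θ_eq h (v := -a) (by rw [map_neg, h1])
  rw [← this]
  simpa using (((hasDerivAt_id s).const_sub 1).smul_const a).hasDerivWithinAt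

/-- Associativity of the product. -/
theorem κ_assoc [CompleteSpace F] {a b c : B × F} (ha : a ∈ X.small) (hb : b ∈ X.small)
    (hc : c ∈ X.small) (hbc : b.1 = (X.Φ (1, c)).1)
    (hm : ∀ t ∈ Icc (0 : ℝ) 1, (b.1, X.κ (t, (b, a))) ∈ X.small)
    (he : (c.1, X.κ (1, (c, b))) ∈ X.small) :
    X.κ (1, (c, (b.1, X.κ (1, (b, a))))) = X.κ (1, ((c.1, X.κ (1, (c, b))), a)) := by
  have hsub : Icc (0 : ℝ) 1 ⊆ Ioo (-2) 2 := Icc_subset_Ioo_two (by norm_num)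
  -- The product path of `a` and `b`, multiplied on the right by `c`, again solves the equation
  -- driven by `a`: right multiplication preserves `Θ`. It starts at the product of `b` and `c`.
  have hd : ∀ t ∈ Icc (0 : ℝ) 1, HasDerivAt (fun t => X.κ (1, (c, (b.1, X.κ (t, (b, a))))))
      ((X.Θ (c.1, X.κ (1, (c, (b.1, X.κ (t, (b, a))))))).inverse (X.Φ (t, a)).2) t := by
    intro t ht
    have hκ := X.κ_contDiffAt 1 (by norm_num) c hc _ (hm t ht)
    have h1 := (X.κ_deriv t (hsub ht) b hb a ha)
    have h2 := (hκ.differentiableAt (by simp)).hasFDerivAt.comp_hasDerivAt t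
      ((hasDerivAt_const t (1 : ℝ)).prodMk ((hasDerivAt_const t c).prodMk
        ((hasDerivAt_const t b.1).prodMk h1)))
    refine h2.congr_deriv (X.eq_inverse_of_Θ_eq
      (X.κ_mem 1 (by norm_num) c hc _ (hm t ht)) ?_)
    rw [X.Θ_fderiv_κ hc (hm t ht) hbc (by simp)]
    exact X.Θ_inverse (X.small_subset_dom (hm t ht)) _
  have := X.eqOn_κ (T := 1) (by norm_num) he ha
    (m := fun t => X.κ (1, (c, (b.1, X.κ (t, (b, a))))))
    (by simp only [X.κ_zero b hb a ha])
    (fun t ht => (hd t ht).continuousAt.continuousWithinAt)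
    (fun t ht _ => (hd t (Ico_subset_Icc_self ht)).hasDerivWithinAt) (right_mem_Icc.2 zero_le_one)
  exact this.symm

/-- The product path stays close to `(x₀, 0)`. -/
theorem eventually_κ_mem [CompleteSpace F] {N : Set (B × F)} (hN : N ∈ 𝓝 ((x₀, 0) : B × F)) :
    ∀ᶠ q in 𝓝 (((x₀, 0) : B × F), ((x₀, 0) : B × F)), ∀ t ∈ Icc (0 : ℝ) 1,
      (q.1.1, X.κ (t, q)) ∈ N := by
  refine isCompact_Icc.eventually_forall_of_forall_eventually fun t ht => ?_
  have ht' : t ∈ Ioo (-2 : ℝ) 2 := Icc_subset_Ioo_two (by norm_num) ht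
  have hc : ContinuousAt (fun p : ((B × F) × (B × F)) × ℝ => X.κ (p.2, p.1))
      (((x₀, 0), (x₀, 0)), t) :=
    ContinuousAt.comp (f := fun p : ((B × F) × (B × F)) × ℝ => (p.2, p.1)) (g := X.κ)
      (X.κ_contDiffAt t ht' _ X.base_mem_small _ X.base_mem_small).continuousAt (by fun_prop)
  have hc' : ContinuousAt (fun p : ((B × F) × (B × F)) × ℝ => (p.1.1.1, X.κ (p.2, p.1)))
      (((x₀, 0), (x₀, 0)), t) := ContinuousAt.prodMk (by fun_prop) hc
  refine hc' ?_
  simp only [X.κ_unit_left X.base_mem_small X.base_mem_small ht]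
  exact hN

end ProductBox

end SprayModel

end Product

/-! ### Tangent vectors in a chart -/

section ChartVec

set_option linter.unusedSectionVars false

variable {EN : Type*} [NormedAddCommGroup EN] [NormedSpace ℝ EN]
  {HN : Type*} [TopologicalSpace HN] {J : ModelWithCorners ℝ EN HN}
  {N : Type*} [TopologicalSpace N] [ChartedSpace HN N]

variable (J) in
/-- The coordinates of a tangent vector in the chart at `x₀`. -/
noncomputable def chartVec (x₀ : N) (p : TangentBundle J N) : EN :=
  mfderiv J 𝓘(ℝ, EN) (extChartAt J x₀) p.1 p.2

theorem chartVec_add (x₀ x : N) (v w : TangentSpace J x) :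
    chartVec J x₀ ⟨x, v + w⟩ = chartVec J x₀ ⟨x, v⟩ + chartVec J x₀ ⟨x, w⟩ :=
  map_add (mfderiv J 𝓘(ℝ, EN) (extChartAt J x₀) x) v w

theorem chartVec_smul (x₀ x : N) (r : ℝ) (v : TangentSpace J x) :
    chartVec J x₀ ⟨x, r • v⟩ = r • chartVec J x₀ ⟨x, v⟩ :=
  map_smul (mfderiv J 𝓘(ℝ, EN) (extChartAt J x₀) x) r v

variable [J.Boundaryless] [IsManifold J ∞ N]

theorem mdifferentiableAt_chart {x₀ x : N} (hx : x ∈ (extChartAt J x₀).source) :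
    MDifferentiableAt J 𝓘(ℝ, EN) (extChartAt J x₀) x :=
  mdifferentiableAt_extChartAt (by rwa [extChartAt_source] at hx)

theorem chartVec_injective {x₀ x : N} (hx : x ∈ (extChartAt J x₀).source)
    {v w : TangentSpace J x} (h : chartVec J x₀ ⟨x, v⟩ = chartVec J x₀ ⟨x, w⟩) : v = w :=
  (isInvertible_mfderiv_extChartAt hx).injective h

theorem chartVec_surjective {x₀ x : N} (hx : x ∈ (extChartAt J x₀).source) (u : EN) :
    ∃ v : TangentSpace J x, chartVec J x₀ ⟨x, v⟩ = u :=
  (isInvertible_mfderiv_extChartAt hx).surjective u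

/-- Comparing base points and coordinate vectors separately avoids transporting vectors between
tangent spaces at points that are only provably equal. -/
theorem tangentBundle_ext {x₀ : N} {p q : TangentBundle J N}
    (hp : p.1 ∈ (extChartAt J x₀).source) (h : p.1 = q.1)
    (hv : chartVec J x₀ p = chartVec J x₀ q) : p = q := by
  obtain ⟨x, v⟩ := p
  obtain ⟨y, w⟩ := q
  obtain rfl : x = y := h
  rw [chartVec_injective hp hv]

/-- Near the base point `chartVec` is the second component of the trivialization of the tangent
bundle, which is smooth. -/
theorem chartVec_contMDiffAt {E' : Type*} [NormedAddCommGroup E'] [NormedSpace ℝ E']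
    {H' : Type*} [TopologicalSpace H'] {I' : ModelWithCorners ℝ E' H'}
    {P : Type*} [TopologicalSpace P] [ChartedSpace H' P] {g : P → TangentBundle J N} {x : P}
    {x₀ : N} (hg : ContMDiffAt I' J.tangent ∞ g x) (hx : (g x).1 ∈ (extChartAt J x₀).source) :
    ContMDiffAt I' 𝓘(ℝ, EN) ∞ (fun y => chartVec J x₀ (g y)) x := by
  rw [extChartAt_source] at hx
  have h1 : ContMDiffAt J.tangent (J.prod 𝓘(ℝ, EN)) ∞
      (trivializationAt EN (TangentSpace J) x₀) (g x) :=
    (Trivialization.contMDiffOn (IB := J) (trivializationAt EN (TangentSpace J) x₀)).contMDiffAt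
      ((trivializationAt EN (TangentSpace J) x₀).open_source.mem_nhds
        ((trivializationAt EN (TangentSpace J) x₀).mem_source.2 hx))
  have h2 := (h1.comp x hg).snd
  refine h2.congr_of_eventuallyEq ?_
  have hc : ContinuousAt (fun y => (g y).1) x :=
    (FiberBundle.continuous_proj EN (TangentSpace J)).continuousAt.comp hg.continuousAt
  filter_upwards [hc ((chartAt HN x₀).open_source.mem_nhds hx)] with y hy
  have h3 := DFunLike.congr_fun
    (TangentBundle.continuousLinearMapAt_trivializationAt (I := J) (x := (g y).1) hy) (g y).2
  exact h3.symm.trans (congrFun (Trivialization.coe_linearMapAt_of_mem (R := ℝ)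
    (trivializationAt EN (TangentSpace J) x₀) (b := (g y).1) hy) (g y).2)

theorem HasMFDerivWithinAt.hasDerivWithinAt_chart {γ : ℝ → N} {t : ℝ} {s : Set ℝ}
    {γ' : TangentSpace 𝓘(ℝ, ℝ) t →L[ℝ] TangentSpace J (γ t)} {x₀ : N}
    (h : HasMFDerivWithinAt 𝓘(ℝ, ℝ) J γ s t γ') (ht : γ t ∈ (extChartAt J x₀).source) :
    HasDerivWithinAt (fun s => extChartAt J x₀ (γ s)) (chartVec J x₀ ⟨γ t, γ' (1 : ℝ)⟩) s t := by
  have h1 := HasMFDerivAt.comp_hasMFDerivWithinAt t (mdifferentiableAt_chart ht).hasMFDerivAt h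
  let γ'' : ℝ →L[ℝ] EN := (mfderiv J 𝓘(ℝ, EN) (extChartAt J x₀) (γ t)).comp γ'
  have h2 : HasFDerivWithinAt (fun s => extChartAt J x₀ (γ s)) γ'' s t :=
    hasMFDerivWithinAt_iff_hasFDerivWithinAt.1 h1
  exact h2.hasDerivWithinAt

theorem hasMFDerivAt_chart_symm {x₀ : N} {z : EN} (hz : z ∈ (extChartAt J x₀).target) :
    HasMFDerivAt 𝓘(ℝ, EN) J (extChartAt J x₀).symm z
      (mfderiv 𝓘(ℝ, EN) J (extChartAt J x₀).symm z) :=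
  ((mdifferentiableOn_extChartAt_symm (x := x₀)).mdifferentiableAt
    ((isOpen_extChartAt_target x₀).mem_nhds hz)).hasMFDerivAt

theorem chartVec_mfderiv_symm {x₀ : N} {z : EN} (hz : z ∈ (extChartAt J x₀).target) (u : EN) :
    chartVec J x₀ ⟨(extChartAt J x₀).symm z, mfderiv 𝓘(ℝ, EN) J (extChartAt J x₀).symm z u⟩
      = u := by
  have h := mfderiv_extChartAt_comp_mfderivWithin_extChartAt_symm hz
  rw [J.range_eq_univ, mfderivWithin_univ] at h
  exact DFunLike.congr_fun h u

theorem mfderiv_symm_chartVec {x₀ : N} {z : EN} (hz : z ∈ (extChartAt J x₀).target)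
    {v : TangentSpace J ((extChartAt J x₀).symm z)} {u : EN} (hu : chartVec J x₀ ⟨_, v⟩ = u) :
    mfderiv 𝓘(ℝ, EN) J (extChartAt J x₀).symm z u = v :=
  chartVec_injective ((extChartAt J x₀).map_target hz) ((chartVec_mfderiv_symm hz u).trans hu.symm)

theorem HasDerivWithinAt.hasMFDerivWithinAt_chart_symm {x₀ : N} {c : ℝ → EN} {c' : EN} {t : ℝ}
    {s : Set ℝ} (h : HasDerivWithinAt c c' s t) (ht : c t ∈ (extChartAt J x₀).target)
    {v : TangentSpace J ((extChartAt J x₀).symm (c t))} (hv : chartVec J x₀ ⟨_, v⟩ = c') :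
    HasMFDerivWithinAt 𝓘(ℝ, ℝ) J (fun s => (extChartAt J x₀).symm (c s)) s t
      ((1 : ℝ →L[ℝ] ℝ).smulRight v) := by
  have h1 := HasMFDerivAt.comp_hasMFDerivWithinAt t (hasMFDerivAt_chart_symm ht)
    (hasMFDerivWithinAt_iff_hasFDerivWithinAt.2 h.hasFDerivWithinAt)
  refine HasMFDerivWithinAt.congr_mfderiv h1 ?_
  rw [← mfderiv_symm_chartVec ht hv]
  refine ContinuousLinearMap.ext_ring ?_
  change mfderiv 𝓘(ℝ, EN) J (extChartAt J x₀).symm (c t) ((1 : ℝ) • c')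
    = (1 : ℝ) • mfderiv 𝓘(ℝ, EN) J (extChartAt J x₀).symm (c t) c'
  rw [one_smul, one_smul]

theorem HasDerivAt.hasMFDerivAt_chart_symm {x₀ : N} {c : ℝ → EN} {c' : EN} {t : ℝ}
    (h : HasDerivAt c c' t) (ht : c t ∈ (extChartAt J x₀).target)
    {v : TangentSpace J ((extChartAt J x₀).symm (c t))} (hv : chartVec J x₀ ⟨_, v⟩ = c') :
    HasMFDerivAt 𝓘(ℝ, ℝ) J (fun s => (extChartAt J x₀).symm (c s)) t
      ((1 : ℝ →L[ℝ] ℝ).smulRight v) :=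
  hasMFDerivWithinAt_univ.1 (h.hasDerivWithinAt.hasMFDerivWithinAt_chart_symm ht hv)

/-- The derivative of a map that is given in charts. -/
theorem hasMFDerivAt_of_chart {E' : Type*} [NormedAddCommGroup E'] [NormedSpace ℝ E']
    {H' : Type*} [TopologicalSpace H'] {J' : ModelWithCorners ℝ E' H'} [J'.Boundaryless]
    {P : Type*} [TopologicalSpace P] [ChartedSpace H' P] [IsManifold J' ∞ P]
    {f : P → N} {x x₀ : P} {y₀ : N} {g : E' → EN} {g' : E' →L[ℝ] EN}
    (hx : x ∈ (extChartAt J' x₀).source) (hg : HasFDerivAt g g' (extChartAt J' x₀ x))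
    (hgt : g (extChartAt J' x₀ x) ∈ (extChartAt J y₀).target)
    (hf : f =ᶠ[𝓝 x] fun y => (extChartAt J y₀).symm (g (extChartAt J' x₀ y))) :
    MDifferentiableAt J' J f x ∧
      ∀ v : TangentSpace J' x, chartVec J y₀ ⟨f x, mfderiv J' J f x v⟩
        = g' (chartVec J' x₀ ⟨x, v⟩) := by
  have h1 := HasMFDerivAt.comp x (hasMFDerivAt_iff_hasFDerivAt.2 hg)
    (mdifferentiableAt_chart hx).hasMFDerivAt
  have h2 := HasMFDerivAt.comp x (hasMFDerivAt_chart_symm hgt) h1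
  have h3 := h2.congr_of_eventuallyEq hf
  refine ⟨h3.mdifferentiableAt, fun v => ?_⟩
  have h4 := chartVec_mfderiv_symm hgt (g' (chartVec J' x₀ ⟨x, v⟩))
  rw [← h4]
  have hfx : f x = (extChartAt J y₀).symm (g (extChartAt J' x₀ x)) := hf.eq_of_nhds
  rw [h3.mfderiv]
  simp only [chartVec]
  rw [hfx]
  rfl

/-- The derivative of a function in the chart at `x₀`. -/
theorem dirDeriv_eq_fderiv {f : N → ℝ} {x₀ x : N} (hx : x ∈ (extChartAt J x₀).source)
    (hf : DifferentiableAt ℝ (fun z => f ((extChartAt J x₀).symm z)) (extChartAt J x₀ x))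
    (v : TangentSpace J x) :
    dirDeriv f x v = fderiv ℝ (fun z => f ((extChartAt J x₀).symm z)) (extChartAt J x₀ x)
      (chartVec J x₀ ⟨x, v⟩) := by
  have h1 := HasMFDerivAt.comp x (hasMFDerivAt_iff_hasFDerivAt.2 hf.hasFDerivAt)
    (mdifferentiableAt_chart hx).hasMFDerivAt
  have h2 : f =ᶠ[𝓝 x] (fun z => f ((extChartAt J x₀).symm z)) ∘ extChartAt J x₀ := by
    filter_upwards [extChartAt_source_mem_nhds' hx] with y hy
    simp only [Function.comp_apply]
    rw [(extChartAt J x₀).left_inv hy]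
  have h3 : HasMFDerivAt J 𝓘(ℝ, ℝ) f x _ := h1.congr_of_eventuallyEq h2
  rw [dirDeriv, h3.mfderiv]
  rfl

theorem contDiffAt_comp_chart_symm {E' : Type*} [NormedAddCommGroup E'] [NormedSpace ℝ E']
    {f : N → E'} {x₀ : N} {z : EN} (hz : z ∈ (extChartAt J x₀).target)
    (hf : ContMDiffAt J 𝓘(ℝ, E') ∞ f ((extChartAt J x₀).symm z)) :
    ContDiffAt ℝ ∞ (fun z => f ((extChartAt J x₀).symm z)) z :=
  contMDiffAt_iff_contDiffAt.1 (hf.comp z ((contMDiffOn_extChartAt_symm x₀).contMDiffAt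
    ((isOpen_extChartAt_target x₀).mem_nhds hz)))

end ChartVec

/-! ### The standard chart of a vector bundle -/

section BundleChart

set_option linter.unusedSectionVars false

variable {B : Type*} [NormedAddCommGroup B] [NormedSpace ℝ B]
  {M : Type*} [TopologicalSpace M] [ChartedSpace B M] [IsManifold 𝓘(ℝ, B) ∞ M]
  {F : Type*} [NormedAddCommGroup F] [NormedSpace ℝ F]
  {A : M → Type*} [TopologicalSpace (TotalSpace F A)]
  [∀ x, TopologicalSpace (A x)] [FiberBundle F A]
  [∀ x, AddCommGroup (A x)] [∀ x, Module ℝ (A x)] [VectorBundle ℝ F A]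
  [ContMDiffVectorBundle ∞ F A 𝓘(ℝ, B)]

local notation "𝓙" => ModelWithCorners.prod 𝓘(ℝ, B) 𝓘(ℝ, F)

variable (F A) in
/-- The coordinates of the elements of the fibre over `x` in the trivialization at `x₀`. -/
noncomputable def fiberCoord (x₀ x : M) : A x →ₗ[ℝ] F :=
  (trivializationAt F A x₀).linearMapAt ℝ x

variable (F A) in
/-- The element of the fibre over `x` with given coordinates in the trivialization at `x₀`. -/
noncomputable def fiberVec (x₀ x : M) : F →ₗ[ℝ] A x :=
  (trivializationAt F A x₀).symmₗ ℝ x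

variable (B F A) in
/-- The domain of the standard chart of a vector bundle, in the base. -/
def chartNhd (x₀ : M) : Set M :=
  (extChartAt 𝓘(ℝ, B) x₀).source ∩ (trivializationAt F A x₀).baseSet

theorem isOpen_chartNhd (x₀ : M) : IsOpen (chartNhd B F A x₀) :=
  (isOpen_extChartAt_source x₀).inter (trivializationAt F A x₀).open_baseSet

theorem mem_chartNhd (x₀ : M) : x₀ ∈ chartNhd B F A x₀ :=
  ⟨mem_extChartAt_source x₀, mem_baseSet_trivializationAt F A x₀⟩

variable {x₀ : M}

theorem fiberVec_fiberCoord {x : M} (hx : x ∈ chartNhd B F A x₀) (a : A x) :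
    fiberVec F A x₀ x (fiberCoord F A x₀ x a) = a :=
  (trivializationAt F A x₀).symmₗ_linearMapAt hx.2 a

theorem fiberCoord_fiberVec {x : M} (hx : x ∈ chartNhd B F A x₀) (v : F) :
    fiberCoord F A x₀ x (fiberVec F A x₀ x v) = v :=
  (trivializationAt F A x₀).linearMapAt_symmₗ hx.2 v

theorem fiberCoord_injective {x : M} (hx : x ∈ chartNhd B F A x₀) {a b : A x}
    (h : fiberCoord F A x₀ x a = fiberCoord F A x₀ x b) : a = b := by
  rw [← fiberVec_fiberCoord hx a, h, fiberVec_fiberCoord hx]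

/-- The chart of the total space at a zero vector contains entire fibres; only the base point
restricts it. Paths inside a fibre therefore never leave the chart. -/
theorem mem_bundleChart_source {a : TotalSpace F A} :
    a ∈ (extChartAt 𝓙 (zeroSection F A x₀)).source ↔ a.proj ∈ chartNhd B F A x₀ := by
  rw [FiberBundle.extChartAt, PartialEquiv.trans_source]
  simp only [zeroSection, Trivialization.source_eq, PartialEquiv.prod_source,
    PartialEquiv.refl_source, mem_inter_iff, mem_preimage, mem_prod, mem_univ, and_true, chartNhd]
  constructor
  · rintro ⟨h1, h2⟩
    refine ⟨?_, h1⟩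
    have : ((trivializationAt F A x₀) a).1 = a.proj := (trivializationAt F A x₀).coe_fst' h1
    rwa [← this]
  · rintro ⟨h1, h2⟩
    refine ⟨h2, ?_⟩
    have : ((trivializationAt F A x₀) a).1 = a.proj := (trivializationAt F A x₀).coe_fst' h2
    rwa [← this] at h1

theorem bundleChart_apply {a : TotalSpace F A} (ha : a.proj ∈ chartNhd B F A x₀) :
    extChartAt 𝓙 (zeroSection F A x₀) a
      = (extChartAt 𝓘(ℝ, B) x₀ a.proj, fiberCoord F A x₀ a.proj a.2) := by
  rw [FiberBundle.extChartAt, PartialEquiv.trans_apply]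
  have h1 : ((trivializationAt F A x₀) a).1 = a.proj := (trivializationAt F A x₀).coe_fst' ha.2
  have h2 : fiberCoord F A x₀ a.proj a.2 = ((trivializationAt F A x₀) a).2 :=
    congrFun ((trivializationAt F A x₀).coe_linearMapAt_of_mem ha.2) a.2
  rw [h2, ← h1]
  rfl

theorem mem_bundleChart_target {z : B × F} :
    z ∈ (extChartAt 𝓙 (zeroSection F A x₀)).target ↔
      z.1 ∈ (extChartAt 𝓘(ℝ, B) x₀).target ∧
        (extChartAt 𝓘(ℝ, B) x₀).symm z.1 ∈ chartNhd B F A x₀ := by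
  rw [FiberBundle.extChartAt_target]
  simp only [zeroSection, mem_prod, mem_inter_iff, mem_preimage, mem_univ, and_true, chartNhd]
  exact ⟨fun h => ⟨h.1, (extChartAt 𝓘(ℝ, B) x₀).map_target h.1, h.2⟩, fun h => ⟨h.1, h.2.2⟩⟩

theorem bundleChart_symm_apply {y : B} (hy : y ∈ (extChartAt 𝓘(ℝ, B) x₀).target)
    (hy' : (extChartAt 𝓘(ℝ, B) x₀).symm y ∈ chartNhd B F A x₀) (v : F) :
    (extChartAt 𝓙 (zeroSection F A x₀)).symm (y, v)
      = ⟨(extChartAt 𝓘(ℝ, B) x₀).symm y, fiberVec F A x₀ _ v⟩ := by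
  refine ((PartialEquiv.eq_symm_apply _ (mem_bundleChart_source.2 hy')
    (mem_bundleChart_target.2 ⟨hy, hy'⟩)).2 ?_).symm
  rw [bundleChart_apply hy', fiberCoord_fiberVec hy', (extChartAt 𝓘(ℝ, B) x₀).right_inv hy]

theorem bundleChart_zeroSection {x : M} (hx : x ∈ chartNhd B F A x₀) :
    extChartAt 𝓙 (zeroSection F A x₀) (zeroSection F A x) = (extChartAt 𝓘(ℝ, B) x₀ x, 0) := by
  rw [bundleChart_apply (a := zeroSection F A x) hx]
  exact Prod.ext rfl (map_zero (fiberCoord F A x₀ x))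

theorem chartVec_mfderiv_proj {a : TotalSpace F A} (ha : a.proj ∈ chartNhd B F A x₀)
    (v : TangentSpace 𝓙 a) :
    chartVec 𝓘(ℝ, B) x₀ ⟨a.proj, mfderiv 𝓙 𝓘(ℝ, B) (TotalSpace.proj : TotalSpace F A → M) a v⟩
      = (chartVec 𝓙 (zeroSection F A x₀) ⟨a, v⟩).1 := by
  refine (hasMFDerivAt_of_chart (J := 𝓘(ℝ, B)) (J' := 𝓙)
    (f := (TotalSpace.proj : TotalSpace F A → M)) (y₀ := x₀)
    (x₀ := zeroSection F A x₀) (g := Prod.fst) (g' := ContinuousLinearMap.fst ℝ B F)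
    (mem_bundleChart_source.2 ha) hasFDerivAt_fst ?_ ?_).2 v
  · rw [bundleChart_apply ha]
    exact (extChartAt 𝓘(ℝ, B) x₀).map_source ha.1
  · filter_upwards [(FiberBundle.continuous_proj F A).continuousAt.preimage_mem_nhds
      ((isOpen_chartNhd x₀).mem_nhds ha)] with b hb
    rw [bundleChart_apply hb, (extChartAt 𝓘(ℝ, B) x₀).left_inv hb.1]

theorem contMDiffAt_fiberCoord {E' : Type*} [NormedAddCommGroup E'] [NormedSpace ℝ E']
    {H' : Type*} [TopologicalSpace H'] {I' : ModelWithCorners ℝ E' H'}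
    {P : Type*} [TopologicalSpace P] [ChartedSpace H' P] {g : P → TotalSpace F A} {p : P}
    (hg : ContMDiffAt I' 𝓙 ∞ g p) (hp : (g p).proj ∈ chartNhd B F A x₀) :
    ContMDiffAt I' 𝓘(ℝ, F) ∞ (fun q => fiberCoord F A x₀ (g q).proj (g q).2) p := by
  have h1 : ContMDiffAt 𝓙 𝓙 ∞ (trivializationAt F A x₀) (g p) :=
    (Trivialization.contMDiffOn (IB := 𝓘(ℝ, B)) (trivializationAt F A x₀)).contMDiffAt
      ((trivializationAt F A x₀).open_source.mem_nhds
        ((trivializationAt F A x₀).mem_source.2 hp.2))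
  refine ((h1.comp p hg).snd).congr_of_eventuallyEq ?_
  have hc : ContinuousAt (fun y => (g y).proj) p :=
    (FiberBundle.continuous_proj F A).continuousAt.comp hg.continuousAt
  filter_upwards [hc ((isOpen_chartNhd x₀).mem_nhds hp)] with q hq
  exact congrFun ((trivializationAt F A x₀).coe_linearMapAt_of_mem hq.2) _

theorem contMDiffOn_fiberVec (v : F) : ContMDiffOn 𝓘(ℝ, B) 𝓙 ∞
    (fun x => (⟨x, fiberVec F A x₀ x v⟩ : TotalSpace F A)) (chartNhd B F A x₀) := by
  have h := (trivializationAt F A x₀).contMDiffOn_section_baseSet_iff (IB := 𝓘(ℝ, B)) (n := ∞)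
    (s := fun x => fiberVec F A x₀ x v)
  refine ContMDiffOn.mono (h.2 ?_) inter_subset_right
  refine (contMDiffOn_const (c := v)).congr fun x hx => ?_
  have h1 := congrFun ((trivializationAt F A x₀).coe_linearMapAt_of_mem (R := ℝ) hx)
    (fiberVec F A x₀ x v)
  exact h1.symm.trans ((trivializationAt F A x₀).linearMapAt_symmₗ hx v)

end BundleChart

/-! ### Bump functions and sections with prescribed coordinates -/

section AdaptedBump

set_option linter.unusedSectionVars false

variable {B : Type*} [NormedAddCommGroup B] [NormedSpace ℝ B]
  {M : Type*} [TopologicalSpace M] [ChartedSpace B M] [IsManifold 𝓘(ℝ, B) ∞ M]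
  {F : Type*} [NormedAddCommGroup F] [NormedSpace ℝ F]
  {A : M → Type*} [TopologicalSpace (TotalSpace F A)]
  [∀ x, TopologicalSpace (A x)] [FiberBundle F A]
  [∀ x, AddCommGroup (A x)] [∀ x, Module ℝ (A x)] [VectorBundle ℝ F A]
  [ContMDiffVectorBundle ∞ F A 𝓘(ℝ, B)]

local notation "𝓙" => ModelWithCorners.prod 𝓘(ℝ, B) 𝓘(ℝ, F)

variable (B F A) in
/-- A bump function supported in the domain of the standard chart at `x₀` and equal to one on the
neighbourhood `O` of `x₀`. -/
structure AdaptedBump (x₀ : M) where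
  toFun : M → ℝ
  O : Set M
  smooth : ContMDiff 𝓘(ℝ, B) 𝓘(ℝ, ℝ) ∞ toFun
  tsupport_subset : tsupport toFun ⊆ chartNhd B F A x₀
  isOpen_O : IsOpen O
  mem_O : x₀ ∈ O
  eq_one : ∀ x ∈ O, toFun x = 1

theorem nonempty_adaptedBump [FiniteDimensional ℝ B] [T2Space M] (x₀ : M) :
    Nonempty (AdaptedBump B F A x₀) := by
  obtain ⟨f, -, hf⟩ := (SmoothBumpFunction.nhds_basis_tsupport (I := 𝓘(ℝ, B)) x₀).mem_iff.1
    ((isOpen_chartNhd (B := B) (F := F) (A := A) x₀).mem_nhds (mem_chartNhd x₀))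
  obtain ⟨O, hO, hOo, hx⟩ := eventually_nhds_iff.1 f.eventuallyEq_one
  exact ⟨⟨f, O, f.contMDiff, hf, hOo, hx, hO⟩⟩

namespace AdaptedBump

variable {x₀ : M} (χ : AdaptedBump B F A x₀)

theorem O_subset : χ.O ⊆ chartNhd B F A x₀ := fun x hx =>
  χ.tsupport_subset (subset_tsupport _ (by simp [χ.eq_one x hx]))

/-- The domain of coordinates in the model space. -/
def U : Set B := (extChartAt 𝓘(ℝ, B) x₀).target ∩ (extChartAt 𝓘(ℝ, B) x₀).symm ⁻¹' χ.O

theorem isOpen_U : IsOpen χ.U :=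
  (continuousOn_extChartAt_symm x₀).isOpen_inter_preimage (isOpen_extChartAt_target x₀) χ.isOpen_O

theorem mem_target {y : B} (hy : y ∈ χ.U) : y ∈ (extChartAt 𝓘(ℝ, B) x₀).target := hy.1

theorem symm_mem_O {y : B} (hy : y ∈ χ.U) : (extChartAt 𝓘(ℝ, B) x₀).symm y ∈ χ.O := hy.2

theorem chart_mem_U {x : M} (hx : x ∈ χ.O) : extChartAt 𝓘(ℝ, B) x₀ x ∈ χ.U := by
  refine ⟨(extChartAt 𝓘(ℝ, B) x₀).map_source (χ.O_subset hx).1, ?_⟩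
  rw [mem_preimage, (extChartAt 𝓘(ℝ, B) x₀).left_inv (χ.O_subset hx).1]
  exact hx

theorem symm_chart {x : M} (hx : x ∈ χ.O) :
    (extChartAt 𝓘(ℝ, B) x₀).symm (extChartAt 𝓘(ℝ, B) x₀ x) = x :=
  (extChartAt 𝓘(ℝ, B) x₀).left_inv (χ.O_subset hx).1

theorem chart_symm {y : B} (hy : y ∈ χ.U) :
    extChartAt 𝓘(ℝ, B) x₀ ((extChartAt 𝓘(ℝ, B) x₀).symm y) = y :=
  (extChartAt 𝓘(ℝ, B) x₀).right_inv hy.1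

/-- Products with the bump function of locally defined smooth functions are smooth. -/
theorem contMDiff_mul {g : M → ℝ}
    (hg : ContMDiffOn 𝓘(ℝ, B) 𝓘(ℝ, ℝ) ∞ g (chartNhd B F A x₀)) :
    ContMDiff 𝓘(ℝ, B) 𝓘(ℝ, ℝ) ∞ (fun x => χ.toFun x * g x) := by
  refine contMDiff_of_tsupport fun x hx => ?_
  have hx' : x ∈ chartNhd B F A x₀ := χ.tsupport_subset (tsupport_mul_subset_left hx)
  exact χ.smooth.contMDiffAt.mul (hg.contMDiffAt ((isOpen_chartNhd x₀).mem_nhds hx'))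

/-- The section with constant coordinates `v` on the neighbourhood `O` of `x₀`. -/
noncomputable def constSection : F →ₗ[ℝ] Cₛ^∞⟮𝓘(ℝ, B); F, A⟯ where
  toFun v := ⟨fun x => χ.toFun x • fiberVec F A x₀ x v,
    ContMDiffOn.smul_section_of_tsupport χ.smooth.contMDiffOn (isOpen_chartNhd x₀)
      χ.tsupport_subset (contMDiffOn_fiberVec v)⟩
  map_add' v w := by ext x; simp [ContMDiffSection.coe_add]
  map_smul' r v := by
    ext x
    change χ.toFun x • fiberVec F A x₀ x (r • v) = r • (χ.toFun x • fiberVec F A x₀ x v)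
    rw [map_smul, smul_comm]

theorem constSection_apply (v : F) (x : M) :
    χ.constSection v x = χ.toFun x • fiberVec F A x₀ x v := rfl

theorem constSection_of_mem {x : M} (hx : x ∈ χ.O) (v : F) :
    χ.constSection v x = fiberVec F A x₀ x v := by
  rw [constSection_apply, χ.eq_one x hx, one_smul]

/-- The coordinates of a section. -/
noncomputable def sectionCoord (_ : AdaptedBump B F A x₀) (α : Cₛ^∞⟮𝓘(ℝ, B); F, A⟯) (y : B) : F :=
  fiberCoord F A x₀ ((extChartAt 𝓘(ℝ, B) x₀).symm y) (α ((extChartAt 𝓘(ℝ, B) x₀).symm y))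

theorem fiberCoord_contMDiffOn (α : Cₛ^∞⟮𝓘(ℝ, B); F, A⟯) :
    ContMDiffOn 𝓘(ℝ, B) 𝓘(ℝ, F) ∞ (fun x => fiberCoord F A x₀ x (α x)) (chartNhd B F A x₀) :=
  fun _ hx => (contMDiffAt_fiberCoord (g := fun x => (⟨x, α x⟩ : TotalSpace F A))
    α.contMDiff.contMDiffAt hx).contMDiffWithinAt

theorem sectionCoord_contDiffOn (α : Cₛ^∞⟮𝓘(ℝ, B); F, A⟯) :
    ContDiffOn ℝ ∞ (χ.sectionCoord α) χ.U := fun _ hy =>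
  (contDiffAt_comp_chart_symm (f := fun x => fiberCoord F A x₀ x (α x)) (χ.mem_target hy)
    ((fiberCoord_contMDiffOn α).contMDiffAt ((isOpen_chartNhd x₀).mem_nhds
      (χ.O_subset (χ.symm_mem_O hy))))).contDiffWithinAt

theorem sectionCoord_differentiableAt (α : Cₛ^∞⟮𝓘(ℝ, B); F, A⟯) {y : B} (hy : y ∈ χ.U) :
    DifferentiableAt ℝ (χ.sectionCoord α) y :=
  ((χ.sectionCoord_contDiffOn α).contDiffAt (χ.isOpen_U.mem_nhds hy)).differentiableAt (by simp)

theorem sectionCoord_constSection {y : B} (hy : y ∈ χ.U) (v : F) :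
    χ.sectionCoord (χ.constSection v) y = v := by
  rw [sectionCoord, χ.constSection_of_mem (χ.symm_mem_O hy),
    fiberCoord_fiberVec (χ.O_subset (χ.symm_mem_O hy))]

theorem sectionCoord_add (α β : Cₛ^∞⟮𝓘(ℝ, B); F, A⟯) (y : B) :
    χ.sectionCoord (α + β) y = χ.sectionCoord α y + χ.sectionCoord β y :=
  map_add (fiberCoord F A x₀ _) _ _

theorem sectionCoord_neg (α : Cₛ^∞⟮𝓘(ℝ, B); F, A⟯) (y : B) :
    χ.sectionCoord (-α) y = -χ.sectionCoord α y :=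
  map_neg (fiberCoord F A x₀ _) _

theorem sectionCoord_smul (r : ℝ) (α : Cₛ^∞⟮𝓘(ℝ, B); F, A⟯) (y : B) :
    χ.sectionCoord (r • α) y = r • χ.sectionCoord α y :=
  map_smul (fiberCoord F A x₀ _) _ _

theorem sectionCoord_chart (α : Cₛ^∞⟮𝓘(ℝ, B); F, A⟯) {x : M} (hx : x ∈ χ.O) :
    χ.sectionCoord α (extChartAt 𝓘(ℝ, B) x₀ x) = fiberCoord F A x₀ x (α x) := by
  rw [sectionCoord, χ.symm_chart hx]

end AdaptedBump

end AdaptedBump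

/-! ### A Lie algebroid in coordinates -/

section AlgebroidCoord

set_option linter.unusedSectionVars false

variable {B : Type*} [NormedAddCommGroup B] [NormedSpace ℝ B]
  {M : Type*} [TopologicalSpace M] [ChartedSpace B M] [IsManifold 𝓘(ℝ, B) ∞ M]
  {F : Type*} [NormedAddCommGroup F] [NormedSpace ℝ F]
  {A : M → Type*} [TopologicalSpace (TotalSpace F A)]
  [∀ x, TopologicalSpace (A x)] [FiberBundle F A]
  [∀ x, AddCommGroup (A x)] [∀ x, Module ℝ (A x)] [VectorBundle ℝ F A]
  [ContMDiffVectorBundle ∞ F A 𝓘(ℝ, B)]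

local notation "𝓙" => ModelWithCorners.prod 𝓘(ℝ, B) 𝓘(ℝ, F)

theorem ContMDiffSection.coe_sum_apply {ι : Type*} (s : Finset ι)
    (α : ι → Cₛ^∞⟮𝓘(ℝ, B); F, A⟯) (x : M) : (∑ i ∈ s, α i) x = ∑ i ∈ s, α i x := by
  have h := map_sum (ContMDiffSection.coeAddHom 𝓘(ℝ, B) F ∞ A) α s
  have h2 := congrFun h x
  rw [Finset.sum_apply] at h2
  exact h2

/-- The product of a smooth function and a smooth section. -/
noncomputable def ContMDiffSection.mulLeft (h : M → ℝ) (hh : ContMDiff 𝓘(ℝ, B) 𝓘(ℝ, ℝ) ∞ h)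
    (α : Cₛ^∞⟮𝓘(ℝ, B); F, A⟯) : Cₛ^∞⟮𝓘(ℝ, B); F, A⟯ :=
  ⟨fun x => h x • α x, hh.smul_section α.contMDiff⟩

theorem ContMDiffSection.mulLeft_apply {h : M → ℝ} (hh : ContMDiff 𝓘(ℝ, B) 𝓘(ℝ, ℝ) ∞ h)
    (α : Cₛ^∞⟮𝓘(ℝ, B); F, A⟯) (x : M) : ContMDiffSection.mulLeft h hh α x = h x • α x := rfl

theorem LieAlgebroid.bracket_swap (L : LieAlgebroid B F A) (α β : Cₛ^∞⟮𝓘(ℝ, B); F, A⟯) :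
    L.bracket α β = -L.bracket β α := by
  have h := L.bracket_self (α + β)
  rw [map_add, map_add, LinearMap.add_apply, LinearMap.add_apply, L.bracket_self,
    L.bracket_self, zero_add, add_zero, add_comm] at h
  exact eq_neg_of_add_eq_zero_left h

theorem dirDeriv_eq_zero_of_eventually_const {f : M → ℝ} {x : M} {r : ℝ}
    (h : ∀ᶠ y in 𝓝 x, f y = r) (v : TangentSpace 𝓘(ℝ, B) x) : dirDeriv f x v = 0 := by
  have h1 : HasMFDerivAt 𝓘(ℝ, B) 𝓘(ℝ, ℝ) f x 0 :=
    (hasMFDerivAt_const r x).congr_of_eventuallyEq h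
  rw [dirDeriv, h1.mfderiv]
  rfl

namespace AdaptedBump

variable {x₀ : M} (χ : AdaptedBump B F A x₀) [FiniteDimensional ℝ F] (L : LieAlgebroid B F A)

/-- The anchor in coordinates. -/
noncomputable def anchorCoord (_ : AdaptedBump B F A x₀) (L : LieAlgebroid B F A) (y : B) :
    F →L[ℝ] B :=
  LinearMap.toContinuousLinearMap
    { toFun := fun v => chartVec 𝓘(ℝ, B) x₀
        ⟨(extChartAt 𝓘(ℝ, B) x₀).symm y, L.anchor _ (fiberVec F A x₀ _ v)⟩
      map_add' := fun v w => by rw [map_add, map_add, chartVec_add]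
      map_smul' := fun r v => by rw [map_smul, map_smul, chartVec_smul, RingHom.id_apply] }

theorem anchorCoord_apply (y : B) (v : F) : χ.anchorCoord L y v = chartVec 𝓘(ℝ, B) x₀
    ⟨(extChartAt 𝓘(ℝ, B) x₀).symm y, L.anchor _ (fiberVec F A x₀ _ v)⟩ := rfl

theorem chartVec_anchor {x : M} (hx : x ∈ χ.O) (a : A x) :
    chartVec 𝓘(ℝ, B) x₀ ⟨x, L.anchor x a⟩
      = χ.anchorCoord L (extChartAt 𝓘(ℝ, B) x₀ x) (fiberCoord F A x₀ x a) := by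
  rw [anchorCoord_apply, χ.symm_chart hx, fiberVec_fiberCoord (χ.O_subset hx)]

theorem chartVec_anchor_symm {y : B} (hy : y ∈ χ.U)
    (a : A ((extChartAt 𝓘(ℝ, B) x₀).symm y)) :
    chartVec 𝓘(ℝ, B) x₀ ⟨(extChartAt 𝓘(ℝ, B) x₀).symm y, L.anchor _ a⟩
      = χ.anchorCoord L y (fiberCoord F A x₀ _ a) := by
  rw [χ.chartVec_anchor L (χ.symm_mem_O hy), χ.chart_symm hy]

theorem anchorCoord_contDiffOn : ContDiffOn ℝ ∞ (χ.anchorCoord L) χ.U := by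
  refine contDiffOn_clm_apply.2 fun v y hy => ContDiffAt.contDiffWithinAt ?_
  have h1 : ContMDiff 𝓘(ℝ, B) 𝓘(ℝ, B).tangent ∞
      (fun x => (⟨x, L.anchor x (χ.constSection v x)⟩ : TangentBundle 𝓘(ℝ, B) M)) :=
    L.anchor_smooth.comp (χ.constSection v).contMDiff
  have h2 := contDiffAt_comp_chart_symm (χ.mem_target hy) (chartVec_contMDiffAt (x₀ := x₀)
    (h1.contMDiffAt (x := (extChartAt 𝓘(ℝ, B) x₀).symm y)) (χ.O_subset (χ.symm_mem_O hy)).1)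
  refine h2.congr_of_eventuallyEq ?_
  filter_upwards [χ.isOpen_U.mem_nhds hy] with y' hy'
  rw [anchorCoord_apply, χ.constSection_of_mem (χ.symm_mem_O hy')]

/-- The bracket of sections with constant coordinates, in coordinates. -/
noncomputable def bracketCoord (y : B) : F →L[ℝ] F →L[ℝ] F :=
  LinearMap.toContinuousBilinearMap (LinearMap.mk₂ ℝ
    (fun v w => χ.sectionCoord (L.bracket (χ.constSection v) (χ.constSection w)) y)
    (fun v v' w => by rw [map_add, map_add, LinearMap.add_apply, sectionCoord_add])
    (fun r v w => by rw [map_smul, map_smul, LinearMap.smul_apply, sectionCoord_smul])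
    (fun v w w' => by rw [map_add, map_add, sectionCoord_add])
    (fun r v w => by rw [map_smul, map_smul, sectionCoord_smul]))

theorem bracketCoord_apply (y : B) (v w : F) : χ.bracketCoord L y v w
    = χ.sectionCoord (L.bracket (χ.constSection v) (χ.constSection w)) y := rfl

theorem bracketCoord_contDiffOn : ContDiffOn ℝ ∞ (χ.bracketCoord L) χ.U :=
  contDiffOn_clm_apply.2 fun _ => contDiffOn_clm_apply.2 fun _ => χ.sectionCoord_contDiffOn _

theorem bracketCoord_self (y : B) (v : F) : χ.bracketCoord L y v v = 0 := by
  rw [bracketCoord_apply, L.bracket_self]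
  exact map_zero (fiberCoord F A x₀ _)

theorem bracketCoord_swap (y : B) (v w : F) :
    χ.bracketCoord L y v w = -χ.bracketCoord L y w v := by
  rw [bracketCoord_apply, L.bracket_swap, sectionCoord_neg, bracketCoord_apply]

/-- The Leibniz rule: near the point `β` is a combination of constant sections with function
coefficients, and differentiating the coefficients along the anchor of `α` gives the second term.
The bracket is defined on global sections only, so the combination has to hold on all of `M`. -/
theorem sectionCoord_bracket_right (α β : Cₛ^∞⟮𝓘(ℝ, B); F, A⟯) {y : B} (hy : y ∈ χ.U) :
    χ.sectionCoord (L.bracket α β) y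
      = χ.sectionCoord (L.bracket α (χ.constSection (χ.sectionCoord β y))) y
        + fderiv ℝ (χ.sectionCoord β) y (χ.anchorCoord L y (χ.sectionCoord α y)) := by
  set x := (extChartAt 𝓘(ℝ, B) x₀).symm y with hx
  have hxO : x ∈ χ.O := χ.symm_mem_O hy
  have hOx : χ.O ∈ 𝓝 x := χ.isOpen_O.mem_nhds hxO
  let b := Module.finBasis ℝ F
  let ℓ : Fin (Module.finrank ℝ F) → F →L[ℝ] ℝ := fun j => LinearMap.toContinuousLinearMap (b.coord j)
  set g : Fin (Module.finrank ℝ F) → M → ℝ := fun j x =>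
    χ.toFun x * ℓ j (fiberCoord F A x₀ x (β x)) with hg
  have hgs : ∀ j, ContMDiff 𝓘(ℝ, B) 𝓘(ℝ, ℝ) ∞ (g j) := fun j => χ.contMDiff_mul
    ((ℓ j).contDiff.contMDiff.comp_contMDiffOn (fiberCoord_contMDiffOn β))
  have hsum : ∀ v : F, ∑ j, ℓ j v • b j = v := fun v => b.sum_repr v
  have hff : ContMDiff 𝓘(ℝ, B) 𝓘(ℝ, ℝ) ∞ (fun x => χ.toFun x * χ.toFun x) :=
    χ.smooth.mul χ.smooth
  -- The square of the bump function appears because one factor makes the coefficients of `β` global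
  -- and the other makes the constant sections global.
  have hγ : ContMDiffSection.mulLeft _ hff β
      = ∑ j, ContMDiffSection.mulLeft (g j) (hgs j) (χ.constSection (b j)) := by
    ext z
    rw [ContMDiffSection.coe_sum_apply]
    simp only [ContMDiffSection.mulLeft_apply, constSection_apply]
    by_cases hz : z ∈ chartNhd B F A x₀
    · conv_lhs => rw [← fiberVec_fiberCoord hz (β z), ← hsum (fiberCoord F A x₀ z (β z))]
      rw [map_sum, Finset.smul_sum]
      refine Finset.sum_congr rfl fun j _ => ?_
      rw [map_smul, smul_smul, smul_smul]
      congr 1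
      simp only [hg]
      ring
    · have h0 : χ.toFun z = 0 := image_eq_zero_of_notMem_tsupport fun h => hz (χ.tsupport_subset h)
      simp [h0]
  -- The square is one near the point, so multiplication of `β` by it does not change the bracket
  -- there.
  have h1 : L.bracket α (ContMDiffSection.mulLeft _ hff β) x = L.bracket α β x := by
    rw [L.leibniz α β _ _ hff (fun z => ContMDiffSection.mulLeft_apply hff β z),
      dirDeriv_eq_zero_of_eventually_const (r := 1) (eventually_of_mem hOx fun z hz => by
        simp [χ.eq_one z hz]), χ.eq_one x hxO]
    simp
  have h2 : ∀ j, L.bracket α (ContMDiffSection.mulLeft (g j) (hgs j) (χ.constSection (b j))) x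
      = g j x • L.bracket α (χ.constSection (b j)) x
        + dirDeriv (g j) x (L.anchor x (α x)) • χ.constSection (b j) x := fun j =>
    L.leibniz α _ _ (g j) (hgs j) (fun z => rfl) x
  have h3 : ∀ j, dirDeriv (g j) x (L.anchor x (α x))
      = ℓ j (fderiv ℝ (χ.sectionCoord β) y (χ.anchorCoord L y (χ.sectionCoord α y))) := by
    intro j
    have hev : (fun z => g j ((extChartAt 𝓘(ℝ, B) x₀).symm z))
        =ᶠ[𝓝 y] fun z => ℓ j (χ.sectionCoord β z) := by
      filter_upwards [χ.isOpen_U.mem_nhds hy] with z hz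
      simp only [hg, χ.eq_one _ (χ.symm_mem_O hz), one_mul]
      rfl
    have hd := (ℓ j).hasFDerivAt.comp y (χ.sectionCoord_differentiableAt β hy).hasFDerivAt
    have hd' := HasFDerivAt.congr_of_eventuallyEq hd hev
    have hxy : extChartAt 𝓘(ℝ, B) x₀ x = y := χ.chart_symm hy
    rw [dirDeriv_eq_fderiv (χ.O_subset hxO).1 (by rw [hxy]; exact hd'.differentiableAt), hxy,
      hd'.fderiv, χ.chartVec_anchor L hxO, hxy]
    rfl
  have hgx : ∀ j, g j x = ℓ j (χ.sectionCoord β y) := fun j => by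
    simp only [hg, χ.eq_one x hxO, one_mul]
    rfl
  have h4 : L.bracket α β x = L.bracket α (χ.constSection (χ.sectionCoord β y)) x
      + fiberVec F A x₀ x
        (fderiv ℝ (χ.sectionCoord β) y (χ.anchorCoord L y (χ.sectionCoord α y))) := by
    rw [← h1, hγ, map_sum, ContMDiffSection.coe_sum_apply]
    simp only [h2, h3, hgx, Finset.sum_add_distrib]
    congr 1
    · conv_rhs => rw [← hsum (χ.sectionCoord β y), map_sum, map_sum, ContMDiffSection.coe_sum_apply]
      refine Finset.sum_congr rfl fun j _ => ?_
      rw [map_smul, map_smul]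
      rfl
    · conv_rhs => rw [← hsum (fderiv ℝ (χ.sectionCoord β) y
        (χ.anchorCoord L y (χ.sectionCoord α y))), map_sum]
      refine Finset.sum_congr rfl fun j _ => ?_
      rw [map_smul, χ.constSection_of_mem hxO]
  have h5 : χ.sectionCoord (L.bracket α β) y = fiberCoord F A x₀ x (L.bracket α β x) := rfl
  rw [h5, h4, map_add, fiberCoord_fiberVec (χ.O_subset hxO)]
  rfl

/-- The bracket in coordinates. -/
theorem sectionCoord_bracket (α β : Cₛ^∞⟮𝓘(ℝ, B); F, A⟯) {y : B} (hy : y ∈ χ.U) :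
    χ.sectionCoord (L.bracket α β) y
      = χ.bracketCoord L y (χ.sectionCoord α y) (χ.sectionCoord β y)
        + fderiv ℝ (χ.sectionCoord β) y (χ.anchorCoord L y (χ.sectionCoord α y))
        - fderiv ℝ (χ.sectionCoord α) y (χ.anchorCoord L y (χ.sectionCoord β y)) := by
  rw [χ.sectionCoord_bracket_right L α β hy, L.bracket_swap α, sectionCoord_neg,
    χ.sectionCoord_bracket_right L _ α hy, sectionCoord_constSection χ hy,
    ← bracketCoord_apply, χ.bracketCoord_swap L y (χ.sectionCoord β y)]
  abel

theorem fderiv_sectionCoord_constSection {y : B} (hy : y ∈ χ.U) (v : F) :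
    fderiv ℝ (χ.sectionCoord (χ.constSection v)) y = 0 := by
  have h : χ.sectionCoord (χ.constSection v) =ᶠ[𝓝 y] fun _ => v := by
    filter_upwards [χ.isOpen_U.mem_nhds hy] with z hz using χ.sectionCoord_constSection hz v
  rw [h.fderiv_eq]
  exact fderiv_const_apply v

end AdaptedBump

end AlgebroidCoord

/-! ### The local model of a Lie algebroid with a spray -/

section LocalModel

open scoped OperatorNorm

set_option linter.unusedSectionVars false

variable {B : Type*} [NormedAddCommGroup B] [NormedSpace ℝ B]
  {M : Type*} [TopologicalSpace M] [ChartedSpace B M] [IsManifold 𝓘(ℝ, B) ∞ M]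
  {F : Type*} [NormedAddCommGroup F] [NormedSpace ℝ F]
  {A : M → Type*} [TopologicalSpace (TotalSpace F A)]
  [∀ x, TopologicalSpace (A x)] [FiberBundle F A]
  [∀ x, AddCommGroup (A x)] [∀ x, Module ℝ (A x)] [VectorBundle ℝ F A]
  [ContMDiffVectorBundle ∞ F A 𝓘(ℝ, B)]

local notation "𝓙" => ModelWithCorners.prod 𝓘(ℝ, B) 𝓘(ℝ, F)

namespace AdaptedBump

variable {x₀ : M} (χ : AdaptedBump B F A x₀) [FiniteDimensional ℝ F] (L : LieAlgebroid B F A)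

theorem anchorCoord_hasFDerivAt {y : B} (hy : y ∈ χ.U) :
    HasFDerivAt (χ.anchorCoord L) (fderiv ℝ (χ.anchorCoord L) y) y :=
  (((χ.anchorCoord_contDiffOn L).contDiffAt (χ.isOpen_U.mem_nhds hy)).differentiableAt
    (by simp)).hasFDerivAt

theorem bracketCoord_hasFDerivAt {y : B} (hy : y ∈ χ.U) :
    HasFDerivAt (χ.bracketCoord L) (fderiv ℝ (χ.bracketCoord L) y) y :=
  (((χ.bracketCoord_contDiffOn L).contDiffAt (χ.isOpen_U.mem_nhds hy)).differentiableAt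
    (by simp)).hasFDerivAt

theorem sectionCoord_bracket_constSection (β : Cₛ^∞⟮𝓘(ℝ, B); F, A⟯) {y : B} (hy : y ∈ χ.U)
    (a : F) : χ.sectionCoord (L.bracket (χ.constSection a) β) y
      = χ.bracketCoord L y a (χ.sectionCoord β y)
        + fderiv ℝ (χ.sectionCoord β) y (χ.anchorCoord L y a) := by
  rw [χ.sectionCoord_bracket L _ _ hy, χ.fderiv_sectionCoord_constSection hy,
    χ.sectionCoord_constSection hy, zero_apply, sub_zero]

/-- The Jacobi identity for constant sections. The inner bracket is no longer constant, and the
derivatives of its coordinates give the three terms with `fderiv`. -/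
theorem bracketCoord_jacobi {y : B} (hy : y ∈ χ.U) (a b d : F) :
    χ.bracketCoord L y a (χ.bracketCoord L y b d)
      + χ.bracketCoord L y b (χ.bracketCoord L y d a)
      + χ.bracketCoord L y d (χ.bracketCoord L y a b)
      + fderiv ℝ (χ.bracketCoord L) y (χ.anchorCoord L y a) b d
      + fderiv ℝ (χ.bracketCoord L) y (χ.anchorCoord L y b) d a
      + fderiv ℝ (χ.bracketCoord L) y (χ.anchorCoord L y d) a b = 0 := by
  have key : ∀ a b d : F, χ.sectionCoord (L.bracket (χ.constSection a)
      (L.bracket (χ.constSection b) (χ.constSection d))) y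
      = χ.bracketCoord L y a (χ.bracketCoord L y b d)
        + fderiv ℝ (χ.bracketCoord L) y (χ.anchorCoord L y a) b d := by
    intro a b d
    rw [χ.sectionCoord_bracket_constSection L _ hy, ← bracketCoord_apply]
    have h : HasFDerivAt (χ.sectionCoord (L.bracket (χ.constSection b) (χ.constSection d))) _ y :=
      ((χ.bracketCoord_hasFDerivAt L hy).clm_apply (hasFDerivAt_const b y)).clm_apply
        (hasFDerivAt_const d y)
    rw [h.fderiv]
    simp
  have h := congrArg (fun s => χ.sectionCoord s y)
    (L.jacobi (χ.constSection a) (χ.constSection b) (χ.constSection d))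
  simp only [sectionCoord_add, key] at h
  have h0 : χ.sectionCoord (0 : Cₛ^∞⟮𝓘(ℝ, B); F, A⟯) y = 0 := map_zero (fiberCoord F A x₀ _)
  rw [h0] at h
  rw [← h]
  abel

/-- The section with coordinates `z ↦ ℓ (z - y) • g`. -/
theorem exists_section_linear (ℓ : B →L[ℝ] ℝ) (y : B) (g : F) :
    ∃ γ : Cₛ^∞⟮𝓘(ℝ, B); F, A⟯, ∀ z ∈ χ.U, χ.sectionCoord γ z = ℓ (z - y) • g := by
  have hs : ContMDiff 𝓘(ℝ, B) 𝓘(ℝ, ℝ) ∞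
      (fun x => χ.toFun x * ℓ (extChartAt 𝓘(ℝ, B) x₀ x - y)) := by
    refine χ.contMDiff_mul ?_
    have h1 : ContDiff ℝ ∞ fun z : B => ℓ (z - y) := by fun_prop
    exact (h1.contMDiff.comp_contMDiffOn contMDiffOn_extChartAt).mono fun x hx => by
      rw [← extChartAt_source 𝓘(ℝ, B)]; exact hx.1
  refine ⟨ContMDiffSection.mulLeft _ hs (χ.constSection g), fun z hz => ?_⟩
  rw [sectionCoord, ContMDiffSection.mulLeft_apply, map_smul,
    χ.constSection_of_mem (χ.symm_mem_O hz), χ.eq_one _ (χ.symm_mem_O hz), χ.chart_symm hz,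
    fiberCoord_fiberVec (χ.O_subset (χ.symm_mem_O hz)), one_mul]

/-- The anchor is a morphism of Lie algebras, in coordinates. -/
theorem anchorCoord_morphism {y : B} (hy : y ∈ χ.U) (a b : F) :
    fderiv ℝ (χ.anchorCoord L) y (χ.anchorCoord L y a) b
      - fderiv ℝ (χ.anchorCoord L) y (χ.anchorCoord L y b) a
      = χ.anchorCoord L y (χ.bracketCoord L y a b) := by
  rcases subsingleton_or_nontrivial F with hF | hF
  · rw [Subsingleton.elim a 0, Subsingleton.elim b 0]
    simp
  -- Compatibility of the anchor with brackets is not an axiom; it follows from the Jacobi identity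
  -- and the Leibniz rule. If the defect were nonzero, some functional `ℓ` would detect it. The test
  -- section `ℓ (z - y) • g` vanishes at `y`, and in the Jacobi identity at `y` only `ℓ` of the
  -- defect times `g` survives.
  obtain ⟨g, hg⟩ := exists_ne (0 : F)
  rw [← sub_eq_zero]
  by_contra hne
  obtain ⟨ℓ, -, hℓ⟩ := exists_dual_vector ℝ _ (norm_ne_zero_iff.2 hne)
  have hℓ0 : ℓ (fderiv ℝ (χ.anchorCoord L) y (χ.anchorCoord L y a) b
      - fderiv ℝ (χ.anchorCoord L) y (χ.anchorCoord L y b) a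
      - χ.anchorCoord L y (χ.bracketCoord L y a b)) ≠ 0 := by
    rw [hℓ]; simpa using hne
  obtain ⟨γ, hγ⟩ := χ.exists_section_linear ℓ y g
  have hγd : ∀ z ∈ χ.U, fderiv ℝ (χ.sectionCoord γ) z = ℓ.smulRight g := by
    intro z hz
    have h1 : χ.sectionCoord γ =ᶠ[𝓝 z] fun z => ℓ (z - y) • g := by
      filter_upwards [χ.isOpen_U.mem_nhds hz] with z' hz' using hγ z' hz'
    have h2 : HasFDerivAt (fun z => ℓ (z - y) • g) (ℓ.smulRight g) z :=
      ((ℓ.hasFDerivAt.comp z ((hasFDerivAt_id z).sub_const y)).smul_const g).congr_fderiv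
        (by ext; simp)
    rw [h1.fderiv_eq, h2.fderiv]
  have hbr : ∀ b : F, ∀ z ∈ χ.U, χ.sectionCoord (L.bracket (χ.constSection b) γ) z
      = ℓ (z - y) • χ.bracketCoord L z b g + ℓ (χ.anchorCoord L z b) • g := by
    intro b z hz
    rw [χ.sectionCoord_bracket_constSection L _ hz, hγ z hz, hγd z hz, map_smul]
    rfl
  have hbrd : ∀ (b : F) (u : B),
      fderiv ℝ (χ.sectionCoord (L.bracket (χ.constSection b) γ)) y u
        = ℓ u • χ.bracketCoord L y b g + ℓ (fderiv ℝ (χ.anchorCoord L) y u b) • g := by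
    intro b u
    have h1 : χ.sectionCoord (L.bracket (χ.constSection b) γ) =ᶠ[𝓝 y]
        fun z => ℓ (z - y) • χ.bracketCoord L z b g + ℓ (χ.anchorCoord L z b) • g := by
      filter_upwards [χ.isOpen_U.mem_nhds hy] with z' hz' using hbr b z' hz'
    have h2 : HasFDerivAt (fun z => χ.bracketCoord L z b g) _ y :=
      ((χ.bracketCoord_hasFDerivAt L hy).clm_apply (hasFDerivAt_const b y)).clm_apply
        (hasFDerivAt_const g y)
    have h3 : HasFDerivAt (fun z => χ.anchorCoord L z b) _ y :=
      (χ.anchorCoord_hasFDerivAt L hy).clm_apply (hasFDerivAt_const b y)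
    have h4 : HasFDerivAt (fun z => ℓ (z - y)) (ℓ.comp (ContinuousLinearMap.id ℝ B)) y :=
      ℓ.hasFDerivAt.comp y ((hasFDerivAt_id y).sub_const y)
    have h5 := (h4.smul h2).add ((ℓ.hasFDerivAt.comp y h3).smul_const g)
    rw [h1.fderiv_eq]
    have h6 : HasFDerivAt
      (fun z => ℓ (z - y) • χ.bracketCoord L z b g + ℓ (χ.anchorCoord L z b) • g) _ y := h5
    rw [h6.fderiv]
    simp
  have hγy : χ.sectionCoord γ y = 0 := by rw [hγ y hy]; simp
  have key : ∀ a b : F, χ.sectionCoord (L.bracket (χ.constSection a)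
      (L.bracket (χ.constSection b) γ)) y
      = ℓ (χ.anchorCoord L y b) • χ.bracketCoord L y a g
        + (ℓ (χ.anchorCoord L y a) • χ.bracketCoord L y b g
        + ℓ (fderiv ℝ (χ.anchorCoord L) y (χ.anchorCoord L y a) b) • g) := by
    intro a b
    rw [χ.sectionCoord_bracket_constSection L _ hy, hbr b y hy, hbrd b]
    simp
  have h := congrArg (fun s => χ.sectionCoord s y)
    (L.jacobi (χ.constSection a) (χ.constSection b) γ)
  have h0 : χ.sectionCoord (0 : Cₛ^∞⟮𝓘(ℝ, B); F, A⟯) y = 0 := map_zero (fiberCoord F A x₀ _)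
  simp only [sectionCoord_add, h0] at h
  rw [L.bracket_swap γ (χ.constSection a), map_neg, sectionCoord_neg, key, key,
    L.bracket_swap γ (L.bracket _ _), sectionCoord_neg, χ.sectionCoord_bracket L _ _ hy, hγy,
    hγd y hy, ← bracketCoord_apply] at h
  simp only [map_zero, zero_add, sub_zero, ContinuousLinearMap.smulRight_apply] at h
  refine hℓ0 ?_
  have h7 : ℓ (fderiv ℝ (χ.anchorCoord L) y (χ.anchorCoord L y a) b
      - fderiv ℝ (χ.anchorCoord L) y (χ.anchorCoord L y b) a
      - χ.anchorCoord L y (χ.bracketCoord L y a b)) • g = 0 := by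
    rw [map_sub, map_sub, sub_smul, sub_smul, ← h]
    abel
  exact (smul_eq_zero.1 h7).resolve_right hg

end AdaptedBump

theorem chartVec_mfderiv_fiberScale {x₀ : M} {a : TotalSpace F A}
    (ha : a.proj ∈ chartNhd B F A x₀) (t : ℝ) (v : TangentSpace 𝓙 a) :
    MDifferentiableAt 𝓙 𝓙 (fiberScale t : TotalSpace F A → TotalSpace F A) a ∧
    chartVec 𝓙 (zeroSection F A x₀) ⟨fiberScale t a, mfderiv 𝓙 𝓙 (fiberScale t) a v⟩
      = ((chartVec 𝓙 (zeroSection F A x₀) ⟨a, v⟩).1,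
        t • (chartVec 𝓙 (zeroSection F A x₀) ⟨a, v⟩).2) := by
  have hg : HasFDerivAt (fun z : B × F => (z.1, t • z.2))
      ((ContinuousLinearMap.fst ℝ B F).prod (t • ContinuousLinearMap.snd ℝ B F))
      (extChartAt 𝓙 (zeroSection F A x₀) a) :=
    hasFDerivAt_fst.prodMk (hasFDerivAt_snd.const_smul t)
  have h := hasMFDerivAt_of_chart (J := 𝓙) (J' := 𝓙)
    (f := (fiberScale t : TotalSpace F A → TotalSpace F A)) (y₀ := zeroSection F A x₀)
    (mem_bundleChart_source.2 ha) hg ?_ ?_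
  · exact ⟨h.1, h.2 v⟩
  · rw [bundleChart_apply ha, mem_bundleChart_target]
    refine ⟨(extChartAt 𝓘(ℝ, B) x₀).map_source ha.1, ?_⟩
    rwa [(extChartAt 𝓘(ℝ, B) x₀).left_inv ha.1]
  · filter_upwards [(FiberBundle.continuous_proj F A).continuousAt.preimage_mem_nhds
      ((isOpen_chartNhd x₀).mem_nhds ha)] with b hb
    have hb' : (fiberScale t b).proj ∈ chartNhd B F A x₀ := hb
    rw [bundleChart_apply hb]
    have h1 : ((extChartAt 𝓘(ℝ, B) x₀ b.proj, t • fiberCoord F A x₀ b.proj b.2) : B × F)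
        = extChartAt 𝓙 (zeroSection F A x₀) (fiberScale t b) := by
      rw [bundleChart_apply hb']
      exact Prod.ext rfl (map_smul (fiberCoord F A x₀ b.proj) t b.2).symm
    change fiberScale t b = (extChartAt 𝓙 (zeroSection F A x₀)).symm
      (extChartAt 𝓘(ℝ, B) x₀ b.proj, t • fiberCoord F A x₀ b.proj b.2)
    rw [h1, (extChartAt 𝓙 (zeroSection F A x₀)).left_inv (mem_bundleChart_source.2 hb')]

namespace AdaptedBump

variable {x₀ : M} (χ : AdaptedBump B F A x₀) [FiniteDimensional ℝ F] {L : LieAlgebroid B F A}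

theorem mem_target_of_mem_U {z : B × F} (hz : z.1 ∈ χ.U) :
    z ∈ (extChartAt 𝓙 (zeroSection F A x₀)).target :=
  mem_bundleChart_target.2 ⟨hz.1, χ.O_subset (χ.symm_mem_O hz)⟩

theorem mem_source_of_mem_O {a : TotalSpace F A} (ha : a.proj ∈ χ.O) :
    a ∈ (extChartAt 𝓙 (zeroSection F A x₀)).source :=
  mem_bundleChart_source.2 (χ.O_subset ha)

/-- The fibre component of a spray, in coordinates. -/
noncomputable def sprayCoord (_ : AdaptedBump B F A x₀)
    (V : (a : TotalSpace F A) → TangentSpace 𝓙 a) (z : B × F) : F :=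
  (chartVec 𝓙 (zeroSection F A x₀)
    ⟨(extChartAt 𝓙 (zeroSection F A x₀)).symm z, V _⟩).2

theorem chartVec_spray {V : (a : TotalSpace F A) → TangentSpace 𝓙 a} (hV : L.IsSpray V)
    {a : TotalSpace F A} (ha : a.proj ∈ χ.O) :
    chartVec 𝓙 (zeroSection F A x₀) ⟨a, V a⟩
      = (χ.anchorCoord L (extChartAt 𝓙 (zeroSection F A x₀) a).1
          (extChartAt 𝓙 (zeroSection F A x₀) a).2,
        χ.sprayCoord V (extChartAt 𝓙 (zeroSection F A x₀) a)) := by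
  refine Prod.ext ?_ ?_
  · rw [← chartVec_mfderiv_proj (χ.O_subset ha), hV.lifts_anchor, χ.chartVec_anchor L ha,
      bundleChart_apply (χ.O_subset ha)]
  · rw [sprayCoord, (extChartAt 𝓙 (zeroSection F A x₀)).left_inv (χ.mem_source_of_mem_O ha)]

theorem sprayCoord_contDiffOn {V : (a : TotalSpace F A) → TangentSpace 𝓙 a} (hV : L.IsSpray V) :
    ContDiffOn ℝ ∞ (χ.sprayCoord V) (χ.U ×ˢ univ) := by
  rintro z ⟨hz, -⟩
  have hzt := χ.mem_target_of_mem_U hz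
  exact (contDiffAt_comp_chart_symm hzt (chartVec_contMDiffAt (x₀ := zeroSection F A x₀)
    (hV.smooth.contMDiffAt (x := (extChartAt 𝓙 (zeroSection F A x₀)).symm z))
    ((extChartAt 𝓙 (zeroSection F A x₀)).map_target hzt))).snd.contDiffWithinAt

theorem bundleChart_symm {y : B} (hy : y ∈ χ.U) (v : F) :
    (extChartAt 𝓙 (zeroSection F A x₀)).symm (y, v)
      = ⟨(extChartAt 𝓘(ℝ, B) x₀).symm y, fiberVec F A x₀ _ v⟩ :=
  bundleChart_symm_apply hy.1 (χ.O_subset (χ.symm_mem_O hy)) v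

theorem sprayCoord_homogeneous {V : (a : TotalSpace F A) → TangentSpace 𝓙 a} (hV : L.IsSpray V)
    {y : B} (hy : y ∈ χ.U) (t : ℝ) (v : F) :
    χ.sprayCoord V (y, t • v) = t ^ 2 • χ.sprayCoord V (y, v) := by
  have main : ∀ t : ℝ, t ≠ 0 → ∀ v : F,
      χ.sprayCoord V (y, t • v) = t ^ 2 • χ.sprayCoord V (y, v) := by
    intro t ht v
    set a : TotalSpace F A := (extChartAt 𝓙 (zeroSection F A x₀)).symm (y, v) with ha
    have hao : a.proj ∈ χ.O := by rw [ha, χ.bundleChart_symm hy]; exact χ.symm_mem_O hy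
    have hta : (extChartAt 𝓙 (zeroSection F A x₀)).symm (y, t • v) = fiberScale t a := by
      rw [ha, χ.bundleChart_symm hy, χ.bundleChart_symm hy, map_smul]
      rfl
    rw [sprayCoord, hta, hV.homogeneous t ht a, chartVec_smul,
      (chartVec_mfderiv_fiberScale (χ.O_subset hao) t (V a)).2, sprayCoord, ← ha]
    rw [Prod.smul_snd, smul_smul, sq]
  rcases eq_or_ne t 0 with rfl | ht
  -- Homogeneity is assumed for nonzero factors only. Applied with factor `2` at the zero vector it
  -- gives `S = 4 S`, hence `S = 0` there, which is the case of factor zero.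
  · have h2 := main 2 two_ne_zero 0
    rw [smul_zero] at h2
    have h3 : χ.sprayCoord V (y, 0) = 0 := by
      have h4 : (3 : ℝ) • χ.sprayCoord V (y, 0) = 0 := by
        have : (3 : ℝ) • χ.sprayCoord V (y, 0)
            = (2 : ℝ) ^ 2 • χ.sprayCoord V (y, 0) - χ.sprayCoord V (y, 0) := by module
        rw [this, ← h2, sub_self]
      exact (smul_eq_zero.1 h4).resolve_left (by norm_num)
    rw [zero_smul, h3]
    simp
  · exact main t ht v

/-- The local model of the spray. -/
noncomputable def sprayModel {V : (a : TotalSpace F A) → TangentSpace 𝓙 a} (hV : L.IsSpray V) :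
    SprayModel B F where
  U := χ.U
  ρ := χ.anchorCoord L
  S := χ.sprayCoord V
  c := χ.bracketCoord L
  isOpen_U := χ.isOpen_U
  ρ_smooth := χ.anchorCoord_contDiffOn L
  S_smooth := χ.sprayCoord_contDiffOn hV
  c_smooth := χ.bracketCoord_contDiffOn L
  homogeneous _ hy t v := χ.sprayCoord_homogeneous hV hy t v
  c_self y _ v := χ.bracketCoord_self L y v
  morphism _ hy a b := χ.anchorCoord_morphism L hy a b
  jacobi _ hy a b d := χ.bracketCoord_jacobi L hy a b d

theorem chartVec_eq_field {V : (a : TotalSpace F A) → TangentSpace 𝓙 a} (hV : L.IsSpray V)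
    {a : TotalSpace F A} (ha : a.proj ∈ χ.O) :
    chartVec 𝓙 (zeroSection F A x₀) ⟨a, V a⟩
      = (χ.sprayModel hV).field (extChartAt 𝓙 (zeroSection F A x₀) a) :=
  χ.chartVec_spray hV ha

end AdaptedBump

end LocalModel

/-! ### The local flow of a spray in coordinates -/

section FlowCoord

set_option linter.unusedSectionVars false

variable {B : Type*} [NormedAddCommGroup B] [NormedSpace ℝ B]
  {M : Type*} [TopologicalSpace M] [ChartedSpace B M] [IsManifold 𝓘(ℝ, B) ∞ M]
  {F : Type*} [NormedAddCommGroup F] [NormedSpace ℝ F]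
  {A : M → Type*} [TopologicalSpace (TotalSpace F A)]
  [∀ x, TopologicalSpace (A x)] [FiberBundle F A]
  [∀ x, AddCommGroup (A x)] [∀ x, Module ℝ (A x)] [VectorBundle ℝ F A]
  [ContMDiffVectorBundle ∞ F A 𝓘(ℝ, B)]

local notation "𝓙" => ModelWithCorners.prod 𝓘(ℝ, B) 𝓘(ℝ, F)

/-- The total space of a fibre bundle with Hausdorff base and fibre is Hausdorff. -/
theorem t2Space_totalSpace [T2Space M] : T2Space (TotalSpace F A) := by
  refine ⟨fun a b hab => ?_⟩
  by_cases h : a.proj = b.proj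
  · set e := trivializationAt F A a.proj
    have ha : a ∈ e.source := e.mem_source.2 (mem_baseSet_trivializationAt F A a.proj)
    have hb : b ∈ e.source := e.mem_source.2 (h ▸ mem_baseSet_trivializationAt F A a.proj)
    have hne : e a ≠ e b := fun he => hab (e.injOn ha hb he)
    obtain ⟨u, v, hu, hv, hau, hbv, huv⟩ := t2_separation hne
    refine ⟨e.source ∩ e ⁻¹' u, e.source ∩ e ⁻¹' v, e.toOpenPartialHomeomorph.isOpen_inter_preimage hu,
      e.toOpenPartialHomeomorph.isOpen_inter_preimage hv, ⟨ha, hau⟩, ⟨hb, hbv⟩, ?_⟩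
    exact (huv.preimage e).mono inter_subset_right inter_subset_right
  · obtain ⟨u, v, hu, hv, hau, hbv, huv⟩ := t2_separation h
    exact ⟨_, _, hu.preimage (FiberBundle.continuous_proj F A),
      hv.preimage (FiberBundle.continuous_proj F A), hau, hbv, huv.preimage _⟩

/-- Integral curves compute the local flow. -/
theorem localFlow_eq_of_integralCurve {EN : Type*} [NormedAddCommGroup EN] [NormedSpace ℝ EN]
    {HN : Type*} [TopologicalSpace HN] {J : ModelWithCorners ℝ EN HN} [J.Boundaryless]
    {N : Type*} [TopologicalSpace N] [ChartedSpace HN N] [IsManifold J ∞ N] [T2Space N]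
    [CompleteSpace EN] {V : (a : N) → TangentSpace J a}
    (hV : ContMDiff J J.tangent ∞ (fun a => (⟨a, V a⟩ : TangentBundle J N)))
    {γ : ℝ → N} {r : ℝ} (hγ : IsMIntegralCurveOn γ V (Ioo (-r) r)) {t : ℝ} (ht : t ∈ Ioo (-r) r) :
    (t, γ 0) ∈ flowDomain V ∧ localFlow V t (γ 0) = γ t := by
  have hr : (0 : ℝ) ∈ Ioo (-r) r := ⟨by linarith [ht.1, ht.2], by linarith [ht.1, ht.2]⟩
  have hsub : uIcc 0 t ⊆ Ioo (-r) r := ordConnected_Ioo.uIcc_subset hr ht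
  have hmem : (t, γ 0) ∈ flowDomain V :=
    ⟨γ, rfl, fun s hs => hγ.isMIntegralCurveAt (isOpen_Ioo.mem_nhds (hsub hs))⟩
  refine ⟨hmem, ?_⟩
  rw [localFlow, dif_pos hmem]
  obtain ⟨h0, h1⟩ := hmem.choose_spec
  set δ := hmem.choose
  -- The curve chosen in `localFlow` is an integral curve near each point of a closed segment. By
  -- compactness this persists on a slightly larger open interval, where uniqueness of integral
  -- curves applies.
  have hopen : IsOpen {s | IsMIntegralCurveAt δ V s} := isOpen_iff_mem_nhds.2 fun s hs =>
    (eventually_eventually_nhds.2 hs : ∀ᶠ s' in 𝓝 s, IsMIntegralCurveAt δ V s')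
  obtain ⟨ε, hε, hεs⟩ := isCompact_uIcc.exists_thickening_subset_open hopen h1
  have hε' : Ioo (min 0 t - ε) (max 0 t + ε) ⊆ {s | IsMIntegralCurveAt δ V s} := by
    refine Subset.trans (fun s hs => ?_) hεs
    rw [Metric.mem_thickening_iff]
    rcases lt_or_ge s (min 0 t) with h | h
    · exact ⟨min 0 t, ⟨le_rfl, min_le_max⟩, by
        rw [Real.dist_eq, abs_sub_comm, abs_of_pos (sub_pos.2 h)]; linarith [hs.1]⟩
    · rcases lt_or_ge (max 0 t) s with h' | h'
      · exact ⟨max 0 t, ⟨min_le_max, le_rfl⟩, by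
          rw [Real.dist_eq, abs_of_pos (sub_pos.2 h')]; linarith [hs.2]⟩
      · exact ⟨s, ⟨h, h'⟩, by rw [dist_self]; exact hε⟩
  set l := max (-r) (min 0 t - ε)
  set u := min r (max 0 t + ε)
  have hlu : ∀ s ∈ uIcc 0 t, s ∈ Ioo l u := fun s hs =>
    ⟨max_lt (hsub hs).1 (by linarith [hs.1]), lt_min (hsub hs).2 (by linarith [hs.2])⟩
  have h2 : IsMIntegralCurveOn γ V (Ioo l u) :=
    hγ.mono (Ioo_subset_Ioo (le_max_left _ _) (min_le_left _ _))
  have h3 : IsMIntegralCurveOn δ V (Ioo l u) := fun s hs =>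
    (hε' (Ioo_subset_Ioo (le_max_right _ _) (min_le_right _ _) hs)).hasMFDerivAt.hasMFDerivWithinAt
  exact isMIntegralCurveOn_Ioo_eqOn_of_contMDiff_boundaryless (hlu 0 left_mem_uIcc)
    (hV.of_le (by simp)) h3 h2 h0 (hlu t right_mem_uIcc)

namespace AdaptedBump

variable [FiniteDimensional ℝ F] {x₀ : M} (χ : AdaptedBump B F A x₀)

/-- The point with given coordinates. -/
noncomputable def pt (_ : AdaptedBump B F A x₀) (z : B × F) : TotalSpace F A :=
  (extChartAt 𝓙 (zeroSection F A x₀)).symm z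

theorem pt_eq {y : B} (hy : y ∈ χ.U) (v : F) :
    χ.pt (y, v) = ⟨(extChartAt 𝓘(ℝ, B) x₀).symm y, fiberVec F A x₀ _ v⟩ :=
  χ.bundleChart_symm hy v

theorem pt_proj {z : B × F} (hz : z.1 ∈ χ.U) :
    (χ.pt z).proj = (extChartAt 𝓘(ℝ, B) x₀).symm z.1 := by
  obtain ⟨y, v⟩ := z
  rw [χ.pt_eq hz]

theorem pt_proj_mem_O {z : B × F} (hz : z.1 ∈ χ.U) : (χ.pt z).proj ∈ χ.O := by
  rw [χ.pt_proj hz]; exact χ.symm_mem_O hz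

theorem chart_pt_proj {z : B × F} (hz : z.1 ∈ χ.U) :
    extChartAt 𝓘(ℝ, B) x₀ (χ.pt z).proj = z.1 := by
  rw [χ.pt_proj hz, χ.chart_symm hz]

theorem pt_mem_source {z : B × F} (hz : z.1 ∈ χ.U) :
    χ.pt z ∈ (extChartAt 𝓙 (zeroSection F A x₀)).source :=
  χ.mem_source_of_mem_O (χ.pt_proj_mem_O hz)

theorem chart_pt {z : B × F} (hz : z.1 ∈ χ.U) :
    extChartAt 𝓙 (zeroSection F A x₀) (χ.pt z) = z :=
  (extChartAt 𝓙 (zeroSection F A x₀)).right_inv (χ.mem_target_of_mem_U hz)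

theorem fiberCoord_pt {z : B × F} (hz : z.1 ∈ χ.U) :
    fiberCoord F A x₀ (χ.pt z).proj (χ.pt z).2 = z.2 := by
  have h := bundleChart_apply (a := χ.pt z) (χ.O_subset (χ.pt_proj_mem_O hz))
  rw [χ.chart_pt hz] at h
  exact (congrArg Prod.snd h).symm

theorem pt_chart {a : TotalSpace F A} (ha : a.proj ∈ χ.O) :
    χ.pt (extChartAt 𝓙 (zeroSection F A x₀) a) = a :=
  (extChartAt 𝓙 (zeroSection F A x₀)).left_inv (χ.mem_source_of_mem_O ha)

theorem pt_injective {z z' : B × F} (hz : z.1 ∈ χ.U) (hz' : z'.1 ∈ χ.U) (h : χ.pt z = χ.pt z') :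
    z = z' := by
  rw [← χ.chart_pt hz, h, χ.chart_pt hz']

/-- Elements of the fibre of a point with given coordinates. -/
theorem eq_pt_of_proj_eq {a : TotalSpace F A} {y : B} (hy : y ∈ χ.U)
    (h : a.proj = (extChartAt 𝓘(ℝ, B) x₀).symm y) :
    a = χ.pt (y, fiberCoord F A x₀ a.proj a.2) := by
  have ha : a.proj ∈ χ.O := h ▸ χ.symm_mem_O hy
  have h1 := χ.pt_chart ha
  rw [bundleChart_apply (χ.O_subset ha)] at h1
  rw [← χ.chart_symm hy, ← h, h1]

theorem pt_proj_eq_iff {z : B × F} {y : B} (hz : z.1 ∈ χ.U) (hy : y ∈ χ.U) :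
    (χ.pt z).proj = (extChartAt 𝓘(ℝ, B) x₀).symm y ↔ z.1 = y := by
  rw [χ.pt_proj hz]
  refine ⟨fun h => ?_, fun h => by rw [h]⟩
  rw [← χ.chart_symm hz, h, χ.chart_symm hy]

theorem pt_zero {y : B} (hy : y ∈ χ.U) :
    χ.pt (y, 0) = zeroSection F A ((extChartAt 𝓘(ℝ, B) x₀).symm y) := by
  rw [χ.pt_eq hy, map_zero]
  rfl

theorem pt_smul {y : B} (hy : y ∈ χ.U) (t : ℝ) (v : F) :
    χ.pt (y, t • v) = fiberScale t (χ.pt (y, v)) := by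
  rw [χ.pt_eq hy, χ.pt_eq hy, map_smul]
  rfl

/-- The coordinates of the origin of the fibre over `x₀`. -/
theorem base_mem_U : extChartAt 𝓘(ℝ, B) x₀ x₀ ∈ χ.U := χ.chart_mem_U χ.mem_O

theorem pt_base : χ.pt (extChartAt 𝓘(ℝ, B) x₀ x₀, 0) = zeroSection F A x₀ := by
  rw [χ.pt_zero χ.base_mem_U, χ.symm_chart χ.mem_O]

theorem pt_contMDiffAt {z : B × F} (hz : z.1 ∈ χ.U) : ContMDiffAt 𝓘(ℝ, B × F) 𝓙 ∞ χ.pt z :=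
  (contMDiffOn_extChartAt_symm (zeroSection F A x₀)).contMDiffAt
    ((isOpen_extChartAt_target (zeroSection F A x₀)).mem_nhds (χ.mem_target_of_mem_U hz))

theorem chart_contMDiffAt {a : TotalSpace F A} (ha : a.proj ∈ χ.O) :
    ContMDiffAt 𝓙 𝓘(ℝ, B × F) ∞ (extChartAt 𝓙 (zeroSection F A x₀)) a :=
  contMDiffOn_extChartAt.contMDiffAt
    ((chartAt _ (zeroSection F A x₀)).open_source.mem_nhds (by
      have := χ.mem_source_of_mem_O ha
      rwa [extChartAt_source] at this))

theorem eventually_mem_O {a : TotalSpace F A} (ha : a.proj ∈ χ.O) :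
    ∀ᶠ b : TotalSpace F A in 𝓝 a, b.proj ∈ χ.O :=
  (FiberBundle.continuous_proj F A).continuousAt.preimage_mem_nhds (χ.isOpen_O.mem_nhds ha)

theorem tendsto_bundleChart (x₀ : M) : Tendsto (extChartAt 𝓙 (zeroSection F A x₀)) (𝓝 (zeroSection F A x₀))
    (𝓝 (extChartAt 𝓘(ℝ, B) x₀ x₀, 0)) := by
  have h := continuousAt_extChartAt (I := 𝓙) (zeroSection F A x₀)
  rwa [ContinuousAt, bundleChart_zeroSection (mem_chartNhd x₀)] at h

theorem eventually_of_eventually_pt {Q : TotalSpace F A → Prop}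
    (h : ∀ᶠ z in 𝓝 ((extChartAt 𝓘(ℝ, B) x₀ x₀, 0) : B × F), Q (χ.pt z)) :
    ∀ᶠ a in 𝓝 (zeroSection F A x₀), Q a := by
  filter_upwards [(tendsto_bundleChart x₀).eventually h,
    χ.eventually_mem_O (a := zeroSection F A x₀) χ.mem_O] with a ha hO
  rwa [χ.pt_chart hO] at ha

theorem eventually_of_eventually_pt₂ {Q : TotalSpace F A × TotalSpace F A → Prop}
    (h : ∀ᶠ z in 𝓝 (((extChartAt 𝓘(ℝ, B) x₀ x₀, 0) : B × F),
      ((extChartAt 𝓘(ℝ, B) x₀ x₀, 0) : B × F)), Q (χ.pt z.1, χ.pt z.2)) :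
    ∀ᶠ p in 𝓝 (zeroSection F A x₀, zeroSection F A x₀), Q p := by
  rw [nhds_prod_eq] at h ⊢
  have hO := χ.eventually_mem_O (a := zeroSection F A x₀) χ.mem_O
  filter_upwards [((tendsto_bundleChart x₀).prodMap (tendsto_bundleChart x₀)).eventually h, hO.prod_mk hO] with p hp hp'
  simp only [Prod.map_apply', χ.pt_chart hp'.1, χ.pt_chart hp'.2] at hp
  exact hp

theorem eventually_of_eventually_pt₃ {Q : TotalSpace F A × TotalSpace F A × TotalSpace F A → Prop}
    (h : ∀ᶠ z in 𝓝 (((extChartAt 𝓘(ℝ, B) x₀ x₀, 0) : B × F),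
      ((extChartAt 𝓘(ℝ, B) x₀ x₀, 0) : B × F), ((extChartAt 𝓘(ℝ, B) x₀ x₀, 0) : B × F)),
      Q (χ.pt z.1, χ.pt z.2.1, χ.pt z.2.2)) :
    ∀ᶠ p in 𝓝 (zeroSection F A x₀, zeroSection F A x₀, zeroSection F A x₀), Q p := by
  have hz : ∀ z : B × F, 𝓝 (z, z, z) = 𝓝 z ×ˢ 𝓝 z ×ˢ 𝓝 z := fun z => by
    rw [nhds_prod_eq, nhds_prod_eq (x := z) (y := z)]
  rw [hz] at h
  rw [nhds_prod_eq, nhds_prod_eq]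
  have hO := χ.eventually_mem_O (a := zeroSection F A x₀) χ.mem_O
  filter_upwards [((tendsto_bundleChart x₀).prodMap ((tendsto_bundleChart x₀).prodMap (tendsto_bundleChart x₀))).eventually h,
    hO.prod_mk (hO.prod_mk hO)] with p hp hp'
  simp only [Prod.map_apply', χ.pt_chart hp'.1, χ.pt_chart hp'.2.1, χ.pt_chart hp'.2.2] at hp
  exact hp

section Flow

variable [FiniteDimensional ℝ B] [T2Space M] {L : LieAlgebroid B F A}
  {V : (a : TotalSpace F A) → TangentSpace (𝓘(ℝ, B).prod 𝓘(ℝ, F)) a} {hV : L.IsSpray V}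
  (X : (χ.sprayModel hV).FlowBox (extChartAt 𝓘(ℝ, B) x₀ x₀))

theorem isMIntegralCurveOn_pt {z : B × F} (hz : z ∈ X.dom) :
    IsMIntegralCurveOn (fun t => χ.pt (X.Φ (t, z))) V (Ioo (-4) 4) := by
  intro t ht
  have hU : (X.Φ (t, z)).1 ∈ χ.U := X.Φ_mem t ht z hz
  refine HasMFDerivAt.hasMFDerivWithinAt ?_
  refine (X.Φ_deriv t ht z hz).hasMFDerivAt_chart_symm (χ.mem_target_of_mem_U hU) ?_
  have h := χ.chartVec_eq_field hV (χ.pt_proj_mem_O hU)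
  rw [χ.chart_pt hU] at h
  exact h

theorem flow_pt {z : B × F} (hz : z ∈ X.dom) {t : ℝ} (ht : t ∈ Ioo (-4 : ℝ) 4) :
    (t, χ.pt z) ∈ flowDomain V ∧ localFlow V t (χ.pt z) = χ.pt (X.Φ (t, z)) := by
  have := t2Space_totalSpace (F := F) (A := A)
  have h := localFlow_eq_of_integralCurve hV.smooth (χ.isMIntegralCurveOn_pt X hz) ht
  rwa [X.Φ_zero z hz] at h

/-- Differentiating the local flow needs its value in a neighbourhood and not just at one point. -/
theorem localFlow_eventuallyEq {z : B × F} (hz : z ∈ X.dom) {t : ℝ} (ht : t ∈ Ioo (-4 : ℝ) 4) :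
    localFlow V t =ᶠ[𝓝 (χ.pt z)]
      fun a => χ.pt (X.Φ (t, extChartAt 𝓙 (zeroSection F A x₀) a)) := by
  have hU : z.1 ∈ χ.U := X.mem_U hz
  have hc := (χ.chart_contMDiffAt (χ.pt_proj_mem_O hU)).continuousAt
  rw [ContinuousAt, χ.chart_pt hU] at hc
  filter_upwards [hc (X.dom_mem_nhds hz), χ.eventually_mem_O (χ.pt_proj_mem_O hU)] with a ha hO
  have h := (χ.flow_pt X ha ht).2
  rwa [χ.pt_chart hO] at h

/-- The differential of the flow. -/
theorem chartVec_tangentMap_localFlow {z : B × F} (hz : z ∈ X.dom) {t : ℝ}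
    (ht : t ∈ Ioo (-4 : ℝ) 4) {v : TangentSpace 𝓙 (χ.pt z)} {w : F}
    (hv : chartVec 𝓙 (zeroSection F A x₀) ⟨χ.pt z, v⟩ = (0, w)) :
    chartVec 𝓙 (zeroSection F A x₀) (tangentMap 𝓙 𝓙 (localFlow V t) ⟨χ.pt z, v⟩)
      = X.dΦ (t, z) w := by
  have hU : z.1 ∈ χ.U := X.mem_U hz
  have hg : HasFDerivAt (fun z => X.Φ (t, z))
      ((fderiv ℝ X.Φ (t, z)).comp (ContinuousLinearMap.inr ℝ ℝ (B × F)))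
      (extChartAt 𝓙 (zeroSection F A x₀) (χ.pt z)) := by
    rw [χ.chart_pt hU]
    exact HasFDerivAt.comp (g := X.Φ) z
      ((X.Φ_contDiffAt t ht _ hz).differentiableAt (by simp)).hasFDerivAt
      ((hasFDerivAt_const t z).prodMk (hasFDerivAt_id z))
  have h := (hasMFDerivAt_of_chart (J := 𝓙) (J' := 𝓙) (f := localFlow V t)
    (y₀ := zeroSection F A x₀) (χ.pt_mem_source hU) hg (by
      rw [χ.chart_pt hU]
      exact χ.mem_target_of_mem_U (X.Φ_mem t ht z hz)) (χ.localFlow_eventuallyEq X hz ht)).2 v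
  rw [hv] at h
  exact h

end Flow

end AdaptedBump

end FlowCoord

/-! ### The realization form in coordinates -/

section RealizationCoord

open scoped OperatorNorm

set_option linter.unusedSectionVars false

variable {B : Type*} [NormedAddCommGroup B] [NormedSpace ℝ B]
  {M : Type*} [TopologicalSpace M] [ChartedSpace B M] [IsManifold 𝓘(ℝ, B) ∞ M]
  {F : Type*} [NormedAddCommGroup F] [NormedSpace ℝ F]
  {A : M → Type*} [TopologicalSpace (TotalSpace F A)]
  [∀ x, TopologicalSpace (A x)] [FiberBundle F A]
  [∀ x, AddCommGroup (A x)] [∀ x, Module ℝ (A x)] [VectorBundle ℝ F A]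
  [ContMDiffVectorBundle ∞ F A 𝓘(ℝ, B)]

local notation "𝓙" => ModelWithCorners.prod 𝓘(ℝ, B) 𝓘(ℝ, F)

/-- A curve in a finite-dimensional space is differentiable if its coordinates are. -/
theorem hasDerivWithinAt_of_dual [FiniteDimensional ℝ F] {e : ℝ → F} {e' : F} {s : Set ℝ} {t : ℝ}
    (h : ∀ ℓ : F →L[ℝ] ℝ, HasDerivWithinAt (fun t => ℓ (e t)) (ℓ e') s t) :
    HasDerivWithinAt e e' s t := by
  let b := Module.finBasis ℝ F
  let ℓ : Fin (Module.finrank ℝ F) → F →L[ℝ] ℝ := fun j => LinearMap.toContinuousLinearMap (b.coord j)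
  have hsum : ∀ v : F, ∑ j, ℓ j v • b j = v := fun v => b.sum_repr v
  have h1 : HasDerivWithinAt (fun t => ∑ j, ℓ j (e t) • b j) (∑ j, ℓ j e' • b j) s t :=
    HasDerivWithinAt.fun_sum fun j _ => (h (ℓ j)).smul_const (b j)
  simpa only [hsum] using h1

namespace AdaptedBump

variable [FiniteDimensional ℝ F] {x₀ : M} (χ : AdaptedBump B F A x₀)

section Dual

variable {η : TotalSpace F A → ℝ} (hη : IsFiberLinear B η)

theorem comp_pt_contDiffAt (hη : IsFiberLinear B η) {z : B × F} (hz : z.1 ∈ χ.U) :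
    ContDiffAt ℝ ∞ (fun z => η (χ.pt z)) z :=
  contDiffAt_comp_chart_symm (χ.mem_target_of_mem_U hz) hη.smooth.contMDiffAt

theorem comp_pt_differentiableAt (hη : IsFiberLinear B η) {z : B × F} (hz : z.1 ∈ χ.U) :
    DifferentiableAt ℝ (fun z => η (χ.pt z)) z :=
  (χ.comp_pt_contDiffAt hη hz).differentiableAt (by simp)

theorem comp_pt_isLinearMap (hη : IsFiberLinear B η) {y : B} (hy : y ∈ χ.U) :
    IsLinearMap ℝ (fun v => η (χ.pt (y, v))) := by
  have h := hη.linear ((extChartAt 𝓘(ℝ, B) x₀).symm y)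
  constructor
  · intro v w
    rw [χ.pt_eq hy, χ.pt_eq hy, χ.pt_eq hy, map_add]
    exact h.map_add _ _
  · intro r v
    rw [χ.pt_eq hy, χ.pt_eq hy, map_smul]
    exact h.map_smul _ _

theorem fderiv_comp_pt_fiber (hη : IsFiberLinear B η) {y : B} (hy : y ∈ χ.U) (v w : F) :
    fderiv ℝ (fun z => η (χ.pt z)) (y, v) (0, w) = η (χ.pt (y, w)) := by
  have h1 : HasDerivAt (fun l : ℝ => η (χ.pt (y, v + l • w)))
      (fderiv ℝ (fun z => η (χ.pt z)) (y, v) (0, w)) 0 := by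
    have h2 : HasFDerivAt (fun z => η (χ.pt z)) (fderiv ℝ (fun z => η (χ.pt z)) (y, v))
        (y, v + (0 : ℝ) • w) := by
      rw [zero_smul, add_zero]; exact (χ.comp_pt_differentiableAt hη hy).hasFDerivAt
    have h3 : HasDerivAt (fun l : ℝ => v + l • w) w 0 := by
      simpa using ((hasDerivAt_id (0 : ℝ)).smul_const w).const_add v
    exact h2.comp_hasDerivAt (0 : ℝ) ((hasDerivAt_const (0 : ℝ) y).prodMk h3)
  have hl := χ.comp_pt_isLinearMap hη hy
  have h4 : (fun l : ℝ => η (χ.pt (y, v + l • w)))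
      = fun l => η (χ.pt (y, v)) + l * η (χ.pt (y, w)) := by
    funext l
    rw [hl.map_add, hl.map_smul, smul_eq_mul]
  rw [h4] at h1
  have h5 : HasDerivAt (fun l : ℝ => η (χ.pt (y, v)) + l * η (χ.pt (y, w))) (η (χ.pt (y, w))) 0 := by
    simpa using ((hasDerivAt_id (0 : ℝ)).mul_const (η (χ.pt (y, w)))).const_add (η (χ.pt (y, v)))
  exact h1.unique h5

theorem fderiv_comp_pt (hη : IsFiberLinear B η) {y : B} (hy : y ∈ χ.U) (v w : F) (u : B) :
    fderiv ℝ (fun z => η (χ.pt z)) (y, v) (u, w)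
      = fderiv ℝ (fun z => η (χ.pt z)) (y, v) (u, 0) + η (χ.pt (y, w)) := by
  rw [← χ.fderiv_comp_pt_fiber hη hy v w, ← map_add]
  simp

theorem section_eq_pt (β : Cₛ^∞⟮𝓘(ℝ, B); F, A⟯) {y : B} (hy : y ∈ χ.U) :
    (⟨(extChartAt 𝓘(ℝ, B) x₀).symm y, β ((extChartAt 𝓘(ℝ, B) x₀).symm y)⟩ : TotalSpace F A)
      = χ.pt (y, χ.sectionCoord β y) :=
  χ.eq_pt_of_proj_eq (a := ⟨_, β _⟩) hy rfl

theorem dirDeriv_section (L : LieAlgebroid B F A) (hη : IsFiberLinear B η)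
    (β : Cₛ^∞⟮𝓘(ℝ, B); F, A⟯) {y : B} (hy : y ∈ χ.U)
    (a : A ((extChartAt 𝓘(ℝ, B) x₀).symm y)) {v : F} (ha : fiberCoord F A x₀ _ a = v) :
    dirDeriv (fun x => η ⟨x, β x⟩) ((extChartAt 𝓘(ℝ, B) x₀).symm y) (L.anchor _ a)
      = fderiv ℝ (fun z => η (χ.pt z)) (y, χ.sectionCoord β y) (χ.anchorCoord L y v, 0)
        + η (χ.pt (y, fderiv ℝ (χ.sectionCoord β) y (χ.anchorCoord L y v))) := by
  have hyc := χ.chart_symm hy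
  have h1 : HasFDerivAt (fun z => η (χ.pt (z, χ.sectionCoord β z)))
      ((fderiv ℝ (fun z => η (χ.pt z)) (y, χ.sectionCoord β y)).comp
        ((ContinuousLinearMap.id ℝ B).prod (fderiv ℝ (χ.sectionCoord β) y))) y :=
    HasFDerivAt.comp (g := fun z => η (χ.pt z)) y (χ.comp_pt_differentiableAt hη hy).hasFDerivAt
      ((hasFDerivAt_id y).prodMk (χ.sectionCoord_differentiableAt β hy).hasFDerivAt)
  have h2 : HasFDerivAt (fun z => η (⟨(extChartAt 𝓘(ℝ, B) x₀).symm z,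
      β ((extChartAt 𝓘(ℝ, B) x₀).symm z)⟩ : TotalSpace F A))
      ((fderiv ℝ (fun z => η (χ.pt z)) (y, χ.sectionCoord β y)).comp
        ((ContinuousLinearMap.id ℝ B).prod (fderiv ℝ (χ.sectionCoord β) y))) y := by
    refine h1.congr_of_eventuallyEq ?_
    filter_upwards [χ.isOpen_U.mem_nhds hy] with z hz
    rw [χ.section_eq_pt β hz]
  rw [dirDeriv_eq_fderiv (x₀ := x₀) (χ.O_subset (χ.symm_mem_O hy)).1
    (by rw [hyc]; exact h2.differentiableAt), χ.chartVec_anchor_symm L hy, ha, hyc, h2.fderiv,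
    ← χ.fderiv_comp_pt hη hy]
  rfl

/-- The Lie algebroid differential in coordinates. -/
theorem dForm_eq (L : LieAlgebroid B F A) (hη : IsFiberLinear B η)
    (α β : Cₛ^∞⟮𝓘(ℝ, B); F, A⟯) {y : B} (hy : y ∈ χ.U) :
    L.dForm η α β ((extChartAt 𝓘(ℝ, B) x₀).symm y)
      = fderiv ℝ (fun z => η (χ.pt z)) (y, χ.sectionCoord β y)
          (χ.anchorCoord L y (χ.sectionCoord α y), 0)
        - fderiv ℝ (fun z => η (χ.pt z)) (y, χ.sectionCoord α y)
          (χ.anchorCoord L y (χ.sectionCoord β y), 0)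
        - η (χ.pt (y, χ.bracketCoord L y (χ.sectionCoord α y) (χ.sectionCoord β y))) := by
  rw [LieAlgebroid.dForm, χ.dirDeriv_section L hη β hy _ (v := χ.sectionCoord α y) rfl,
    χ.dirDeriv_section L hη α hy _ (v := χ.sectionCoord β y) rfl, χ.section_eq_pt _ hy,
    χ.sectionCoord_bracket L α β hy]
  have hl := χ.comp_pt_isLinearMap hη hy
  rw [hl.map_sub, hl.map_add]
  ring

theorem dirDeriv_pt (hη : IsFiberLinear B η) {z : B × F} (hz : z.1 ∈ χ.U)
    (v : TangentSpace 𝓙 (χ.pt z)) :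
    dirDeriv η (χ.pt z) v = fderiv ℝ (fun z => η (χ.pt z)) z
      (chartVec 𝓙 (zeroSection F A x₀) ⟨χ.pt z, v⟩) := by
  have h := χ.chart_pt hz
  have h2 := dirDeriv_eq_fderiv (J := 𝓙) (f := η) (χ.pt_mem_source hz)
    (by rw [h]; exact χ.comp_pt_differentiableAt hη hz) v
  rw [h] at h2
  exact h2

theorem dirDeriv_of_eq_pt (hη : IsFiberLinear B η) {z : B × F} (hz : z.1 ∈ χ.U)
    {p : TangentBundle 𝓙 (TotalSpace F A)} (hp : p.proj = χ.pt z) :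
    dirDeriv η p.proj p.2 = fderiv ℝ (fun z => η (χ.pt z)) z
      (chartVec 𝓙 (zeroSection F A x₀) p) := by
  obtain ⟨a, v⟩ := p
  obtain rfl : a = χ.pt z := hp
  exact χ.dirDeriv_pt hη hz v

/-- The right-hand side of the equation of a flow line in coordinates. -/
theorem flowLine_rhs (L : LieAlgebroid B F A) (hη : IsFiberLinear B η)
    {α β : Cₛ^∞⟮𝓘(ℝ, B); F, A⟯} {y : B} (hy : y ∈ χ.U) {p e : F}
    (hα : χ.sectionCoord α y = p) (hβ : χ.sectionCoord β y = e) {u : B × F}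
    (hu : u.1 = χ.anchorCoord L y e) :
    fderiv ℝ (fun z => η (χ.pt z)) (y, p) u + L.dForm η α β ((extChartAt 𝓘(ℝ, B) x₀).symm y)
      = fderiv ℝ (fun z => η (χ.pt z)) (y, e)
        (χ.anchorCoord L y p, u.2 - χ.bracketCoord L y p e) := by
  obtain ⟨u₁, u₂⟩ := u
  obtain rfl : u₁ = χ.anchorCoord L y e := hu
  have hl := χ.comp_pt_isLinearMap hη hy
  -- The derivative of `η` along the anchor of `e`, taken at `p`, occurs once in the directional
  -- derivative and once with opposite sign in `d_A η`, and cancels.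
  rw [χ.dForm_eq L hη α β hy, hα, hβ, χ.fderiv_comp_pt hη hy p u₂,
    χ.fderiv_comp_pt hη hy e (u₂ - _), hl.map_sub]
  ring

end Dual

/-- A fibrewise linear function with given coordinates. -/
noncomputable def dualSection (ℓ : F →L[ℝ] ℝ) (a : TotalSpace F A) : ℝ :=
  χ.toFun a.proj * ℓ (fiberCoord F A x₀ a.proj a.2)

theorem isFiberLinear_dualSection (ℓ : F →L[ℝ] ℝ) : IsFiberLinear B (χ.dualSection ℓ) where
  smooth := by
    refine contMDiff_of_tsupport fun a ha => ?_
    have hproj : ContMDiff 𝓙 𝓘(ℝ, B) ∞ (TotalSpace.proj : TotalSpace F A → M) := contMDiff_proj A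
    have ha' : a.proj ∈ chartNhd B F A x₀ := by
      refine χ.tsupport_subset ?_
      have h1 : tsupport (χ.dualSection ℓ) ⊆ (TotalSpace.proj : TotalSpace F A → M) ⁻¹'
          tsupport χ.toFun := by
        refine closure_minimal (fun b hb => subset_tsupport _ ?_)
          ((isClosed_tsupport _).preimage (FiberBundle.continuous_proj F A))
        exact left_ne_zero_of_mul hb
      exact h1 ha
    have h1 : ContMDiffAt 𝓙 𝓘(ℝ, ℝ) ∞ (fun a : TotalSpace F A => χ.toFun a.proj) a :=
      (χ.smooth.comp hproj).contMDiffAt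
    have h2 := contMDiffAt_fiberCoord (x₀ := x₀) (g := fun a : TotalSpace F A => a) (p := a)
      (I' := 𝓙) contMDiffAt_id ha'
    exact h1.mul ((ℓ.contDiff.contMDiff.contMDiffAt).comp a h2)
  linear x := by
    constructor
    · intro v w
      simp only [dualSection, map_add]
      ring
    · intro r v
      simp only [dualSection, map_smul, smul_eq_mul]
      ring

theorem dualSection_pt (ℓ : F →L[ℝ] ℝ) {z : B × F} (hz : z.1 ∈ χ.U) :
    χ.dualSection ℓ (χ.pt z) = ℓ z.2 := by
  rw [dualSection, χ.eq_one _ (χ.pt_proj_mem_O hz), χ.fiberCoord_pt hz, one_mul]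

theorem fderiv_dualSection (ℓ : F →L[ℝ] ℝ) {z : B × F} (hz : z.1 ∈ χ.U) (u : B × F) :
    fderiv ℝ (fun z => χ.dualSection ℓ (χ.pt z)) z u = ℓ u.2 := by
  have h : (fun z => χ.dualSection ℓ (χ.pt z)) =ᶠ[𝓝 z] fun z => ℓ z.2 := by
    filter_upwards [continuous_fst.continuousAt.preimage_mem_nhds (χ.isOpen_U.mem_nhds hz)]
      with z' hz' using χ.dualSection_pt ℓ hz'
  have h2 : HasFDerivAt (fun z : B × F => ℓ z.2) (ℓ.comp (ContinuousLinearMap.snd ℝ B F)) z :=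
    ℓ.hasFDerivAt.comp z hasFDerivAt_snd
  rw [h.fderiv_eq, h2.fderiv]
  rfl

section Realization

variable [FiniteDimensional ℝ B] [T2Space M] {L : LieAlgebroid B F A}
  {V : (a : TotalSpace F A) → TangentSpace (𝓘(ℝ, B).prod 𝓘(ℝ, F)) a} {hV : L.IsSpray V}
  (X : (χ.sprayModel hV).RealizationBox (extChartAt 𝓘(ℝ, B) x₀ x₀))

theorem Icc_subset_Ioo_four : Icc (0 : ℝ) 1 ⊆ Ioo (-4) 4 := fun _ hs =>
  ⟨by linarith [hs.1], by linarith [hs.2]⟩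

theorem Icc_subset_Ioo_three : Icc (0 : ℝ) 1 ⊆ Ioo (-3) 3 := fun _ hs =>
  ⟨by linarith [hs.1], by linarith [hs.2]⟩

/-- A flow line refers to its own value at time zero, where the tangent map of `localFlow V 0` has
to be recognized as the identity. -/
theorem tangentMap_localFlow_zero (X : (χ.sprayModel hV).FlowBox (extChartAt 𝓘(ℝ, B) x₀ x₀))
    {z : B × F} (hz : z ∈ X.dom) {v : TangentSpace 𝓙 (χ.pt z)} {w : F}
    (hv : chartVec 𝓙 (zeroSection F A x₀) ⟨χ.pt z, v⟩ = (0, w)) :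
    tangentMap 𝓙 𝓙 (localFlow V 0) ⟨χ.pt z, v⟩ = ⟨χ.pt z, v⟩ := by
  have h0 : (0 : ℝ) ∈ Ioo (-4 : ℝ) 4 := by norm_num
  have h1 : (tangentMap 𝓙 𝓙 (localFlow V 0) ⟨χ.pt z, v⟩).1 = χ.pt z := by
    have h := (χ.flow_pt X hz h0).2
    rwa [X.Φ_zero z hz] at h
  refine tangentBundle_ext (J := 𝓙) (x₀ := zeroSection F A x₀) ?_ h1 ?_
  · rw [h1]
    exact χ.pt_mem_source (X.mem_U hz)
  · rw [χ.chartVec_tangentMap_localFlow X hz h0 hv, X.dΦ_zero hz, hv]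

/-- Membership in the pullback algebroid is the anchor relation `ρ_E`. The condition on dual
sections, by `flowLine_rhs`, is the linear equation of `E` paired with `η`. -/
theorem isPullbackFlowLine {z : B × F} (hz : z ∈ X.dom) {v : TangentSpace 𝓙 (χ.pt z)} {w : F}
    (hv : chartVec 𝓙 (zeroSection F A x₀) ⟨χ.pt z, v⟩ = (0, w)) :
    L.IsPullbackFlowLine V (fun t => (tangentMap 𝓙 𝓙 (localFlow V t) ⟨χ.pt z, v⟩,
      χ.pt ((X.Φ (t, z)).1, X.E (t, z) w))) := by
  have hU : z.1 ∈ χ.U := X.mem_U hz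
  have hΦU : ∀ t ∈ Icc (0 : ℝ) 1, (X.Φ (t, z)).1 ∈ χ.U := fun t ht =>
    X.Φ_mem t (Icc_subset_Ioo_four ht) z hz
  have hbase : ∀ t ∈ Icc (0 : ℝ) 1,
      (tangentMap 𝓙 𝓙 (localFlow V t) ⟨χ.pt z, v⟩).1 = χ.pt (X.Φ (t, z)) := fun t ht =>
    (χ.flow_pt X.toFlowBox hz (Icc_subset_Ioo_four ht)).2
  have hvec := fun t (ht : t ∈ Icc (0 : ℝ) 1) =>
    χ.chartVec_tangentMap_localFlow X.toFlowBox hz (Icc_subset_Ioo_four ht) hv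
  have hρ : ∀ t ∈ Icc (0 : ℝ) 1,
      χ.anchorCoord L (X.Φ (t, z)).1 (X.E (t, z) w) = (X.dΦ (t, z) w).1 := fun t ht =>
    X.ρ_E (t := t) ⟨ht.1, by linarith [ht.2]⟩ hz w
  have hv0 : tangentMap 𝓙 𝓙 (localFlow V 0) ⟨χ.pt z, v⟩ = ⟨χ.pt z, v⟩ :=
    χ.tangentMap_localFlow_zero X.toFlowBox hz hv
  refine ⟨fun t ht => ?_, fun t ht => ?_, fun t ht => ?_, fun t ht η hη α β hα hβ => ?_⟩
  · have hproj : (χ.pt ((X.Φ (t, z)).1, X.E (t, z) w)).proj = (χ.pt (X.Φ (t, z))).proj :=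
      (χ.pt_proj (z := ((X.Φ (t, z)).1, X.E (t, z) w)) (hΦU t ht)).trans
        (χ.pt_proj (hΦU t ht)).symm
    have hO : (χ.pt (X.Φ (t, z))).proj ∈ χ.O := χ.pt_proj_mem_O (hΦU t ht)
    refine tangentBundle_ext (J := 𝓘(ℝ, B)) (x₀ := x₀) ?_ ?_ ?_
    · change (tangentMap 𝓙 𝓙 (localFlow V t) ⟨χ.pt z, v⟩).1.proj ∈ _
      rw [hbase t ht]
      exact (χ.O_subset hO).1
    · change (tangentMap 𝓙 𝓙 (localFlow V t) ⟨χ.pt z, v⟩).1.proj = _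
      rw [hbase t ht]
      exact hproj.symm
    · have h1 := chartVec_mfderiv_proj (x₀ := x₀)
        (a := (tangentMap 𝓙 𝓙 (localFlow V t) ⟨χ.pt z, v⟩).1)
        (by rw [hbase t ht]; exact χ.O_subset hO)
        (tangentMap 𝓙 𝓙 (localFlow V t) ⟨χ.pt z, v⟩).2
      refine h1.trans ?_
      have h2 := χ.chartVec_anchor L (x := (χ.pt ((X.Φ (t, z)).1, X.E (t, z) w)).proj)
        (by rw [hproj]; exact hO) (χ.pt ((X.Φ (t, z)).1, X.E (t, z) w)).2
      refine Eq.trans ?_ h2.symm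
      rw [χ.chart_pt_proj (z := ((X.Φ (t, z)).1, X.E (t, z) w)) (hΦU t ht),
        χ.fiberCoord_pt (z := ((X.Φ (t, z)).1, X.E (t, z) w)) (hΦU t ht), hρ t ht]
      exact congrArg Prod.fst (hvec t ht)
  · change (t, (tangentMap 𝓙 𝓙 (localFlow V 0) ⟨χ.pt z, v⟩).1) ∈ flowDomain V
    rw [hv0]
    exact (χ.flow_pt X.toFlowBox hz (Icc_subset_Ioo_four ht)).1
  · change _ = tangentMap 𝓙 𝓙 (localFlow V t) (tangentMap 𝓙 𝓙 (localFlow V 0) ⟨χ.pt z, v⟩)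
    rw [hv0]
  · have hd : HasDerivAt (fun s => η (χ.pt ((X.Φ (s, z)).1, X.E (s, z) w)))
        (fderiv ℝ (fun z => η (χ.pt z)) ((X.Φ (t, z)).1, X.E (t, z) w)
          (χ.anchorCoord L (X.Φ (t, z)).1 (X.Φ (t, z)).2, (X.dΦ (t, z) w).2
            - χ.bracketCoord L (X.Φ (t, z)).1 (X.Φ (t, z)).2 (X.E (t, z) w))) t :=
      HasFDerivAt.comp_hasDerivAt (l := fun z => η (χ.pt z)) t
        (χ.comp_pt_differentiableAt hη
          (z := ((X.Φ (t, z)).1, X.E (t, z) w)) (hΦU t ht)).hasFDerivAt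
        ((X.Φ_deriv t (Icc_subset_Ioo_four ht) z hz).prod_fst.prodMk
          (X.hasDerivAt_E_apply (Icc_subset_Ioo_three ht) hz w))
    refine hd.hasDerivWithinAt.congr_deriv ?_
    have hpp : (χ.pt ((X.Φ (t, z)).1, X.E (t, z) w)).proj
        = (extChartAt 𝓘(ℝ, B) x₀).symm (X.Φ (t, z)).1 :=
      χ.pt_proj (z := ((X.Φ (t, z)).1, X.E (t, z) w)) (hΦU t ht)
    have hsec : ∀ (γ : Cₛ^∞⟮𝓘(ℝ, B); F, A⟯) (u : F),
        (⟨(χ.pt ((X.Φ (t, z)).1, X.E (t, z) w)).proj,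
          γ (χ.pt ((X.Φ (t, z)).1, X.E (t, z) w)).proj⟩ : TotalSpace F A)
            = χ.pt ((X.Φ (t, z)).1, u) → χ.sectionCoord γ (X.Φ (t, z)).1 = u := by
      intro γ u h
      rw [hpp, χ.section_eq_pt γ (hΦU t ht)] at h
      exact congrArg Prod.snd (χ.pt_injective
        (z := ((X.Φ (t, z)).1, χ.sectionCoord γ (X.Φ (t, z)).1)) (z' := ((X.Φ (t, z)).1, u))
        (hΦU t ht) (hΦU t ht) h)
    have hα' := hsec α (X.Φ (t, z)).2 (hα.trans (hbase t ht))
    have hβ' := hsec β (X.E (t, z) w) hβ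
    have hr := χ.flowLine_rhs L hη (hΦU t ht) hα' hβ' (hρ t ht).symm
    have hdir : dirDeriv η (tangentMap 𝓙 𝓙 (localFlow V t) ⟨χ.pt z, v⟩).proj
        (tangentMap 𝓙 𝓙 (localFlow V t) ⟨χ.pt z, v⟩).2
          = fderiv ℝ (fun z => η (χ.pt z)) (X.Φ (t, z)) (X.dΦ (t, z) w) := by
      rw [← hvec t ht]
      exact χ.dirDeriv_of_eq_pt hη (hΦU t ht) (hbase t ht)
    change _ = dirDeriv η (tangentMap 𝓙 𝓙 (localFlow V t) ⟨χ.pt z, v⟩).proj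
        (tangentMap 𝓙 𝓙 (localFlow V t) ⟨χ.pt z, v⟩).2
          + L.dForm η α β (χ.pt ((X.Φ (t, z)).1, X.E (t, z) w)).proj
    rw [hdir, hpp]
    exact hr.symm

/-- Flow lines of the pullback algebroid with initial condition `(v, 0)` are given by the
realization box. -/
theorem flowLine_eq {z : B × F} (hz : z ∈ X.dom) {v : TangentSpace 𝓙 (χ.pt z)} {w : F}
    (hv : chartVec 𝓙 (zeroSection F A x₀) ⟨χ.pt z, v⟩ = (0, w))
    {W : ℝ → TangentBundle 𝓙 (TotalSpace F A) × TotalSpace F A}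
    (hW : L.IsPullbackFlowLine V W)
    (hW0 : W 0 = (⟨χ.pt z, v⟩, zeroSection F A (χ.pt z).proj)) :
    (W 1).2 = χ.pt ((X.Φ (1, z)).1, X.Θ z w) := by
  have hU : z.1 ∈ χ.U := X.mem_U hz
  have hΦU : ∀ t ∈ Icc (0 : ℝ) 1, (X.Φ (t, z)).1 ∈ χ.U := fun t ht =>
    X.Φ_mem t (Icc_subset_Ioo_four ht) z hz
  have hfst : ∀ t ∈ Icc (0 : ℝ) 1, (W t).1 = tangentMap 𝓙 𝓙 (localFlow V t) ⟨χ.pt z, v⟩ := by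
    intro t ht
    rw [hW.fst_eq t ht, hW0]
  have hbase : ∀ t ∈ Icc (0 : ℝ) 1, (W t).1.proj = χ.pt (X.Φ (t, z)) := fun t ht => by
    rw [hfst t ht]
    exact (χ.flow_pt X.toFlowBox hz (Icc_subset_Ioo_four ht)).2
  have hvec : ∀ t ∈ Icc (0 : ℝ) 1, chartVec 𝓙 (zeroSection F A x₀) (W t).1 = X.dΦ (t, z) w := by
    intro t ht
    rw [hfst t ht]
    exact χ.chartVec_tangentMap_localFlow X.toFlowBox hz (Icc_subset_Ioo_four ht) hv
  have hproj : ∀ t ∈ Icc (0 : ℝ) 1,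
      (W t).2.proj = (extChartAt 𝓘(ℝ, B) x₀).symm (X.Φ (t, z)).1 := by
    intro t ht
    have h : (W t).1.proj.proj = (W t).2.proj :=
      congrArg (TotalSpace.proj : TangentBundle 𝓘(ℝ, B) M → M) (hW.mem t ht)
    rw [← h, hbase t ht, χ.pt_proj (hΦU t ht)]
  set e : ℝ → F := fun t => fiberCoord F A x₀ (W t).2.proj (W t).2.2 with he
  have hWe : ∀ t ∈ Icc (0 : ℝ) 1, (W t).2 = χ.pt ((X.Φ (t, z)).1, e t) := fun t ht =>
    χ.eq_pt_of_proj_eq (hΦU t ht) (hproj t ht)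
  have hrho : ∀ t ∈ Icc (0 : ℝ) 1,
      (X.dΦ (t, z) w).1 = χ.anchorCoord L (X.Φ (t, z)).1 (e t) := by
    intro t ht
    have hO : (W t).2.proj ∈ χ.O := by rw [hproj t ht]; exact χ.symm_mem_O (hΦU t ht)
    have h1 := chartVec_mfderiv_proj (x₀ := x₀) (a := (W t).1.proj)
      (by rw [hbase t ht]; exact χ.O_subset (χ.pt_proj_mem_O (hΦU t ht))) (W t).1.2
    have h2 := χ.chartVec_anchor L hO (W t).2.2
    have h3 := congrArg (chartVec 𝓘(ℝ, B) x₀) (hW.mem t ht)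
    have h4 := (h1.symm.trans h3).trans h2
    have h5 : extChartAt 𝓘(ℝ, B) x₀ (W t).2.proj = (X.Φ (t, z)).1 := by
      rw [hproj t ht, χ.chart_symm (hΦU t ht)]
    rw [← hvec t ht, ← h5]
    exact h4
  have hder : ∀ t ∈ Icc (0 : ℝ) 1, HasDerivWithinAt e ((X.dΦ (t, z) w).2
      - χ.bracketCoord L (X.Φ (t, z)).1 (X.Φ (t, z)).2 (e t)) (Icc 0 1) t := by
    intro t ht
    -- The flow-line condition is tested on the cut-off coordinate functionals. Their derivatives
    -- see only the fibre component, so together they give the full linear equation for `e`, and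
    -- `eqOn_E` identifies it with `E`.
    refine hasDerivWithinAt_of_dual fun ℓ => ?_
    have hη := χ.isFiberLinear_dualSection ℓ
    have hsec : ∀ u : F, (⟨(W t).2.proj, χ.constSection u (W t).2.proj⟩ : TotalSpace F A)
        = χ.pt ((X.Φ (t, z)).1, u) := by
      intro u
      rw [hproj t ht, χ.section_eq_pt _ (hΦU t ht), χ.sectionCoord_constSection (hΦU t ht) _]
    have h := hW.snd_deriv t ht _ hη (χ.constSection (X.Φ (t, z)).2) (χ.constSection (e t))
      ((hsec _).trans (hbase t ht).symm) ((hsec _).trans (hWe t ht).symm)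
    have hval : ∀ s ∈ Icc (0 : ℝ) 1, ℓ (e s) = χ.dualSection ℓ (W s).2 := by
      intro s hs
      rw [hWe s hs, χ.dualSection_pt ℓ (z := ((X.Φ (s, z)).1, e s)) (hΦU s hs)]
    refine (h.congr hval (hval t ht)).congr_deriv ?_
    rw [χ.dirDeriv_of_eq_pt hη (hΦU t ht) (hbase t ht), hproj t ht, hvec t ht,
      χ.flowLine_rhs L hη (hΦU t ht) (χ.sectionCoord_constSection (hΦU t ht) _)
        (χ.sectionCoord_constSection (hΦU t ht) _) (hrho t ht),
      χ.fderiv_dualSection ℓ (z := ((X.Φ (t, z)).1, e t)) (hΦU t ht)]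
  have he0 : e 0 = 0 := by
    have h : ∀ (a : TotalSpace F A) (x : M), a = zeroSection F A x →
        fiberCoord F A x₀ a.proj a.2 = 0 := by
      rintro _ x rfl
      exact map_zero (fiberCoord F A x₀ x)
    exact h _ _ (congrArg Prod.snd hW0)
  have hE := X.eqOn_E (T := 1) (by norm_num) hz w he0
    (fun t ht => (hder t ht).continuousWithinAt)
    (fun t ht => (hder t ⟨ht.1, ht.2.le⟩).Ici_of_Icc ht) ⟨zero_le_one, le_rfl⟩
  rw [hWe 1 ⟨zero_le_one, le_rfl⟩, ← hE]
  rfl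

/-- The realization form in coordinates. -/
theorem realizationForm_pt {z : B × F} (hz : z ∈ X.dom) {v : TangentSpace 𝓙 (χ.pt z)} {w : F}
    (hv : chartVec 𝓙 (zeroSection F A x₀) ⟨χ.pt z, v⟩ = (0, w)) :
    L.realizationForm V ⟨χ.pt z, v⟩ = χ.pt ((X.Φ (1, z)).1, X.Θ z w) := by
  have h : ∃ e, L.IsRealizationValue V ⟨χ.pt z, v⟩ e := by
    refine ⟨_, _, χ.isPullbackFlowLine X hz hv, ?_, rfl⟩
    refine Prod.ext (χ.tangentMap_localFlow_zero X.toFlowBox hz hv) ?_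
    change χ.pt ((X.Φ (0, z)).1, X.E (0, z) w) = zeroSection F A (χ.pt z).proj
    rw [X.Φ_zero z hz, X.E_zero z hz, zero_apply, χ.pt_zero (X.mem_U hz),
      χ.pt_proj (X.mem_U hz)]
  rw [LieAlgebroid.realizationForm, dif_pos h]
  -- All flow lines with this initial condition have the same endpoint, so the choice in
  -- `realizationForm` does not matter.
  obtain ⟨W, hW, hW0, hW1⟩ := h.choose_spec
  rw [← hW1]
  exact χ.flowLine_eq X hz hv hW hW0

end Realization

end AdaptedBump

end RealizationCoord

/-! ### The product equation in coordinates -/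

section ProductPath

set_option linter.unusedSectionVars false

variable {B : Type*} [NormedAddCommGroup B] [NormedSpace ℝ B]
  {M : Type*} [TopologicalSpace M] [ChartedSpace B M] [IsManifold 𝓘(ℝ, B) ∞ M]
  {F : Type*} [NormedAddCommGroup F] [NormedSpace ℝ F]
  {A : M → Type*} [TopologicalSpace (TotalSpace F A)]
  [∀ x, TopologicalSpace (A x)] [FiberBundle F A]
  [∀ x, AddCommGroup (A x)] [∀ x, Module ℝ (A x)] [VectorBundle ℝ F A]
  [ContMDiffVectorBundle ∞ F A 𝓘(ℝ, B)]

local notation "𝓙" => ModelWithCorners.prod 𝓘(ℝ, B) 𝓘(ℝ, F)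

namespace AdaptedBump

variable [FiniteDimensional ℝ F] {x₀ : M} (χ : AdaptedBump B F A x₀)

theorem pt_ext {y y' : B} {v v' : F} (h : y = y') (h' : v = v') :
    χ.pt (y, v) = χ.pt (y', v') := by rw [h, h']

theorem curveVelocityWithin_pt {c : ℝ → B × F} {c' : B × F} {s : Set ℝ} {t : ℝ}
    (h : HasDerivWithinAt c c' s t) (hs : UniqueDiffWithinAt ℝ s t) (ht : (c t).1 ∈ χ.U) :
    MDifferentiableWithinAt 𝓘(ℝ, ℝ) 𝓙 (fun r => χ.pt (c r)) s t ∧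
      chartVec 𝓙 (zeroSection F A x₀) (curveVelocityWithin 𝓙 (fun r => χ.pt (c r)) s t) = c' := by
  obtain ⟨v, hv⟩ := chartVec_surjective (J := 𝓙) (χ.pt_mem_source ht) c'
  have h1 := h.hasMFDerivWithinAt_chart_symm (x₀ := zeroSection F A x₀)
    (χ.mem_target_of_mem_U ht) hv
  refine ⟨h1.mdifferentiableWithinAt, ?_⟩
  have h2 := h1.mfderivWithin hs.uniqueMDiffWithinAt
  change chartVec 𝓙 (zeroSection F A x₀) ⟨χ.pt (c t),
    mfderivWithin 𝓘(ℝ, ℝ) 𝓙 (fun r => (extChartAt 𝓙 (zeroSection F A x₀)).symm (c r)) s t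
      (1 : ℝ)⟩ = c'
  rw [h2, ← hv]
  congr 2
  exact one_smul ℝ v

theorem curveVelocity_pt {c : ℝ → B × F} {c' : B × F} {t : ℝ}
    (h : HasDerivAt c c' t) (ht : (c t).1 ∈ χ.U) :
    MDifferentiableAt 𝓘(ℝ, ℝ) 𝓙 (fun r => χ.pt (c r)) t ∧
      chartVec 𝓙 (zeroSection F A x₀) (curveVelocity 𝓙 (fun r => χ.pt (c r)) t) = c' := by
  have h1 := χ.curveVelocityWithin_pt (s := univ) h.hasDerivWithinAt uniqueDiffWithinAt_univ ht
  rw [mdifferentiableWithinAt_univ] at h1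
  refine ⟨h1.1, ?_⟩
  have h2 := h1.2
  rw [curveVelocityWithin, mfderivWithin_univ] at h2
  exact h2

variable [FiniteDimensional ℝ B] [T2Space M] {L : LieAlgebroid B F A}
  {V : (a : TotalSpace F A) → TangentSpace (𝓘(ℝ, B).prod 𝓘(ℝ, F)) a} {hV : L.IsSpray V}

theorem realizationForm_of_eq_pt
    (X : (χ.sprayModel hV).RealizationBox (extChartAt 𝓘(ℝ, B) x₀ x₀))
    {z : B × F} (hz : z ∈ X.dom) {p : TangentBundle 𝓙 (TotalSpace F A)} {w : F}
    (hp : p.proj = χ.pt z) (hv : chartVec 𝓙 (zeroSection F A x₀) p = (0, w)) :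
    L.realizationForm V p = χ.pt ((X.Φ (1, z)).1, X.Θ z w) := by
  obtain ⟨a, v⟩ := p
  obtain rfl : a = χ.pt z := hp
  exact χ.realizationForm_pt X hz hv

variable (X : (χ.sprayModel hV).ProductBox (extChartAt 𝓘(ℝ, B) x₀ x₀))

/-- The base component of the equation is `target_κ`, the fibre component is the equation of `κ`.
Composability is used for the base component only. -/
theorem isProductPath_pt {zb za : B × F} (hb : zb ∈ X.small) (ha : za ∈ X.small)
    (hab : za.1 = (X.Φ (1, zb)).1) :
    L.IsProductPath V (χ.pt za) (χ.pt zb) (fun t => χ.pt (zb.1, X.κ (t, (zb, za)))) := by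
  have hI : ∀ t ∈ Icc (0 : ℝ) 1, t ∈ Ioo (-2 : ℝ) 2 := fun t ht =>
    ⟨by linarith [ht.1], by linarith [ht.2]⟩
  have hbU : zb.1 ∈ χ.U := X.mem_U (X.small_subset_dom hb)
  have hmem : ∀ t ∈ Icc (0 : ℝ) 1, (zb.1, X.κ (t, (zb, za))) ∈ X.dom := fun t ht =>
    X.κ_mem t (hI t ht) zb hb za ha
  have hvel : ∀ t ∈ Icc (0 : ℝ) 1, _ := fun t (ht : t ∈ Icc (0 : ℝ) 1) =>
    χ.curveVelocityWithin_pt (c := fun t => (zb.1, X.κ (t, (zb, za))))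
      ((hasDerivAt_const t zb.1).prodMk (X.κ_deriv t (hI t ht) zb hb za ha)).hasDerivWithinAt
      (uniqueDiffOn_Icc zero_lt_one t ht) hbU
  refine ⟨?_, fun t ht => ?_, fun t ht => ?_, fun t ht => ?_, fun t ht => (hvel t ht).1,
    fun t ht => ?_⟩
  · rw [X.κ_zero zb hb za ha]
  · rw [χ.pt_proj hbU]
    exact χ.pt_proj (z := (zb.1, X.κ (t, (zb, za)))) hbU
  · exact (χ.flow_pt X.toFlowBox (X.small_subset_dom ha) (Icc_subset_Ioo_four ht)).1
  · exact (χ.flow_pt X.toFlowBox (hmem t ht) (by norm_num)).1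
  · rw [χ.realizationForm_of_eq_pt X.toRealizationBox (hmem t ht) rfl (hvel t ht).2,
      (χ.flow_pt X.toFlowBox (X.small_subset_dom ha) (Icc_subset_Ioo_four ht)).2]
    exact χ.pt_ext (X.target_κ hb ha hab ht) (X.Θ_inverse (hmem t ht) _)

/-- An arbitrary solution lies in one fibre, hence in the chart, but it might leave the box in which
`Θ` is computed. `eqOn_κ` only uses its equation inside the box. -/
theorem isProductPath_eqOn {zb za : B × F} (hb : zb ∈ X.small) (ha : za ∈ X.small)
    {k : ℝ → TotalSpace F A} (hk : L.IsProductPath V (χ.pt za) (χ.pt zb) k) :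
    EqOn k (fun t => χ.pt (zb.1, X.κ (t, (zb, za)))) (Icc 0 1) := by
  have hbU : zb.1 ∈ χ.U := X.mem_U (X.small_subset_dom hb)
  set m : ℝ → F := fun t => fiberCoord F A x₀ (k t).proj (k t).2
  have hkm : ∀ t ∈ Icc (0 : ℝ) 1, k t = χ.pt (zb.1, m t) := fun t ht =>
    χ.eq_pt_of_proj_eq hbU ((hk.mem_fiber t ht).trans (χ.pt_proj hbU))
  have h01 : (0 : ℝ) ∈ Icc (0 : ℝ) 1 := ⟨le_rfl, zero_le_one⟩
  have hm0 : m 0 = zb.2 := by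
    have h := (hkm 0 h01).symm.trans hk.init
    exact congrArg Prod.snd (χ.pt_injective (z := (zb.1, m 0)) hbU hbU h)
  have hder : ∀ t ∈ Icc (0 : ℝ) 1, ∃ w : F, HasDerivWithinAt m w (Icc 0 1) t ∧
      chartVec 𝓙 (zeroSection F A x₀) (curveVelocityWithin 𝓙 k (Icc 0 1) t) = (0, w) := by
    intro t ht
    have h1 := (hk.differentiable t ht).hasMFDerivWithinAt.hasDerivWithinAt_chart
      (x₀ := zeroSection F A x₀) (by rw [hkm t ht]; exact χ.pt_mem_source hbU)
    have h2 := h1.congr_of_mem (f₁ := fun s => (zb.1, m s)) (fun s hs => by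
      rw [hkm s hs]; exact (χ.chart_pt (z := (zb.1, m s)) hbU).symm) ht
    have h3 : HasDerivWithinAt (fun _ : ℝ => zb.1) _ (Icc 0 1) t :=
      (ContinuousLinearMap.fst ℝ B F).hasFDerivAt.comp_hasDerivWithinAt
        (f := fun s => (zb.1, m s)) t h2
    have h4 : HasDerivWithinAt m _ (Icc 0 1) t :=
      (ContinuousLinearMap.snd ℝ B F).hasFDerivAt.comp_hasDerivWithinAt
        (f := fun s => (zb.1, m s)) t h2
    -- The base coordinate of the path is constant, so the coordinate velocity is vertical and the
    -- formula for the realization form applies.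
    refine ⟨_, h4, Prod.ext ?_ rfl⟩
    exact (uniqueDiffOn_Icc (zero_lt_one' ℝ) t ht).eq_deriv _ h3 (hasDerivWithinAt_const _ _ _)
  have heq := X.eqOn_κ (T := 1) (by norm_num) hb ha hm0
    (fun t ht => (hder t ht).choose_spec.1.continuousWithinAt) (fun t ht hdom => ?_)
  · intro t ht
    rw [hkm t ht, ← heq ht]
  · have ht' : t ∈ Icc (0 : ℝ) 1 := ⟨ht.1, ht.2.le⟩
    obtain ⟨w, hw, hw'⟩ := hder t ht'
    have h1 := hk.equation t ht'
    rw [χ.realizationForm_of_eq_pt X.toRealizationBox hdom (hkm t ht') hw',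
      (χ.flow_pt X.toFlowBox (X.small_subset_dom ha) (Icc_subset_Ioo_four ht')).2] at h1
    have h2 := χ.pt_injective (z := ((X.Φ (1, (zb.1, m t))).1, X.Θ (zb.1, m t) w))
      (X.Φ_mem 1 (by norm_num) _ hdom)
      (X.Φ_mem t (Icc_subset_Ioo_four ht') _ (X.small_subset_dom ha)) h1
    rw [← X.eq_inverse_of_Θ_eq hdom (congrArg Prod.snd h2)]
    exact hw.Ici_of_Icc ht

theorem hasUniqueProductPath_pt {zb za : B × F} (hb : zb ∈ X.small) (ha : za ∈ X.small)
    (hab : za.1 = (X.Φ (1, zb)).1) : L.HasUniqueProductPath V (χ.pt za) (χ.pt zb) :=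
  ⟨_, χ.isProductPath_pt X hb ha hab, fun _ hk => χ.isProductPath_eqOn X hb ha hk⟩

theorem target_pt {z : B × F} (hz : z ∈ X.dom) :
    (localFlow V 1 (χ.pt z)).proj = (extChartAt 𝓘(ℝ, B) x₀).symm (X.Φ (1, z)).1 := by
  rw [(χ.flow_pt X.toFlowBox hz (by norm_num)).2, χ.pt_proj (X.Φ_mem 1 (by norm_num) _ hz)]

theorem composable_iff {zb za : B × F} (hb : zb ∈ X.dom) (ha : za ∈ X.dom) :
    (χ.pt za).proj = (localFlow V 1 (χ.pt zb)).proj ↔ za.1 = (X.Φ (1, zb)).1 := by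
  rw [χ.target_pt X hb, χ.pt_proj_eq_iff (X.mem_U ha) (X.Φ_mem 1 (by norm_num) _ hb)]

end AdaptedBump

end ProductPath

/-! ### The structure maps in coordinates -/

section StructureMaps

set_option linter.unusedSectionVars false

variable {B : Type*} [NormedAddCommGroup B] [NormedSpace ℝ B]
  {M : Type*} [TopologicalSpace M] [ChartedSpace B M] [IsManifold 𝓘(ℝ, B) ∞ M]
  {F : Type*} [NormedAddCommGroup F] [NormedSpace ℝ F]
  {A : M → Type*} [TopologicalSpace (TotalSpace F A)]
  [∀ x, TopologicalSpace (A x)] [FiberBundle F A]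
  [∀ x, AddCommGroup (A x)] [∀ x, Module ℝ (A x)] [VectorBundle ℝ F A]
  [ContMDiffVectorBundle ∞ F A 𝓘(ℝ, B)]

local notation "𝓙" => ModelWithCorners.prod 𝓘(ℝ, B) 𝓘(ℝ, F)

/-- The target map `q ∘ φ_V^1` of the local groupoid of the spray `V`. -/
noncomputable def sprayTarget (V : (a : TotalSpace F A) → TangentSpace 𝓙 a)
    (a : TotalSpace F A) : M :=
  (localFlow V 1 a).proj

/-- The inversion `- φ_V^1` of the local groupoid of the spray `V`. -/
noncomputable def sprayInv (V : (a : TotalSpace F A) → TangentSpace 𝓙 a)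
    (a : TotalSpace F A) : TotalSpace F A :=
  fiberScale (-1) (localFlow V 1 a)

open Classical in
/-- The product of `a` and `b`: the endpoint of a solution of the product equation. -/
noncomputable def LieAlgebroid.sprayMul (L : LieAlgebroid B F A)
    (V : (a : TotalSpace F A) → TangentSpace 𝓙 a) (a b : TotalSpace F A) : TotalSpace F A :=
  if h : ∃ k, L.IsProductPath V a b k then h.choose 1 else b

/-- The interior of the set where the target map is defined and smooth. -/
def sprayTargetDom (V : (a : TotalSpace F A) → TangentSpace 𝓙 a) : Set (TotalSpace F A) :=
  {a | ∀ᶠ b in 𝓝 a, b ∈ timeOneDomain V ∧ ContMDiffAt 𝓙 𝓘(ℝ, B) ∞ (sprayTarget V) b}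

/-- The interior of the set where the inversion is defined and smooth. -/
def sprayInvDom (V : (a : TotalSpace F A) → TangentSpace 𝓙 a) : Set (TotalSpace F A) :=
  {a | ∀ᶠ b in 𝓝 a, b ∈ timeOneDomain V ∧ ContMDiffAt 𝓙 𝓙 ∞ (sprayInv V) b}

/-- The composable pairs. -/
def sprayComposable (V : (a : TotalSpace F A) → TangentSpace 𝓙 a) :
    Set (TotalSpace F A × TotalSpace F A) :=
  {p | p.2 ∈ sprayTargetDom V ∧ p.1.proj = sprayTarget V p.2}

/-- The interior of the set where the product equation is uniquely solvable, with smooth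
solution at time one. -/
def LieAlgebroid.sprayMulOpen (L : LieAlgebroid B F A)
    (V : (a : TotalSpace F A) → TangentSpace 𝓙 a) : Set (TotalSpace F A × TotalSpace F A) :=
  {p | ∀ᶠ p' in 𝓝 p, p' ∈ sprayComposable V → L.HasUniqueProductPath V p'.1 p'.2 ∧
    ContMDiffWithinAt (ModelWithCorners.prod 𝓙 𝓙) 𝓙 ∞
      (fun p : TotalSpace F A × TotalSpace F A => L.sprayMul V p.1 p.2) (sprayComposable V) p'}

/-- The domain of the multiplication. -/
def LieAlgebroid.sprayMulDom (L : LieAlgebroid B F A)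
    (V : (a : TotalSpace F A) → TangentSpace 𝓙 a) : Set (TotalSpace F A × TotalSpace F A) :=
  L.sprayMulOpen V ∩ sprayComposable V

theorem LieAlgebroid.HasUniqueProductPath.sprayMul_eq {L : LieAlgebroid B F A}
    {V : (a : TotalSpace F A) → TangentSpace 𝓙 a} {a b : TotalSpace F A}
    (h : L.HasUniqueProductPath V a b) {k : ℝ → TotalSpace F A} (hk : L.IsProductPath V a b k) :
    L.sprayMul V a b = k 1 := by
  have h' : ∃ k, L.IsProductPath V a b k := ⟨k, hk⟩
  obtain ⟨k₀, _, hu⟩ := h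
  have h1 : (1 : ℝ) ∈ Icc (0 : ℝ) 1 := ⟨zero_le_one, le_rfl⟩
  rw [LieAlgebroid.sprayMul, dif_pos h', hu _ h'.choose_spec h1, hu k hk h1]

namespace SprayModel.ProductBox

variable {D : SprayModel B F} {y₀ : B} (X : D.ProductBox y₀)

theorem neg_mem_small {y : B} {v : F} (h : (y, v) ∈ X.small) : (y, -v) ∈ X.small := by
  have h' : dist (y, v) ((y₀, 0) : B × F) < X.s := h
  change dist (y, -v) ((y₀, 0) : B × F) < X.s
  rw [Prod.dist_eq] at h' ⊢
  simpa using h'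

end SprayModel.ProductBox

namespace AdaptedBump

variable [FiniteDimensional ℝ F] {x₀ : M} (χ : AdaptedBump B F A x₀)

theorem tendsto_chart {z : B × F} (hz : z.1 ∈ χ.U) :
    Tendsto (extChartAt 𝓙 (zeroSection F A x₀)) (𝓝 (χ.pt z)) (𝓝 z) := by
  have hc := (χ.chart_contMDiffAt (χ.pt_proj_mem_O hz)).continuousAt
  rwa [ContinuousAt, χ.chart_pt hz] at hc

theorem eventually_pt {z : B × F} (hz : z.1 ∈ χ.U) {Q : B × F → Prop} (h : ∀ᶠ z' in 𝓝 z, Q z') :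
    ∀ᶠ a in 𝓝 (χ.pt z), Q (extChartAt 𝓙 (zeroSection F A x₀) a) ∧
      χ.pt (extChartAt 𝓙 (zeroSection F A x₀) a) = a := by
  filter_upwards [(χ.tendsto_chart hz).eventually h, χ.eventually_mem_O (χ.pt_proj_mem_O hz)]
    with a ha hO using ⟨ha, χ.pt_chart hO⟩

theorem contMDiffAt_of_pt {f : TotalSpace F A → TotalSpace F A} {g : B × F → B × F} {z : B × F}
    (hz : z.1 ∈ χ.U) (hg : ContDiffAt ℝ ∞ g z) (hgz : (g z).1 ∈ χ.U)
    (h : ∀ᶠ z' in 𝓝 z, f (χ.pt z') = χ.pt (g z')) : ContMDiffAt 𝓙 𝓙 ∞ f (χ.pt z) := by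
  have h1 : ContMDiffAt 𝓙 𝓙 ∞ (fun a => χ.pt (g (extChartAt 𝓙 (zeroSection F A x₀) a)))
      (χ.pt z) := by
    refine ContMDiffAt.comp (I' := 𝓘(ℝ, B × F)) (g := χ.pt) (χ.pt z) ?_ ?_
    · rw [χ.chart_pt hz]
      exact χ.pt_contMDiffAt hgz
    · refine ContMDiffAt.comp (I' := 𝓘(ℝ, B × F)) (g := g) (χ.pt z) ?_
        (χ.chart_contMDiffAt (χ.pt_proj_mem_O hz))
      rw [χ.chart_pt hz]
      exact hg.contMDiffAt
  refine h1.congr_of_eventuallyEq ?_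
  filter_upwards [χ.eventually_pt hz h] with a ha
  rw [← ha.1, ha.2]

theorem fiberScale_pt {z : B × F} (hz : z.1 ∈ χ.U) (t : ℝ) :
    fiberScale t (χ.pt z) = χ.pt (z.1, t • z.2) := (χ.pt_smul hz t z.2).symm

variable [FiniteDimensional ℝ B] [T2Space M] {L : LieAlgebroid B F A}
  {V : (a : TotalSpace F A) → TangentSpace (𝓘(ℝ, B).prod 𝓘(ℝ, F)) a} {hV : L.IsSpray V}
  (X : (χ.sprayModel hV).ProductBox (extChartAt 𝓘(ℝ, B) x₀ x₀))

theorem one_mem_Ioo_four : (1 : ℝ) ∈ Ioo (-4 : ℝ) 4 := by norm_num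

theorem localFlow_contMDiffAt {z : B × F} (hz : z ∈ X.dom) :
    ContMDiffAt 𝓙 𝓙 ∞ (localFlow V 1) (χ.pt z) := by
  refine χ.contMDiffAt_of_pt (X.mem_U hz) (g := fun z => X.Φ (1, z))
    ((X.Φ_contDiffAt 1 one_mem_Ioo_four z hz).comp z (contDiffAt_const.prodMk contDiffAt_id))
    (X.Φ_mem 1 one_mem_Ioo_four z hz) ?_
  filter_upwards [X.dom_mem_nhds hz] with z' hz'
  exact (χ.flow_pt X.toFlowBox hz' one_mem_Ioo_four).2

theorem sprayInv_pt {z : B × F} (hz : z ∈ X.dom) :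
    sprayInv V (χ.pt z) = χ.pt ((X.Φ (1, z)).1, -(X.Φ (1, z)).2) := by
  rw [sprayInv, (χ.flow_pt X.toFlowBox hz one_mem_Ioo_four).2,
    χ.fiberScale_pt (X.Φ_mem 1 one_mem_Ioo_four z hz), neg_one_smul]

theorem sprayInv_contMDiffAt {z : B × F} (hz : z ∈ X.dom) :
    ContMDiffAt 𝓙 𝓙 ∞ (sprayInv V) (χ.pt z) := by
  have h := (X.Φ_contDiffAt 1 one_mem_Ioo_four z hz).comp z
    (contDiffAt_const.prodMk contDiffAt_id)
  refine χ.contMDiffAt_of_pt (X.mem_U hz)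
    (g := fun z => ((X.Φ (1, z)).1, -(X.Φ (1, z)).2))
    (h.fst.prodMk h.snd.neg) (X.Φ_mem 1 one_mem_Ioo_four z hz) ?_
  filter_upwards [X.dom_mem_nhds hz] with z' hz' using χ.sprayInv_pt X hz'

theorem pt_mem_sprayTargetDom {z : B × F} (hz : z ∈ X.dom) : χ.pt z ∈ sprayTargetDom V := by
  filter_upwards [χ.eventually_pt (X.mem_U hz) (X.dom_mem_nhds hz)] with a ha
  obtain ⟨ha, ha'⟩ := ha
  rw [← ha']
  refine ⟨(χ.flow_pt X.toFlowBox ha one_mem_Ioo_four).1, ?_⟩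
  have hp : ContMDiff 𝓙 𝓘(ℝ, B) ∞ (TotalSpace.proj : TotalSpace F A → M) := contMDiff_proj A
  exact hp.contMDiffAt.comp _ (χ.localFlow_contMDiffAt X ha)

theorem pt_mem_sprayInvDom {z : B × F} (hz : z ∈ X.dom) : χ.pt z ∈ sprayInvDom V := by
  filter_upwards [χ.eventually_pt (X.mem_U hz) (X.dom_mem_nhds hz)] with a ha
  obtain ⟨ha, ha'⟩ := ha
  rw [← ha']
  exact ⟨(χ.flow_pt X.toFlowBox ha one_mem_Ioo_four).1, χ.sprayInv_contMDiffAt X ha⟩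

theorem pt_mem_sprayComposable_iff {za zb : B × F} (hb : zb ∈ X.dom) (ha : za ∈ X.dom) :
    (χ.pt za, χ.pt zb) ∈ sprayComposable V ↔ za.1 = (X.Φ (1, zb)).1 :=
  (and_iff_right (χ.pt_mem_sprayTargetDom X hb)).trans (χ.composable_iff X hb ha)

theorem sprayMul_pt {zb za : B × F} (hb : zb ∈ X.small) (ha : za ∈ X.small)
    (hab : za.1 = (X.Φ (1, zb)).1) :
    L.sprayMul V (χ.pt za) (χ.pt zb) = χ.pt (zb.1, X.κ (1, (zb, za))) :=
  (χ.hasUniqueProductPath_pt X hb ha hab).sprayMul_eq (χ.isProductPath_pt X hb ha hab)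

/-- In coordinates `κ` is smooth near the pair even at pairs that are not composable. It extends the
product off the fibre product, which gives smoothness within that subset. -/
theorem sprayMul_contMDiffWithinAt {zb za : B × F} (hb : zb ∈ X.small) (ha : za ∈ X.small)
    (hab : za.1 = (X.Φ (1, zb)).1) :
    ContMDiffWithinAt (ModelWithCorners.prod 𝓙 𝓙) 𝓙 ∞
      (fun p : TotalSpace F A × TotalSpace F A => L.sprayMul V p.1 p.2) (sprayComposable V)
      (χ.pt za, χ.pt zb) := by
  have haU := X.mem_U (X.small_subset_dom ha)
  have hbU := X.mem_U (X.small_subset_dom hb)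
  set ψ := extChartAt 𝓙 (zeroSection F A x₀) with hψ
  have hκ := X.κ_contDiffAt 1 (by norm_num) zb hb za ha
  have h1 : ContMDiffAt (ModelWithCorners.prod 𝓙 𝓙) 𝓘(ℝ, B × F) ∞
      (fun p : TotalSpace F A × TotalSpace F A => ψ p.1) (χ.pt za, χ.pt zb) :=
    ContMDiffAt.comp (g := ψ) (χ.pt za, χ.pt zb) (χ.chart_contMDiffAt (χ.pt_proj_mem_O haU))
      contMDiffAt_fst
  have h2 : ContMDiffAt (ModelWithCorners.prod 𝓙 𝓙) 𝓘(ℝ, B × F) ∞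
      (fun p : TotalSpace F A × TotalSpace F A => ψ p.2) (χ.pt za, χ.pt zb) :=
    ContMDiffAt.comp (g := ψ) (χ.pt za, χ.pt zb) (χ.chart_contMDiffAt (χ.pt_proj_mem_O hbU))
      contMDiffAt_snd
  have h3 : ContDiffAt ℝ ∞ (fun q : (B × F) × (B × F) => (q.2.1, X.κ (1, (q.2, q.1)))) (za, zb) :=
    contDiffAt_snd.fst.prodMk (ContDiffAt.comp (g := X.κ) (za, zb) hκ
      (contDiffAt_const.prodMk (contDiffAt_snd.prodMk contDiffAt_fst)))
  have h4 : ContMDiffAt (ModelWithCorners.prod 𝓙 𝓙) 𝓘(ℝ, B × F) ∞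
      (fun p : TotalSpace F A × TotalSpace F A => ((ψ p.2).1, X.κ (1, (ψ p.2, ψ p.1))))
      (χ.pt za, χ.pt zb) := by
    refine ContMDiffAt.comp (I' := 𝓘(ℝ, (B × F) × (B × F)))
      (g := fun q : (B × F) × (B × F) => (q.2.1, X.κ (1, (q.2, q.1))))
      (f := fun p : TotalSpace F A × TotalSpace F A => (ψ p.1, ψ p.2)) (χ.pt za, χ.pt zb) ?_
      (h1.prodMk_space h2)
    simp only [hψ, χ.chart_pt haU, χ.chart_pt hbU]
    exact h3.contMDiffAt
  have h5 : ContMDiffAt (ModelWithCorners.prod 𝓙 𝓙) 𝓙 ∞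
      (fun p : TotalSpace F A × TotalSpace F A => χ.pt ((ψ p.2).1, X.κ (1, (ψ p.2, ψ p.1))))
      (χ.pt za, χ.pt zb) := by
    refine ContMDiffAt.comp (I' := 𝓘(ℝ, B × F)) (g := χ.pt) (χ.pt za, χ.pt zb) ?_ h4
    refine χ.pt_contMDiffAt ?_
    simp only [hψ, χ.chart_pt hbU]
    exact hbU
  have hev := (χ.eventually_pt haU (X.isOpen_small.mem_nhds ha)).prod_nhds
    (χ.eventually_pt hbU (X.isOpen_small.mem_nhds hb))
  have key : ∀ p : TotalSpace F A × TotalSpace F A, p ∈ sprayComposable V →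
      (ψ p.1 ∈ X.small ∧ χ.pt (ψ p.1) = p.1) ∧ (ψ p.2 ∈ X.small ∧ χ.pt (ψ p.2) = p.2) →
      L.sprayMul V p.1 p.2 = χ.pt ((ψ p.2).1, X.κ (1, (ψ p.2, ψ p.1))) := by
    rintro p hp ⟨⟨h1, h1'⟩, h2, h2'⟩
    have hp' : (χ.pt (ψ p.1), χ.pt (ψ p.2)) ∈ sprayComposable V := by rw [h1', h2']; exact hp
    have := χ.sprayMul_pt X h2 h1 ((χ.pt_mem_sprayComposable_iff X (X.small_subset_dom h2)
      (X.small_subset_dom h1)).1 hp')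
    rwa [h1', h2'] at this
  refine h5.contMDiffWithinAt.congr_of_eventuallyEq ?_ ?_
  · filter_upwards [nhdsWithin_le_nhds hev, self_mem_nhdsWithin] with p hp hp' using key p hp' hp
  · exact key _ ((χ.pt_mem_sprayComposable_iff X (X.small_subset_dom hb)
      (X.small_subset_dom ha)).2 hab) hev.self_of_nhds

theorem pt_mem_sprayMulDom {zb za : B × F} (hb : zb ∈ X.small) (ha : za ∈ X.small)
    (hab : za.1 = (X.Φ (1, zb)).1) : (χ.pt za, χ.pt zb) ∈ L.sprayMulDom V := by
  have haU := X.mem_U (X.small_subset_dom ha)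
  have hbU := X.mem_U (X.small_subset_dom hb)
  refine ⟨?_, (χ.pt_mem_sprayComposable_iff X (X.small_subset_dom hb)
      (X.small_subset_dom ha)).2 hab⟩
  have hev := (χ.eventually_pt haU (X.isOpen_small.mem_nhds ha)).prod_nhds
    (χ.eventually_pt hbU (X.isOpen_small.mem_nhds hb))
  filter_upwards [hev]
  rintro ⟨a, b⟩ ⟨⟨h1, h1'⟩, h2, h2'⟩ hp
  simp only at h1 h1' h2 h2'
  rw [← h1', ← h2'] at hp ⊢
  have hc := (χ.pt_mem_sprayComposable_iff X (X.small_subset_dom h2)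
    (X.small_subset_dom h1)).1 hp
  exact ⟨χ.hasUniqueProductPath_pt X h2 h1 hc, χ.sprayMul_contMDiffWithinAt X h2 h1 hc⟩

end AdaptedBump

end StructureMaps

/-! ### The local groupoid of a spray -/

section LocalGroupoidOfSpray

set_option linter.unusedSectionVars false

variable {B : Type*} [NormedAddCommGroup B] [NormedSpace ℝ B]
  {M : Type*} [TopologicalSpace M] [ChartedSpace B M] [IsManifold 𝓘(ℝ, B) ∞ M]
  {F : Type*} [NormedAddCommGroup F] [NormedSpace ℝ F]
  {A : M → Type*} [TopologicalSpace (TotalSpace F A)]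
  [∀ x, TopologicalSpace (A x)] [FiberBundle F A]
  [∀ x, AddCommGroup (A x)] [∀ x, Module ℝ (A x)] [VectorBundle ℝ F A]
  [ContMDiffVectorBundle ∞ F A 𝓘(ℝ, B)]

local notation "𝓙" => ModelWithCorners.prod 𝓘(ℝ, B) 𝓘(ℝ, F)

theorem zeroSection_isClosedEmbedding [T2Space M] :
    Topology.IsClosedEmbedding (zeroSection F A) := by
  have := t2Space_totalSpace (F := F) (A := A)
  exact Function.LeftInverse.isClosedEmbedding (f := (TotalSpace.proj : TotalSpace F A → M))
    (fun _ => rfl) (FiberBundle.continuous_proj F A)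
    (Bundle.Trivialization.continuous_zeroSection ℝ)

theorem mfderiv_proj_zeroSection (x : M) (v : TangentSpace 𝓘(ℝ, B) x) :
    mfderiv 𝓙 𝓘(ℝ, B) (TotalSpace.proj : TotalSpace F A → M) (zeroSection F A x)
      (mfderiv 𝓘(ℝ, B) 𝓙 (zeroSection F A) x v) = v := by
  have hp : ContMDiff 𝓙 𝓘(ℝ, B) ∞ (TotalSpace.proj : TotalSpace F A → M) := contMDiff_proj A
  have hz : ContMDiff 𝓘(ℝ, B) 𝓙 ∞ (zeroSection F A) := Bundle.contMDiff_zeroSection ℝ A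
  have h := mfderiv_comp x (hp.mdifferentiableAt (x := zeroSection F A x) (by simp))
    (hz.mdifferentiableAt (by simp))
  have h2 : (TotalSpace.proj : TotalSpace F A → M) ∘ zeroSection F A = id := rfl
  rw [h2, mfderiv_id] at h
  exact (DFunLike.congr_fun h v).symm

theorem mfderiv_proj_surjective (a : TotalSpace F A) : Function.Surjective
    (mfderiv 𝓙 𝓘(ℝ, B) (TotalSpace.proj : TotalSpace F A → M) a) := by
  intro u
  have ha : a.proj ∈ chartNhd B F A a.proj := mem_chartNhd a.proj
  obtain ⟨v, hv⟩ := chartVec_surjective (J := 𝓙) (x₀ := zeroSection F A a.proj)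
    (mem_bundleChart_source.2 ha) (chartVec 𝓘(ℝ, B) a.proj ⟨a.proj, u⟩, (0 : F))
  refine ⟨v, chartVec_injective (J := 𝓘(ℝ, B)) (x₀ := a.proj) ha.1 ?_⟩
  rw [chartVec_mfderiv_proj ha, hv]

section Local

variable [FiniteDimensional ℝ B] [FiniteDimensional ℝ F] [T2Space M] {L : LieAlgebroid B F A}
  {V : (a : TotalSpace F A) → TangentSpace (𝓘(ℝ, B).prod 𝓘(ℝ, F)) a}

theorem exists_productBox (hV : L.IsSpray V) (x₀ : M) : ∃ χ : AdaptedBump B F A x₀,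
    Nonempty ((χ.sprayModel hV).ProductBox (extChartAt 𝓘(ℝ, B) x₀ x₀)) := by
  have := FiniteDimensional.complete ℝ B
  have := FiniteDimensional.complete ℝ F
  obtain ⟨χ⟩ := nonempty_adaptedBump (B := B) (F := F) (A := A) x₀
  exact ⟨χ, SprayModel.nonempty_productBox χ.base_mem_U⟩

/-- A property near all units can be checked in one coordinate box around each unit. The same
reduction is used below for pairs and triples. -/
theorem eventually_units (hV : L.IsSpray V) {Q : TotalSpace F A → Prop}
    (h : ∀ (x₀ : M) (χ : AdaptedBump B F A x₀)
      (_ : (χ.sprayModel hV).ProductBox (extChartAt 𝓘(ℝ, B) x₀ x₀)),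
      ∀ᶠ z in 𝓝 ((extChartAt 𝓘(ℝ, B) x₀ x₀, 0) : B × F), Q (χ.pt z)) :
    ∀ᶠ a in 𝓝ˢ (range (zeroSection F A)), Q a := by
  rw [eventually_nhdsSet_iff_forall]
  rintro _ ⟨x₀, rfl⟩
  obtain ⟨χ, ⟨X⟩⟩ := exists_productBox hV x₀
  exact χ.eventually_of_eventually_pt (h x₀ χ X)

theorem eventually_unit_pairs (hV : L.IsSpray V) {Q : TotalSpace F A × TotalSpace F A → Prop}
    (h : ∀ (x₀ : M) (χ : AdaptedBump B F A x₀)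
      (_ : (χ.sprayModel hV).ProductBox (extChartAt 𝓘(ℝ, B) x₀ x₀)),
      ∀ᶠ z in 𝓝 (((extChartAt 𝓘(ℝ, B) x₀ x₀, 0) : B × F),
        ((extChartAt 𝓘(ℝ, B) x₀ x₀, 0) : B × F)), Q (χ.pt z.1, χ.pt z.2)) :
    ∀ᶠ p in 𝓝ˢ (range fun x : M => (zeroSection F A x, zeroSection F A x)), Q p := by
  rw [eventually_nhdsSet_iff_forall]
  rintro _ ⟨x₀, rfl⟩
  obtain ⟨χ, ⟨X⟩⟩ := exists_productBox hV x₀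
  exact χ.eventually_of_eventually_pt₂ (h x₀ χ X)

theorem eventually_unit_triples (hV : L.IsSpray V)
    {Q : TotalSpace F A × TotalSpace F A × TotalSpace F A → Prop}
    (h : ∀ (x₀ : M) (χ : AdaptedBump B F A x₀)
      (_ : (χ.sprayModel hV).ProductBox (extChartAt 𝓘(ℝ, B) x₀ x₀)),
      ∀ᶠ z in 𝓝 (((extChartAt 𝓘(ℝ, B) x₀ x₀, 0) : B × F),
        ((extChartAt 𝓘(ℝ, B) x₀ x₀, 0) : B × F), ((extChartAt 𝓘(ℝ, B) x₀ x₀, 0) : B × F)),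
        Q (χ.pt z.1, χ.pt z.2.1, χ.pt z.2.2)) :
    ∀ᶠ p in 𝓝ˢ (range fun x : M => (zeroSection F A x, zeroSection F A x, zeroSection F A x)),
      Q p := by
  rw [eventually_nhdsSet_iff_forall]
  rintro _ ⟨x₀, rfl⟩
  obtain ⟨χ, ⟨X⟩⟩ := exists_productBox hV x₀
  exact χ.eventually_of_eventually_pt₃ (h x₀ χ X)

namespace AdaptedBump

variable {x₀ : M} (χ : AdaptedBump B F A x₀) {hV : L.IsSpray V}
  (X : (χ.sprayModel hV).ProductBox (extChartAt 𝓘(ℝ, B) x₀ x₀))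

theorem sprayTarget_pt {z : B × F} (hz : z ∈ X.dom) :
    sprayTarget V (χ.pt z) = (extChartAt 𝓘(ℝ, B) x₀).symm (X.Φ (1, z)).1 := χ.target_pt X hz

theorem eventually_mem_small :
    ∀ᶠ z in 𝓝 ((extChartAt 𝓘(ℝ, B) x₀ x₀, 0) : B × F), z ∈ X.small :=
  X.isOpen_small.mem_nhds X.base_mem_small

theorem eventually_Φ_mem_small :
    ∀ᶠ z in 𝓝 ((extChartAt 𝓘(ℝ, B) x₀ x₀, 0) : B × F), z ∈ X.small ∧ X.Φ (1, z) ∈ X.small := by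
  filter_upwards [χ.eventually_mem_small X, X.eventually_Φ_mem (χ.eventually_mem_small X)]
    with z hz hz' using ⟨hz, hz' 1 (by norm_num)⟩

/-- The involution of the local model: the target of the inverse is the source, and inverting
twice is the identity. -/
theorem Φ_one_inv {z : B × F} (hz : z ∈ X.small) (hz' : X.Φ (1, z) ∈ X.small) :
    X.Φ (1, ((X.Φ (1, z)).1, -(X.Φ (1, z)).2)) = (z.1, -z.2) := by
  rw [X.Φ_neg (X.small_subset_dom hz) (X.small_subset_dom (X.neg_mem_small hz')) (by norm_num),
    sub_self, X.Φ_zero z (X.small_subset_dom hz)]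

theorem Φ_one_zero {y : B} {v : F} (h : (y, v) ∈ X.small) : X.Φ (1, (y, 0)) = (y, 0) :=
  X.Φ_base (X.small_subset_dom (X.zero_mem_small h)) one_mem_Ioo_four

end AdaptedBump

theorem mem_sprayInvDom_zeroSection (hV : L.IsSpray V) (x : M) :
    zeroSection F A x ∈ sprayInvDom V := by
  obtain ⟨χ, ⟨X⟩⟩ := exists_productBox hV x
  rw [← χ.pt_base]
  exact χ.pt_mem_sprayInvDom X X.base_mem_dom

theorem mem_sprayTargetDom_zeroSection (hV : L.IsSpray V) (x : M) :
    zeroSection F A x ∈ sprayTargetDom V := by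
  obtain ⟨χ, ⟨X⟩⟩ := exists_productBox hV x
  rw [← χ.pt_base]
  exact χ.pt_mem_sprayTargetDom X X.base_mem_dom

theorem sprayInv_zeroSection (hV : L.IsSpray V) (x : M) :
    sprayInv V (zeroSection F A x) = zeroSection F A x := by
  obtain ⟨χ, ⟨X⟩⟩ := exists_productBox hV x
  rw [← χ.pt_base, χ.sprayInv_pt X X.base_mem_dom, X.Φ_base X.base_mem_dom AdaptedBump.one_mem_Ioo_four,
    neg_zero]

theorem sprayTarget_zeroSection (hV : L.IsSpray V) (x : M) :
    sprayTarget V (zeroSection F A x) = x := by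
  obtain ⟨χ, ⟨X⟩⟩ := exists_productBox hV x
  rw [← χ.pt_base, χ.sprayTarget_pt X X.base_mem_dom, X.Φ_base X.base_mem_dom AdaptedBump.one_mem_Ioo_four,
    χ.symm_chart χ.mem_O]

theorem mem_sprayMulDom_zeroSection (hV : L.IsSpray V) (x : M) :
    (zeroSection F A x, zeroSection F A x) ∈ L.sprayMulDom V := by
  obtain ⟨χ, ⟨X⟩⟩ := exists_productBox hV x
  rw [← χ.pt_base]
  exact χ.pt_mem_sprayMulDom X X.base_mem_small X.base_mem_small
    (by rw [X.Φ_base X.base_mem_dom AdaptedBump.one_mem_Ioo_four])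

theorem sprayTarget_sprayInv (hV : L.IsSpray V) : ∀ᶠ g in 𝓝ˢ (range (zeroSection F A)),
    sprayInv V g ∈ sprayTargetDom V ∧ sprayTarget V (sprayInv V g) = g.proj := by
  refine eventually_units hV fun x₀ χ X => ?_
  filter_upwards [χ.eventually_Φ_mem_small X] with z ⟨hz, hz'⟩
  have h := X.small_subset_dom (X.neg_mem_small hz')
  rw [χ.sprayInv_pt X (X.small_subset_dom hz), χ.sprayTarget_pt X h, χ.Φ_one_inv X hz hz',
    χ.pt_proj (X.mem_U (X.small_subset_dom hz))]
  exact ⟨χ.pt_mem_sprayTargetDom X h, rfl⟩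

theorem sprayInv_sprayInv (hV : L.IsSpray V) : ∀ᶠ g in 𝓝ˢ (range (zeroSection F A)),
    sprayInv V g ∈ sprayInvDom V ∧ sprayInv V (sprayInv V g) = g := by
  refine eventually_units hV fun x₀ χ X => ?_
  filter_upwards [χ.eventually_Φ_mem_small X] with z ⟨hz, hz'⟩
  have h := X.small_subset_dom (X.neg_mem_small hz')
  rw [χ.sprayInv_pt X (X.small_subset_dom hz), χ.sprayInv_pt X h, χ.Φ_one_inv X hz hz', neg_neg]
  exact ⟨χ.pt_mem_sprayInvDom X h, rfl⟩

theorem proj_sprayMul (hV : L.IsSpray V) :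
    ∀ᶠ p in 𝓝ˢ (range fun x : M => (zeroSection F A x, zeroSection F A x)),
      p ∈ L.sprayMulDom V → (L.sprayMul V p.1 p.2).proj = p.2.proj := by
  refine eventually_unit_pairs hV fun x₀ χ X => ?_
  have h := χ.eventually_mem_small X
  filter_upwards [h.prod_nhds h] with z ⟨ha, hb⟩ hp
  have hb' := X.small_subset_dom hb
  have hc := (χ.pt_mem_sprayComposable_iff X hb' (X.small_subset_dom ha)).1 hp.2
  change (L.sprayMul V (χ.pt z.1) (χ.pt z.2)).proj = (χ.pt z.2).proj
  rw [χ.sprayMul_pt X hb ha hc, χ.pt_proj (X.mem_U hb')]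
  have hU : z.2.1 ∈ χ.U := X.mem_U hb'
  exact χ.pt_proj (z := (z.2.1, X.κ (1, (z.2, z.1)))) hU

theorem sprayTarget_sprayMul (hV : L.IsSpray V) :
    ∀ᶠ p in 𝓝ˢ (range fun x : M => (zeroSection F A x, zeroSection F A x)),
      p ∈ L.sprayMulDom V → p.1 ∈ sprayTargetDom V ∧ L.sprayMul V p.1 p.2 ∈ sprayTargetDom V ∧
        sprayTarget V (L.sprayMul V p.1 p.2) = sprayTarget V p.1 := by
  refine eventually_unit_pairs hV fun x₀ χ X => ?_
  have h := χ.eventually_mem_small X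
  filter_upwards [h.prod_nhds h] with z ⟨ha, hb⟩ hp
  have hb' := X.small_subset_dom hb
  have ha' := X.small_subset_dom ha
  have hc := (χ.pt_mem_sprayComposable_iff X hb' ha').1 hp.2
  have hκ := X.κ_mem 1 (by norm_num) z.2 hb z.1 ha
  change χ.pt z.1 ∈ _ ∧ L.sprayMul V (χ.pt z.1) (χ.pt z.2) ∈ _ ∧
    sprayTarget V (L.sprayMul V (χ.pt z.1) (χ.pt z.2)) = sprayTarget V (χ.pt z.1)
  rw [χ.sprayMul_pt X hb ha hc, χ.sprayTarget_pt X ha']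
  refine ⟨χ.pt_mem_sprayTargetDom X ha', χ.pt_mem_sprayTargetDom X hκ, ?_⟩
  rw [χ.sprayTarget_pt X hκ]
  exact congrArg _ (X.target_κ hb ha hc ⟨zero_le_one, le_rfl⟩)

/-- Besides `κ_assoc` this needs the partial products to remain in the small ball, for all times in
the case of the path from `b` to the product of `a` and `b`; `eventually_κ_mem` provides it near the
units. -/
theorem sprayMul_assoc (hV : L.IsSpray V) :
    ∀ᶠ p in 𝓝ˢ (range fun x : M => (zeroSection F A x, zeroSection F A x, zeroSection F A x)),
      (p.1, p.2.1) ∈ L.sprayMulDom V → (p.2.1, p.2.2) ∈ L.sprayMulDom V →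
      (L.sprayMul V p.1 p.2.1, p.2.2) ∈ L.sprayMulDom V ∧
        (p.1, L.sprayMul V p.2.1 p.2.2) ∈ L.sprayMulDom V ∧
        L.sprayMul V (L.sprayMul V p.1 p.2.1) p.2.2
          = L.sprayMul V p.1 (L.sprayMul V p.2.1 p.2.2) := by
  have := FiniteDimensional.complete ℝ F
  refine eventually_unit_triples hV fun x₀ χ X => ?_
  have h := χ.eventually_mem_small X
  have hκ := X.eventually_κ_mem (χ.eventually_mem_small X)
  set z : B × F := (extChartAt 𝓘(ℝ, B) x₀ x₀, 0)
  have hκ₁ : ∀ᶠ z in 𝓝 (((extChartAt 𝓘(ℝ, B) x₀ x₀, 0) : B × F),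
      ((extChartAt 𝓘(ℝ, B) x₀ x₀, 0) : B × F), ((extChartAt 𝓘(ℝ, B) x₀ x₀, 0) : B × F)),
      ∀ t ∈ Icc (0 : ℝ) 1, (z.2.1.1, X.κ (t, (z.2.1, z.1))) ∈ X.small :=
    (Continuous.tendsto' (f := fun z : (B × F) × (B × F) × (B × F) => (z.2.1, z.1))
      (by fun_prop) (z, z, z) (z, z) rfl).eventually hκ
  have hκ₂ : ∀ᶠ z in 𝓝 (((extChartAt 𝓘(ℝ, B) x₀ x₀, 0) : B × F),
      ((extChartAt 𝓘(ℝ, B) x₀ x₀, 0) : B × F), ((extChartAt 𝓘(ℝ, B) x₀ x₀, 0) : B × F)),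
      ∀ t ∈ Icc (0 : ℝ) 1, (z.2.2.1, X.κ (t, (z.2.2, z.2.1))) ∈ X.small :=
    (Continuous.tendsto' (f := fun z : (B × F) × (B × F) × (B × F) => (z.2.2, z.2.1))
      (by fun_prop) (z, z, z) (z, z) rfl).eventually hκ
  have h1 : (1 : ℝ) ∈ Icc (0 : ℝ) 1 := ⟨zero_le_one, le_rfl⟩
  filter_upwards [h.prod_nhds (h.prod_nhds h), hκ₁, hκ₂]
    with z ⟨ha, hb, hc⟩ hba hcb hp hq
  obtain ⟨a, b, c⟩ := z
  simp only at ha hb hc hba hcb hp hq ⊢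
  have hab := (χ.pt_mem_sprayComposable_iff X (X.small_subset_dom hb)
    (X.small_subset_dom ha)).1 hp.2
  have hbc := (χ.pt_mem_sprayComposable_iff X (X.small_subset_dom hc)
    (X.small_subset_dom hb)).1 hq.2
  have htarget : a.1 = (X.Φ (1, (c.1, X.κ (1, (c, b))))).1 :=
    hab.trans (X.target_κ hc hb hbc h1).symm
  rw [χ.sprayMul_pt X hb ha hab, χ.sprayMul_pt X hc hb hbc,
    χ.sprayMul_pt X hc (hba 1 h1) hbc, χ.sprayMul_pt X (hcb 1 h1) ha htarget]
  refine ⟨χ.pt_mem_sprayMulDom X hc (hba 1 h1) hbc, χ.pt_mem_sprayMulDom X (hcb 1 h1) ha htarget,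
    χ.pt_ext rfl ?_⟩
  exact X.κ_assoc ha hb hc hbc hba (hcb 1 h1)

theorem zeroSection_sprayMul (hV : L.IsSpray V) : ∀ᶠ g in 𝓝ˢ (range (zeroSection F A)),
    (zeroSection F A (sprayTarget V g), g) ∈ L.sprayMulDom V ∧
      L.sprayMul V (zeroSection F A (sprayTarget V g)) g = g := by
  have := FiniteDimensional.complete ℝ F
  refine eventually_units hV fun x₀ χ X => ?_
  filter_upwards [χ.eventually_Φ_mem_small X] with z ⟨hz, hz'⟩
  have h0 := X.zero_mem_small (x := (X.Φ (1, z)).1) (a := (X.Φ (1, z)).2) hz'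
  rw [χ.sprayTarget_pt X (X.small_subset_dom hz), ← χ.pt_zero (X.mem_U (X.small_subset_dom hz')),
    χ.sprayMul_pt X hz h0 rfl, X.κ_unit_left hz h0 ⟨zero_le_one, le_rfl⟩]
  exact ⟨χ.pt_mem_sprayMulDom X hz h0 rfl, rfl⟩

theorem sprayMul_zeroSection (hV : L.IsSpray V) : ∀ᶠ g in 𝓝ˢ (range (zeroSection F A)),
    (g, zeroSection F A g.proj) ∈ L.sprayMulDom V ∧
      L.sprayMul V g (zeroSection F A g.proj) = g := by
  have := FiniteDimensional.complete ℝ F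
  refine eventually_units hV fun x₀ χ X => ?_
  filter_upwards [χ.eventually_mem_small X] with ⟨y, v⟩ hz
  have hU := X.mem_U (X.small_subset_dom hz)
  have h0 := X.zero_mem_small hz
  have hc : y = (X.Φ (1, (y, 0))).1 := by rw [χ.Φ_one_zero X hz]
  rw [χ.pt_proj hU, ← χ.pt_zero hU, χ.sprayMul_pt X h0 hz hc,
    X.κ_unit_right hz ⟨zero_le_one, le_rfl⟩, one_smul]
  exact ⟨χ.pt_mem_sprayMulDom X h0 hz hc, rfl⟩

theorem sprayMul_sprayInv (hV : L.IsSpray V) : ∀ᶠ g in 𝓝ˢ (range (zeroSection F A)),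
    (g, sprayInv V g) ∈ L.sprayMulDom V ∧
      L.sprayMul V g (sprayInv V g) = zeroSection F A (sprayTarget V g) := by
  have := FiniteDimensional.complete ℝ F
  refine eventually_units hV fun x₀ χ X => ?_
  filter_upwards [χ.eventually_Φ_mem_small X] with z ⟨hz, hz'⟩
  have hd := X.small_subset_dom hz
  have hn := X.neg_mem_small (y := (X.Φ (1, z)).1) (v := (X.Φ (1, z)).2) hz'
  have hi := χ.Φ_one_inv X hz hz'
  have hc : z.1 = (X.Φ (1, ((X.Φ (1, z)).1, -(X.Φ (1, z)).2))).1 := by rw [hi]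
  -- `κ_inverse` treats the product of an inverse with its argument. For the opposite order it is
  -- applied to the inverse, whose own inverse is `z` by `Φ_one_inv`.
  have hκ := X.κ_inverse (x := (X.Φ (1, z)).1) (a := -(X.Φ (1, z)).2) hn
    (by rw [hi, neg_neg]; exact hz) (t := 1) ⟨zero_le_one, le_rfl⟩
  rw [hi, neg_neg, sub_self, zero_smul] at hκ
  rw [χ.sprayInv_pt X hd, χ.sprayMul_pt X hn hz hc, χ.sprayTarget_pt X hd,
    ← χ.pt_zero (X.mem_U (X.small_subset_dom hz'))]
  exact ⟨χ.pt_mem_sprayMulDom X hn hz hc, χ.pt_ext rfl hκ⟩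

theorem sprayInv_sprayMul (hV : L.IsSpray V) : ∀ᶠ g in 𝓝ˢ (range (zeroSection F A)),
    (sprayInv V g, g) ∈ L.sprayMulDom V ∧
      L.sprayMul V (sprayInv V g) g = zeroSection F A g.proj := by
  have := FiniteDimensional.complete ℝ F
  refine eventually_units hV fun x₀ χ X => ?_
  filter_upwards [χ.eventually_Φ_mem_small X] with z ⟨hz, hz'⟩
  have hd := X.small_subset_dom hz
  have hn := X.neg_mem_small (y := (X.Φ (1, z)).1) (v := (X.Φ (1, z)).2) hz'
  have hκ := X.κ_inverse (x := z.1) (a := z.2) hz hn (t := 1) ⟨zero_le_one, le_rfl⟩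
  rw [sub_self, zero_smul] at hκ
  rw [χ.sprayInv_pt X hd, χ.sprayMul_pt X hz hn rfl, χ.pt_proj (X.mem_U hd),
    ← χ.pt_zero (X.mem_U hd)]
  exact ⟨χ.pt_mem_sprayMulDom X hz hn rfl, χ.pt_ext rfl hκ⟩

/-- The local Lie groupoid of a Lie algebroid spray. -/
noncomputable def LieAlgebroid.IsSpray.localGroupoid (hV : L.IsSpray V) :
    LocalLieGroupoid (𝓘(ℝ, B).prod 𝓘(ℝ, F)) 𝓘(ℝ, B)
      (zeroSection F A) (TotalSpace.proj : TotalSpace F A → M) where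
  unit_isClosedEmbedding := zeroSection_isClosedEmbedding
  unit_smooth := Bundle.contMDiff_zeroSection ℝ A
  unit_immersion x := Function.LeftInverse.injective
    (g := mfderiv 𝓙 𝓘(ℝ, B) (TotalSpace.proj : TotalSpace F A → M) (zeroSection F A x))
    (mfderiv_proj_zeroSection x)
  source_smooth := contMDiff_proj A
  source_submersion := mfderiv_proj_surjective
  source_unit _ := rfl
  target := sprayTarget V
  targetDom := sprayTargetDom V
  isOpen_targetDom := isOpen_setOfPred_eventually_nhds
  unit_mem_targetDom := mem_sprayTargetDom_zeroSection hV
  target_smooth _ ha := ha.self_of_nhds.2.contMDiffWithinAt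
  target_unit := sprayTarget_zeroSection hV
  inv := sprayInv V
  invDom := sprayInvDom V
  isOpen_invDom := isOpen_setOfPred_eventually_nhds
  unit_mem_invDom := mem_sprayInvDom_zeroSection hV
  inv_smooth _ ha := ha.self_of_nhds.2.contMDiffWithinAt
  mul := L.sprayMul V
  mulDom := L.sprayMulDom V
  mulDom_relatively_open := ⟨L.sprayMulOpen V, isOpen_setOfPred_eventually_nhds, rfl⟩
  unit_mem_mulDom := mem_sprayMulDom_zeroSection hV
  mul_smooth _ hp := (hp.1.self_of_nhds hp.2).2.mono inter_subset_right
  source_inv := Eventually.of_forall fun _ => rfl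
  target_inv := sprayTarget_sprayInv hV
  inv_unit := sprayInv_zeroSection hV
  inv_inv := sprayInv_sprayInv hV
  source_mul := proj_sprayMul hV
  target_mul := sprayTarget_sprayMul hV
  mul_assoc := sprayMul_assoc hV
  unit_mul := zeroSection_sprayMul hV
  mul_unit := sprayMul_zeroSection hV
  mul_inv := sprayMul_sprayInv hV
  inv_mul := sprayInv_sprayMul hV

theorem eventually_hasUniqueProductPath (hV : L.IsSpray V) :
    ∀ᶠ p in 𝓝ˢ (range fun x : M => (zeroSection F A x, zeroSection F A x)),
      p.1.proj = (localFlow V 1 p.2).proj → L.HasUniqueProductPath V p.1 p.2 := by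
  refine eventually_unit_pairs hV fun x₀ χ X => ?_
  have h := χ.eventually_mem_small X
  filter_upwards [h.prod_nhds h] with z ⟨ha, hb⟩ hp
  exact χ.hasUniqueProductPath_pt X hb ha
    ((χ.composable_iff X (X.small_subset_dom hb) (X.small_subset_dom ha)).1 hp)

end Local

end LocalGroupoidOfSpray

/-! ### The Maurer-Cartan form -/

section MaurerCartanForm

set_option linter.unusedSectionVars false

variable {B : Type*} [NormedAddCommGroup B] [NormedSpace ℝ B]
  {M : Type*} [TopologicalSpace M] [ChartedSpace B M] [IsManifold 𝓘(ℝ, B) ∞ M]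
  {F : Type*} [NormedAddCommGroup F] [NormedSpace ℝ F]
  {A : M → Type*} [TopologicalSpace (TotalSpace F A)]
  [∀ x, TopologicalSpace (A x)] [FiberBundle F A]
  [∀ x, AddCommGroup (A x)] [∀ x, Module ℝ (A x)] [VectorBundle ℝ F A]
  [ContMDiffVectorBundle ∞ F A 𝓘(ℝ, B)]

local notation "𝓙" => ModelWithCorners.prod 𝓘(ℝ, B) 𝓘(ℝ, F)

theorem curveVelocity_congr {EN : Type*} [NormedAddCommGroup EN] [NormedSpace ℝ EN]
    {HN : Type*} [TopologicalSpace HN] {J : ModelWithCorners ℝ EN HN}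
    {N : Type*} [TopologicalSpace N] [ChartedSpace HN N] {c c' : ℝ → N} {t : ℝ}
    (h : c =ᶠ[𝓝 t] c') : curveVelocity J c t = curveVelocity J c' t :=
  TotalSpace.ext h.eq_of_nhds (heq_of_eq (DFunLike.congr_fun (h.mfderiv_eq (I := 𝓘(ℝ, ℝ))
    (I' := J)) (1 : ℝ)))

/-- The two sides have base points `0` and `0 • e`, which agree only after rewriting. -/
theorem verticalLift_eq_curveVelocity (x : M) (e : A x) :
    (⟨zeroSection F A x, verticalLift B F x e⟩ : TangentBundle 𝓙 (TotalSpace F A))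
      = curveVelocity 𝓙 (fun t : ℝ => (⟨x, t • e⟩ : TotalSpace F A)) 0 := by
  refine TotalSpace.ext ?_ HEq.rfl
  change (⟨x, 0⟩ : TotalSpace F A) = ⟨x, (0 : ℝ) • e⟩
  rw [zero_smul]

namespace AdaptedBump

variable [FiniteDimensional ℝ F] {x₀ : M} (χ : AdaptedBump B F A x₀)

theorem chartVec_verticalLift {x : M} (hx : x ∈ χ.O) (e : A x) :
    chartVec 𝓙 (zeroSection F A x₀) ⟨zeroSection F A x, verticalLift B F x e⟩
      = (0, fiberCoord F A x₀ x e) := by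
  have hU := χ.chart_mem_U hx
  have h : (fun t : ℝ => (⟨x, t • e⟩ : TotalSpace F A))
      = fun t => χ.pt (extChartAt 𝓘(ℝ, B) x₀ x, t • fiberCoord F A x₀ x e) := by
    funext t
    refine (χ.eq_pt_of_proj_eq (a := ⟨x, t • e⟩) hU (χ.symm_chart hx).symm).trans ?_
    exact χ.pt_ext rfl (map_smul (fiberCoord F A x₀ x) t e)
  rw [verticalLift_eq_curveVelocity, h]
  refine (χ.curveVelocity_pt ((hasDerivAt_const (0 : ℝ) _).prodMk
    ((hasDerivAt_id (0 : ℝ)).smul_const _)) hU).2.trans ?_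
  rw [one_smul]

/-- Paths in a source fibre, in coordinates. -/
theorem isSourcePath_coord {z : B × F} (hz : z.1 ∈ χ.U) {c : ℝ → TotalSpace F A}
    (hc : IsSourcePath 𝓙 (TotalSpace.proj : TotalSpace F A → M) (χ.pt z) c) :
    ∃ (m : ℝ → F) (m' : F), m 0 = z.2 ∧ HasDerivAt m m' 0 ∧ (∀ᶠ t in 𝓝 0, c t = χ.pt (z.1, m t)) ∧
      chartVec 𝓙 (zeroSection F A x₀) (curveVelocity 𝓙 c 0) = (0, m') := by
  obtain ⟨h0, hc⟩ := hc
  set m : ℝ → F := fun t => fiberCoord F A x₀ (c t).proj (c t).2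
  have hcm : ∀ᶠ t in 𝓝 0, c t = χ.pt (z.1, m t) := by
    filter_upwards [hc] with t ht
    exact χ.eq_pt_of_proj_eq hz (ht.2.trans (χ.pt_proj hz))
  have hm : ContDiffAt ℝ ∞ m 0 :=
    (contMDiffAt_fiberCoord (x₀ := x₀) hc.self_of_nhds.1 (by
      rw [h0]; exact χ.O_subset (χ.pt_proj_mem_O hz))).contDiffAt
  have hm' := (hm.differentiableAt (by simp)).hasDerivAt
  refine ⟨m, deriv m 0, ?_, hm', hcm, ?_⟩
  · have h : χ.pt (z.1, m 0) = χ.pt z := hcm.self_of_nhds.symm.trans h0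
    exact congrArg Prod.snd (χ.pt_injective (z := (z.1, m 0)) hz hz h)
  · rw [curveVelocity_congr hcm]
    exact (χ.curveVelocity_pt ((hasDerivAt_const (0 : ℝ) z.1).prodMk hm') hz).2

variable [FiniteDimensional ℝ B] [T2Space M] {L : LieAlgebroid B F A}
  {V : (a : TotalSpace F A) → TangentSpace (𝓘(ℝ, B).prod 𝓘(ℝ, F)) a} {hV : L.IsSpray V}
  (X : (χ.sprayModel hV).ProductBox (extChartAt 𝓘(ℝ, B) x₀ x₀))

/-- The velocity of a product `c(t) b`. -/
theorem sprayMul_path {zb za : B × F} (hb : zb ∈ X.small) (ha : za ∈ X.small)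
    (hab : za.1 = (X.Φ (1, zb)).1) {c : ℝ → TotalSpace F A} {m : ℝ → F} {m' : F}
    (hm0 : m 0 = za.2) (hm : HasDerivAt m m' 0) (hc : ∀ᶠ t in 𝓝 0, c t = χ.pt (za.1, m t)) :
    MDifferentiableAt 𝓘(ℝ, ℝ) 𝓙 (fun t => L.sprayMul V (c t) (χ.pt zb)) 0 ∧
    (curveVelocity 𝓙 (fun t => L.sprayMul V (c t) (χ.pt zb)) 0).proj
      = χ.pt (zb.1, X.κ (1, (zb, za))) ∧
    ∃ d, X.Θ (zb.1, X.κ (1, (zb, za))) d = X.Θ za m' ∧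
      chartVec 𝓙 (zeroSection F A x₀)
        (curveVelocity 𝓙 (fun t => L.sprayMul V (c t) (χ.pt zb)) 0) = (0, d) := by
  have := FiniteDimensional.complete ℝ F
  have hbU : zb.1 ∈ χ.U := X.mem_U (X.small_subset_dom hb)
  have hza : (za.1, m 0) = za := by rw [hm0]
  have hcurve : HasDerivAt (fun t => (za.1, m t)) (0, m') (0 : ℝ) :=
    (hasDerivAt_const (0 : ℝ) za.1).prodMk hm
  have hsmall : ∀ᶠ t in 𝓝 (0 : ℝ), (za.1, m t) ∈ X.small :=
    hcurve.continuousAt.preimage_mem_nhds (X.isOpen_small.mem_nhds (by rw [hza]; exact ha))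
  have hmul : (fun t => L.sprayMul V (c t) (χ.pt zb))
      =ᶠ[𝓝 0] fun t => χ.pt (zb.1, X.κ (1, (zb, (za.1, m t)))) := by
    filter_upwards [hc, hsmall] with t ht ht'
    rw [ht]
    exact χ.sprayMul_pt X hb ht' hab
  have hκ : HasDerivAt (fun t => X.κ (1, (zb, (za.1, m t))))
      (fderiv ℝ X.κ (1, (zb, za)) (0, (0, (0, m')))) (0 : ℝ) := by
    have h1 : HasFDerivAt X.κ (fderiv ℝ X.κ (1, (zb, za))) (1, (zb, (za.1, m 0))) := by
      rw [hza]
      exact ((X.κ_contDiffAt 1 (by norm_num) zb hb za ha).differentiableAt (by simp)).hasFDerivAt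
    exact h1.comp_hasDerivAt (0 : ℝ) ((hasDerivAt_const (0 : ℝ) (1 : ℝ)).prodMk
      ((hasDerivAt_const (0 : ℝ) zb).prodMk hcurve))
  have hvel := χ.curveVelocity_pt ((hasDerivAt_const (0 : ℝ) zb.1).prodMk hκ) hbU
  -- The velocity `d` of the translated path is not computed itself. Right invariance determines its
  -- image under `Θ`, which suffices because `Θ` is invertible.
  refine ⟨hvel.1.congr_of_eventuallyEq hmul, ?_, _,
    X.Θ_fderiv_κ hb ha hab ⟨zero_le_one, le_rfl⟩ m', ?_⟩
  · rw [curveVelocity_congr hmul]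
    change χ.pt (zb.1, X.κ (1, (zb, (za.1, m 0)))) = _
    rw [hza]
  · rw [curveVelocity_congr hmul]
    exact hvel.2

end AdaptedBump

variable [FiniteDimensional ℝ B] [FiniteDimensional ℝ F] [T2Space M] {L : LieAlgebroid B F A}
  {V : (a : TotalSpace F A) → TangentSpace (𝓘(ℝ, B).prod 𝓘(ℝ, F)) a}

/-- The Maurer-Cartan form of the local groupoid of a spray is the realization form. -/
theorem isMaurerCartanForm_verticalRealizationForm (hV : L.IsSpray V) :
    hV.localGroupoid.IsMaurerCartanForm (L.verticalRealizationForm V) := by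
  have := FiniteDimensional.complete ℝ F
  refine eventually_units hV fun x₀ χ X => ?_
  filter_upwards [χ.eventually_Φ_mem_small X] with z ⟨hz, hz'⟩ c hc
  have hd := X.small_subset_dom hz
  have hn := X.neg_mem_small (y := (X.Φ (1, z)).1) (v := (X.Φ (1, z)).2) hz'
  have hyU : (X.Φ (1, z)).1 ∈ χ.U := X.mem_U (X.small_subset_dom hz')
  have hi := χ.Φ_one_inv X hz hz'
  have hcomp : z.1 = (X.Φ (1, ((X.Φ (1, z)).1, -(X.Φ (1, z)).2))).1 := by rw [hi]
  have hκ := X.κ_inverse (x := (X.Φ (1, z)).1) (a := -(X.Φ (1, z)).2) hn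
    (by rw [hi, neg_neg]; exact hz) (t := 1) ⟨zero_le_one, le_rfl⟩
  rw [hi, neg_neg, sub_self, zero_smul] at hκ
  obtain ⟨m, m', hm0, hm, hcm, hvel⟩ := χ.isSourcePath_coord (X.mem_U hd) hc
  obtain ⟨h1, h2, d, hd1, hd2⟩ := χ.sprayMul_path X hn hz hcomp hm0 hm hcm
  -- The translated path passes through a unit at time zero, where `Θ` is the identity. Right
  -- invariance then identifies its velocity with `Θ z m'`.
  have hdd : d = X.Θ z m' := by
    have h0 : X.Θ ((X.Φ (1, z)).1, 0) = ContinuousLinearMap.id ℝ F :=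
      X.Θ_zero (X.small_subset_dom (X.zero_mem_small (a := (X.Φ (1, z)).2) hz'))
    change X.Θ ((X.Φ (1, z)).1, X.κ (1, (_, z))) d = _ at hd1
    rw [hκ, h0] at hd1
    exact hd1
  change MDifferentiableAt 𝓘(ℝ, ℝ) 𝓙 (fun t => L.sprayMul V (c t) (sprayInv V (χ.pt z))) 0 ∧
    L.verticalRealizationForm V (curveVelocity 𝓙 c 0)
      = curveVelocity 𝓙 (fun t => L.sprayMul V (c t) (sprayInv V (χ.pt z))) 0
  rw [χ.sprayInv_pt X hd]
  refine ⟨h1, ?_⟩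
  have hreal := χ.realizationForm_of_eq_pt X.toRealizationBox hd
    (p := curveVelocity 𝓙 c 0) hc.1 hvel
  have hproj : (χ.pt ((X.Φ (1, z)).1, X.Θ z m')).proj
      = (extChartAt 𝓘(ℝ, B) x₀).symm (X.Φ (1, z)).1 :=
    χ.pt_proj (z := ((X.Φ (1, z)).1, X.Θ z m')) hyU
  have hO : (χ.pt ((X.Φ (1, z)).1, X.Θ z m')).proj ∈ χ.O :=
    χ.pt_proj_mem_O (z := ((X.Φ (1, z)).1, X.Θ z m')) hyU
  rw [LieAlgebroid.verticalRealizationForm, hreal]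
  refine tangentBundle_ext (J := 𝓙) (x₀ := zeroSection F A x₀)
    (χ.mem_source_of_mem_O hO) ?_ ?_
  · refine Eq.trans ?_ h2.symm
    change zeroSection F A (χ.pt ((X.Φ (1, z)).1, X.Θ z m')).proj
      = χ.pt ((X.Φ (1, z)).1, X.κ (1, (_, z)))
    rw [hκ, hproj, χ.pt_zero hyU]
  · rw [hd2, χ.chartVec_verticalLift hO, hdd]
    exact congrArg _ (χ.fiberCoord_pt (z := ((X.Φ (1, z)).1, X.Θ z m')) hyU)

end MaurerCartanForm

/-! ### The Lie algebroid of the local groupoid -/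

section Integration

open scoped OperatorNorm

set_option linter.unusedSectionVars false

variable {B : Type*} [NormedAddCommGroup B] [NormedSpace ℝ B]
  {M : Type*} [TopologicalSpace M] [ChartedSpace B M] [IsManifold 𝓘(ℝ, B) ∞ M]
  {F : Type*} [NormedAddCommGroup F] [NormedSpace ℝ F]
  {A : M → Type*} [TopologicalSpace (TotalSpace F A)]
  [∀ x, TopologicalSpace (A x)] [FiberBundle F A]
  [∀ x, AddCommGroup (A x)] [∀ x, Module ℝ (A x)] [VectorBundle ℝ F A]
  [ContMDiffVectorBundle ∞ F A 𝓘(ℝ, B)]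

local notation "𝓙" => ModelWithCorners.prod 𝓘(ℝ, B) 𝓘(ℝ, F)

theorem contMDiffAt_of_chartVec {EN : Type*} [NormedAddCommGroup EN] [NormedSpace ℝ EN]
    {HN : Type*} [TopologicalSpace HN] {J : ModelWithCorners ℝ EN HN} [J.Boundaryless]
    {N : Type*} [TopologicalSpace N] [ChartedSpace HN N] [IsManifold J ∞ N]
    {E' : Type*} [NormedAddCommGroup E'] [NormedSpace ℝ E']
    {H' : Type*} [TopologicalSpace H'] {I' : ModelWithCorners ℝ E' H'}
    {P : Type*} [TopologicalSpace P] [ChartedSpace H' P] {g : P → TangentBundle J N} {x : P}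
    {x₀ : N} (hx : (g x).1 ∈ (extChartAt J x₀).source)
    (hb : ContMDiffAt I' J ∞ (fun y => (g y).1) x)
    (hg : ContMDiffAt I' 𝓘(ℝ, EN) ∞ (fun y => chartVec J x₀ (g y)) x) :
    ContMDiffAt I' J.tangent ∞ g x := by
  rw [extChartAt_source] at hx
  refine ((trivializationAt EN (TangentSpace J) x₀).contMDiffAt_iff
    ((trivializationAt EN (TangentSpace J) x₀).mem_source.2 hx)).2 ⟨hb, ?_⟩
  refine hg.congr_of_eventuallyEq ?_
  filter_upwards [hb.continuousAt ((chartAt HN x₀).open_source.mem_nhds hx)] with y hy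
  have h3 := DFunLike.congr_fun
    (TangentBundle.continuousLinearMapAt_trivializationAt (I := J) (x := (g y).1) hy) (g y).2
  exact (h3.symm.trans (congrFun (Trivialization.coe_linearMapAt_of_mem (R := ℝ)
    (trivializationAt EN (TangentSpace J) x₀) (b := (g y).1) hy) (g y).2)).symm

/-- The Lie bracket of vector fields in a chart. -/
theorem chartVec_mlieBracket {EN : Type*} [NormedAddCommGroup EN] [NormedSpace ℝ EN]
    {HN : Type*} [TopologicalSpace HN] {J : ModelWithCorners ℝ EN HN} [J.Boundaryless]
    {N : Type*} [TopologicalSpace N] [ChartedSpace HN N] [IsManifold J ∞ N]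
    {X Y : (a : N) → TangentSpace J a} {x : N} {X' Y' : EN → EN}
    (hX : ∀ᶠ z in 𝓝 (extChartAt J x x), chartVec J x
      ⟨(extChartAt J x).symm z, X ((extChartAt J x).symm z)⟩ = X' z)
    (hY : ∀ᶠ z in 𝓝 (extChartAt J x x), chartVec J x
      ⟨(extChartAt J x).symm z, Y ((extChartAt J x).symm z)⟩ = Y' z) :
    chartVec J x ⟨x, VectorField.mlieBracket J X Y x⟩
      = fderiv ℝ Y' (extChartAt J x x) (X' (extChartAt J x x))
        - fderiv ℝ X' (extChartAt J x x) (Y' (extChartAt J x x)) := by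
  -- The bracket on a manifold is defined by pulling the fields back along the inverse chart; the
  -- pullbacks are the coordinate expressions given by `chartVec`.
  have hpull : ∀ {Z : (a : N) → TangentSpace J a} {Z' : EN → EN},
      (∀ᶠ z in 𝓝 (extChartAt J x x), chartVec J x
        ⟨(extChartAt J x).symm z, Z ((extChartAt J x).symm z)⟩ = Z' z) →
      VectorField.mpullbackWithin 𝓘(ℝ, EN) J (extChartAt J x).symm Z (range J)
        =ᶠ[𝓝 (extChartAt J x x)] Z' := by
    intro Z Z' hZ
    filter_upwards [hZ, (isOpen_extChartAt_target x).mem_nhds (mem_extChartAt_target x)]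
      with z hz ht
    have hinv : (mfderiv 𝓘(ℝ, EN) J (extChartAt J x).symm z).IsInvertible := by
      have := isInvertible_mfderivWithin_extChartAt_symm (I := J) ht
      rwa [J.range_eq_univ, mfderivWithin_univ] at this
    rw [VectorField.mpullbackWithin_apply, J.range_eq_univ, mfderivWithin_univ,
      ← mfderiv_symm_chartVec ht hz]
    exact hinv.inverse_apply_eq.2 rfl
  let P : ((a : N) → TangentSpace J a) → EN → EN := fun Z =>
    VectorField.mpullbackWithin 𝓘(ℝ, EN) J (extChartAt J x).symm Z (range J)
  have hPX : P X =ᶠ[𝓝 (extChartAt J x x)] X' := hpull hX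
  have hPY : P Y =ᶠ[𝓝 (extChartAt J x x)] Y' := hpull hY
  have key : VectorField.lieBracketWithin ℝ (P X) (P Y)
      ((extChartAt J x).symm ⁻¹' univ ∩ range J) (extChartAt J x x)
        = fderiv ℝ Y' (extChartAt J x x) (X' (extChartAt J x x))
          - fderiv ℝ X' (extChartAt J x x) (Y' (extChartAt J x x)) := by
    rw [preimage_univ, univ_inter, J.range_eq_univ, VectorField.lieBracketWithin_univ,
      VectorField.lieBracket, hPX.fderiv_eq, hPY.fderiv_eq, hPX.eq_of_nhds, hPY.eq_of_nhds]
  rw [← key]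
  exact ((isInvertible_mfderiv_extChartAt (mem_extChartAt_source x)).inverse_apply_eq.1 rfl).symm

namespace AdaptedBump

variable [FiniteDimensional ℝ F] {x₀ : M} (χ : AdaptedBump B F A x₀)
  [FiniteDimensional ℝ B] [T2Space M] {L : LieAlgebroid B F A}
  {V : (a : TotalSpace F A) → TangentSpace (𝓘(ℝ, B).prod 𝓘(ℝ, F)) a} {hV : L.IsSpray V}
  (X : (χ.sprayModel hV).ProductBox (extChartAt 𝓘(ℝ, B) x₀ x₀))

/-- The fibre component of the right invariant extension of a section, in coordinates. -/
noncomputable def rightInvCoord (α : Cₛ^∞⟮𝓘(ℝ, B); F, A⟯) (z : B × F) : F :=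
  (X.Θ z).inverse (χ.sectionCoord α (X.Φ (1, z)).1)

theorem rightInvCoord_contDiffAt (α : Cₛ^∞⟮𝓘(ℝ, B); F, A⟯) {z : B × F} (hz : z ∈ X.dom) :
    ContDiffAt ℝ ∞ (χ.rightInvCoord X α) z := by
  have := FiniteDimensional.complete ℝ F
  have hΦ := (X.Φ_contDiffAt 1 one_mem_Ioo_four z hz).comp z
    (contDiffAt_const.prodMk contDiffAt_id)
  have hα : ContDiffAt ℝ ∞ (χ.sectionCoord α) (X.Φ (1, z)).1 :=
    (χ.sectionCoord_contDiffOn α).contDiffAt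
      (χ.isOpen_U.mem_nhds (X.Φ_mem 1 one_mem_Ioo_four z hz))
  exact (X.inverse_Θ_contDiffAt hz (X.Θ_isInvertible z hz)).clm_apply
    (ContDiffAt.comp (g := χ.sectionCoord α) (f := fun z => (X.Φ (1, z)).1) z hα hΦ.fst)

theorem Θ_rightInvCoord (α : Cₛ^∞⟮𝓘(ℝ, B); F, A⟯) {z : B × F} (hz : z ∈ X.dom) :
    X.Θ z (χ.rightInvCoord X α z) = χ.sectionCoord α (X.Φ (1, z)).1 := X.Θ_inverse hz _

/-- The velocity at `g` of `c(t) g`, for a path `c` in the source fibre of the unit at the target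
of `g` with prescribed velocity. -/
theorem rightTranslate_velocity (α : Cₛ^∞⟮𝓘(ℝ, B); F, A⟯) {z : B × F} (hz : z ∈ X.small)
    (hz' : X.Φ (1, z) ∈ X.small) {c : ℝ → TotalSpace F A}
    (hc : IsSourcePath 𝓙 (TotalSpace.proj : TotalSpace F A → M)
      (zeroSection F A (sprayTarget V (χ.pt z))) c)
    (hvel : curveVelocity 𝓙 c 0 = ⟨zeroSection F A (sprayTarget V (χ.pt z)),
      verticalLift B F (sprayTarget V (χ.pt z)) (α (sprayTarget V (χ.pt z)))⟩) :
    MDifferentiableAt 𝓘(ℝ, ℝ) 𝓙 (fun t => L.sprayMul V (c t) (χ.pt z)) 0 ∧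
    (curveVelocity 𝓙 (fun t => L.sprayMul V (c t) (χ.pt z)) 0).proj = χ.pt z ∧
    chartVec 𝓙 (zeroSection F A x₀) (curveVelocity 𝓙 (fun t => L.sprayMul V (c t) (χ.pt z)) 0)
      = (0, χ.rightInvCoord X α z) := by
  have := FiniteDimensional.complete ℝ F
  have hd := X.small_subset_dom hz
  have hyU : (X.Φ (1, z)).1 ∈ χ.U := X.mem_U (X.small_subset_dom hz')
  have h0 : ((X.Φ (1, z)).1, (0 : F)) ∈ X.small :=
    X.zero_mem_small (a := (X.Φ (1, z)).2) hz'
  rw [χ.sprayTarget_pt X hd] at hvel hc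
  have hvel' : chartVec 𝓙 (zeroSection F A x₀) (curveVelocity 𝓙 c 0)
      = (0, χ.sectionCoord α (X.Φ (1, z)).1) := by
    rw [hvel, χ.chartVec_verticalLift (χ.symm_mem_O hyU)]
    rfl
  rw [← χ.pt_zero hyU] at hc
  obtain ⟨m, m', hm0, hm, hcm, hvel₂⟩ := χ.isSourcePath_coord (z := ((X.Φ (1, z)).1, 0)) hyU hc
  have hm' : m' = χ.sectionCoord α (X.Φ (1, z)).1 :=
    congrArg Prod.snd (hvel₂.symm.trans hvel')
  obtain ⟨h1, h2, d, hd1, hd2⟩ := χ.sprayMul_path X hz h0 rfl hm0 hm hcm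
  have hκ : X.κ (1, (z, ((X.Φ (1, z)).1, 0))) = z.2 :=
    X.κ_unit_left hz h0 ⟨zero_le_one, le_rfl⟩
  rw [hκ] at h2 hd1
  rw [X.Θ_zero (X.small_subset_dom h0), hm'] at hd1
  refine ⟨h1, h2, hd2.trans ?_⟩
  rw [X.eq_inverse_of_Θ_eq (z := (z.1, z.2)) hd hd1]
  rfl

/-- The radial path in a fibre of the bundle. -/
theorem isSourcePath_smul {x : M} (hx : x ∈ χ.O) (e : A x) :
    IsSourcePath 𝓙 (TotalSpace.proj : TotalSpace F A → M) (zeroSection F A x)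
      (fun t : ℝ => ⟨x, t • e⟩) := by
  have hU := χ.chart_mem_U hx
  have h : (fun t : ℝ => (⟨x, t • e⟩ : TotalSpace F A))
      = fun t => χ.pt (extChartAt 𝓘(ℝ, B) x₀ x, t • fiberCoord F A x₀ x e) := by
    funext t
    refine (χ.eq_pt_of_proj_eq (a := ⟨x, t • e⟩) hU (χ.symm_chart hx).symm).trans ?_
    exact χ.pt_ext rfl (map_smul (fiberCoord F A x₀ x) t e)
  refine ⟨?_, Eventually.of_forall fun t => ⟨?_, rfl⟩⟩
  · change (⟨x, (0 : ℝ) • e⟩ : TotalSpace F A) = ⟨x, 0⟩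
    rw [zero_smul]
  · rw [h]
    refine ContMDiffAt.comp (I' := 𝓘(ℝ, B × F)) (g := χ.pt) t (χ.pt_contMDiffAt hU) ?_
    exact (contDiffAt_const.prodMk (contDiffAt_id.smul contDiffAt_const)).contMDiffAt

/-- Right invariant vector fields in coordinates. -/
theorem chartVec_rightInvariant (α : Cₛ^∞⟮𝓘(ℝ, B); F, A⟯)
    {Y : (g : TotalSpace F A) → TangentSpace 𝓙 g}
    (hY : hV.localGroupoid.IsRightInvariantExtension (fun x => verticalLift B F x (α x)) Y) :
    ∀ᶠ z in 𝓝 ((extChartAt 𝓘(ℝ, B) x₀ x₀, 0) : B × F),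
      chartVec 𝓙 (zeroSection F A x₀) ⟨χ.pt z, Y (χ.pt z)⟩ = (0, χ.rightInvCoord X α z) := by
  have h1 := eventually_nhdsSet_iff_forall.1 hY _ (mem_range_self x₀)
  rw [← χ.pt_base] at h1
  filter_upwards [(χ.pt_contMDiffAt χ.base_mem_U).continuousAt.eventually h1,
    χ.eventually_Φ_mem_small X] with z hz ⟨hs, hs'⟩
  have hO : sprayTarget V (χ.pt z) ∈ χ.O := by
    rw [χ.sprayTarget_pt X (X.small_subset_dom hs)]
    exact χ.symm_mem_O (X.mem_U (X.small_subset_dom hs'))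
  -- Right invariance is a condition on all paths with the prescribed velocity. The radial path is
  -- one of them, so it determines the value of the field.
  have hc := χ.isSourcePath_smul hO (α (sprayTarget V (χ.pt z)))
  have hv := (verticalLift_eq_curveVelocity (B := B) (F := F) _
    (α (sprayTarget V (χ.pt z)))).symm
  have h2 := (hz _ hc hv).2
  have h3 := (χ.rightTranslate_velocity X α hs hs' hc hv).2.2
  exact (congrArg (chartVec 𝓙 (zeroSection F A x₀)) h2.symm).trans h3

theorem rightInvCoord_base (α : Cₛ^∞⟮𝓘(ℝ, B); F, A⟯) :
    χ.rightInvCoord X α (extChartAt 𝓘(ℝ, B) x₀ x₀, 0)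
      = χ.sectionCoord α (extChartAt 𝓘(ℝ, B) x₀ x₀) := by
  have h := χ.Θ_rightInvCoord X α X.base_mem_dom
  rwa [X.Θ_zero X.base_mem_dom, X.Φ_base X.base_mem_dom one_mem_Ioo_four] at h

/-- The relation `ρ_E` at a unit, where `E` at time one is the identity. This is the statement that
the anchor is the differential of the target. -/
theorem dΦ_one_base_fst (v : F) : (X.dΦ (1, (extChartAt 𝓘(ℝ, B) x₀ x₀, 0)) v).1
    = χ.anchorCoord L (extChartAt 𝓘(ℝ, B) x₀ x₀) v := by
  have h := X.ρ_E (t := 1) (by norm_num) X.base_mem_dom v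
  have h2 : X.E (1, (extChartAt 𝓘(ℝ, B) x₀ x₀, 0)) v = v := by
    have h0 := X.Θ_zero X.base_mem_dom
    exact DFunLike.congr_fun h0 v
  rw [h2, X.Φ_base X.base_mem_dom one_mem_Ioo_four] at h
  exact h.symm

/-- Obtained by differentiating `Θ(z) R(z) = α(τ(z))` along the fibre at a unit, where `Θ` is the
identity and the differential of the target is the anchor. -/
theorem fderiv_rightInvCoord (α : Cₛ^∞⟮𝓘(ℝ, B); F, A⟯) (v : F) :
    fderiv ℝ (χ.rightInvCoord X α) (extChartAt 𝓘(ℝ, B) x₀ x₀, 0) (0, v)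
      = fderiv ℝ (χ.sectionCoord α) (extChartAt 𝓘(ℝ, B) x₀ x₀)
          (χ.anchorCoord L (extChartAt 𝓘(ℝ, B) x₀ x₀) v)
        - fderiv ℝ X.Θ (extChartAt 𝓘(ℝ, B) x₀ x₀, 0) (0, v)
          (χ.sectionCoord α (extChartAt 𝓘(ℝ, B) x₀ x₀)) := by
  set z₀ : B × F := (extChartAt 𝓘(ℝ, B) x₀ x₀, 0) with hz₀
  have hd : z₀ ∈ X.dom := X.base_mem_dom
  have hline : HasDerivAt (fun l : ℝ => z₀ + l • ((0 : B), v)) ((0 : B), v) 0 :=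
    SprayModel.RealizationBox.hasDerivAt_line z₀ v
  have hl0 : z₀ + (0 : ℝ) • ((0 : B), v) = z₀ := by simp
  have hΘ : HasFDerivAt X.Θ (fderiv ℝ X.Θ z₀) (z₀ + (0 : ℝ) • ((0 : B), v)) := by
    rw [hl0]; exact ((X.Θ_contDiffAt hd).differentiableAt (by simp)).hasFDerivAt
  have hR : HasFDerivAt (χ.rightInvCoord X α) (fderiv ℝ (χ.rightInvCoord X α) z₀)
      (z₀ + (0 : ℝ) • ((0 : B), v)) := by
    rw [hl0]; exact ((χ.rightInvCoord_contDiffAt X α hd).differentiableAt (by simp)).hasFDerivAt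
  have hΦ : HasDerivAt (fun l : ℝ => (X.Φ (1, z₀ + l • ((0 : B), v))).1)
      (X.dΦ (1, z₀) v).1 0 := by
    have h : HasDerivAt (fun l : ℝ => X.Φ (1, z₀ + l • ((0 : B), v))) (X.dΦ (1, z₀) v) 0 :=
      SprayModel.RealizationBox.hasDerivAt_comp_line
        ((X.Φ_contDiffAt 1 one_mem_Ioo_four z₀ hd).differentiableAt (by simp)) v
    exact h.prod_fst
  have hα : HasFDerivAt (χ.sectionCoord α) (fderiv ℝ (χ.sectionCoord α) z₀.1)
      (X.Φ (1, z₀ + (0 : ℝ) • ((0 : B), v))).1 := by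
    rw [hl0, X.Φ_base hd one_mem_Ioo_four]
    exact (χ.sectionCoord_differentiableAt α χ.base_mem_U).hasFDerivAt
  have h1 := (hΘ.comp_hasDerivAt (0 : ℝ) hline).clm_apply (hR.comp_hasDerivAt (0 : ℝ) hline)
  have h2 := hα.comp_hasDerivAt (0 : ℝ) hΦ
  have heq : (fun l : ℝ => X.Θ (z₀ + l • ((0 : B), v))
        (χ.rightInvCoord X α (z₀ + l • ((0 : B), v))))
      =ᶠ[𝓝 0] fun l => χ.sectionCoord α (X.Φ (1, z₀ + l • ((0 : B), v))).1 := by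
    filter_upwards [hline.continuousAt.preimage_mem_nhds (by rw [hl0]; exact X.dom_mem_nhds hd)]
      with l hl using χ.Θ_rightInvCoord X α hl
  have h3 := h1.unique (h2.congr_of_eventuallyEq heq)
  simp only [Function.comp_apply, hl0] at h3
  rw [X.Θ_zero hd, χ.rightInvCoord_base X α, χ.dΦ_one_base_fst X] at h3
  exact eq_sub_of_add_eq' h3

end AdaptedBump

end Integration

/-! ### The local groupoid of a spray integrates the Lie algebroid -/

section Integrates

open scoped OperatorNorm

set_option linter.unusedSectionVars false

variable {B : Type*} [NormedAddCommGroup B] [NormedSpace ℝ B]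
  {M : Type*} [TopologicalSpace M] [ChartedSpace B M] [IsManifold 𝓘(ℝ, B) ∞ M]
  {F : Type*} [NormedAddCommGroup F] [NormedSpace ℝ F]
  {A : M → Type*} [TopologicalSpace (TotalSpace F A)]
  [∀ x, TopologicalSpace (A x)] [FiberBundle F A]
  [∀ x, AddCommGroup (A x)] [∀ x, Module ℝ (A x)] [VectorBundle ℝ F A]
  [ContMDiffVectorBundle ∞ F A 𝓘(ℝ, B)]

local notation "𝓙" => ModelWithCorners.prod 𝓘(ℝ, B) 𝓘(ℝ, F)

section VerticalLift

variable [FiniteDimensional ℝ B] [FiniteDimensional ℝ F] [T2Space M]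

theorem zeroSection_mem_chart_source (x : M) :
    zeroSection F A x ∈ (extChartAt 𝓙 (zeroSection F A x)).source := mem_extChartAt_source _

theorem verticalLift_isLinearMap (x : M) : IsLinearMap ℝ (verticalLift B F x : A x → _) := by
  obtain ⟨χ⟩ := nonempty_adaptedBump (B := B) (F := F) (A := A) x
  constructor
  · intro e e'
    refine chartVec_injective (J := 𝓙) (zeroSection_mem_chart_source x) ?_
    rw [chartVec_add, χ.chartVec_verticalLift χ.mem_O, χ.chartVec_verticalLift χ.mem_O,
      χ.chartVec_verticalLift χ.mem_O, map_add, Prod.mk_add_mk, add_zero]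
  · intro r e
    refine chartVec_injective (J := 𝓙) (zeroSection_mem_chart_source x) ?_
    rw [chartVec_smul, χ.chartVec_verticalLift χ.mem_O, χ.chartVec_verticalLift χ.mem_O,
      map_smul, Prod.smul_mk, smul_zero]

theorem verticalLift_bijOn (x : M) : BijOn (verticalLift B F x : A x → _) univ
    {v | mfderiv 𝓙 𝓘(ℝ, B) (TotalSpace.proj : TotalSpace F A → M) (zeroSection F A x) v = 0} := by
  obtain ⟨χ⟩ := nonempty_adaptedBump (B := B) (F := F) (A := A) x
  have hx : x ∈ chartNhd B F A x := mem_chartNhd x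
  refine ⟨fun e _ => ?_, fun e _ e' _ h => ?_, fun v hv => ?_⟩
  · refine chartVec_injective (J := 𝓘(ℝ, B)) (x₀ := x) (mem_extChartAt_source x) ?_
    refine (chartVec_mfderiv_proj (x₀ := x) (a := zeroSection F A x) hx _).trans ?_
    rw [χ.chartVec_verticalLift χ.mem_O]
    exact (map_zero (mfderiv 𝓘(ℝ, B) 𝓘(ℝ, B) (extChartAt 𝓘(ℝ, B) x) x)).symm
  · have h1 := congrArg (fun v => chartVec 𝓙 (zeroSection F A x) ⟨zeroSection F A x, v⟩) h
    simp only [χ.chartVec_verticalLift χ.mem_O] at h1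
    exact fiberCoord_injective hx (congrArg Prod.snd h1)
  · refine ⟨fiberVec F A x x (chartVec 𝓙 (zeroSection F A x) ⟨zeroSection F A x, v⟩).2,
      mem_univ _, ?_⟩
    refine chartVec_injective (J := 𝓙) (zeroSection_mem_chart_source x) ?_
    rw [χ.chartVec_verticalLift χ.mem_O, fiberCoord_fiberVec hx]
    refine Prod.ext ?_ rfl
    have h1 := chartVec_mfderiv_proj (x₀ := x) (a := zeroSection F A x) hx v
    rw [hv] at h1
    exact (map_zero (mfderiv 𝓘(ℝ, B) 𝓘(ℝ, B) (extChartAt 𝓘(ℝ, B) x) x)).symm.trans h1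

theorem verticalLift_contMDiff : ContMDiff 𝓙 (ModelWithCorners.tangent 𝓙) ∞
    (fun e : TotalSpace F A => (⟨zeroSection F A e.proj, verticalLift B F e.proj e.2⟩ :
      TangentBundle 𝓙 (TotalSpace F A))) := by
  intro a
  obtain ⟨χ⟩ := nonempty_adaptedBump (B := B) (F := F) (A := A) a.proj
  have hz : ContMDiff 𝓘(ℝ, B) 𝓙 ∞ (zeroSection F A) := Bundle.contMDiff_zeroSection ℝ A
  have hp : ContMDiff 𝓙 𝓘(ℝ, B) ∞ (TotalSpace.proj : TotalSpace F A → M) := contMDiff_proj A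
  refine contMDiffAt_of_chartVec (x₀ := zeroSection F A a.proj)
    (zeroSection_mem_chart_source a.proj) (hz.comp hp).contMDiffAt ?_
  have h1 : ContMDiffAt 𝓙 𝓘(ℝ, B × F) ∞
      (fun e : TotalSpace F A => ((0 : B), fiberCoord F A a.proj e.proj e.2)) a :=
    contMDiffAt_const.prodMk_space
      (contMDiffAt_fiberCoord (x₀ := a.proj) (g := fun e => e) contMDiffAt_id (mem_chartNhd _))
  refine h1.congr_of_eventuallyEq ?_
  filter_upwards [χ.eventually_mem_O (a := a) χ.mem_O] with e he
  exact χ.chartVec_verticalLift he e.2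

end VerticalLift

variable [FiniteDimensional ℝ B] [FiniteDimensional ℝ F] [T2Space M] {L : LieAlgebroid B F A}
  {V : (a : TotalSpace F A) → TangentSpace (𝓘(ℝ, B).prod 𝓘(ℝ, F)) a}

theorem tangentMap_sprayTarget_verticalLift (hV : L.IsSpray V) (x : M) (e : A x) :
    tangentMap 𝓙 𝓘(ℝ, B) (sprayTarget V) ⟨zeroSection F A x, verticalLift B F x e⟩
      = ⟨x, L.anchor x e⟩ := by
  obtain ⟨χ, ⟨X⟩⟩ := exists_productBox hV x
  have hd := X.base_mem_dom
  have htx := sprayTarget_zeroSection hV x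
  have hψ : extChartAt 𝓙 (zeroSection F A x) (zeroSection F A x)
      = (extChartAt 𝓘(ℝ, B) x x, 0) := bundleChart_zeroSection (mem_chartNhd x)
  have hg : HasFDerivAt (fun z => (X.Φ (1, z)).1)
      ((ContinuousLinearMap.fst ℝ B F).comp
        ((fderiv ℝ X.Φ (1, (extChartAt 𝓘(ℝ, B) x x, 0))).comp
          (ContinuousLinearMap.inr ℝ ℝ (B × F))))
      (extChartAt 𝓙 (zeroSection F A x) (zeroSection F A x)) := by
    rw [hψ]
    exact hasFDerivAt_fst.comp _ (HasFDerivAt.comp (g := X.Φ) _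
      ((X.Φ_contDiffAt 1 AdaptedBump.one_mem_Ioo_four _ hd).differentiableAt (by simp)).hasFDerivAt
      ((hasFDerivAt_const (1 : ℝ) _).prodMk (hasFDerivAt_id _)))
  have hev : sprayTarget V =ᶠ[𝓝 (zeroSection F A x)] fun a =>
      (extChartAt 𝓘(ℝ, B) x).symm (X.Φ (1, extChartAt 𝓙 (zeroSection F A x) a)).1 := by
    have h := χ.eventually_pt χ.base_mem_U (X.dom_mem_nhds hd)
    rw [χ.pt_base] at h
    filter_upwards [h] with a ⟨ha, ha'⟩
    have h2 := χ.sprayTarget_pt X ha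
    rwa [ha'] at h2
  have h := (hasMFDerivAt_of_chart (J := 𝓘(ℝ, B)) (J' := 𝓙) (zeroSection_mem_chart_source x) hg
    (by
      rw [hψ]
      exact χ.mem_target (X.Φ_mem 1 AdaptedBump.one_mem_Ioo_four _ hd)) hev).2
    (verticalLift B F x e)
  refine tangentBundle_ext (J := 𝓘(ℝ, B)) (x₀ := x) ?_ htx ?_
  · change sprayTarget V (zeroSection F A x) ∈ _
    rw [htx]
    exact mem_extChartAt_source x
  · refine h.trans ?_
    rw [χ.chartVec_verticalLift χ.mem_O, χ.chartVec_anchor L χ.mem_O]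
    exact χ.dΦ_one_base_fst X _

theorem exists_rightInvariantExtension (hV : L.IsSpray V) (α : Cₛ^∞⟮𝓘(ℝ, B); F, A⟯) :
    ∃ Y : (g : TotalSpace F A) → TangentSpace (𝓘(ℝ, B).prod 𝓘(ℝ, F)) g,
      hV.localGroupoid.IsRightInvariantExtension (fun x => verticalLift B F x (α x)) Y ∧
      ∀ᶠ g in 𝓝ˢ (range (zeroSection F A)), ContMDiffAt 𝓙 (ModelWithCorners.tangent 𝓙) ∞
        (fun g => (⟨g, Y g⟩ : TangentBundle 𝓙 (TotalSpace F A))) g := by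
  -- The field is defined by translating the radial path at the target of `g`. The derivative really
  -- sits over the product of a unit with `g`, which equals `g` only near the units; `hY` keeps the
  -- actual base point.
  let Y : (g : TotalSpace F A) → TangentSpace (𝓘(ℝ, B).prod 𝓘(ℝ, F)) g := fun g =>
    mfderiv 𝓘(ℝ, ℝ) 𝓙 (fun t : ℝ => L.sprayMul V
      ⟨sprayTarget V g, t • α (sprayTarget V g)⟩ g) 0 (1 : ℝ)
  have hY : ∀ g, (⟨L.sprayMul V ⟨sprayTarget V g, (0 : ℝ) • α (sprayTarget V g)⟩ g, Y g⟩ :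
      TangentBundle 𝓙 (TotalSpace F A)) = curveVelocity 𝓙 (fun t : ℝ => L.sprayMul V
        ⟨sprayTarget V g, t • α (sprayTarget V g)⟩ g) 0 := fun g => rfl
  have key : ∀ (x₀ : M) (χ : AdaptedBump B F A x₀)
      (X : (χ.sprayModel hV).ProductBox (extChartAt 𝓘(ℝ, B) x₀ x₀)) (z : B × F), z ∈ X.small →
      X.Φ (1, z) ∈ X.small → chartVec 𝓙 (zeroSection F A x₀) ⟨χ.pt z, Y (χ.pt z)⟩
        = (0, χ.rightInvCoord X α z) := by
    intro x₀ χ X z hz hz'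
    have hO : sprayTarget V (χ.pt z) ∈ χ.O := by
      rw [χ.sprayTarget_pt X (X.small_subset_dom hz)]
      exact χ.symm_mem_O (X.mem_U (X.small_subset_dom hz'))
    obtain ⟨_, h2, h3⟩ := χ.rightTranslate_velocity X α hz hz'
      (χ.isSourcePath_smul hO (α (sprayTarget V (χ.pt z))))
      (verticalLift_eq_curveVelocity (B := B) (F := F) _ (α (sprayTarget V (χ.pt z)))).symm
    rw [← h3]
    exact congrArg _ (TotalSpace.ext h2.symm HEq.rfl)
  refine ⟨Y, eventually_units hV fun x₀ χ X => ?_, eventually_units hV fun x₀ χ X => ?_⟩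
  · filter_upwards [χ.eventually_Φ_mem_small X] with z ⟨hz, hz'⟩ c hc hvel
    obtain ⟨h1, h2, h3⟩ := χ.rightTranslate_velocity X α hz hz' hc hvel
    refine ⟨h1, (tangentBundle_ext (J := 𝓙) (x₀ := zeroSection F A x₀) ?_ h2.symm ?_).symm⟩
    · exact χ.pt_mem_source (X.mem_U (X.small_subset_dom hz))
    · exact (key x₀ χ X z hz hz').trans h3.symm
  · filter_upwards [(χ.eventually_Φ_mem_small X).eventually_nhds, χ.eventually_mem_small X]
      with z hz hzs
    have hd := X.small_subset_dom hzs
    have hU := X.mem_U hd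
    refine contMDiffAt_of_chartVec (x₀ := zeroSection F A x₀) (χ.pt_mem_source hU)
      contMDiffAt_id ?_
    have h1 : ContMDiffAt 𝓙 𝓘(ℝ, B × F) ∞ (fun a => ((0 : B),
        χ.rightInvCoord X α (extChartAt 𝓙 (zeroSection F A x₀) a))) (χ.pt z) := by
      refine contMDiffAt_const.prodMk_space (ContMDiffAt.comp (I' := 𝓘(ℝ, B × F))
        (g := χ.rightInvCoord X α) (χ.pt z) ?_ (χ.chart_contMDiffAt (χ.pt_proj_mem_O hU)))
      rw [χ.chart_pt hU]
      exact (χ.rightInvCoord_contDiffAt X α hd).contMDiffAt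
    refine h1.congr_of_eventuallyEq ?_
    filter_upwards [χ.eventually_pt hU hz] with a ⟨⟨ha, ha'⟩, ha''⟩
    have h2 := key x₀ χ X _ ha ha'
    rwa [ha''] at h2

/-- The bracket of the coordinate fields at a unit consists of derivatives of `α` and `β` along the
anchors and of the antisymmetrized derivative of `Θ`. The Maurer-Cartan equation turns the latter
into `c`, and the sum is the coordinate formula for the algebroid bracket. -/
theorem mlieBracket_rightInvariant (hV : L.IsSpray V) (α β : Cₛ^∞⟮𝓘(ℝ, B); F, A⟯)
    {Y Z : (g : TotalSpace F A) → TangentSpace (𝓘(ℝ, B).prod 𝓘(ℝ, F)) g}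
    (hY : hV.localGroupoid.IsRightInvariantExtension (fun x => verticalLift B F x (α x)) Y)
    (hZ : hV.localGroupoid.IsRightInvariantExtension (fun x => verticalLift B F x (β x)) Z)
    (x : M) : VectorField.mlieBracket 𝓙 Y Z (zeroSection F A x)
      = verticalLift B F x (L.bracket α β x) := by
  obtain ⟨χ, ⟨X⟩⟩ := exists_productBox hV x
  have hψ : extChartAt 𝓙 (zeroSection F A x) (zeroSection F A x)
      = (extChartAt 𝓘(ℝ, B) x x, 0) := bundleChart_zeroSection (mem_chartNhd x)
  have hd := X.base_mem_dom
  have hder : ∀ γ : Cₛ^∞⟮𝓘(ℝ, B); F, A⟯, ∀ v : F,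
      fderiv ℝ (fun z => ((0 : B), χ.rightInvCoord X γ z)) (extChartAt 𝓘(ℝ, B) x x, 0) (0, v)
        = (0, fderiv ℝ (χ.rightInvCoord X γ) (extChartAt 𝓘(ℝ, B) x x, 0) (0, v)) := by
    intro γ v
    rw [((hasFDerivAt_const (0 : B) _).prodMk ((χ.rightInvCoord_contDiffAt X γ
      hd).differentiableAt (by simp)).hasFDerivAt).fderiv]
    rfl
  refine chartVec_injective (J := 𝓙) (zeroSection_mem_chart_source x) ?_
  rw [chartVec_mlieBracket (X' := fun z => (0, χ.rightInvCoord X α z))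
    (Y' := fun z => (0, χ.rightInvCoord X β z))
    (by rw [hψ]; exact χ.chartVec_rightInvariant X α hY)
    (by rw [hψ]; exact χ.chartVec_rightInvariant X β hZ), χ.chartVec_verticalLift χ.mem_O, hψ,
    hder, hder, χ.fderiv_rightInvCoord, χ.fderiv_rightInvCoord, χ.rightInvCoord_base,
    χ.rightInvCoord_base, ← χ.sectionCoord_chart _ χ.mem_O,
    χ.sectionCoord_bracket L α β χ.base_mem_U]
  have hmc := X.maurerCartan hd (χ.sectionCoord α (extChartAt 𝓘(ℝ, B) x x))
    (χ.sectionCoord β (extChartAt 𝓘(ℝ, B) x x))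
  rw [X.Θ_zero hd, X.Φ_base hd AdaptedBump.one_mem_Ioo_four] at hmc
  refine Prod.ext (sub_self 0) ?_
  have hc : χ.bracketCoord L (extChartAt 𝓘(ℝ, B) x x)
      (χ.sectionCoord α (extChartAt 𝓘(ℝ, B) x x)) (χ.sectionCoord β (extChartAt 𝓘(ℝ, B) x x))
      = fderiv ℝ X.Θ (extChartAt 𝓘(ℝ, B) x x, 0) (0, χ.sectionCoord β (extChartAt 𝓘(ℝ, B) x x))
          (χ.sectionCoord α (extChartAt 𝓘(ℝ, B) x x))
        - fderiv ℝ X.Θ (extChartAt 𝓘(ℝ, B) x x, 0)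
          (0, χ.sectionCoord α (extChartAt 𝓘(ℝ, B) x x))
          (χ.sectionCoord β (extChartAt 𝓘(ℝ, B) x x)) := by
    exact (eq_neg_of_add_eq_zero_right hmc).trans (neg_sub _ _)
  rw [hc]
  simp only [Prod.snd_sub]
  abel

/-- The local groupoid of a spray on a Lie algebroid integrates the Lie algebroid. -/
theorem localGroupoid_integrates (hV : L.IsSpray V) :
    hV.localGroupoid.Integrates L (verticalLift B F) where
  isLinear := verticalLift_isLinearMap
  bijective := verticalLift_bijOn
  smooth := verticalLift_contMDiff
  anchor := tangentMap_sprayTarget_verticalLift hV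
  exists_rightInvariant := exists_rightInvariantExtension hV
  bracket α β _ _ hY hZ x := mlieBracket_rightInvariant hV α β hY hZ x

end Integrates

theorem theorem3
    {B : Type*} [NormedAddCommGroup B] [NormedSpace ℝ B] [FiniteDimensional ℝ B]
    {M : Type*} [TopologicalSpace M] [ChartedSpace B M] [IsManifold 𝓘(ℝ, B) ∞ M]
    [T2Space M] [SecondCountableTopology M]
    {F : Type*} [NormedAddCommGroup F] [NormedSpace ℝ F] [FiniteDimensional ℝ F]
    {A : M → Type*} [TopologicalSpace (TotalSpace F A)]
    [∀ x, TopologicalSpace (A x)] [FiberBundle F A]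
    [∀ x, AddCommGroup (A x)] [∀ x, Module ℝ (A x)] [VectorBundle ℝ F A]
    [ContMDiffVectorBundle ∞ F A 𝓘(ℝ, B)]
    (L : LieAlgebroid B F A)
    (V : (a : TotalSpace F A) → TangentSpace (𝓘(ℝ, B).prod 𝓘(ℝ, F)) a)
    (hV : L.IsSpray V) :
    (∀ᶠ p in 𝓝ˢ (range fun x : M => (zeroSection F A x, zeroSection F A x)),
      p.2 ∈ timeOneDomain V → p.1.proj = (localFlow V 1 p.2).proj →
        L.HasUniqueProductPath V p.1 p.2) ∧
    ∃ 𝒢 : LocalLieGroupoid (𝓘(ℝ, B).prod 𝓘(ℝ, F)) 𝓘(ℝ, B)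
        (zeroSection F A) (TotalSpace.proj : TotalSpace F A → M),
      (∀ a ∈ 𝒢.targetDom, a ∈ timeOneDomain V ∧ 𝒢.target a = (localFlow V 1 a).proj) ∧
      (∀ a ∈ 𝒢.invDom, a ∈ timeOneDomain V ∧ 𝒢.inv a = fiberScale (-1) (localFlow V 1 a)) ∧
      (∀ p ∈ 𝒢.mulDom, L.HasUniqueProductPath V p.1 p.2 ∧
        ∀ k, L.IsProductPath V p.1 p.2 k → 𝒢.mul p.1 p.2 = k 1) ∧
      𝒢.IsMaurerCartanForm (L.verticalRealizationForm V) ∧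
      𝒢.Integrates L (verticalLift B F) := by
  refine ⟨(eventually_hasUniqueProductPath hV).mono fun p hp _ => hp, hV.localGroupoid,
    fun a ha => ⟨ha.self_of_nhds.1, rfl⟩, fun a ha => ⟨ha.self_of_nhds.1, rfl⟩, fun p hp => ?_,
    isMaurerCartanForm_verticalRealizationForm hV, localGroupoid_integrates hV⟩
  -- The domain of the multiplication was chosen inside the set of unique solvability, so the
  -- product is the endpoint of every solution.
  have h := (hp.1.self_of_nhds hp.2).1
  exact ⟨h, fun k hk => h.sprayMul_eq hk⟩
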